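/- **Setting.** Let $d\ge 1$ and $\beta_0\in(0,1)$. Let $\gamma:\mathbb R^d\to[0,\infty]$ be symmetric, continuous and locally integrable, and a tempered distribution whose Fourier transform $\widehat\gamma$ (with $\widehat\varphi(\xi)=\int e^{-i\xi\cdot x}\varphi(x)\,dx$) is a locally integrable, a.e. nonnegative measurable function; let the spectral measure $\mu(d\xi)=\widehat\gamma(\xi)\,d\xi$, for which $\int\gamma\varphi\,dx=(2\pi)^{-d}\int\widehat\varphi\,d\mu$ for all Schwartz functions $\varphi$, be tempered. Assume that either $\gamma(x)<\infty\Leftrightarrow x\ne0$, or $\widehat\gamma\in L^\infty$ and $\gamma(x)<\infty$ for all $x\neq0$. Let $\mathcal H$ be the completion of $C_0^\infty(\mathbb R_+\times\mathbb R^d)$ for $$\langle\varphi,\psi\rangle_{\mathcal H}=\int_{\mathbb R_+^2}\int_{\mathbb R^{2d}}\varphi(s,x)\psi(t,y)|t-s|^{-\beta_0}\gamma(x-y)\,dx\,dy\,ds\,dt,$$ and let $W=\{W(h):h\in\mathcal H\}$ be an isonormal (centered) Gaussian process with $\mathbb E[W(g)W(h)]=\langle g,h\rangle_{\mathcal H}$.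 Let $X$ be a symmetric Lévy process in $\mathbb R^d$, independent of $W$, with $\mathbb E\,e^{i\xi\cdot X_t}=e^{-t\Psi(\xi)}$, such that $X_t$ has a density for every $t>0$. Let $p\in C_0^\infty(\mathbb R^d)$ be a symmetric probability density with $\widehat p\ge0$, $p_\varepsilon(x)=\varepsilon^{-d}p(x/\varepsilon)$, $g_\delta=\delta^{-1}1_{[0,\delta]}$, and $$\Phi^{\varepsilon,\delta}_{t,x}(r,y)=1_{[0,t]}(r)\int_0^t g_\delta(t-s-r)\,p_\varepsilon(X_s+x-y)\,ds .$$ Write $V_{t,x}=\int_0^t\int_{\mathbb R^d}\delta_0(X_{t-r}+x-y)\,W(dr,dy)$ for the $L^2$-limit of $W(\Phi^{\varepsilon,\delta}_{t,x})$ as $(\varepsilon,\delta)\downarrow0$. The Feynman–Kac solution (in the Stratonovich sense) of $\partial_tu=\mathcal Lu+u\dot W$, $u(0,\cdot)\equiv1$, where $\mathcal L$ is the generator of $X$, is $$u(t,x)=\mathbb E^X\big[\exp(V_{t,x})\big],\qquad t\ge0,\ x\in\mathbb R^d,$$ where $\mathbb E^X$ is the expectation with respect to $X$ only. **Hypothesis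 (S1)** with $\alpha_1\in(0,1]$: for every $T>0$ there is $C>0$ such that for all $z\in\mathbb R^d$ $$\int_0^T\!\!\int_0^T\!\!\int_{\mathbb R^d}|r-s|^{-\beta_0}e^{-|r-s|\Psi(\xi)}\bigl(1-\cos(\xi\cdot z)\bigr)\,\mu(d\xi)\,dr\,ds\le C|z|^{2\alpha_1}.$$ **Hypothesis (T1)** with $\alpha_2\in(0,1]$: for every $T>0$ and every $M>0$ there is $C>0$ such that for all $a\in[-M,M]$ $$\int_0^T\!\!\int_0^T\!\!\int_{\mathbb R^d}|r-s|^{-\beta_0}\Bigl|e^{-|r-s|\Psi(\xi)}-e^{-|r-s+a|\Psi(\xi)}\Bigr|\,\mu(d\xi)\,dr\,ds\le C|a|^{\alpha_2}.$$ **Theorem.** Under (S1) or (T1), $u(t,x)$ is well defined (the $L^2$-limit $V_{t,x}$ exists, and $\mathbb E^X[\exp(V_{t,x})]<\infty$ a.s.) for all $t\ge0$ and $x\in\mathbb R^d$. Moreover: 1. Under (S1), $u$ has a version $v$ (that is, $v(t,x)=u(t,x)$ a.s. for every $(t,x)$) all of whose realizations are $\theta_1$-Hölder continuous in $x$ on every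 compact set, for every $\theta_1\in(0,\alpha_1)$: for every compact $K\subset[0,\infty)\times\mathbb R^d$ there is a (random) $C$ with $|v(t,x)-v(t,y)|\le C|x-y|^{\theta_1}$ for all $(t,x),(t,y)\in K$. 2. Under (T1), $u$ has a version $v$ all of whose realizations are $\theta_2$-Hölder continuous in $t$ on every compact set, for every $\theta_2\in(0,\alpha_2/2)$: for every compact $K\subset[0,\infty)\times\mathbb R^d$ and every $x\in\mathbb R^d$ there is a (random) $C$ with $|v(s,x)-v(t,x)|\le C|s-t|^{\theta_2}$ for all $s,t$ with $(s,x),(t,x)\in K$. -/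

import Mathlib

open MeasureTheory ProbabilityTheory Set Filter Topology
open scoped NNReal ENNReal SchwartzMap

noncomputable section

namespace FeynmanKac

/-- The Euclidean space `ℝᵈ`. -/
abbrev E (d : ℕ) : Type := EuclideanSpace ℝ (Fin d)

/-- The Fourier transform `f̂(ξ) = ∫ e^{-i ξ·x} f(x) dx`. -/
def fourier {d : ℕ} (f : E d → ℂ) (ξ : E d) : ℂ :=
  ∫ x, Complex.exp (-(Complex.I * (inner ℝ ξ x : ℝ))) * f x

/-- The spectral measure `μ(dξ) = γ̂(ξ) dξ`. -/
def spectralMeasure {d : ℕ} (γhat : E d → ℝ) : Measure (E d) :=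
  volume.withDensity (fun ξ => ENNReal.ofReal (γhat ξ))

/-- The standing assumptions on the spatial covariance `γ` and its Fourier transform `γ̂`:
`γ : ℝᵈ → [0,∞]` is symmetric, continuous and locally integrable, it is a tempered distribution
whose Fourier transform is an almost everywhere nonnegative measurable function `γ̂`, the
(positive) spectral measure is tempered, and either `γ(x) < ∞` exactly for `x ≠ 0`, or `γ̂` is
bounded and `γ(x) < ∞` for all `x ≠ 0`. -/
structure IsCovarianceKernel {d : ℕ} (γ : E d → ℝ≥0∞) (γhat : E d → ℝ) : Prop where
  symm : ∀ x, γ (-x) = γ x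
  locallyIntegrable : ∀ K : Set (E d), IsCompact K → ∫⁻ x in K, γ x < ∞
  integrable_schwartz : ∀ φ : 𝓢(E d, ℂ), Integrable (fun x => ((γ x).toReal : ℂ) * φ x)
  hat_measurable : Measurable γhat
  hat_nonneg : ∀ᵐ ξ, 0 ≤ γhat ξ
  hat_locallyIntegrable : LocallyIntegrable γhat
  tempered : (spectralMeasure γhat).HasTemperateGrowth
  hat_eq : ∀ φ : 𝓢(E d, ℂ),
    ∫ x, ((γ x).toReal : ℂ) * φ x
      = (((2 * Real.pi) ^ d)⁻¹ : ℝ) * ∫ ξ, fourier φ ξ ∂(spectralMeasure γhat)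
  continuous : Continuous γ
  finite_off_zero : (∀ x, γ x < ∞ ↔ x ≠ 0) ∨ (MemLp γhat ∞ volume ∧ ∀ x, x ≠ 0 → γ x < ∞)

/-- A symmetric Lévy process `X` with characteristic exponent `Ψ`, having transition densities. -/
structure IsSymmetricLevyProcess {d : ℕ} {Ω' : Type*} [MeasurableSpace Ω']
    (X : ℝ≥0 → Ω' → E d) (Ψ : E d → ℝ) (P' : Measure Ω') : Prop where
  measurable : ∀ t, Measurable (X t)
  zero : ∀ᵐ ω' ∂P', X 0 ω' = 0
  indep_increments : HasIndepIncrements X P'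
  stationary_increments : ∀ s h, IdentDistrib (fun ω' => X (s + h) ω' - X s ω') (X h) P' P'
  cadlag : ∀ᵐ ω' ∂P', ∀ t, ContinuousWithinAt (fun s => X s ω') (Ici t) t ∧
    ∃ l, Tendsto (fun s => X s ω') (𝓝[<] t) (𝓝 l)
  symm : ∀ t, IdentDistrib (fun ω' => -X t ω') (X t) P' P'
  exponent : ∀ t ξ,
    ∫ ω', Complex.exp (Complex.I * (inner ℝ ξ (X t ω') : ℝ)) ∂P' = Real.exp (-(t * Ψ ξ))
  density : ∀ t, 0 < t → P'.map (X t) ≪ volume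

/-- Lebesgue measure on `ℝ₊ × ℝᵈ`, as a measure on `ℝ × ℝᵈ`. -/
def spaceTime (d : ℕ) : Measure (ℝ × E d) :=
  ((volume : Measure ℝ).restrict (Ici 0)).prod volume

/-- The measurable functions `φ` on `ℝ₊ × ℝᵈ` with
`∫∫ |φ(s,x)| |φ(t,y)| |t-s|^{-β₀} γ(x-y) ds dx dt dy < ∞`. They include the smooth functions with
compact support, and the latter are dense in them for the inner product `energyInner`. So the
Hilbert space completion `𝓗` of the former is also the completion of this space. -/
def FiniteEnergy {d : ℕ} (β₀ : ℝ) (γ : E d → ℝ≥0∞) (φ : ℝ × E d → ℝ) : Prop :=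
  Measurable φ ∧
    ∫⁻ z, ∫⁻ w, ‖φ z‖ₑ * ‖φ w‖ₑ * ENNReal.ofReal (|w.1 - z.1| ^ (-β₀)) * γ (z.2 - w.2)
      ∂(spaceTime d) ∂(spaceTime d) < ∞

/-- `⟨φ, ψ⟩_𝓗 = ∫∫ φ(s,x) ψ(t,y) |t-s|^{-β₀} γ(x-y) ds dx dt dy`. -/
def energyInner {d : ℕ} (β₀ : ℝ) (γ : E d → ℝ≥0∞) (φ ψ : ℝ × E d → ℝ) : ℝ :=
  ∫ z : (ℝ × E d) × (ℝ × E d),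
    φ z.1 * ψ z.2 * |z.2.1 - z.1.1| ^ (-β₀) * (γ (z.1.2 - z.2.2)).toReal
      ∂((spaceTime d).prod (spaceTime d))

/-- The noise: the isonormal Gaussian process of the space `𝓗`, i.e. a centered Gaussian family
with covariance `𝔼[W(φ) W(ψ)] = ⟨φ, ψ⟩_𝓗`. It is indexed by the (dense) space of the functions in
`𝓗`, whose members are its only arguments below; by isometry it determines its extension
to `𝓗`. -/
structure IsGaussianNoise {d : ℕ} {Ω : Type*} [MeasurableSpace Ω] (β₀ : ℝ) (γ : E d → ℝ≥0∞)
    (W : {φ : ℝ × E d → ℝ // FiniteEnergy β₀ γ φ} → Ω → ℝ) (P : Measure Ω) : Prop where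
  gaussian : IsGaussianProcess W P
  centered : ∀ φ, ∫ ω, W φ ω ∂P = 0
  covariance : ∀ φ ψ, ∫ ω, W φ ω * W ψ ω ∂P = energyInner β₀ γ φ.1 ψ.1

/-- A smooth, compactly supported, symmetric probability density `p` with `p̂ ≥ 0`. (The imaginary
part of `p̂` vanishes by symmetry.) -/
structure IsMollifier {d : ℕ} (p : E d → ℝ) : Prop where
  smooth : ContDiff ℝ ((⊤ : ℕ∞) : WithTop ℕ∞) p
  compact : HasCompactSupport p
  symm : ∀ x, p (-x) = p x
  nonneg : ∀ x, 0 ≤ p x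
  integral_eq_one : ∫ x, p x = 1
  fourier_nonneg : ∀ ξ, 0 ≤ (fourier (fun x => (p x : ℂ)) ξ).re

/-- `g_δ = δ⁻¹ 1_{[0,δ]}`. -/
def gApprox (δ τ : ℝ) : ℝ := (Icc 0 δ).indicator (fun _ => δ⁻¹) τ

/-- `p_ε(x) = ε⁻ᵈ p(x/ε)`. -/
def pApprox {d : ℕ} (p : E d → ℝ) (ε : ℝ) (x : E d) : ℝ := (ε ^ d)⁻¹ * p (ε⁻¹ • x)

/-- `Φ_{t,x}^{ε,δ}(r,y) = ∫₀ᵗ g_δ(t-s-r) p_ε(X_s + x - y) ds · 1_{[0,t]}(r)` along a path `X`. -/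
def Phi {d : ℕ} (p : E d → ℝ) (ε δ : ℝ) (t : ℝ≥0) (x : E d) (path : ℝ≥0 → E d) :
    ℝ × E d → ℝ := fun z =>
  (Icc (0 : ℝ) t).indicator
    (fun r => ∫ s in (0 : ℝ)..t, gApprox δ (t - s - r) * pApprox p ε (path s.toNNReal + x - z.2))
    z.1

section Noise

variable {d : ℕ} {β₀ : ℝ} {γ : E d → ℝ≥0∞} {Ω Ω' : Type*} [MeasurableSpace Ω] [MeasurableSpace Ω']

/-- `Y = W(Φ)` for a random function `Φ` on `Ω'`, the noise living on `Ω`: the random variable `Y`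
on the product space (on which the noise and `Φ` are independent) is such that for almost every
fixed `ω'` the function `Φ(ω')` lies in `𝓗` and `Y(·, ω') = W(Φ(ω'))` almost surely. This determines
`Y` up to null sets. -/
def IsNoiseIntegral (W : {φ : ℝ × E d → ℝ // FiniteEnergy β₀ γ φ} → Ω → ℝ) (P : Measure Ω)
    (P' : Measure Ω') (Φ : Ω' → ℝ × E d → ℝ) (Y : Ω × Ω' → ℝ) : Prop :=
  AEStronglyMeasurable Y (P.prod P') ∧
    ∀ᵐ ω' ∂P', ∃ h : FiniteEnergy β₀ γ (Φ ω'), ∀ᵐ ω ∂P, Y (ω, ω') = W ⟨Φ ω', h⟩ ω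

/-- `V = ∫₀ᵗ ∫ δ₀(X_{t-r} + x - y) W(dr,dy)`, the limit in `L²` of `W(Φ_{t,x}^{ε,δ})` as
`(ε,δ) ↓ 0`. -/
def IsDeltaIntegral (W : {φ : ℝ × E d → ℝ // FiniteEnergy β₀ γ φ} → Ω → ℝ) (P : Measure Ω)
    (X : ℝ≥0 → Ω' → E d) (P' : Measure Ω') (p : E d → ℝ) (t : ℝ≥0) (x : E d)
    (V : Ω × Ω' → ℝ) : Prop :=
  MemLp V 2 (P.prod P') ∧ ∃ Y : ℝ → ℝ → Ω × Ω' → ℝ,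
    (∀ ε δ, 0 < ε → 0 < δ →
      IsNoiseIntegral W P P' (fun ω' => Phi p ε δ t x (fun s => X s ω')) (Y ε δ)) ∧
    Tendsto (fun q : ℝ × ℝ => eLpNorm (Y q.1 q.2 - V) 2 (P.prod P'))
      (𝓝[>] 0 ×ˢ 𝓝[>] 0) (𝓝 0)

/-- The random field `u` is given by the Feynman–Kac formula
`u(t,x) = 𝔼^X[u₀(X_t + x) exp(∫₀ᵗ ∫ δ₀(X_{t-r} + x - y) W(dr,dy))]`; in particular the stochastic
integral and the expectation with respect to `X` exist. -/
def IsFeynmanKac (W : {φ : ℝ × E d → ℝ // FiniteEnergy β₀ γ φ} → Ω → ℝ) (P : Measure Ω)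
    (X : ℝ≥0 → Ω' → E d) (P' : Measure Ω') (p : E d → ℝ) (u₀ : E d → ℝ)
    (u : ℝ≥0 → E d → Ω → ℝ) : Prop :=
  ∀ t x, ∃ V, IsDeltaIntegral W P X P' p t x V ∧ ∀ᵐ ω ∂P,
    Integrable (fun ω' => u₀ (X t ω' + x) * Real.exp (V (ω, ω'))) P' ∧
    u t x ω = ∫ ω', u₀ (X t ω' + x) * Real.exp (V (ω, ω')) ∂P'

/-- `v` is a version of the random field `u`. -/
def IsVersion (P : Measure Ω) (u v : ℝ≥0 → E d → Ω → ℝ) : Prop :=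
  ∀ t x, Measurable (v t x) ∧ v t x =ᵐ[P] u t x

end Noise

/-- Hypothesis (S1) with exponent `α₁`. The imaginary part of `1 - e^{-iξ·z}` integrates to zero
by symmetry of `Ψ` and `μ`, and its real part is `1 - cos(ξ·z)`. -/
def HypothesisS1 {d : ℕ} (β₀ : ℝ) (Ψ : E d → ℝ) (μ : Measure (E d)) (α₁ : ℝ) : Prop :=
  0 < α₁ ∧ α₁ ≤ 1 ∧ ∀ T : ℝ, 0 < T → ∃ C : ℝ, 0 < C ∧ ∀ z : E d,
    ∫⁻ r in Icc 0 T, ∫⁻ s in Icc 0 T, ∫⁻ ξ, ENNReal.ofReal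
        (|r - s| ^ (-β₀) * Real.exp (-(|r - s| * Ψ ξ)) * (1 - Real.cos (inner ℝ ξ z))) ∂μ
      ≤ ENNReal.ofReal (C * ‖z‖ ^ (2 * α₁))

/-- Hypothesis (T1) with exponent `α₂`. -/
def HypothesisT1 {d : ℕ} (β₀ : ℝ) (Ψ : E d → ℝ) (μ : Measure (E d)) (α₂ : ℝ) : Prop :=
  0 < α₂ ∧ α₂ ≤ 1 ∧ ∀ T : ℝ, 0 < T → ∀ M : ℝ, 0 < M → ∃ C : ℝ, 0 < C ∧ ∀ a : ℝ, |a| ≤ M →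
    ∫⁻ r in Icc 0 T, ∫⁻ s in Icc 0 T, ∫⁻ ξ, ENNReal.ofReal
        (|r - s| ^ (-β₀) * |Real.exp (-(|r - s| * Ψ ξ)) - Real.exp (-(|r - s + a| * Ψ ξ))|) ∂μ
      ≤ ENNReal.ofReal (C * |a| ^ α₂)

/-- `f` is `θ`-Hölder continuous in `x` on every compact set `K` of `[0,∞) × ℝᵈ`, with a constant
that is uniform over `K`. -/
def HolderInSpace {d : ℕ} (θ : ℝ) (f : ℝ≥0 → E d → ℝ) : Prop :=
  ∀ K : Set (ℝ≥0 × E d), IsCompact K → ∃ C : ℝ, ∀ t x y, (t, x) ∈ K → (t, y) ∈ K →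
    |f t x - f t y| ≤ C * ‖x - y‖ ^ θ

/-- For every `x`, `f` is `θ`-Hölder continuous in `t` on every compact set of `[0,∞) × ℝᵈ`. -/
def HolderInTime {d : ℕ} (θ : ℝ) (f : ℝ≥0 → E d → ℝ) : Prop :=
  ∀ K : Set (ℝ≥0 × E d), IsCompact K → ∀ x, ∃ C : ℝ, ∀ s t, (s, x) ∈ K → (t, x) ∈ K →
    |f s x - f t x| ≤ C * |(s : ℝ) - t| ^ θ

end FeynmanKac

end

/-! Conditionally on the path of `X`, the variable `V_{t,x}` is centered Gaussian, and its
approximations have as conditional variance the energy of a mollified occupation density. Everything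
about `u` is thereby reduced to two quantities that no longer involve the noise: exponential moments
of that energy, and the expectation over the path of the conditional variance of `V_{t,x} -
V_{s,y}`, which in the limit is `limitVar`.

Both are governed by the condition `DalangCondition`, `∫₀ᵀ v^{-β₀} ∫ e^{-vΨ} dμ dv < ∞`, which each
hypothesis implies. Under (T1), the density of `X_1` and the Riemann–Lebesgue lemma give `Ψ → ∞`, so
that off a compact set `e^{-vΨ} - e^{-(v+1)Ψ}` is comparable to `e^{-vΨ}` (`dalangCondition_of_T1`).
Under (S1), integrating the bound for `1 - cos(τ ξ_i)` against `τ^{-1-α₁} dτ` yields moments of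
order `α₁` of the large coordinates of `ξ`. As `Ψ` grows at most quadratically, this controls
`Ψ^{α₁/2}`, and gives both the condition (`dalangCondition_of_S1`) and (T1) with exponent `α₁/2`
(`HypothesisS1.hypothesisT1`).

Existence of `V`: by Parseval the energy of two approximations is a double time integral of
`timeKernel` times the spectral covariance `smoothCov`, evaluated along the path. Its expectation
replaces `smoothCov` by `mollCov`, which is at most a constant times `∫ e^{-vΨ} dμ` whatever the
mollification. Dominated convergence then gives convergence to `limitEnergy`, so the approximations
are Cauchy in `L²` (`IsModel.exists_noiseLimit`).

Exponential moments: the energy is at most a constant times a time integral of occupation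
functionals. Jensen's inequality reduces its exponential moments to those of a single functional,
and Khasminskii's argument bounds these uniformly in the mollification
(`IsRegularProcess.lintegral_exp_occupation_le`). Independence of the increments turns the expansion
of the exponential into a Volterra inequality. A weight `e^{-θv}` with `θ` large makes its kernel
have mass at most `1/2`, so no smallness of the time interval or of the exponent is needed.

Regularity: from `|e^a - e^b| ≤ |a - b| (e^a + e^b)`, two Cauchy–Schwarz inequalities and the
Gaussian moments, `E|u(t,x) - u(s,y)|^{2m} ≤ K limitVar^m` for every `m`
(`IsModel.exists_lintegral_feynmanKac_sub_le`). Under (S1) the variance is `O(|x-y|^{2α₁})` at equal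
times, and under (T1) it is `O(|t-s|^{α₂})` at equal points. Since `m` is arbitrary, the
Kolmogorov–Chentsov theorem `exists_holder_version` loses nothing of the open range of exponents. In
the spatial case the constant has to be uniform in `t`; therefore the field is treated jointly in
`(t,x)`, with the distance `|x-y| + |t-s|^{1/4}` dictated by the consequence (T1) of (S1). -/

namespace FeynmanKac

/-! ### A Kolmogorov–Chentsov theorem -/

section Kolmogorov

variable {I : Type*}

/-- Chaining: a function whose increments over close pairs of net points decay geometrically has
limits along the net which are Hölder continuous. -/
lemma chaining_holder {ρ : I → I → ℝ} (hsymm : ∀ a b, ρ a b = ρ b a)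
    (htri : ∀ a b c, ρ a c ≤ ρ a b + ρ b c) (hnn : ∀ a b, 0 ≤ ρ a b)
    {π : ℕ → I → I} {c : ℝ} (hπ : ∀ n z, ρ (π n z) z ≤ c * (2⁻¹ : ℝ) ^ n)
    {S : Set I} {R : ℝ} (hR : 0 < R) (hdiam : ∀ z ∈ S, ∀ z' ∈ S, ρ z z' ≤ R)
    {f : I → ℝ} {θ M : ℝ} (hθ : 0 < θ)
    (hM : ∀ n, ∀ a ∈ π n '' S ∪ π (n + 1) '' S, ∀ b ∈ π n '' S ∪ π (n + 1) '' S,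
      ρ a b ≤ (2 * c + R) * (2⁻¹ : ℝ) ^ n → |f a - f b| ≤ M * ((2⁻¹ : ℝ) ^ θ) ^ n) :
    (∀ z ∈ S, ∃ l, Tendsto (fun n => f (π n z)) atTop (𝓝 l)) ∧
    ∀ g : I → ℝ, (∀ z ∈ S, Tendsto (fun n => f (π n z)) atTop (𝓝 (g z))) →
      ∃ C, ∀ z ∈ S, ∀ z' ∈ S, |g z - g z'| ≤ C * ρ z z' ^ θ := by
  set q : ℝ := (2⁻¹ : ℝ) ^ θ with hq
  have hq0 : 0 < q := by positivity
  have hq1 : q < 1 := Real.rpow_lt_one (by norm_num) (by norm_num) hθ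
  -- The radius `2 * c + R` in `hM` serves two kinds of pairs: consecutive net points `π n z`, `π (n
  -- + 1) z`, here, and net points of level `n` of two points at distance at most `R 2⁻ⁿ`, in
  -- `hmain`.
  have hstep : ∀ z ∈ S, ∀ n, dist (f (π n z)) (f (π (n + 1) z)) ≤ M * q ^ n := by
    intro z hz n
    rw [Real.dist_eq]
    refine hM n _ (Or.inl ⟨z, hz, rfl⟩) _ (Or.inr ⟨z, hz, rfl⟩) ?_
    have h1 := htri (π n z) z (π (n + 1) z)
    have h2 := hπ n z
    have h3 := hπ (n + 1) z
    rw [hsymm] at h3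
    have hc : 0 ≤ c := by
      have := (hnn (π 0 z) z).trans (hπ 0 z)
      simpa using this
    have h4 : (2⁻¹ : ℝ) ^ (n + 1) ≤ (2⁻¹ : ℝ) ^ n :=
      pow_le_pow_of_le_one (by norm_num) (by norm_num) (Nat.le_succ n)
    have h5 : 0 < (2⁻¹ : ℝ) ^ n := by positivity
    nlinarith
  have hlim : ∀ z ∈ S, ∃ l, Tendsto (fun n => f (π n z)) atTop (𝓝 l) := fun z hz =>
    cauchySeq_tendsto_of_complete (cauchySeq_of_le_geometric q M hq1 (hstep z hz))
  refine ⟨hlim, fun g hg => ?_⟩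
  have htail : ∀ z ∈ S, ∀ n, |f (π n z) - g z| ≤ M * q ^ n / (1 - q) := by
    intro z hz n
    rw [← Real.dist_eq]
    exact dist_le_of_le_geometric_of_tendsto q M hq1 (hstep z hz) (hg z hz) n
  have hmain : ∀ z ∈ S, ∀ z' ∈ S, ∀ n : ℕ, ρ z z' ≤ R * (2⁻¹ : ℝ) ^ n →
      |g z - g z'| ≤ (M + 2 * (M / (1 - q))) * q ^ n := by
    intro z hz z' hz' n h
    have h1 : |f (π n z) - f (π n z')| ≤ M * q ^ n := by
      refine hM n _ (Or.inl ⟨z, hz, rfl⟩) _ (Or.inl ⟨z', hz', rfl⟩) ?_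
      have e1 := htri (π n z) z (π n z')
      have e2 := htri z z' (π n z')
      have e3 := hπ n z'
      rw [hsymm] at e3
      have e4 := hπ n z
      nlinarith
    have h2 := htail z hz n
    have h3 := htail z' hz' n
    have h4 : M * q ^ n / (1 - q) = M / (1 - q) * q ^ n := by ring
    rw [h4] at h2 h3
    rw [abs_le] at *
    constructor <;> nlinarith
  set C₀ := M + 2 * (M / (1 - q)) with hC₀
  refine ⟨C₀ * (q⁻¹ * (R⁻¹) ^ θ), fun z hz z' hz' => ?_⟩
  -- As `ρ` is only a pseudodistance, distinct points may be at distance `0`; every level `n` is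
  -- then admissible and the values of `g` coincide.
  rcases (hnn z z').eq_or_lt with h0 | h0
  · rw [← h0, Real.zero_rpow hθ.ne', mul_zero]
    have : Tendsto (fun n : ℕ => C₀ * q ^ n) atTop (𝓝 (C₀ * 0)) :=
      (tendsto_pow_atTop_nhds_zero_of_lt_one hq0.le hq1).const_mul _
    rw [mul_zero] at this
    refine ge_of_tendsto' this fun n => hmain z hz z' hz' n ?_
    rw [← h0]; positivity
  -- The level satisfies `2^{-(n+1)} < ρ z z' / R ≤ 2⁻ⁿ`. The missing power of `2⁻¹` is the source
  -- of the factor `q⁻¹` in the constant.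
  · obtain ⟨n, hn1, hn2⟩ := exists_nat_pow_near_of_lt_one (x := ρ z z' / R) (y := (2⁻¹ : ℝ))
      (by positivity) ((div_le_one hR).2 (hdiam z hz z' hz')) (by norm_num) (by norm_num)
    have h1 := hmain z hz z' hz' n (by rw [div_le_iff₀ hR] at hn2; linarith)
    have hC0 : 0 ≤ C₀ := by
      have := (abs_nonneg _).trans h1
      exact nonneg_of_mul_nonneg_left this (by positivity)
    refine h1.trans ?_
    rw [mul_assoc]
    refine mul_le_mul_of_nonneg_left ?_ hC0
    have h2 : q ^ (n + 1) ≤ (ρ z z' / R) ^ θ := by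
      rw [hq, ← Real.rpow_natCast, ← Real.rpow_mul (by norm_num), mul_comm θ,
        Real.rpow_mul (by norm_num), Real.rpow_natCast]
      exact Real.rpow_le_rpow (by positivity) hn1.le hθ.le
    rw [div_eq_mul_inv, Real.mul_rpow h0.le (by positivity)] at h2
    calc q ^ n = q⁻¹ * q ^ (n + 1) := by field_simp; ring
      _ ≤ q⁻¹ * (ρ z z' ^ θ * R⁻¹ ^ θ) := by gcongr
      _ = _ := by ring

variable {Ω : Type*} [MeasurableSpace Ω] {P : Measure Ω}

/-- Moment bounds on increments give almost sure geometric decay over close pairs of net points. -/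
lemma ae_increments_decay {ρ : I → I → ℝ} (hnn : ∀ a b, 0 ≤ ρ a b)
    {π : ℕ → I → I} {S : Set I} (hmaps : ∀ n, MapsTo (π n) S S) {A B : ℝ} (hA : 0 ≤ A) (hB : 1 ≤ B)
    (hfin : ∀ n, (π n '' S).Finite ∧ ((π n '' S).ncard : ℝ) ≤ A * B ^ n)
    {u : I → Ω → ℝ} (hu : ∀ z, Measurable (u z)) {α θ K : ℝ} {p : ℕ} (hK : 0 < K) (hp0 : p ≠ 0)
    (hα : 0 < α)
    (hp : B ^ 2 * ((2⁻¹ : ℝ) ^ (α - θ)) ^ p < 1) {C : ℝ≥0}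
    (hmom : ∀ z ∈ S, ∀ z' ∈ S,
      ∫⁻ ω, ‖u z ω - u z' ω‖ₑ ^ p ∂P ≤ C * ENNReal.ofReal (ρ z z' ^ α) ^ p) :
    ∀ᵐ ω ∂P, ∃ M, ∀ n, ∀ a ∈ π n '' S ∪ π (n + 1) '' S, ∀ b ∈ π n '' S ∪ π (n + 1) '' S,
      ρ a b ≤ K * (2⁻¹ : ℝ) ^ n → |u a ω - u b ω| ≤ M * ((2⁻¹ : ℝ) ^ θ) ^ n := by
  classical
  set q : ℝ := (2⁻¹ : ℝ) ^ θ with hq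
  have hq0 : 0 < q := by positivity
  set r : ℝ := (2⁻¹ : ℝ) ^ α with hr
  have hr0 : 0 < r := by positivity
  have hrq : (2⁻¹ : ℝ) ^ (α - θ) = r / q := Real.rpow_sub (by norm_num) _ _
  have hDfin : ∀ n, (π n '' S ∪ π (n + 1) '' S).Finite := fun n => (hfin n).1.union (hfin (n + 1)).1
  set D : ℕ → Finset I := fun n => (hDfin n).toFinset with hD
  set Q : ℕ → Finset (I × I) := fun n =>
    ((D n) ×ˢ (D n)).filter (fun ab => ρ ab.1 ab.2 ≤ K * (2⁻¹ : ℝ) ^ n) with hQ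
  have hcardD : ∀ n, ((D n).card : ℝ) ≤ 2 * A * B * B ^ n := by
    intro n
    have h1 : (D n).card = (π n '' S ∪ π (n + 1) '' S).ncard :=
      (Set.ncard_eq_toFinset_card _ (hDfin n)).symm
    have h2 : ((D n).card : ℝ) ≤ (π n '' S).ncard + (π (n + 1) '' S).ncard := by
      rw [h1]; exact_mod_cast Set.ncard_union_le _ _
    have h3 := (hfin n).2
    have h4 := (hfin (n + 1)).2
    have h5 : A * B ^ n ≤ A * B ^ (n + 1) := by gcongr <;> omega
    rw [pow_succ] at h4 h5
    linarith
  have hcardQ : ∀ n, ((Q n).card : ℝ) ≤ (2 * A * B) ^ 2 * (B ^ 2) ^ n := by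
    intro n
    have h1 : (Q n).card ≤ (D n).card * (D n).card := by
      rw [← Finset.card_product]; exact Finset.card_filter_le _ _
    calc ((Q n).card : ℝ) ≤ (D n).card * (D n).card := by exact_mod_cast h1
      _ ≤ (2 * A * B * B ^ n) * (2 * A * B * B ^ n) := by
        gcongr <;> exact hcardD n
      _ = _ := by ring
  -- The `n`-th term has at most `(2AB)² B^{2n}` pairs, moments of order `2^{-αnp}` and weight
  -- `2^{θnp}`. The expectation of `Z` is thus dominated by a geometric series whose ratio is less
  -- than `1` by `hp`, and `Z^{1/p}` bounds all the normalized increments at once.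
  set Z : Ω → ℝ≥0∞ := fun ω => ∑' n, ENNReal.ofReal ((q⁻¹) ^ n) ^ p *
    ∑ ab ∈ Q n, ‖u ab.1 ω - u ab.2 ω‖ₑ ^ p with hZ
  have hmeas : ∀ ab : I × I, Measurable fun ω => ‖u ab.1 ω - u ab.2 ω‖ₑ ^ p := fun ab =>
    (((hu _).sub (hu _)).enorm).pow_const _
  have hterm : ∀ n, Measurable fun ω => ENNReal.ofReal ((q⁻¹) ^ n) ^ p *
      ∑ ab ∈ Q n, ‖u ab.1 ω - u ab.2 ω‖ₑ ^ p := fun n =>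
    (Finset.measurable_sum _ fun ab _ => hmeas ab).const_mul _
  have hZm : Measurable Z := Measurable.tsum hterm
  have hZint : ∫⁻ ω, Z ω ∂P < ∞ := by
    rw [lintegral_tsum fun n => (hterm n).aemeasurable]
    have hbound : ∀ n, ∫⁻ ω, ENNReal.ofReal ((q⁻¹) ^ n) ^ p *
        ∑ ab ∈ Q n, ‖u ab.1 ω - u ab.2 ω‖ₑ ^ p ∂P ≤
        ENNReal.ofReal ((C * (2 * A * B) ^ 2 * (K ^ α) ^ p) *
          (B ^ 2 * ((2⁻¹ : ℝ) ^ (α - θ)) ^ p) ^ n) := by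
      intro n
      rw [lintegral_const_mul _ (Finset.measurable_sum _ fun ab _ => hmeas ab),
        lintegral_finsetSum _ fun ab _ => hmeas ab]
      have h1 : ∑ ab ∈ Q n, ∫⁻ ω, ‖u ab.1 ω - u ab.2 ω‖ₑ ^ p ∂P ≤
          ∑ _ab ∈ Q n, ENNReal.ofReal (C * ((K * (2⁻¹ : ℝ) ^ n) ^ α) ^ p) := by
        refine Finset.sum_le_sum fun ab hab => ?_
        simp only [hQ, hD, Finset.mem_filter, Finset.mem_product, Set.Finite.mem_toFinset] at hab
        have hDS : π n '' S ∪ π (n + 1) '' S ⊆ S :=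
          union_subset (hmaps n).image_subset (hmaps (n + 1)).image_subset
        refine (hmom _ (hDS hab.1.1) _ (hDS hab.1.2)).trans ?_
        rw [ENNReal.ofReal_mul (by positivity), ENNReal.ofReal_coe_nnreal,
          ENNReal.ofReal_pow (by positivity)]
        gcongr
        · exact hnn _ _
        · exact hab.2
      calc _ ≤ ENNReal.ofReal ((q⁻¹) ^ n) ^ p *
            ∑ _ab ∈ Q n, ENNReal.ofReal (C * ((K * (2⁻¹ : ℝ) ^ n) ^ α) ^ p) := by gcongr
        _ = ENNReal.ofReal (((q⁻¹) ^ n) ^ p * ((Q n).card *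
            (C * ((K * (2⁻¹ : ℝ) ^ n) ^ α) ^ p))) := by
          rw [Finset.sum_const, nsmul_eq_mul,
            ENNReal.ofReal_mul (p := ((q⁻¹) ^ n) ^ p) (by positivity),
            ENNReal.ofReal_mul (p := ((Q n).card : ℝ)) (Nat.cast_nonneg _),
            ENNReal.ofReal_pow (p := (q⁻¹) ^ n) (by positivity) p, ENNReal.ofReal_natCast]
        _ ≤ _ := by
          apply ENNReal.ofReal_le_ofReal
          have h2 : ((K * (2⁻¹ : ℝ) ^ n) ^ α) = K ^ α * r ^ n := by
            rw [Real.mul_rpow hK.le (by positivity), hr, ← Real.rpow_natCast,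
              ← Real.rpow_natCast, ← Real.rpow_mul (by norm_num), ← Real.rpow_mul (by norm_num),
              mul_comm α]
          rw [h2, hrq]
          calc ((q⁻¹) ^ n) ^ p * ((Q n).card * (C * (K ^ α * r ^ n) ^ p))
              ≤ ((q⁻¹) ^ n) ^ p * (((2 * A * B) ^ 2 * (B ^ 2) ^ n) * (C * (K ^ α * r ^ n) ^ p)) := by
                gcongr; exact hcardQ n
            _ = _ := by
              rw [div_eq_mul_inv]; simp only [mul_pow, ← pow_mul]
              ring_nf
    refine (ENNReal.tsum_le_tsum hbound).trans_lt ?_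
    rw [← ENNReal.ofReal_tsum_of_nonneg (fun n => by positivity)
      ((summable_geometric_of_lt_one (by positivity) hp).mul_left _)]
    exact ENNReal.ofReal_lt_top
  filter_upwards [ae_lt_top hZm hZint.ne] with ω hω
  refine ⟨(Z ω ^ (p : ℝ)⁻¹).toReal, fun n a ha b hb hab => ?_⟩
  have hmem : (a, b) ∈ Q n := by
    simp only [hQ, hD, Finset.mem_filter, Finset.mem_product, Set.Finite.mem_toFinset]
    exact ⟨⟨ha, hb⟩, hab⟩
  have h1 : (ENNReal.ofReal ((q⁻¹) ^ n) * ‖u a ω - u b ω‖ₑ) ^ p ≤ Z ω := by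
    rw [mul_pow]
    calc _ ≤ ENNReal.ofReal ((q⁻¹) ^ n) ^ p * ∑ ab ∈ Q n, ‖u ab.1 ω - u ab.2 ω‖ₑ ^ p := by
          gcongr
          exact Finset.single_le_sum (f := fun ab : I × I => ‖u ab.1 ω - u ab.2 ω‖ₑ ^ p)
            (fun _ _ => zero_le) hmem
      _ ≤ Z ω := ENNReal.le_tsum n
  have h2 : ENNReal.ofReal ((q⁻¹) ^ n) * ‖u a ω - u b ω‖ₑ ≤ Z ω ^ (p : ℝ)⁻¹ := by
    rw [ENNReal.le_rpow_inv_iff (by positivity)]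
    exact_mod_cast h1
  have h3 := ENNReal.toReal_mono (by finiteness) h2
  rw [ENNReal.toReal_mul, ENNReal.toReal_ofReal (by positivity), toReal_enorm,
    Real.norm_eq_abs] at h3
  calc |u a ω - u b ω| = ((q⁻¹) ^ n * |u a ω - u b ω|) * q ^ n := by
        rw [inv_pow]; field_simp
    _ ≤ _ := by gcongr

/-- Kolmogorov–Chentsov theorem for a random field over a set `I` with a pseudodistance `ρ`,
exhausted by sets `S N` which have finite nets `π n '' S N` of exponentially growing size. -/
theorem exists_holder_version {ρ : I → I → ℝ} (hsymm : ∀ a b, ρ a b = ρ b a)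
    (htri : ∀ a b c, ρ a c ≤ ρ a b + ρ b c) (hnn : ∀ a b, 0 ≤ ρ a b)
    {π : ℕ → I → I} {c : ℝ} (hπ : ∀ n z, ρ (π n z) z ≤ c * (2⁻¹ : ℝ) ^ n)
    {S : ℕ → Set I} (hS : ∀ z, ∃ N, z ∈ S N) (hmaps : ∀ N n, MapsTo (π n) (S N) (S N))
    (hdiam : ∀ N, ∃ R, ∀ z ∈ S N, ∀ z' ∈ S N, ρ z z' ≤ R)
    (hfin : ∀ N, ∃ A B : ℝ, 0 ≤ A ∧ 1 ≤ B ∧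
      ∀ n, (π n '' S N).Finite ∧ ((π n '' S N).ncard : ℝ) ≤ A * B ^ n)
    {u : I → Ω → ℝ} (hu : ∀ z, AEMeasurable (u z) P) {α : ℝ} (hα : 0 < α)
    (hmom : ∀ (N p₀ : ℕ), ∃ p ≥ p₀, ∃ C : ℝ≥0, ∀ z ∈ S N, ∀ z' ∈ S N,
      ∫⁻ ω, ‖u z ω - u z' ω‖ₑ ^ p ∂P ≤ C * ENNReal.ofReal (ρ z z' ^ α) ^ p) :
    ∃ v : I → Ω → ℝ, (∀ z, Measurable (v z)) ∧ (∀ z, v z =ᵐ[P] u z) ∧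
      ∀ ω θ, 0 < θ → θ < α → ∀ N, ∃ C, ∀ z ∈ S N, ∀ z' ∈ S N,
        |v z ω - v z' ω| ≤ C * ρ z z' ^ θ := by
  classical
  rcases isEmpty_or_nonempty I with hI | ⟨⟨z₀⟩⟩
  · exact ⟨u, fun z => (hI.false z).elim, fun z => (hI.false z).elim,
      fun ω θ _ _ N => ⟨0, fun z => (hI.false z).elim⟩⟩
  have hc : 0 ≤ c := by
    have := (hnn (π 0 z₀) z₀).trans (hπ 0 z₀)
    simpa using this
  choose R₀ hR₀ using hdiam
  set R : ℕ → ℝ := fun N => max (R₀ N) 1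
  have hRpos : ∀ N, 0 < R N := fun N => lt_of_lt_of_le one_pos (le_max_right _ _)
  have hR : ∀ N, ∀ z ∈ S N, ∀ z' ∈ S N, ρ z z' ≤ R N := fun N z hz z' hz' =>
    (hR₀ N z hz z' hz').trans (le_max_left _ _)
  set w : I → Ω → ℝ := fun z => (hu z).mk (u z)
  have hw : ∀ z, Measurable (w z) := fun z => (hu z).measurable_mk
  have hwu : ∀ z, w z =ᵐ[P] u z := fun z => (hu z).ae_eq_mk.symm
  have hmomw : ∀ (N p₀ : ℕ), ∃ p ≥ p₀, ∃ C : ℝ≥0, ∀ z ∈ S N, ∀ z' ∈ S N,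
      ∫⁻ ω, ‖w z ω - w z' ω‖ₑ ^ p ∂P ≤ C * ENNReal.ofReal (ρ z z' ^ α) ^ p := by
    intro N p₀
    obtain ⟨p, hp, C, hC⟩ := hmom N p₀
    refine ⟨p, hp, C, fun z hz z' hz' => ?_⟩
    rw [lintegral_congr_ae (g := fun ω => ‖u z ω - u z' ω‖ₑ ^ p)]
    · exact hC z hz z' hz'
    · filter_upwards [hwu z, hwu z'] with ω h1 h2
      rw [h1, h2]
  have hgood : ∀ θ, θ < α → ∀ N, ∀ᵐ ω ∂P, ∃ M, ∀ n,
      ∀ a ∈ π n '' S N ∪ π (n + 1) '' S N, ∀ b ∈ π n '' S N ∪ π (n + 1) '' S N,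
      ρ a b ≤ (2 * c + R N) * (2⁻¹ : ℝ) ^ n → |w a ω - w b ω| ≤ M * ((2⁻¹ : ℝ) ^ θ) ^ n := by
    intro θ hθ N
    obtain ⟨A, B, hA, hB, hAB⟩ := hfin N
    have hq : (2⁻¹ : ℝ) ^ (α - θ) < 1 :=
      Real.rpow_lt_one (by norm_num) (by norm_num) (by linarith)
    have ht : Tendsto (fun p : ℕ => B ^ 2 * ((2⁻¹ : ℝ) ^ (α - θ)) ^ p) atTop (𝓝 (B ^ 2 * 0)) :=
      (tendsto_pow_atTop_nhds_zero_of_lt_one (by positivity) hq).const_mul _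
    rw [mul_zero] at ht
    obtain ⟨p₁, hp₁⟩ := eventually_atTop.1 (ht.eventually_lt_const one_pos)
    obtain ⟨p, hp, C, hC⟩ := hmomw N (max p₁ 1)
    have hRN := hRpos N
    exact ae_increments_decay hnn (hmaps N) hA hB hAB hw (K := 2 * c + R N) (by positivity)
      (by have := (le_max_right p₁ 1).trans hp; omega) hα
      (hp₁ p ((le_max_left _ _).trans hp)) hC
  -- Countably many exponents increasing to `α` allow a single exceptional null set for all `θ < α`.
  set θs : ℕ → ℝ := fun k => α - α / (k + 2)
  have hθs : ∀ k, 0 < θs k ∧ θs k < α := by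
    intro k
    have h1 : α / (k + 2) < α := div_lt_self hα (by linarith [(Nat.cast_nonneg k : (0:ℝ) ≤ k)])
    have h2 : 0 < α / (k + 2) := by positivity
    simp only [θs]; constructor <;> linarith
  have hall : ∀ᵐ ω ∂P, ∀ k N, ∃ M, ∀ n,
      ∀ a ∈ π n '' S N ∪ π (n + 1) '' S N, ∀ b ∈ π n '' S N ∪ π (n + 1) '' S N,
      ρ a b ≤ (2 * c + R N) * (2⁻¹ : ℝ) ^ n →
        |w a ω - w b ω| ≤ M * ((2⁻¹ : ℝ) ^ (θs k)) ^ n := by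
    rw [ae_all_iff]; intro k; rw [ae_all_iff]; intro N
    exact hgood _ (hθs k).2 N
  rw [ae_iff] at hall
  -- A measurable null set containing all bad points. The version is set to `0` on it, which keeps
  -- it measurable and makes every realization Hölder continuous.
  set N₀ := toMeasurable P {ω | ¬ ∀ k N, ∃ M, ∀ n,
      ∀ a ∈ π n '' S N ∪ π (n + 1) '' S N, ∀ b ∈ π n '' S N ∪ π (n + 1) '' S N,
      ρ a b ≤ (2 * c + R N) * (2⁻¹ : ℝ) ^ n →
        |w a ω - w b ω| ≤ M * ((2⁻¹ : ℝ) ^ (θs k)) ^ n} with hN₀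
  have hN₀m : MeasurableSet N₀ := measurableSet_toMeasurable _ _
  have hN₀0 : P N₀ = 0 := by rw [hN₀, measure_toMeasurable, hall]
  have hgoodω : ∀ ω ∉ N₀, ∀ k N, ∃ M, ∀ n,
      ∀ a ∈ π n '' S N ∪ π (n + 1) '' S N, ∀ b ∈ π n '' S N ∪ π (n + 1) '' S N,
      ρ a b ≤ (2 * c + R N) * (2⁻¹ : ℝ) ^ n →
        |w a ω - w b ω| ≤ M * ((2⁻¹ : ℝ) ^ (θs k)) ^ n := by
    intro ω hω
    by_contra hcon
    exact hω (subset_toMeasurable _ _ hcon)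
  have hex : ∀ ω z, ∃ l, Tendsto (fun n => N₀ᶜ.indicator (w (π n z)) ω) atTop (𝓝 l) := by
    intro ω z
    by_cases hω : ω ∈ N₀
    · refine ⟨0, ?_⟩
      simp [Set.indicator, hω]
    · obtain ⟨N, hN⟩ := hS z
      obtain ⟨M, hM⟩ := hgoodω ω hω 0 N
      obtain ⟨l, hl⟩ := (chaining_holder hsymm htri hnn hπ (hRpos N) (hR N)
        (f := fun z => w z ω) (hθs 0).1 hM).1 z hN
      exact ⟨l, by simpa [Set.indicator, hω] using hl⟩
  choose g hg using hex
  refine ⟨fun z ω => g ω z, fun z => ?_, fun z => ?_, ?_⟩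
  · exact measurable_of_tendsto_metrizable (fun n => (hw (π n z)).indicator hN₀m.compl)
      (tendsto_pi_nhds.2 fun ω => hg ω z)
  · obtain ⟨N, hN⟩ := hS z
    obtain ⟨p, hp, C, hC⟩ := hmomw N 1
    have hp0 : p ≠ 0 := by omega
    -- The limit along the net is a version by Fatou's lemma: the `p`-th moment of the increment
    -- from `π n z` to `z` tends to `0`, as `ρ (π n z) z` does. Here `p ≥ 1` matters.
    have h1 : ∫⁻ ω, ‖g ω z - w z ω‖ₑ ^ p ∂P = 0 := by
      have hle : ∫⁻ ω, ‖g ω z - w z ω‖ₑ ^ p ∂P ≤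
          liminf (fun n => ∫⁻ ω, ‖w (π n z) ω - w z ω‖ₑ ^ p ∂P) atTop := by
        refine le_trans (lintegral_mono_ae ?_) (lintegral_liminf_le fun n =>
          (((hw (π n z)).sub (hw z)).enorm).pow_const p)
        have : ∀ᵐ ω ∂P, ω ∉ N₀ := by rw [ae_iff]; simpa using hN₀0
        filter_upwards [this] with ω hω
        have h2 : Tendsto (fun n => w (π n z) ω) atTop (𝓝 (g ω z)) := by
          simpa [Set.indicator, hω] using hg ω z
        have h3 : Tendsto (fun n => ‖w (π n z) ω - w z ω‖ₑ ^ p) atTop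
            (𝓝 (‖g ω z - w z ω‖ₑ ^ p)) :=
          (ENNReal.continuous_pow p).continuousAt.tendsto.comp
            ((continuous_enorm.tendsto _).comp (h2.sub_const _))
        exact h3.liminf_eq.ge
      have hto : Tendsto (fun n => (C : ℝ≥0∞) * ENNReal.ofReal (ρ (π n z) z ^ α) ^ p) atTop
          (𝓝 0) := by
        have h2 : Tendsto (fun n => ρ (π n z) z) atTop (𝓝 0) := by
          refine squeeze_zero (fun n => hnn _ _) (fun n => hπ n z) ?_
          simpa using (tendsto_pow_atTop_nhds_zero_of_lt_one
            (by norm_num : (0:ℝ) ≤ 2⁻¹) (by norm_num)).const_mul c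
        have h3 : Tendsto (fun n => ρ (π n z) z ^ α) atTop (𝓝 0) := by
          simpa [Real.zero_rpow hα.ne'] using h2.rpow_const (Or.inr hα.le)
        have h4 := (ENNReal.continuous_pow p).continuousAt.tendsto.comp (ENNReal.tendsto_ofReal h3)
        have h5 := ENNReal.Tendsto.const_mul (a := (C : ℝ≥0∞)) h4 (Or.inr (by simp))
        simpa [hp0] using h5
      have h6 : Tendsto (fun n => ∫⁻ ω, ‖w (π n z) ω - w z ω‖ₑ ^ p ∂P) atTop (𝓝 0) :=
        tendsto_of_tendsto_of_tendsto_of_le_of_le tendsto_const_nhds hto (fun n => zero_le)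
          fun n => hC _ (hmaps N n hN) _ hN
      rw [h6.liminf_eq] at hle
      exact le_antisymm hle zero_le
    have hgm : Measurable fun ω => g ω z :=
      measurable_of_tendsto_metrizable (fun n => (hw (π n z)).indicator hN₀m.compl)
        (tendsto_pi_nhds.2 fun ω => hg ω z)
    have h1' := (lintegral_eq_zero_iff ((hgm.sub (hw z)).enorm.pow_const p)).1 h1
    filter_upwards [h1', hwu z] with ω h2 h3
    have h4 : ‖g ω z - w z ω‖ₑ = 0 := by simpa [hp0] using h2
    rw [enorm_eq_zero, sub_eq_zero] at h4
    rw [h4, h3]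
  · intro ω θ hθ0 hθ N
    by_cases hω : ω ∈ N₀
    · refine ⟨0, fun z _ z' _ => ?_⟩
      have h0 : ∀ z, g ω z = 0 := fun z => by
        refine tendsto_nhds_unique (hg ω z) ?_
        simp [Set.indicator, hω]
      simp [h0]
    · obtain ⟨k, hk⟩ : ∃ k : ℕ, θ ≤ θs k := by
        obtain ⟨k, hk⟩ := exists_nat_gt (α / (α - θ))
        refine ⟨k, ?_⟩
        have h1 : 0 < α - θ := by linarith
        rw [div_lt_iff₀ h1] at hk
        have h2 : α / (k + 2) ≤ α - θ := by
          rw [div_le_iff₀ (by positivity)]; nlinarith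
        simp only [θs]; linarith
      obtain ⟨M, hM⟩ := hgoodω ω hω k N
      have hM' : ∀ n, ∀ a ∈ π n '' S N ∪ π (n + 1) '' S N,
          ∀ b ∈ π n '' S N ∪ π (n + 1) '' S N, ρ a b ≤ (2 * c + R N) * (2⁻¹ : ℝ) ^ n →
          |w a ω - w b ω| ≤ |M| * ((2⁻¹ : ℝ) ^ θ) ^ n := by
        intro n a ha b hb hab
        refine (hM n a ha b hb hab).trans ?_
        have h1 : ((2⁻¹ : ℝ) ^ (θs k)) ≤ (2⁻¹ : ℝ) ^ θ :=
          Real.rpow_le_rpow_of_exponent_ge (by norm_num) (by norm_num) hk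
        calc M * ((2⁻¹ : ℝ) ^ (θs k)) ^ n ≤ |M| * ((2⁻¹ : ℝ) ^ (θs k)) ^ n := by
              gcongr; exact le_abs_self M
          _ ≤ _ := by gcongr
      exact (chaining_holder hsymm htri hnn hπ (hRpos N) (hR N) (f := fun z => w z ω) hθ0 hM').2 _
        fun z hz => by simpa [Set.indicator, hω] using hg ω z

end Kolmogorov


/-! ### Jointly measurable versions of random elements of `L²` -/

/-- A strongly measurable map into `L²(P)` is given by a jointly measurable function. -/
lemma exists_stronglyMeasurable_uncurry {Ω Ω' : Type*} [MeasurableSpace Ω] [MeasurableSpace Ω']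
    {P : Measure Ω} [IsProbabilityMeasure P] {F : Ω' → Lp ℝ 2 P} (hF : StronglyMeasurable F) :
    ∃ Y : Ω × Ω' → ℝ, StronglyMeasurable Y ∧ ∀ ω', (fun ω => Y (ω, ω')) =ᵐ[P] F ω' := by
  classical
  -- Simple approximations converge only pointwise in `ω'`. The first index with error below
  -- `2^{-k}` depends measurably on `ω'` and makes the errors summable for every `ω'`.
  have hex : ∀ k : ℕ, ∀ ω', ∃ n, dist (hF.approx n ω') (F ω') < (2⁻¹ : ℝ) ^ k := fun k ω' =>
    (((tendsto_iff_dist_tendsto_zero.1 (hF.tendsto_approx ω')).eventually_lt_const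
      (by positivity : (0:ℝ) < (2⁻¹ : ℝ) ^ k)).exists)
  have hN : ∀ k : ℕ, Measurable fun ω' => Nat.find (hex k ω') := fun k =>
    measurable_find (hex k) fun n =>
      ((hF.approx n).stronglyMeasurable.dist hF).measurable measurableSet_Iio
  -- A simple function takes finitely many values in `L²`, each with a measurable representative, so
  -- its evaluation is jointly measurable.
  have hG : ∀ n : ℕ, Measurable fun a : Ω × Ω' => (hF.approx n a.2 : Ω → ℝ) a.1 := fun n =>
    SimpleFunc.measurable_bind ((hF.approx n).comp Prod.snd measurable_snd)
      (fun (b : Lp ℝ 2 P) (a : Ω × Ω') => (b : Ω → ℝ) a.1)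
      (fun b => (Lp.stronglyMeasurable b).measurable.comp measurable_fst)
  set Yk : ℕ → Ω × Ω' → ℝ := fun k a => (hF.approx (Nat.find (hex k a.2)) a.2 : Ω → ℝ) a.1 with hYk
  have hYm : ∀ k, Measurable (Yk k) := by
    intro k
    have h1 : Measurable fun q : ℕ × (Ω × Ω') => (hF.approx q.1 q.2.2 : Ω → ℝ) q.2.1 :=
      measurable_from_prod_countable_right fun n => hG n
    exact h1.comp (((hN k).comp measurable_snd).prodMk measurable_id)
  refine ⟨fun a => limUnder atTop (fun k => Yk k a),
    StronglyMeasurable.limUnder fun k => (hYm k).stronglyMeasurable, fun ω' => ?_⟩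
  have hm : ∀ k, Measurable fun ω => ‖Yk k (ω, ω') - F ω' ω‖ₑ := fun k =>
    (((hYm k).comp measurable_prodMk_right).sub (Lp.stronglyMeasurable _).measurable).enorm
  have hb : ∀ k, ∫⁻ ω, ‖Yk k (ω, ω') - F ω' ω‖ₑ ∂P ≤ ENNReal.ofReal ((2⁻¹ : ℝ) ^ k) := by
    intro k
    set n := Nat.find (hex k ω') with hn
    have h1 : dist (hF.approx n ω') (F ω') < (2⁻¹ : ℝ) ^ k := Nat.find_spec (hex k ω')
    have h2 : eLpNorm (fun ω => Yk k (ω, ω') - F ω' ω) 1 P ≤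
        eLpNorm (⇑(hF.approx n ω') - ⇑(F ω')) 2 P :=
      eLpNorm_le_eLpNorm_of_exponent_le (f := ⇑(hF.approx n ω') - ⇑(F ω')) (by norm_num)
        ((Lp.aestronglyMeasurable _).sub (Lp.aestronglyMeasurable _))
    rw [eLpNorm_one_eq_lintegral_enorm] at h2
    refine h2.trans ?_
    rw [← Lp.edist_def, edist_dist]
    exact ENNReal.ofReal_le_ofReal h1.le
  -- Summable `L¹` errors force almost sure convergence, with no passage to a subsequence depending
  -- on `ω'`.
  have hsum : ∫⁻ ω, ∑' k, ‖Yk k (ω, ω') - F ω' ω‖ₑ ∂P ≠ ∞ := by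
    rw [lintegral_tsum fun k => (hm k).aemeasurable]
    refine ((ENNReal.tsum_le_tsum hb).trans_lt ?_).ne
    rw [← ENNReal.ofReal_tsum_of_nonneg (fun n => by positivity)
      (summable_geometric_of_lt_one (by positivity) (by norm_num))]
    exact ENNReal.ofReal_lt_top
  filter_upwards [ae_lt_top (Measurable.tsum hm) hsum] with ω hω
  have h1 := ENNReal.tendsto_atTop_zero_of_tsum_ne_top hω.ne
  have h2 : Tendsto (fun k => Yk k (ω, ω')) atTop (𝓝 (F ω' ω)) := by
    rw [tendsto_iff_edist_tendsto_0]
    simpa [edist_eq_enorm_sub] using h1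
  exact h2.limUnder_eq


/-! ### The mollified spatial covariance -/

section Spectral

variable {d : ℕ} {p : E d → ℝ}

/-- The Fourier transform of a symmetric real function. -/
noncomputable def cosTransform (p : E d → ℝ) (ξ : E d) : ℝ := ∫ x, p x * Real.cos (inner ℝ ξ x)

lemma IsMollifier.continuous (hp : IsMollifier p) : Continuous p := hp.smooth.continuous

lemma IsMollifier.integrable (hp : IsMollifier p) : Integrable p :=
  hp.continuous.integrable_of_hasCompactSupport hp.compact

lemma abs_cosTransform_le (hp : IsMollifier p) (ξ : E d) : |cosTransform p ξ| ≤ 1 := by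
  rw [← hp.integral_eq_one, cosTransform, ← Real.norm_eq_abs]
  refine norm_integral_le_of_norm_le hp.integrable (Eventually.of_forall fun x => ?_)
  rw [norm_mul, Real.norm_eq_abs, abs_of_nonneg (hp.nonneg x)]
  exact mul_le_of_le_one_right (hp.nonneg x) (Real.abs_cos_le_one _)

lemma continuous_cosTransform (hp : IsMollifier p) : Continuous (cosTransform p) := by
  refine continuous_of_dominated (bound := p) (fun ξ => ?_) (fun ξ => Eventually.of_forall fun x => ?_)
    hp.integrable (Eventually.of_forall fun x => ?_)
  · have := hp.continuous
    exact (by fun_prop : Continuous fun x => p x * Real.cos (inner ℝ ξ x)).aestronglyMeasurable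
  · rw [norm_mul, Real.norm_eq_abs, abs_of_nonneg (hp.nonneg x)]
    exact mul_le_of_le_one_right (hp.nonneg x) (Real.abs_cos_le_one _)
  · fun_prop

lemma cosTransform_zero (hp : IsMollifier p) : cosTransform p 0 = 1 := by
  simp [cosTransform, hp.integral_eq_one]

/-- The sine part integrates to zero because `p` is even. -/
lemma integral_exp_mul_eq_cosTransform (hp : IsMollifier p) (ξ : E d) :
    ∫ x, Complex.exp (Complex.I * (inner ℝ ξ x : ℝ)) * p x = cosTransform p ξ := by
  have hc := hp.continuous
  have h1 : ∀ x, Complex.exp (Complex.I * (inner ℝ ξ x : ℝ)) * p x =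
      ((p x * Real.cos (inner ℝ ξ x) : ℝ) : ℂ) +
        Complex.I * ((p x * Real.sin (inner ℝ ξ x) : ℝ) : ℂ) := by
    intro x
    rw [mul_comm Complex.I, Complex.exp_mul_I]
    push_cast; ring
  have i1 : Integrable fun x => p x * Real.cos (inner ℝ ξ x) :=
    hp.integrable.mul_bdd (c := 1) (by fun_prop)
      (Eventually.of_forall fun x => Real.abs_cos_le_one _)
  have i2 : Integrable fun x => p x * Real.sin (inner ℝ ξ x) :=
    hp.integrable.mul_bdd (c := 1) (by fun_prop)
      (Eventually.of_forall fun x => Real.abs_sin_le_one _)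
  have h2 : ∫ x, p x * Real.sin (inner ℝ ξ x) = 0 := by
    have h3 : ∫ x, p (-x) * Real.sin (inner ℝ ξ (-x)) = ∫ x, p x * Real.sin (inner ℝ ξ x) :=
      integral_neg_eq_self (fun x => p x * Real.sin (inner ℝ ξ x)) volume
    simp only [hp.symm, inner_neg_right, Real.sin_neg, mul_neg, integral_neg] at h3
    linarith
  simp_rw [h1]
  rw [integral_add i1.ofReal (i2.ofReal.const_mul _), integral_const_mul, integral_complex_ofReal,
    integral_complex_ofReal, h2]
  simp [cosTransform]

lemma pApprox_nonneg (hp : IsMollifier p) {ε : ℝ} (hε : 0 < ε) (x : E d) : 0 ≤ pApprox p ε x :=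
  mul_nonneg (by positivity) (hp.nonneg _)

lemma continuous_pApprox (hp : IsMollifier p) (ε : ℝ) : Continuous (pApprox p ε) := by
  have := hp.continuous
  unfold pApprox
  fun_prop

lemma hasCompactSupport_pApprox (hp : IsMollifier p) {ε : ℝ} (hε : 0 < ε) :
    HasCompactSupport (pApprox p ε) :=
  (hp.compact.comp_smul (inv_ne_zero hε.ne')).mul_left

lemma integrable_pApprox (hp : IsMollifier p) {ε : ℝ} (hε : 0 < ε) :
    Integrable (pApprox p ε) :=
  (continuous_pApprox hp ε).integrable_of_hasCompactSupport (hasCompactSupport_pApprox hp hε)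

/-- `w ↦ p_ε(c - w)` as a Schwartz function. -/
noncomputable def mollifierSchwartz (hp : IsMollifier p) {ε : ℝ} (hε : 0 < ε) (c : E d) :
    𝓢(E d, ℂ) :=
  HasCompactSupport.toSchwartzMap (f := fun w => (pApprox p ε (c - w) : ℂ))
    (((hasCompactSupport_pApprox hp hε).comp_homeomorph (Homeomorph.subLeft c)).comp_left
      (g := fun x : ℝ => (x : ℂ)) Complex.ofReal_zero)
    (by
      have h := hp.smooth
      unfold pApprox
      refine Complex.ofRealCLM.contDiff.comp ?_
      refine contDiff_const.mul (h.comp ?_)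
      fun_prop)

lemma mollifierSchwartz_apply (hp : IsMollifier p) {ε : ℝ} (hε : 0 < ε) (c w : E d) :
    mollifierSchwartz hp hε c w = (pApprox p ε (c - w) : ℂ) := rfl

/-- Translation by `c` produces the phase, and the dilation by `ε` in space becomes the dilation `ε
• ξ` in frequency. -/
lemma fourier_pApprox (hp : IsMollifier p) {ε : ℝ} (hε : 0 < ε) (c ξ : E d) :
    fourier (fun w => (pApprox p ε (c - w) : ℂ)) ξ =
      Complex.exp (-(Complex.I * (inner ℝ ξ c : ℝ))) * cosTransform p (ε • ξ) := by
  unfold fourier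
  rw [← integral_sub_left_eq_self _ _ c]
  simp only [sub_sub_cancel]
  have h1 : ∀ v : E d, Complex.exp (-(Complex.I * (inner ℝ ξ (c - v) : ℝ))) * (pApprox p ε v : ℂ) =
      Complex.exp (-(Complex.I * (inner ℝ ξ c : ℝ))) * (((ε ^ d)⁻¹ : ℝ) *
        (fun w => Complex.exp (Complex.I * (inner ℝ (ε • ξ) w : ℝ)) * p w) (ε⁻¹ • v)) := by
    intro v
    have h2 : inner ℝ (ε • ξ) (ε⁻¹ • v) = inner ℝ ξ v := by
      rw [inner_smul_left, inner_smul_right]; simp; field_simp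
    simp only [h2]
    rw [inner_sub_right, pApprox]
    have h3 : -(Complex.I * ((inner ℝ ξ c - inner ℝ ξ v : ℝ) : ℂ)) =
      -(Complex.I * (inner ℝ ξ c : ℝ)) + Complex.I * (inner ℝ ξ v : ℝ) := by push_cast; ring
    rw [h3, Complex.exp_add]
    push_cast; ring
  simp_rw [h1]
  have h4 := Measure.integral_comp_smul (volume : Measure (E d))
    (fun w => Complex.exp (Complex.I * (inner ℝ (ε • ξ) w : ℝ)) * p w) ε⁻¹
  rw [integral_exp_mul_eq_cosTransform hp] at h4
  rw [integral_const_mul, integral_const_mul, h4]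
  congr 1
  rw [finrank_euclideanSpace_fin, inv_pow, inv_inv, abs_of_pos (by positivity), Complex.real_smul,
    ← mul_assoc, ← Complex.ofReal_mul, inv_mul_cancel₀ (by positivity)]
  simp

lemma fourier_eq_fourierIntegral (f : E d → ℂ) (ξ : E d) :
    fourier f ξ = FourierTransform.fourier f ((2 * Real.pi)⁻¹ • ξ) := by
  rw [Real.fourier_eq', fourier]
  refine integral_congr_ae (Eventually.of_forall fun x => ?_)
  simp only [smul_eq_mul]
  congr 2
  rw [inner_smul_right, real_inner_comm]
  push_cast
  have : (Real.pi : ℂ) ≠ 0 := by exact_mod_cast Real.pi_ne_zero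
  field_simp

/-- `p̂(ε ·)` is a Schwartz function, being the transform of one, and a measure of temperate growth
integrates it. The dilation `e` by `(2π)⁻¹` accounts for the two normalizations of the Fourier
transform. -/
lemma integrable_cosTransform {γ : E d → ℝ≥0∞} {γhat : E d → ℝ} (hγ : IsCovarianceKernel γ γhat)
    (hp : IsMollifier p) {ε : ℝ} (hε : 0 < ε) :
    Integrable (fun ξ => cosTransform p (ε • ξ)) (spectralMeasure γhat) := by
  have := hγ.tempered
  have hne : (2 * Real.pi)⁻¹ ≠ 0 := by positivity
  let e : E d ≃L[ℝ] E d := ContinuousLinearEquiv.smulLeft (Units.mk0 (2 * Real.pi)⁻¹ hne)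
  have h1 := (SchwartzMap.compCLMOfContinuousLinearEquiv ℝ e
    (FourierTransform.fourier (mollifierSchwartz hp hε 0))).integrable
      (μ := spectralMeasure γhat)
  have h2 : (fun ξ => ((cosTransform p (ε • ξ) : ℝ) : ℂ)) =
      (SchwartzMap.compCLMOfContinuousLinearEquiv ℝ e
        (FourierTransform.fourier (mollifierSchwartz hp hε 0)) : E d → ℂ) := by
    ext ξ
    have h3 := fourier_pApprox hp hε 0 ξ
    rw [fourier_eq_fourierIntegral] at h3
    simp only [inner_zero_right, Complex.ofReal_zero, mul_zero, neg_zero, Complex.exp_zero,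
      one_mul] at h3
    rw [SchwartzMap.compCLMOfContinuousLinearEquiv_apply, Function.comp_apply,
      SchwartzMap.fourier_coe, ← h3]
    rfl
  rw [← h2] at h1
  simpa using h1.re

end Spectral


/-! ### Parseval's identity for the mollified spatial kernel. -/

section SpaceKernel

variable {d : ℕ} {p : E d → ℝ} {γ : E d → ℝ≥0∞} {γhat : E d → ℝ}

/-- `(p_ε * p_ε' * γ)(w)`, written in terms of the spectral measure. -/
noncomputable def smoothCov (p γhat : E d → ℝ) (ε ε' : ℝ) (w : E d) : ℝ :=
  ((2 * Real.pi) ^ d)⁻¹ * ∫ ξ, cosTransform p (ε • ξ) * cosTransform p (ε' • ξ) *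
    Real.cos (inner ℝ ξ w) ∂(spectralMeasure γhat)

/-- `∫∫ p_ε(a - y) p_ε'(b - y') γ(y - y') dy dy'`. -/
noncomputable def spaceKernel (p : E d → ℝ) (γ : E d → ℝ≥0∞) (ε ε' : ℝ) (a b : E d) : ℝ≥0∞ :=
  ∫⁻ y, ∫⁻ y', ENNReal.ofReal (pApprox p ε (a - y)) * ENNReal.ofReal (pApprox p ε' (b - y')) *
    γ (y - y')

instance sigmaFinite_spectralMeasure : SigmaFinite (spectralMeasure γhat) := by
  unfold spectralMeasure; infer_instance

/-- In positive dimension the origin, the only point where `γ` may be infinite, is a null set. -/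
lemma ae_lt_top_of_isCovarianceKernel (hd : 0 < d) (hγ : IsCovarianceKernel γ γhat) :
    ∀ᵐ x, γ x < ∞ := by
  have : Nonempty (Fin d) := ⟨⟨0, hd⟩⟩
  have : Nontrivial (E d) := by unfold E; infer_instance
  have h0 : ∀ᵐ x : E d, x ≠ 0 := by
    rw [ae_iff]; simp
  filter_upwards [h0] with x hx
  rcases hγ.finite_off_zero with h | h
  · exact (h x).2 hx
  · exact h.2 x hx

/-- This is the duality between `γ` and `γ̂` tested on the translated mollifier; taking real parts
turns the phase into a cosine. The sign of the spectral side is read off from the spatial side,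
whose integrand is nonnegative. -/
lemma lintegral_pApprox_mul (hd : 0 < d) (hγ : IsCovarianceKernel γ γhat) (hp : IsMollifier p)
    {ε : ℝ} (hε : 0 < ε) (c : E d) :
    0 ≤ ((2 * Real.pi) ^ d)⁻¹ *
      ∫ ξ, cosTransform p (ε • ξ) * Real.cos (inner ℝ ξ c) ∂(spectralMeasure γhat) ∧
    ∫⁻ w, ENNReal.ofReal (pApprox p ε (c - w)) * γ w = ENNReal.ofReal (((2 * Real.pi) ^ d)⁻¹ *
      ∫ ξ, cosTransform p (ε • ξ) * Real.cos (inner ℝ ξ c) ∂(spectralMeasure γhat)) := by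
  have h1 := hγ.hat_eq (mollifierSchwartz hp hε c)
  have h2 := hγ.integrable_schwartz (mollifierSchwartz hp hε c)
  simp only [mollifierSchwartz_apply] at h1 h2
  have h3 : ∀ ξ, fourier (mollifierSchwartz hp hε c) ξ =
      Complex.exp (-(Complex.I * (inner ℝ ξ c : ℝ))) * cosTransform p (ε • ξ) :=
    fun ξ => fourier_pApprox hp hε c ξ
  simp_rw [h3] at h1
  have h2' : Integrable fun w => (γ w).toReal * pApprox p ε (c - w) := by
    have := h2.re
    simpa [← Complex.ofReal_mul] using this
  have hint : Integrable (fun ξ => Complex.exp (-(Complex.I * (inner ℝ ξ c : ℝ))) *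
      (cosTransform p (ε • ξ) : ℂ)) (spectralMeasure γhat) := by
    refine (integrable_cosTransform hγ hp hε).ofReal.bdd_mul (c := 1)
      (by fun_prop) (Eventually.of_forall fun ξ => ?_)
    rw [← mul_neg, mul_comm, ← Complex.ofReal_neg, Complex.norm_exp_ofReal_mul_I]
  have h4 : ∫ w, (γ w).toReal * pApprox p ε (c - w) = ((2 * Real.pi) ^ d)⁻¹ *
      ∫ ξ, cosTransform p (ε • ξ) * Real.cos (inner ℝ ξ c) ∂(spectralMeasure γhat) := by
    have h5 := congrArg Complex.re h1
    have h6 : (∫ w, ((γ w).toReal : ℂ) * (pApprox p ε (c - w) : ℂ)) =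
        ((∫ w, (γ w).toReal * pApprox p ε (c - w) : ℝ) : ℂ) := by
      rw [← integral_complex_ofReal]; simp
    rw [h6, Complex.ofReal_re, Complex.re_ofReal_mul] at h5
    rw [h5]
    congr 1
    rw [← RCLike.re_eq_complex_re, ← integral_re hint]
    refine integral_congr_ae (Eventually.of_forall fun ξ => ?_)
    simp only [RCLike.re_eq_complex_re]
    rw [← mul_neg, mul_comm Complex.I, ← Complex.ofReal_neg, Complex.exp_mul_I,
      ← Complex.ofReal_cos, ← Complex.ofReal_sin, Complex.re_mul_ofReal]
    simp only [Complex.add_re, Complex.ofReal_re, Complex.mul_re, Complex.ofReal_im,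
      Complex.I_re, Complex.I_im, Real.cos_neg]
    ring
  have h7 : 0 ≤ ∫ w, (γ w).toReal * pApprox p ε (c - w) :=
    integral_nonneg fun w => mul_nonneg ENNReal.toReal_nonneg (pApprox_nonneg hp hε _)
  refine ⟨h4 ▸ h7, ?_⟩
  rw [← h4, ofReal_integral_eq_lintegral_ofReal h2' (Eventually.of_forall fun w =>
    mul_nonneg ENNReal.toReal_nonneg (pApprox_nonneg hp hε _))]
  refine lintegral_congr_ae ?_
  filter_upwards [ae_lt_top_of_isCovarianceKernel hd hγ] with w hw
  rw [ENNReal.ofReal_mul ENNReal.toReal_nonneg, ENNReal.ofReal_toReal hw.ne, mul_comm]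

lemma integral_pApprox_mul_cos (hp : IsMollifier p) {ε : ℝ} (hε : 0 < ε) (a b ξ : E d) :
    ∫ y, pApprox p ε (b - y) * Real.cos (inner ℝ ξ (a - y)) =
      cosTransform p (ε • ξ) * Real.cos (inner ℝ ξ (a - b)) := by
  have h1 := fourier_pApprox hp hε b ξ
  unfold fourier at h1
  have h2 := congrArg (fun z => (Complex.exp (Complex.I * (inner ℝ ξ a : ℝ)) * z).re) h1
  simp only at h2
  have hint : Integrable fun y : E d => Complex.exp (Complex.I * (inner ℝ ξ a : ℝ)) *
      (Complex.exp (-(Complex.I * (inner ℝ ξ y : ℝ))) * (pApprox p ε (b - y) : ℂ)) := by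
    refine Integrable.const_mul ?_ _
    refine ((integrable_pApprox hp hε).comp_sub_left b).ofReal.bdd_mul (c := 1)
      (by fun_prop) (Eventually.of_forall fun ξ => ?_)
    rw [← mul_neg, mul_comm, ← Complex.ofReal_neg, Complex.norm_exp_ofReal_mul_I]
  have hre : ∀ (x y z : ℝ), (Complex.exp (Complex.I * (x : ℝ)) *
      (Complex.exp (-(Complex.I * (y : ℝ))) * (z : ℂ))).re = z * Real.cos (x - y) := by
    intro x y z
    rw [← mul_assoc, ← Complex.exp_add]
    have : Complex.I * (x : ℂ) + -(Complex.I * (y : ℂ)) = ((x - y : ℝ) : ℂ) * Complex.I := by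
      push_cast; ring
    rw [this, Complex.re_mul_ofReal, Complex.exp_ofReal_mul_I_re, mul_comm]
  rw [← integral_const_mul, ← RCLike.re_eq_complex_re, ← integral_re hint] at h2
  simp only [RCLike.re_eq_complex_re, hre] at h2
  simp_rw [inner_sub_right]
  exact h2

/-- Integrating out `y` leaves the spectral function `R (a - y')`. Averaging it against the second
mollifier and applying Fubini's theorem, licensed by the integrability of `p̂(ε ·)`, inserts the
second factor `p̂(ε' ·)`. -/
lemma spaceKernel_eq (hd : 0 < d) (hγ : IsCovarianceKernel γ γhat) (hp : IsMollifier p)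
    {ε ε' : ℝ} (hε : 0 < ε) (hε' : 0 < ε') (a b : E d) :
    0 ≤ smoothCov p γhat ε ε' (a - b) ∧
      spaceKernel p γ ε ε' a b = ENNReal.ofReal (smoothCov p γhat ε ε' (a - b)) := by
  have hγm : Measurable γ := hγ.continuous.measurable
  have hpm : ∀ ε, Measurable (pApprox p ε) := fun ε => (continuous_pApprox hp ε).measurable
  have hpc := fun ε => continuous_pApprox hp ε
  have hcc := continuous_cosTransform hp
  set R : E d → ℝ := fun c => ((2 * Real.pi) ^ d)⁻¹ *
      ∫ ξ, cosTransform p (ε • ξ) * Real.cos (inner ℝ ξ c) ∂(spectralMeasure γhat) with hR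
  have hR0 : ∀ c, 0 ≤ R c := fun c => (lintegral_pApprox_mul hd hγ hp hε c).1
  have h1 : spaceKernel p γ ε ε' a b =
      ∫⁻ y', ENNReal.ofReal (pApprox p ε' (b - y')) * ENNReal.ofReal (R (a - y')) := by
    unfold spaceKernel
    rw [lintegral_lintegral_swap]
    · refine lintegral_congr fun y' => ?_
      rw [← (lintegral_pApprox_mul hd hγ hp hε (a - y')).2]
      rw [← lintegral_add_right_eq_self _ y', ← lintegral_const_mul _ (by fun_prop)]
      refine lintegral_congr fun y => ?_
      rw [add_sub_cancel_right, show a - y' - y = a - (y + y') by abel]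
      ring
    · exact Measurable.aemeasurable (by unfold Function.uncurry; fun_prop)
  have hRcont : Continuous R := by
    refine continuous_const.mul ?_
    refine continuous_of_dominated (bound := fun ξ => |cosTransform p (ε • ξ)|) (fun c => ?_)
      (fun c => Eventually.of_forall fun ξ => ?_) (integrable_cosTransform hγ hp hε).abs
      (Eventually.of_forall fun ξ => ?_)
    · exact (by fun_prop : Continuous fun ξ : E d =>
        cosTransform p (ε • ξ) * Real.cos (inner ℝ ξ c)).aestronglyMeasurable
    · rw [norm_mul, Real.norm_eq_abs]
      exact mul_le_of_le_one_right (abs_nonneg _) (Real.abs_cos_le_one _)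
    · fun_prop
  have hprod : Integrable (fun q : E d × E d => pApprox p ε' (b - q.1) *
      (cosTransform p (ε • q.2) * Real.cos (inner ℝ q.2 (a - q.1))))
      (volume.prod (spectralMeasure γhat)) := by
    have := (((integrable_pApprox hp hε').comp_sub_left b).mul_prod
      (integrable_cosTransform hγ hp hε)).mul_bdd (c := 1)
      (g := fun q : E d × E d => Real.cos (inner ℝ q.2 (a - q.1)))
      (by fun_prop) (Eventually.of_forall fun q => Real.abs_cos_le_one _)
    refine this.congr (Eventually.of_forall fun q => ?_)
    simp only; ring
  have hfub : ∫ y, pApprox p ε' (b - y) * R (a - y) = smoothCov p γhat ε ε' (a - b) := by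
    have e1 : ∀ y, pApprox p ε' (b - y) * R (a - y) = ((2 * Real.pi) ^ d)⁻¹ *
        ∫ ξ, pApprox p ε' (b - y) * (cosTransform p (ε • ξ) * Real.cos (inner ℝ ξ (a - y)))
          ∂(spectralMeasure γhat) := by
      intro y; rw [integral_const_mul, hR]; ring
    simp_rw [e1]
    rw [integral_const_mul, integral_integral_swap hprod, smoothCov]
    congr 1
    refine integral_congr_ae (Eventually.of_forall fun ξ => ?_)
    simp only
    rw [mul_assoc, ← integral_pApprox_mul_cos hp hε', ← integral_const_mul]
    refine integral_congr_ae (Eventually.of_forall fun y => ?_)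
    simp only; ring
  have hRint : Integrable fun y => pApprox p ε' (b - y) * R (a - y) := by
    have e1 := hprod.integral_prod_left.const_mul ((2 * Real.pi) ^ d)⁻¹
    refine e1.congr (Eventually.of_forall fun y => ?_)
    simp only
    rw [integral_const_mul, hR]; ring
  have hnn : ∀ y, 0 ≤ pApprox p ε' (b - y) * R (a - y) := fun y =>
    mul_nonneg (pApprox_nonneg hp hε' _) (hR0 _)
  rw [← hfub]
  refine ⟨integral_nonneg hnn, ?_⟩
  rw [h1, ofReal_integral_eq_lintegral_ofReal hRint (Eventually.of_forall hnn)]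
  refine lintegral_congr fun y => ?_
  rw [ENNReal.ofReal_mul (pApprox_nonneg hp hε' _)]

lemma continuous_smoothCov (hγ : IsCovarianceKernel γ γhat) (hp : IsMollifier p) {ε : ℝ}
    (hε : 0 < ε) (ε' : ℝ) : Continuous (smoothCov p γhat ε ε') := by
  have hcc := continuous_cosTransform hp
  refine continuous_const.mul ?_
  refine continuous_of_dominated (bound := fun ξ => |cosTransform p (ε • ξ)|) (fun c => ?_)
    (fun c => Eventually.of_forall fun ξ => ?_) (integrable_cosTransform hγ hp hε).abs
    (Eventually.of_forall fun ξ => ?_)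
  · exact (by fun_prop : Continuous fun ξ : E d => cosTransform p (ε • ξ) *
      cosTransform p (ε' • ξ) * Real.cos (inner ℝ ξ c)).aestronglyMeasurable
  · rw [norm_mul, norm_mul, Real.norm_eq_abs, mul_assoc]
    exact mul_le_of_le_one_right (abs_nonneg _) (mul_le_one₀ (abs_cosTransform_le hp _)
      (abs_nonneg _) (Real.abs_cos_le_one _))
  · fun_prop

lemma smoothCov_nonneg (hd : 0 < d) (hγ : IsCovarianceKernel γ γhat) (hp : IsMollifier p)
    {ε ε' : ℝ} (hε : 0 < ε) (hε' : 0 < ε') (w : E d) : 0 ≤ smoothCov p γhat ε ε' w := by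
  simpa using (spaceKernel_eq hd hγ hp hε hε' w 0).1

lemma smoothCov_bounded (hγ : IsCovarianceKernel γ γhat) (hp : IsMollifier p) {ε : ℝ}
    (hε : 0 < ε) (ε' : ℝ) : ∃ B, ∀ w, |smoothCov p γhat ε ε' w| ≤ B := by
  refine ⟨((2 * Real.pi) ^ d)⁻¹ * ∫ ξ, |cosTransform p (ε • ξ)| ∂(spectralMeasure γhat),
    fun w => ?_⟩
  rw [smoothCov, abs_mul, abs_of_pos (by positivity : 0 < ((2 * Real.pi) ^ d)⁻¹)]
  gcongr
  rw [← Real.norm_eq_abs]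
  refine norm_integral_le_of_norm_le (integrable_cosTransform hγ hp hε).abs
    (Eventually.of_forall fun ξ => ?_)
  rw [norm_mul, norm_mul, Real.norm_eq_abs, mul_assoc]
  exact mul_le_of_le_one_right (abs_nonneg _) (mul_le_one₀ (abs_cosTransform_le hp _)
    (abs_nonneg _) (Real.abs_cos_le_one _))

end SpaceKernel


/-! ### The mollified temporal covariance -/

section TimeKernel

lemma lintegral_Icc_abs_le {g : ℝ → ℝ≥0∞} (R : ℝ) :
    ∫⁻ x in Icc (-R) R, g |x| ≤ 2 * ∫⁻ x in Ioc 0 R, g x := by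
  have hsub : Icc (-R) R ⊆ (Ico (-R) 0 ∪ {0}) ∪ Ioc 0 R := by
    intro x hx
    rcases lt_trichotomy x 0 with h | h | h
    · exact Or.inl (Or.inl ⟨hx.1, h⟩)
    · exact Or.inl (Or.inr h)
    · exact Or.inr ⟨h, hx.2⟩
  have h1 : ∫⁻ x in Ico (-R) 0, g |x| = ∫⁻ x in Ioc 0 R, g x := by
    have h2 := (Measure.measurePreserving_neg (volume : Measure ℝ)).setLIntegral_comp_preimage_emb
      (Homeomorph.neg ℝ).measurableEmbedding g (Ioc 0 R)
    rw [← h2]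
    have h3 : (fun x : ℝ => -x) ⁻¹' Ioc 0 R = Ico (-R) 0 := by
      ext x; simp only [mem_preimage, mem_Ioc, mem_Ico]; constructor <;> rintro ⟨_, _⟩ <;>
        constructor <;> linarith
    change _ = ∫⁻ x in (fun x : ℝ => -x) ⁻¹' Ioc 0 R, g (-x)
    rw [h3]
    refine setLIntegral_congr_fun measurableSet_Ico fun x hx => ?_
    rw [abs_of_neg hx.2]
  have h4 : ∫⁻ x in Ioc 0 R, g |x| = ∫⁻ x in Ioc 0 R, g x :=
    setLIntegral_congr_fun measurableSet_Ioc fun x hx => by rw [abs_of_pos hx.1]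
  calc ∫⁻ x in Icc (-R) R, g |x| ≤ ∫⁻ x in (Ico (-R) 0 ∪ {0}) ∪ Ioc 0 R, g |x| :=
        lintegral_mono_set hsub
    _ ≤ (∫⁻ x in Ico (-R) 0 ∪ {0}, g |x|) + ∫⁻ x in Ioc 0 R, g |x| := lintegral_union_le _ _ _
    _ ≤ ((∫⁻ x in Ico (-R) 0, g |x|) + ∫⁻ x in {0}, g |x|) + ∫⁻ x in Ioc 0 R, g |x| := by
        gcongr; exact lintegral_union_le _ _ _
    _ = _ := by
        rw [h1, h4, Measure.restrict_singleton]; simp [two_mul]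

lemma lintegral_Ioc_rpow {β₀ : ℝ} (hβ₁ : β₀ < 1) {R : ℝ} (hR : 0 ≤ R) :
    ∫⁻ x in Ioc 0 R, ENNReal.ofReal (x ^ (-β₀)) = ENNReal.ofReal (R ^ (1 - β₀) / (1 - β₀)) := by
  have hi : IntervalIntegrable (fun x : ℝ => x ^ (-β₀)) volume 0 R :=
    intervalIntegral.intervalIntegrable_rpow' (by linarith)
  rw [intervalIntegrable_iff_integrableOn_Ioc_of_le hR] at hi
  rw [← ofReal_integral_eq_lintegral_ofReal hi]
  · rw [← intervalIntegral.integral_of_le hR, integral_rpow (Or.inl (by linarith))]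
    rw [Real.zero_rpow (by linarith)]; congr 1; ring_nf
  · filter_upwards [ae_restrict_mem measurableSet_Ioc] with x hx
    exact Real.rpow_nonneg hx.1.le _

lemma gApprox_nonneg {δ : ℝ} (hδ : 0 < δ) (τ : ℝ) : 0 ≤ gApprox δ τ :=
  indicator_nonneg (fun _ _ => by positivity) _

lemma measurable_gApprox (δ : ℝ) : Measurable (gApprox δ) :=
  measurable_const.indicator measurableSet_Icc

lemma lintegral_gApprox_mul {δ : ℝ} (A : ℝ) (f : ℝ → ℝ≥0∞) :
    ∫⁻ u, ENNReal.ofReal (gApprox δ (A - u)) * f u =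
      ENNReal.ofReal δ⁻¹ * ∫⁻ u in Icc (A - δ) A, f u := by
  rw [← lintegral_const_mul' _ _ ENNReal.ofReal_ne_top, ← lintegral_indicator measurableSet_Icc]
  refine lintegral_congr fun u => ?_
  by_cases hu : u ∈ Icc (A - δ) A
  · rw [indicator_of_mem hu, gApprox, indicator_of_mem]
    exact ⟨by linarith [hu.2], by linarith [hu.1]⟩
  · rw [indicator_of_notMem hu, gApprox, indicator_of_notMem]
    · simp
    · exact fun h => hu ⟨by linarith [h.2], by linarith [h.1]⟩

lemma lintegral_gApprox {δ : ℝ} (hδ : 0 < δ) (A : ℝ) :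
    ∫⁻ u, ENNReal.ofReal (gApprox δ (A - u)) = 1 := by
  have h := lintegral_gApprox_mul (δ := δ) A (fun _ => 1)
  simp only [mul_one] at h
  rw [h, setLIntegral_one, Real.volume_Icc, ← ENNReal.ofReal_mul (by positivity)]
  have : δ⁻¹ * (A - (A - δ)) = 1 := by field_simp; ring
  rw [this, ENNReal.ofReal_one]

/-- The constant in the bound of an averaged power by the power. -/
noncomputable def avgConst (β₀ : ℝ) : ℝ := 2 ^ β₀ * (1 + 6 / (1 - β₀))

lemma avgConst_pos {β₀ : ℝ} (hβ₁ : β₀ < 1) : 0 < avgConst β₀ := by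
  have : 0 < 1 - β₀ := by linarith
  unfold avgConst; positivity

/-- Averaging the singularity costs only a constant independent of `δ`. If `δ ≤ |B-A|/2`, the window
stays at distance at least `|B-A|/2` from `B`. Otherwise it lies within `3δ` of `B`, so that
integrating the power gives at most `6/(1-β₀) δ^{-β₀}`, and `δ` dominates `|B-A|/2`. -/
lemma lintegral_gApprox_mul_rpow_le {β₀ : ℝ} (hβ₀ : 0 < β₀) (hβ₁ : β₀ < 1) {δ : ℝ} (hδ : 0 < δ)
    {A B : ℝ} (hAB : B ≠ A) :
    ∫⁻ u, ENNReal.ofReal (gApprox δ (A - u)) * ENNReal.ofReal (|B - u| ^ (-β₀)) ≤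
      ENNReal.ofReal (avgConst β₀) * ENNReal.ofReal (|B - A| ^ (-β₀)) := by
  have h1β : 0 < 1 - β₀ := by linarith
  have hc : 0 < |B - A| := abs_pos.2 (sub_ne_zero.2 hAB)
  have hhalf : (|B - A| / 2) ^ (-β₀) = 2 ^ β₀ * |B - A| ^ (-β₀) := by
    rw [Real.div_rpow hc.le (by norm_num), Real.rpow_neg (by norm_num : (0:ℝ) ≤ 2)]
    field_simp
  rw [← ENNReal.ofReal_mul (avgConst_pos hβ₁).le]
  rcases le_or_gt δ (|B - A| / 2) with hle | hlt
  · calc _ ≤ ∫⁻ u, ENNReal.ofReal (gApprox δ (A - u)) *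
          ENNReal.ofReal ((|B - A| / 2) ^ (-β₀)) := by
          refine lintegral_mono fun u => ?_
          by_cases hu : A - u ∈ Icc 0 δ
          · refine mul_le_mul_right (ENNReal.ofReal_le_ofReal ?_) _
            refine Real.rpow_le_rpow_of_nonpos (by positivity) ?_ (by linarith)
            have h1 : |B - A| ≤ |B - u| + |u - A| := abs_sub_le _ _ _
            have h2 : |u - A| ≤ δ := by
              rw [abs_le]; constructor <;> linarith [hu.1, hu.2]
            linarith
          · simp [gApprox, hu]
      _ = ENNReal.ofReal ((|B - A| / 2) ^ (-β₀)) := by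
          rw [lintegral_mul_const' _ _ ENNReal.ofReal_ne_top, lintegral_gApprox hδ, one_mul]
      _ ≤ _ := by
          apply ENNReal.ofReal_le_ofReal
          rw [hhalf, avgConst]
          gcongr
          have : 0 ≤ 6 / (1 - β₀) := by positivity
          nlinarith [Real.rpow_pos_of_pos (by norm_num : (0:ℝ) < 2) β₀]
  · rw [lintegral_gApprox_mul]
    have h2 : ∫⁻ u in Icc (A - δ) A, ENNReal.ofReal (|B - u| ^ (-β₀)) ≤
        ∫⁻ x in Icc (-(3 * δ)) (3 * δ), ENNReal.ofReal (|x| ^ (-β₀)) := by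
      have h3 := (Measure.measurePreserving_sub_left (volume : Measure ℝ) B).setLIntegral_comp_preimage_emb
        (Homeomorph.subLeft B).measurableEmbedding (fun x => ENNReal.ofReal (|x| ^ (-β₀)))
        (Icc (-(3 * δ)) (3 * δ))
      rw [← h3]
      refine lintegral_mono_set fun u hu => ?_
      have h4 := abs_le.1 (by linarith : |B - A| ≤ 2 * δ)
      simp only [mem_preimage, mem_Icc]
      constructor <;> linarith [hu.1, hu.2]
    calc _ ≤ ENNReal.ofReal δ⁻¹ * (2 * ∫⁻ x in Ioc 0 (3 * δ), ENNReal.ofReal (x ^ (-β₀))) := by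
          gcongr
          exact h2.trans (lintegral_Icc_abs_le (g := fun x => ENNReal.ofReal (x ^ (-β₀))) _)
      _ = ENNReal.ofReal (δ⁻¹ * (2 * ((3 * δ) ^ (1 - β₀) / (1 - β₀)))) := by
          rw [lintegral_Ioc_rpow hβ₁ (by positivity), ENNReal.ofReal_mul (by positivity),
            ENNReal.ofReal_mul (by norm_num)]
          simp
      _ ≤ _ := by
          apply ENNReal.ofReal_le_ofReal
          have h5 : (3 * δ) ^ (1 - β₀) ≤ 3 * (δ * δ ^ (-β₀)) := by
            rw [Real.mul_rpow (by norm_num) hδ.le]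
            have h6 : (3:ℝ) ^ (1 - β₀) ≤ 3 := by
              calc (3:ℝ) ^ (1 - β₀) ≤ 3 ^ (1:ℝ) :=
                    Real.rpow_le_rpow_of_exponent_le (by norm_num) (by linarith)
                _ = 3 := Real.rpow_one _
            have h7 : δ ^ (1 - β₀) = δ * δ ^ (-β₀) := by
              rw [sub_eq_add_neg, Real.rpow_add hδ, Real.rpow_one]
            rw [h7]
            gcongr
          have h8 : δ ^ (-β₀) ≤ 2 ^ β₀ * |B - A| ^ (-β₀) := by
            rw [← hhalf]
            exact Real.rpow_le_rpow_of_nonpos (by positivity) hlt.le (by linarith)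
          calc δ⁻¹ * (2 * ((3 * δ) ^ (1 - β₀) / (1 - β₀)))
              ≤ δ⁻¹ * (2 * ((3 * (δ * δ ^ (-β₀))) / (1 - β₀))) := by gcongr
            _ = 6 / (1 - β₀) * δ ^ (-β₀) := by field_simp; ring
            _ ≤ 6 / (1 - β₀) * (2 ^ β₀ * |B - A| ^ (-β₀)) := by gcongr
            _ ≤ _ := by
              rw [avgConst]
              have : 0 ≤ 2 ^ β₀ * |B - A| ^ (-β₀) := by positivity
              nlinarith

/-- `∫_0^t ∫_0^s g_δ(t-a-u) g_δ'(s-b-u') |u'-u|^{-β₀} du' du`. -/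
noncomputable def timeKernel (β₀ δ δ' t s a b : ℝ) : ℝ≥0∞ :=
  ∫⁻ u in Icc 0 t, ∫⁻ u' in Icc 0 s, ENNReal.ofReal (gApprox δ (t - a - u)) *
    ENNReal.ofReal (gApprox δ' (s - b - u')) * ENNReal.ofReal (|u' - u| ^ (-β₀))

lemma measurable_timeKernel (β₀ δ δ' t s : ℝ) :
    Measurable fun q : ℝ × ℝ => timeKernel β₀ δ δ' t s q.1 q.2 := by
  unfold timeKernel
  have h := measurable_gApprox δ
  have h' := measurable_gApprox δ'
  refine Measurable.lintegral_prod_right' (ν := volume.restrict (Icc 0 t))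
    (f := fun z : (ℝ × ℝ) × ℝ => ∫⁻ u' in Icc 0 s, ENNReal.ofReal (gApprox δ (t - z.1.1 - z.2)) *
    ENNReal.ofReal (gApprox δ' (s - z.1.2 - u')) * ENNReal.ofReal (|u' - z.2| ^ (-β₀))) ?_
  refine Measurable.lintegral_prod_right' (ν := volume.restrict (Icc 0 s))
    (f := fun z : ((ℝ × ℝ) × ℝ) × ℝ => ENNReal.ofReal (gApprox δ (t - z.1.1.1 - z.1.2)) *
    ENNReal.ofReal (gApprox δ' (s - z.1.1.2 - z.2)) * ENNReal.ofReal (|z.2 - z.1.2| ^ (-β₀))) ?_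
  fun_prop

/-- The one-variable averaging bound is used once in `u'` and once in `u`, hence the square of
`avgConst`. -/
lemma timeKernel_le {β₀ : ℝ} (hβ₀ : 0 < β₀) (hβ₁ : β₀ < 1) {δ δ' : ℝ} (hδ : 0 < δ) (hδ' : 0 < δ')
    {t s a b : ℝ} (h : t - a ≠ s - b) :
    timeKernel β₀ δ δ' t s a b ≤
      ENNReal.ofReal (avgConst β₀ ^ 2) * ENNReal.ofReal (|t - a - (s - b)| ^ (-β₀)) := by
  have hg := measurable_gApprox δ
  have hg' := measurable_gApprox δ'
  calc timeKernel β₀ δ δ' t s a b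
      ≤ ∫⁻ u, ∫⁻ u', ENNReal.ofReal (gApprox δ (t - a - u)) *
        ENNReal.ofReal (gApprox δ' (s - b - u')) * ENNReal.ofReal (|u' - u| ^ (-β₀)) :=
        (lintegral_mono fun u => setLIntegral_le_lintegral _ _).trans
          (setLIntegral_le_lintegral _ _)
    _ ≤ ∫⁻ u, ENNReal.ofReal (gApprox δ (t - a - u)) *
        (ENNReal.ofReal (avgConst β₀) * ENNReal.ofReal (|s - b - u| ^ (-β₀))) := by
        refine lintegral_mono_ae ?_
        have h0 : ∀ᵐ u : ℝ, u ≠ s - b := by rw [ae_iff]; simp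
        filter_upwards [h0] with u hu
        simp_rw [mul_assoc]
        rw [lintegral_const_mul _ (by fun_prop)]
        gcongr
        have := lintegral_gApprox_mul_rpow_le hβ₀ hβ₁ hδ' (A := s - b) (B := u) hu
        rw [abs_sub_comm u (s - b)] at this
        simpa only [abs_sub_comm u] using this
    _ = ENNReal.ofReal (avgConst β₀) * ∫⁻ u, ENNReal.ofReal (gApprox δ (t - a - u)) *
        ENNReal.ofReal (|s - b - u| ^ (-β₀)) := by
        rw [← lintegral_const_mul _ (by fun_prop)]
        refine lintegral_congr fun u => ?_
        ring
    _ ≤ ENNReal.ofReal (avgConst β₀) *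
        (ENNReal.ofReal (avgConst β₀) * ENNReal.ofReal (|s - b - (t - a)| ^ (-β₀))) := by
        gcongr
        exact lintegral_gApprox_mul_rpow_le hβ₀ hβ₁ hδ h.symm
    _ = _ := by
        rw [← mul_assoc, ← ENNReal.ofReal_mul (avgConst_pos hβ₁).le, sq, abs_sub_comm]

/-- Since `a < t` and `b < s`, small windows fit inside `[0,t]` and `[0,s]`, and the double average
of a constant is that constant. On the windows `|u' - u|` differs from its limiting value by at most
`δ + δ'`, which squeezes the kernel. -/
lemma tendsto_timeKernel {β₀ : ℝ} (hβ₀ : 0 < β₀) {t s a b : ℝ} (ha : 0 ≤ a) (hb : 0 ≤ b)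
    (hat : a < t) (hbs : b < s) (h : t - a ≠ s - b) :
    Tendsto (fun q : ℝ × ℝ => timeKernel β₀ q.1 q.2 t s a b) (𝓝[>] 0 ×ˢ 𝓝[>] 0)
      (𝓝 (ENNReal.ofReal (|t - a - (s - b)| ^ (-β₀)))) := by
  set c := |t - a - (s - b)| with hc
  have hc0 : 0 < c := abs_pos.2 (sub_ne_zero.2 h)
  have hF : Tendsto (fun q : ℝ × ℝ => q.1 + q.2) (𝓝[>] 0 ×ˢ 𝓝[>] 0) (𝓝 0) := by
    have h1 : Tendsto (fun q : ℝ × ℝ => q.1 + q.2) (𝓝 (0, 0)) (𝓝 (0 + 0)) :=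
      (continuous_fst.add continuous_snd).tendsto (0, 0)
    rw [nhds_prod_eq, add_zero] at h1
    exact h1.mono_left (prod_mono nhdsWithin_le_nhds nhdsWithin_le_nhds)
  have hlow : Tendsto (fun q : ℝ × ℝ => ENNReal.ofReal ((c + (q.1 + q.2)) ^ (-β₀)))
      (𝓝[>] 0 ×ˢ 𝓝[>] 0) (𝓝 (ENNReal.ofReal (c ^ (-β₀)))) := by
    refine ENNReal.tendsto_ofReal (Tendsto.rpow_const ?_ (Or.inl hc0.ne'))
    simpa using hF.const_add c
  have hup : Tendsto (fun q : ℝ × ℝ => ENNReal.ofReal ((c - (q.1 + q.2)) ^ (-β₀)))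
      (𝓝[>] 0 ×ˢ 𝓝[>] 0) (𝓝 (ENNReal.ofReal (c ^ (-β₀)))) := by
    refine ENNReal.tendsto_ofReal (Tendsto.rpow_const ?_ (Or.inl hc0.ne'))
    simpa using hF.const_sub c
  have hpos1 : ∀ᶠ q : ℝ × ℝ in 𝓝[>] 0 ×ˢ 𝓝[>] 0, 0 < q.1 ∧ q.1 < t - a :=
    tendsto_fst.eventually (Ioo_mem_nhdsGT (by linarith))
  have hpos2 : ∀ᶠ q : ℝ × ℝ in 𝓝[>] 0 ×ˢ 𝓝[>] 0, 0 < q.2 ∧ q.2 < s - b :=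
    tendsto_snd.eventually (Ioo_mem_nhdsGT (by linarith))
  have hkey : ∀ q : ℝ × ℝ, 0 < q.1 → q.1 < t - a → 0 < q.2 → q.2 < s - b →
      ∀ u u' : ℝ, t - a - u ∈ Icc 0 q.1 → s - b - u' ∈ Icc 0 q.2 →
      c - (q.1 + q.2) ≤ |u' - u| ∧ |u' - u| ≤ c + (q.1 + q.2) := by
    intro q _ _ _ _ u u' hu hu'
    have e1 : |t - a - u| ≤ q.1 := by rw [abs_of_nonneg hu.1]; exact hu.2
    have e2 : |s - b - u'| ≤ q.2 := by rw [abs_of_nonneg hu'.1]; exact hu'.2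
    rw [abs_le] at e1 e2
    rcases abs_cases (t - a - (s - b)) with ⟨h1, _⟩ | ⟨h1, _⟩ <;>
    rcases abs_cases (u' - u) with ⟨h2, _⟩ | ⟨h2, _⟩ <;> rw [hc, h1, h2] <;>
      constructor <;> linarith
  have hprodone : ∀ q : ℝ × ℝ, 0 < q.1 → q.1 < t - a → 0 < q.2 → q.2 < s - b → ∀ κ : ℝ≥0∞, κ ≠ ∞ →
      ∫⁻ u in Icc 0 t, ∫⁻ u' in Icc 0 s, ENNReal.ofReal (gApprox q.1 (t - a - u)) *
        ENNReal.ofReal (gApprox q.2 (s - b - u')) * κ = κ := by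
    intro q h1 h2 h3 h4 κ hκ
    have e1 : ∀ (δ A T : ℝ), 0 < δ → δ < A → A ≤ T →
        ∫⁻ u in Icc 0 T, ENNReal.ofReal (gApprox δ (A - u)) = 1 := by
      intro δ A T hδ hA hT
      rw [← lintegral_gApprox hδ A]
      refine setLIntegral_eq_of_support_subset fun u hu => ?_
      by_contra hcon
      refine hu ?_
      have h0 : gApprox δ (A - u) = 0 :=
        indicator_of_notMem (fun h => hcon ⟨by linarith [h.2], by linarith [h.1]⟩) _
      simp only [h0, ENNReal.ofReal_zero]
    have e2 : ∀ u, ∫⁻ u' in Icc 0 s, ENNReal.ofReal (gApprox q.1 (t - a - u)) *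
        ENNReal.ofReal (gApprox q.2 (s - b - u')) * κ =
        ENNReal.ofReal (gApprox q.1 (t - a - u)) * κ := by
      intro u
      rw [lintegral_mul_const' _ _ hκ, lintegral_const_mul' _ _ ENNReal.ofReal_ne_top,
        e1 _ _ _ h3 h4 (by linarith), mul_one]
    simp_rw [e2]
    rw [lintegral_mul_const' _ _ hκ, e1 _ _ _ h1 h2 (by linarith), one_mul]
  refine tendsto_of_tendsto_of_tendsto_of_le_of_le' hlow hup ?_ ?_
  · filter_upwards [hpos1, hpos2] with q h1 h2
    rw [← hprodone q h1.1 h1.2 h2.1 h2.2 _ (ENNReal.ofReal_ne_top (r := (c + (q.1 + q.2)) ^ (-β₀)))]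
    -- The diagonal must be discarded for the lower bound: there `0 ^ (-β₀)` takes the value `0`.
    have h3 : ∀ᵐ u : ℝ, ∀ᵐ u' : ℝ, u' ≠ u := by
      refine Eventually.of_forall fun u => ?_
      rw [ae_iff]; simp
    refine lintegral_mono_ae (ae_restrict_of_ae ?_)
    filter_upwards [h3] with u hu
    refine lintegral_mono_ae (ae_restrict_of_ae ?_)
    filter_upwards [hu] with u' hu'
    by_cases m1 : t - a - u ∈ Icc 0 q.1
    · by_cases m2 : s - b - u' ∈ Icc 0 q.2
      · refine mul_le_mul_right (ENNReal.ofReal_le_ofReal ?_) _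
        exact Real.rpow_le_rpow_of_nonpos (abs_pos.2 (sub_ne_zero.2 hu'))
          (hkey q h1.1 h1.2 h2.1 h2.2 u u' m1 m2).2 (by linarith)
      · simp [gApprox, m2]
    · simp [gApprox, m1]
  · have hsmall : ∀ᶠ q : ℝ × ℝ in 𝓝[>] 0 ×ˢ 𝓝[>] 0, q.1 + q.2 < c := hF.eventually_lt_const hc0
    filter_upwards [hpos1, hpos2, hsmall] with q h1 h2 h3
    conv_rhs =>
      rw [← hprodone q h1.1 h1.2 h2.1 h2.2 _
        (ENNReal.ofReal_ne_top (r := (c - (q.1 + q.2)) ^ (-β₀)))]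
    refine lintegral_mono fun u => lintegral_mono fun u' => ?_
    by_cases m1 : t - a - u ∈ Icc 0 q.1
    · by_cases m2 : s - b - u' ∈ Icc 0 q.2
      · refine mul_le_mul_right (ENNReal.ofReal_le_ofReal ?_) _
        exact Real.rpow_le_rpow_of_nonpos (by linarith)
          (hkey q h1.1 h1.2 h2.1 h2.2 u u' m1 m2).1 (by linarith)
      · simp [gApprox, m2]
    · simp [gApprox, m1]

end TimeKernel


/-! ### The energy of the mollified occupation densities -/

section Tonelli

variable {A B Z Y : Type*} [MeasurableSpace A] [MeasurableSpace B] [MeasurableSpace Z]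
  [MeasurableSpace Y] {μa : Measure A} {μb : Measure B} {μz : Measure Z} {μy : Measure Y}
  [SFinite μa] [SFinite μb] [SFinite μz] [SFinite μy]

lemma lintegral_quad_swap {J : A → B → Z → Y → ℝ≥0∞}
    (hJ : Measurable fun q : (Z × Y) × (A × B) => J q.2.1 q.2.2 q.1.1 q.1.2) :
    ∫⁻ z, ∫⁻ y, ∫⁻ a, ∫⁻ b, J a b z y ∂μb ∂μa ∂μy ∂μz =
      ∫⁻ a, ∫⁻ b, ∫⁻ z, ∫⁻ y, J a b z y ∂μy ∂μz ∂μb ∂μa := by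
  have h1 : ∀ z y, ∫⁻ a, ∫⁻ b, J a b z y ∂μb ∂μa = ∫⁻ c, J c.1 c.2 z y ∂(μa.prod μb) := by
    intro z y
    refine lintegral_lintegral (f := fun a b => J a b z y) (Measurable.aemeasurable ?_)
    exact hJ.comp (measurable_const.prodMk measurable_id : Measurable fun c : A × B => ((z, y), c))
  have h2 : ∀ a b, ∫⁻ z, ∫⁻ y, J a b z y ∂μy ∂μz = ∫⁻ c, J a b c.1 c.2 ∂(μz.prod μy) := by
    intro a b
    refine lintegral_lintegral (f := fun z y => J a b z y) (Measurable.aemeasurable ?_)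
    exact hJ.comp (measurable_id.prodMk measurable_const : Measurable fun c : Z × Y => (c, (a, b)))
  simp_rw [h1, h2]
  rw [lintegral_lintegral (f := fun z y => ∫⁻ c, J c.1 c.2 z y ∂(μa.prod μb))
      hJ.lintegral_prod_right'.aemeasurable,
    lintegral_lintegral (f := fun a b => ∫⁻ c, J a b c.1 c.2 ∂(μz.prod μy))
      (hJ.lintegral_prod_left' (μ := μz.prod μy)).aemeasurable]
  exact lintegral_lintegral_swap hJ.aemeasurable

lemma lintegral_prod_mul_prod {H : A → B → ℝ≥0∞} {L : Z → Y → ℝ≥0∞}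
    (hH : Measurable fun q : A × B => H q.1 q.2) (hL : Measurable fun q : Z × Y => L q.1 q.2) :
    ∫⁻ q, ∫⁻ r, H q.1 r.1 * L q.2 r.2 ∂(μb.prod μy) ∂(μa.prod μz) =
      (∫⁻ a, ∫⁻ b, H a b ∂μb ∂μa) * ∫⁻ z, ∫⁻ y, L z y ∂μy ∂μz := by
  have h1 : ∀ q : A × Z, ∫⁻ r, H q.1 r.1 * L q.2 r.2 ∂(μb.prod μy) =
      (∫⁻ b, H q.1 b ∂μb) * ∫⁻ y, L q.2 y ∂μy := fun q =>
    lintegral_prod_mul (hH.comp measurable_prodMk_left).aemeasurable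
      (hL.comp measurable_prodMk_left).aemeasurable
  simp_rw [h1]
  exact lintegral_prod_mul hH.lintegral_prod_right'.aemeasurable
    hL.lintegral_prod_right'.aemeasurable

end Tonelli

/-! ### The energy form and its value on mollified occupation densities. -/

section Energy

variable {d : ℕ} {p : E d → ℝ} {γ : E d → ℝ≥0∞} {γhat : E d → ℝ} {β₀ : ℝ}

/-- `∫∫ φ(s,x) ψ(t,y) |t-s|^{-β₀} γ(x-y)` for nonnegative functions. -/
noncomputable def energy (β₀ : ℝ) (γ : E d → ℝ≥0∞) (φ ψ : ℝ × E d → ℝ) : ℝ≥0∞ :=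
  ∫⁻ z, ∫⁻ w, ENNReal.ofReal (φ z) * ENNReal.ofReal (ψ w) *
    ENNReal.ofReal (|w.1 - z.1| ^ (-β₀)) * γ (z.2 - w.2) ∂(spaceTime d) ∂(spaceTime d)

instance : SFinite (spaceTime d) := by unfold spaceTime; infer_instance

lemma measurable_energy_kernel (hγ : Measurable γ) {φ ψ : ℝ × E d → ℝ} (hφ : Measurable φ)
    (hψ : Measurable ψ) : Measurable fun q : (ℝ × E d) × (ℝ × E d) =>
      ENNReal.ofReal (φ q.1) * ENNReal.ofReal (ψ q.2) *
        ENNReal.ofReal (|q.2.1 - q.1.1| ^ (-β₀)) * γ (q.1.2 - q.2.2) := by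
  fun_prop

lemma finiteEnergy_of_energy_lt_top {φ : ℝ × E d → ℝ} (hφ : Measurable φ) (h0 : ∀ z, 0 ≤ φ z)
    (h : energy β₀ γ φ φ < ∞) : FiniteEnergy β₀ γ φ := by
  refine ⟨hφ, ?_⟩
  convert h using 1
  unfold energy
  simp only [Real.enorm_of_nonneg (h0 _)]

/-- The real-valued form truncates `γ = ∞` to `0`. This is harmless because `γ` is finite almost
everywhere, so `γ (x - y)` is finite for almost every pair of points. -/
lemma energyInner_eq_toReal (hγ : Measurable γ) (hγ' : ∀ᵐ x, γ x < ∞) {φ ψ : ℝ × E d → ℝ}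
    (hφ : Measurable φ) (hψ : Measurable ψ) (hφ0 : ∀ z, 0 ≤ φ z) (hψ0 : ∀ z, 0 ≤ ψ z) :
    energyInner β₀ γ φ ψ = (energy β₀ γ φ ψ).toReal := by
  have hfin : ∀ᵐ z ∂((spaceTime d).prod (spaceTime d)), γ (z.1.2 - z.2.2) < ∞ := by
    have hset : MeasurableSet {z : (ℝ × E d) × (ℝ × E d) | γ (z.1.2 - z.2.2) < ∞} :=
      measurableSet_lt (by fun_prop) measurable_const
    refine (Measure.ae_prod_iff_ae_ae hset).2 (Eventually.of_forall fun z => ?_)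
    have h1 : ∀ᵐ y : E d, γ (z.2 - y) < ∞ :=
      (Measure.measurePreserving_sub_left volume z.2).quasiMeasurePreserving.ae hγ'
    exact (Measure.quasiMeasurePreserving_snd (μ := (volume : Measure ℝ).restrict (Ici 0))
      (ν := (volume : Measure (E d)))).ae h1
  unfold energyInner energy
  rw [integral_eq_lintegral_of_nonneg_ae]
  · rw [lintegral_lintegral (measurable_energy_kernel hγ hφ hψ).aemeasurable]
    congr 1
    refine lintegral_congr_ae ?_
    filter_upwards [hfin] with z hz
    rw [ENNReal.ofReal_mul (by have := hφ0 z.1; have := hψ0 z.2; positivity),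
      ENNReal.ofReal_mul (by have := hφ0 z.1; have := hψ0 z.2; positivity),
      ENNReal.ofReal_mul (hφ0 _), ENNReal.ofReal_toReal hz.ne]
  · refine Eventually.of_forall fun z => ?_
    have := hφ0 z.1; have := hψ0 z.2
    have := ENNReal.toReal_nonneg (a := γ (z.1.2 - z.2.2))
    simp only [Pi.zero_apply]
    positivity
  · exact Measurable.aestronglyMeasurable (by fun_prop)

variable {ε ε' δ δ' : ℝ} {t s : ℝ≥0} {x y : E d} {f g : ℝ≥0 → E d}

lemma Phi_nonneg (hp : IsMollifier p) (hε : 0 < ε) (hδ : 0 < δ) (z : ℝ × E d) :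
    0 ≤ Phi p ε δ t x f z :=
  indicator_nonneg (fun _ _ => intervalIntegral.integral_nonneg t.2 fun _ _ =>
    mul_nonneg (gApprox_nonneg hδ _) (pApprox_nonneg hp hε _)) _

lemma measurable_Phi_integrand (hp : IsMollifier p) (hf : Measurable f) :
    Measurable fun q : (ℝ × E d) × ℝ => gApprox δ (t - q.2 - q.1.1) *
      pApprox p ε (f q.2.toNNReal + x - q.1.2) := by
  have h1 := (continuous_pApprox hp ε).measurable
  have h2 := measurable_gApprox δ
  fun_prop

lemma measurable_Phi (hp : IsMollifier p) (hf : Measurable f) :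
    Measurable (Phi p ε δ t x f) := by
  have h1 : Measurable fun z : ℝ × E d => ∫ s in (0 : ℝ)..t, gApprox δ (t - s - z.1) *
      pApprox p ε (f s.toNNReal + x - z.2) := by
    simp_rw [intervalIntegral.integral_of_le t.coe_nonneg]
    exact ((measurable_Phi_integrand hp hf).stronglyMeasurable.integral_prod_right'
      (ν := volume.restrict (Ioc (0:ℝ) t))).measurable
  have h2 : Phi p ε δ t x f = (Prod.fst ⁻¹' Icc (0:ℝ) t).indicator fun z : ℝ × E d =>
      ∫ s in (0 : ℝ)..t, gApprox δ (t - s - z.1) * pApprox p ε (f s.toNNReal + x - z.2) := by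
    ext z; simp [Phi, indicator]
  rw [h2]
  exact h1.indicator (measurable_fst measurableSet_Icc)

lemma ofReal_Phi (hp : IsMollifier p) (hε : 0 < ε) (hδ : 0 < δ) (hf : Measurable f)
    (z : ℝ × E d) :
    ENNReal.ofReal (Phi p ε δ t x f z) = (Icc (0 : ℝ) t).indicator (fun r => ∫⁻ a in Icc (0 : ℝ) t,
      ENNReal.ofReal (gApprox δ (t - a - r)) *
        ENNReal.ofReal (pApprox p ε (f a.toNNReal + x - z.2))) z.1 := by
  by_cases hz : z.1 ∈ Icc (0 : ℝ) t
  · rw [Phi, indicator_of_mem hz, indicator_of_mem hz, intervalIntegral.integral_of_le t.coe_nonneg,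
      ← integral_Icc_eq_integral_Ioc]
    obtain ⟨C, hC⟩ := (continuous_pApprox hp ε).bounded_above_of_compact_support
      (hasCompactSupport_pApprox hp hε)
    have hmeas : Measurable fun a : ℝ => gApprox δ (t - a - z.1) *
        pApprox p ε (f a.toNNReal + x - z.2) :=
      (measurable_Phi_integrand hp hf).comp (measurable_const.prodMk measurable_id)
    have hint : IntegrableOn (fun a : ℝ => gApprox δ (t - a - z.1) *
        pApprox p ε (f a.toNNReal + x - z.2)) (Icc 0 t) := by
      refine Measure.integrableOn_of_bounded (M := δ⁻¹ * C) (by simp) hmeas.aestronglyMeasurable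
        (Eventually.of_forall fun a => ?_)
      rw [norm_mul]
      refine mul_le_mul ?_ (hC _) (norm_nonneg _) (by positivity)
      rw [Real.norm_of_nonneg (gApprox_nonneg hδ _)]
      exact indicator_le' (fun _ _ => le_rfl) (fun _ _ => by positivity) _
    rw [ofReal_integral_eq_lintegral_ofReal hint (Eventually.of_forall fun a =>
      mul_nonneg (gApprox_nonneg hδ _) (pApprox_nonneg hp hε _))]
    refine lintegral_congr fun a => ?_
    rw [ENNReal.ofReal_mul (gApprox_nonneg hδ _)]
  · rw [Phi, indicator_of_notMem hz, indicator_of_notMem hz, ENNReal.ofReal_zero]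

lemma lintegral_spaceTime_indicator {T : ℝ≥0} {F : ℝ × E d → ℝ≥0∞} :
    ∫⁻ z, (Prod.fst ⁻¹' Icc (0 : ℝ) T).indicator F z ∂(spaceTime d) =
      ∫⁻ z, F z ∂((volume.restrict (Icc (0 : ℝ) T)).prod volume) := by
  rw [lintegral_indicator (measurable_fst measurableSet_Icc)]
  congr 1
  have h1 : (Prod.fst ⁻¹' Icc (0 : ℝ) T : Set (ℝ × E d)) = Icc (0 : ℝ) T ×ˢ univ := by
    ext z; simp
  rw [h1, spaceTime, ← Measure.prod_restrict, Measure.restrict_univ,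
    Measure.restrict_restrict measurableSet_Icc, inter_eq_left.2 Icc_subset_Ici_self]

/-- The energy of two mollified occupation densities, as a double integral along the paths. -/
theorem energy_Phi (hp : IsMollifier p) (hγ : Measurable γ) (hε : 0 < ε) (hδ : 0 < δ)
    (hε' : 0 < ε') (hδ' : 0 < δ') (hf : Measurable f) (hg : Measurable g) :
    energy β₀ γ (Phi p ε δ t x f) (Phi p ε' δ' s y g) =
      ∫⁻ a in Icc (0 : ℝ) t, ∫⁻ b in Icc (0 : ℝ) s, timeKernel β₀ δ δ' t s a b *
        spaceKernel p γ ε ε' (f a.toNNReal + x) (g b.toNNReal + y) := by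
  have hgm := measurable_gApprox δ
  have hgm' := measurable_gApprox δ'
  have hpm := (continuous_pApprox hp ε).measurable
  have hpm' := (continuous_pApprox hp ε').measurable
  set F : ℝ → ℝ × E d → ℝ≥0∞ := fun a z => ENNReal.ofReal (gApprox δ (t - a - z.1)) *
        ENNReal.ofReal (pApprox p ε (f a.toNNReal + x - z.2)) with hF
  set G : ℝ → ℝ × E d → ℝ≥0∞ := fun b z => ENNReal.ofReal (gApprox δ' (s - b - z.1)) *
        ENNReal.ofReal (pApprox p ε' (g b.toNNReal + y - z.2)) with hG
  set k : ℝ × E d → ℝ × E d → ℝ≥0∞ := fun z w =>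
    ENNReal.ofReal (|w.1 - z.1| ^ (-β₀)) * γ (z.2 - w.2) with hk
  have h1 : energy β₀ γ (Phi p ε δ t x f) (Phi p ε' δ' s y g) =
      ∫⁻ z, ∫⁻ w, (∫⁻ a in Icc (0 : ℝ) t, F a z) * (∫⁻ b in Icc (0 : ℝ) s, G b w) * k z w
        ∂((volume.restrict (Icc (0 : ℝ) s)).prod volume)
        ∂((volume.restrict (Icc (0 : ℝ) t)).prod volume) := by
    rw [← lintegral_spaceTime_indicator]
    unfold energy
    refine lintegral_congr fun z => ?_
    by_cases hz : z.1 ∈ Icc (0 : ℝ) t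
    · rw [indicator_of_mem (by exact hz), ← lintegral_spaceTime_indicator]
      refine lintegral_congr fun w => ?_
      rw [ofReal_Phi hp hε hδ hf, ofReal_Phi hp hε' hδ' hg, indicator_of_mem hz]
      by_cases hw : w.1 ∈ Icc (0 : ℝ) s
      · rw [indicator_of_mem hw, indicator_of_mem (by exact hw), mul_assoc]
      · rw [indicator_of_notMem hw, indicator_of_notMem (by exact hw)]; simp
    · rw [indicator_of_notMem (by exact hz)]
      simp_rw [ofReal_Phi hp hε hδ hf z, indicator_of_notMem hz]
      simp
  have h2 : ∀ z w, (∫⁻ a in Icc (0 : ℝ) t, F a z) * (∫⁻ b in Icc (0 : ℝ) s, G b w) * k z w =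
      ∫⁻ a in Icc (0 : ℝ) t, ∫⁻ b in Icc (0 : ℝ) s, F a z * G b w * k z w := by
    intro z w
    have m1 : Measurable fun a => F a z := by simp only [hF]; fun_prop
    have m2 : Measurable fun b => G b w := by simp only [hG]; fun_prop
    rw [mul_assoc, ← lintegral_mul_const _ m1]
    refine lintegral_congr fun a => ?_
    rw [← lintegral_mul_const _ m2, ← lintegral_const_mul _ (m2.mul_const _)]
    refine lintegral_congr fun b => ?_
    ring
  rw [h1]
  simp_rw [h2]
  -- Once the path times `a` and `b` are outermost, the integrand splits into a function of the two
  -- time variables and a function of the two space variables.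
  rw [lintegral_quad_swap (J := fun a b z w => F a z * G b w * k z w)
    (by simp only [hF, hG, hk]; fun_prop)]
  refine lintegral_congr fun a => lintegral_congr fun b => ?_
  have h3 : ∀ z w : ℝ × E d, F a z * G b w * k z w =
      (fun u u' => ENNReal.ofReal (gApprox δ (t - a - u)) * ENNReal.ofReal (gApprox δ' (s - b - u')) *
        ENNReal.ofReal (|u' - u| ^ (-β₀))) z.1 w.1 *
      (fun v v' => ENNReal.ofReal (pApprox p ε (f a.toNNReal + x - v)) *
        ENNReal.ofReal (pApprox p ε' (g b.toNNReal + y - v')) * γ (v - v')) z.2 w.2 := by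
    intro z w; simp only [hF, hG, hk]; ring
  simp_rw [h3]
  rw [lintegral_prod_mul_prod
    (H := fun u u' => ENNReal.ofReal (gApprox δ (t - a - u)) *
      ENNReal.ofReal (gApprox δ' (s - b - u')) * ENNReal.ofReal (|u' - u| ^ (-β₀)))
    (L := fun v v' => ENNReal.ofReal (pApprox p ε (f a.toNNReal + x - v)) *
        ENNReal.ofReal (pApprox p ε' (g b.toNNReal + y - v')) * γ (v - v'))
    (by fun_prop) (by fun_prop)]
  rfl

end Energy


/-! ### Symmetric Lévy processes -/

section Levy

variable {d : ℕ} {Ω' : Type*} [MeasurableSpace Ω'] {P' : Measure Ω'} {Ψ : E d → ℝ}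

/-- In a process with independent increments, the future increments are independent of the past. -/
lemma HasIndepIncrements.indepFun_past [IsProbabilityMeasure P'] {X : ℝ≥0 → Ω' → E d}
    (hX : HasIndepIncrements X P') (hm : ∀ t, Measurable (X t)) {s q r : ℝ≥0} (hsq : s ≤ q)
    (hqr : q ≤ r) :
    IndepFun (fun ω (u : Icc s q) => X u ω - X s ω) (fun ω => X r ω - X q ω) P' := by
  classical
  refine IndepFun.process_indepFun (fun u => (hm _).sub (hm _)) ((hm r).sub (hm q)) fun I => ?_
  set J : Finset ℝ≥0 := I.image (Subtype.val : Icc s q → ℝ≥0) with hJ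
  have hJmem : ∀ u ∈ J, s ≤ u ∧ u ≤ q := by
    intro u hu
    obtain ⟨v, -, rfl⟩ := Finset.mem_image.1 hu
    exact v.2
  set n := J.card with hn
  set e : Fin n ↪o ℝ≥0 := J.orderEmbOfFin rfl with he
  have heJ : ∀ i, e i ∈ J := fun i => J.orderEmbOfFin_mem rfl i
  -- The times are `s`, then the points of `J` in increasing order, then `q`, then `r` forever.
  -- Increments `0, …, n` lie in the past and increment `n + 1` is `X r - X q`; each `X u - X s` is
  -- a telescoping sum of the former.
  set τ : ℕ → ℝ≥0 := fun k =>
    if k = 0 then s else if h : k - 1 < n then e ⟨k - 1, h⟩ else if k = n + 1 then q else r with hτ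
  have τ0 : τ 0 = s := by simp [hτ]
  have τe : ∀ i : Fin n, τ (i + 1) = e i := by
    intro i; simp [hτ]
  have τq : τ (n + 1) = q := by simp [hτ]
  have τr : ∀ k, n + 1 < k → τ k = r := by
    intro k hk
    simp only [hτ]
    rw [if_neg (by omega), dif_neg (by omega), if_neg (by omega)]
  have hmono : Monotone τ := by
    refine monotone_nat_of_le_succ fun k => ?_
    rcases Nat.eq_zero_or_pos k with rfl | hk
    · rw [τ0]
      rcases Nat.eq_zero_or_pos n with h0 | h0
      · have : τ (0 + 1) = q := by rw [← τq, h0]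
        rw [this]; exact hsq
      · have := τe ⟨0, h0⟩
        simp only at this
        rw [this]; exact (hJmem _ (heJ _)).1
    · obtain ⟨j, rfl⟩ : ∃ j, k = j + 1 := ⟨k - 1, by omega⟩
      rcases lt_trichotomy j n with h | h | h
      · have h1 := τe ⟨j, h⟩
        simp only at h1
        rw [h1]
        rcases Nat.lt_or_ge (j + 1) n with h2 | h2
        · have h3 := τe ⟨j + 1, h2⟩
          simp only at h3
          rw [h3]
          exact e.monotone (by simp)
        · have : j + 1 = n := by omega
          rw [this, τq]; exact (hJmem _ (heJ _)).2
      · subst h; rw [τq, τr _ (by omega)]; exact hqr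
      · rw [τr _ (by omega), τr _ (by omega)]
  have hind := hX.nat hmono
  have hmeas : ∀ k, Measurable fun ω => X (τ (k + 1)) ω - X (τ k) ω := fun k => (hm _).sub (hm _)
  have h1 := hind.indepFun_finset (Finset.range (n + 1)) {n + 1} (by simp) hmeas
  have hidx : ∀ u : I, ∃ i : Fin n, e i = (u : Icc s q) := by
    intro u
    have : ((u : Icc s q) : ℝ≥0) ∈ Set.range e := by
      rw [he, Finset.range_orderEmbOfFin]
      exact Finset.mem_coe.2 (Finset.mem_image.2 ⟨u, u.2, rfl⟩)
    exact this
  choose idx hidx using hidx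
  let Φ₁ : (Finset.range (n + 1) → E d) → (I → E d) := fun z u =>
    ∑ k : Finset.range (n + 1), if (k : ℕ) < idx u + 1 then z k else 0
  let Φ₂ : (({n + 1} : Finset ℕ) → E d) → E d := fun z => z ⟨n + 1, by simp⟩
  have hΦ₁ : Measurable Φ₁ := by
    refine measurable_pi_iff.2 fun u => ?_
    refine Finset.measurable_sum _ fun k _ => ?_
    split_ifs
    · exact measurable_pi_apply k
    · exact measurable_const
  have h2 := h1.comp hΦ₁ (measurable_pi_apply _ : Measurable Φ₂)
  convert h2 using 1
  · ext ω u : 2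
    simp only [Function.comp, Φ₁]
    rw [Finset.sum_coe_sort (Finset.range (n + 1))
      (fun k => if k < (idx u : ℕ) + 1 then X (τ (k + 1)) ω - X (τ k) ω else 0),
      ← Finset.sum_filter]
    have hf : (Finset.range (n + 1)).filter (fun k => k < (idx u : ℕ) + 1) =
        Finset.range ((idx u : ℕ) + 1) := by
      ext k; simp only [Finset.mem_filter, Finset.mem_range]
      have := (idx u).2
      omega
    rw [hf, Finset.sum_range_sub (fun k => X (τ k) ω), τ0, τe, hidx]
  · ext ω : 1
    simp only [Function.comp]
    rw [τq, τr _ (by omega)]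

/-- A jointly measurable process with right-continuous paths and independent increments, whose
increments have symmetric characteristic functions with exponent `Ψ`. -/
structure IsRegularProcess (X : ℝ≥0 → Ω' → E d) (Ψ : E d → ℝ) (P' : Measure Ω') : Prop where
  measurable : Measurable fun q : ℝ≥0 × Ω' => X q.1 q.2
  right_continuous : ∀ ω' t, ContinuousWithinAt (fun s => X s ω') (Ici t) t
  indep : ∀ s q r : ℝ≥0, s ≤ q → q ≤ r →
    IndepFun (fun ω (u : Icc s q) => X u ω - X s ω) (fun ω => X r ω - X q ω) P'
  integral_cos : ∀ (r s : ℝ≥0) (ξ z : E d),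
    ∫ ω', Real.cos (inner ℝ ξ (X r ω' - X s ω' + z)) ∂P' =
      Real.exp (-(|(r : ℝ) - s| * Ψ ξ)) * Real.cos (inner ℝ ξ z)

/-- The grid point of mesh `1/(n+1)` just above `t`. -/
noncomputable def gridAbove (n : ℕ) (t : ℝ≥0) : ℝ≥0 := (⌈(n + 1) * t⌉₊ : ℝ≥0) / (n + 1)

lemma le_gridAbove (n : ℕ) (t : ℝ≥0) : t ≤ gridAbove n t := by
  rw [gridAbove, le_div_iff₀ (by positivity), mul_comm]
  exact Nat.le_ceil ((n + 1 : ℝ≥0) * t)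

lemma tendsto_gridAbove (t : ℝ≥0) : Tendsto (fun n => gridAbove n t) atTop (𝓝[≥] t) := by
  refine tendsto_nhdsWithin_iff.2 ⟨?_, Eventually.of_forall fun n => le_gridAbove n t⟩
  have h1 : Tendsto (fun n : ℕ => t + 1 / ((n : ℝ≥0) + 1)) atTop (𝓝 (t + 0)) := by
    refine Tendsto.const_add _ ?_
    rw [← NNReal.tendsto_coe]
    simpa using tendsto_one_div_add_atTop_nhds_zero_nat (𝕜 := ℝ)
  rw [add_zero] at h1
  refine tendsto_of_tendsto_of_tendsto_of_le_of_le tendsto_const_nhds h1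
    (fun n => le_gridAbove n t) fun n => ?_
  rw [gridAbove]
  have h2 : (t + 1 / ((n : ℝ≥0) + 1)) * (n + 1) = (n + 1) * t + 1 := by field_simp
  rw [div_le_iff₀ (by positivity), h2]
  exact (Nat.ceil_lt_add_one (a := (n + 1 : ℝ≥0) * t) zero_le).le

/-- Replacing `t` by the next grid point leaves countably many times, hence a jointly measurable
map; right continuity recovers `X` in the limit since the grid points approach from above. -/
lemma measurable_uncurry_of_rightContinuous {X : ℝ≥0 → Ω' → E d} (hm : ∀ t, Measurable (X t))
    (hrc : ∀ ω' t, ContinuousWithinAt (fun s => X s ω') (Ici t) t) :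
    Measurable fun q : ℝ≥0 × Ω' => X q.1 q.2 := by
  refine measurable_of_tendsto_metrizable (f := fun n (q : ℝ≥0 × Ω') => X (gridAbove n q.1) q.2)
    (fun n => ?_) ?_
  · have h1 : Measurable fun q : ℕ × Ω' => X ((q.1 : ℝ≥0) / (n + 1)) q.2 :=
      measurable_from_prod_countable_right fun k => hm ((k : ℝ≥0) / (n + 1))
    have h2 : Measurable fun q : ℝ≥0 × Ω' => (⌈((n : ℝ≥0) + 1) * q.1⌉₊, q.2) :=
      (Nat.measurable_ceil.comp (measurable_fst.const_mul _)).prodMk measurable_snd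
    have h3 := h1.comp h2
    exact h3
  · refine tendsto_pi_nhds.2 fun q => ?_
    exact (hrc q.2 q.1).tendsto.comp (tendsto_gridAbove q.1)

variable [IsProbabilityMeasure P'] {X : ℝ≥0 → Ω' → E d}

/-- The characteristic function of an increment is real, so the phase of `z` factors out as a
cosine. When `r < s` the evenness of the cosine exchanges the roles of the two times. -/
lemma IsSymmetricLevyProcess.integral_cos_sub (hX : IsSymmetricLevyProcess X Ψ P') (r s : ℝ≥0)
    (ξ z : E d) : ∫ ω', Real.cos (inner ℝ ξ (X r ω' - X s ω' + z)) ∂P' =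
      Real.exp (-(|(r : ℝ) - s| * Ψ ξ)) * Real.cos (inner ℝ ξ z) := by
  have key : ∀ (s h : ℝ≥0),
      ∫ ω', Complex.exp (Complex.I * (inner ℝ ξ (X (s + h) ω' - X s ω') : ℝ)) ∂P' =
        Real.exp (-(h * Ψ ξ)) := by
    intro s h
    rw [← hX.exponent h ξ]
    have := (hX.stationary_increments s h).comp (u := fun x : E d =>
      Complex.exp (Complex.I * (inner ℝ ξ x : ℝ))) (by fun_prop)
    exact this.integral_eq
  have hint : ∀ (r s : ℝ≥0) (c : ℂ), Integrable (fun ω' => c *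
      Complex.exp (Complex.I * (inner ℝ ξ (X r ω' - X s ω') : ℝ))) P' := by
    intro r s c
    have h1 := hX.measurable r
    have h2 := hX.measurable s
    refine Integrable.const_mul (Integrable.of_bound (C := 1) ?_ (Eventually.of_forall fun ω => ?_)) _
    · exact Measurable.aestronglyMeasurable (by fun_prop)
    · rw [mul_comm, Complex.norm_exp_ofReal_mul_I]
  have key2 : ∀ (s h : ℝ≥0) (z : E d),
      ∫ ω', Real.cos (inner ℝ ξ (X (s + h) ω' - X s ω' + z)) ∂P' =
        Real.exp (-(h * Ψ ξ)) * Real.cos (inner ℝ ξ z) := by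
    intro s h z
    have h1 := congrArg (fun w => (Complex.exp (Complex.I * (inner ℝ ξ z : ℝ)) * w).re) (key s h)
    rw [← integral_const_mul, ← RCLike.re_eq_complex_re, ← integral_re (hint _ _ _)] at h1
    simp only [RCLike.re_eq_complex_re] at h1
    rw [Complex.re_mul_ofReal, mul_comm Complex.I, Complex.exp_ofReal_mul_I_re] at h1
    rw [mul_comm, ← h1]
    refine integral_congr_ae (Eventually.of_forall fun ω => ?_)
    simp only
    rw [← Complex.exp_add, mul_comm Complex.I, ← add_mul, ← Complex.ofReal_add,
      Complex.exp_ofReal_mul_I_re, inner_add_right, add_comm]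
  rcases le_total s r with h | h
  · obtain ⟨v, rfl⟩ : ∃ v, r = s + v := exists_add_of_le h
    rw [key2]
    simp
  · obtain ⟨v, rfl⟩ : ∃ v, s = r + v := exists_add_of_le h
    have h1 : ∀ ω', Real.cos (inner ℝ ξ (X r ω' - X (r + v) ω' + z)) =
        Real.cos (inner ℝ ξ (X (r + v) ω' - X r ω' + (-z))) := by
      intro ω'
      rw [← Real.cos_neg, ← inner_neg_right]
      congr 2; abel
    simp_rw [h1]
    rw [key2]
    simp

/-- A symmetric Lévy process agrees almost surely, at all times, with a regular process. -/
theorem IsSymmetricLevyProcess.exists_regular (hX : IsSymmetricLevyProcess X Ψ P') :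
    ∃ X' : ℝ≥0 → Ω' → E d, IsRegularProcess X' Ψ P' ∧ ∀ᵐ ω' ∂P', ∀ t, X' t ω' = X t ω' := by
  classical
  have h0 := hX.cadlag
  rw [ae_iff] at h0
  -- On a measurable null set containing the paths that fail to be càdlàg, the path is replaced by
  -- the zero path.
  set N := toMeasurable P' {a | ¬∀ (t : ℝ≥0), ContinuousWithinAt (fun s => X s a) (Ici t) t ∧
    ∃ l, Tendsto (fun s => X s a) (𝓝[<] t) (𝓝 l)} with hN
  have hNm : MeasurableSet N := measurableSet_toMeasurable _ _
  have hN0 : P' N = 0 := by rw [hN, measure_toMeasurable, h0]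
  have hNc : ∀ᵐ ω' ∂P', ω' ∉ N := by rw [ae_iff]; simpa using hN0
  set X' : ℝ≥0 → Ω' → E d := fun t => Nᶜ.indicator (X t) with hX'
  have hae : ∀ᵐ ω' ∂P', ∀ t, X' t ω' = X t ω' := by
    filter_upwards [hNc] with ω' h t
    simp [hX', h]
  have hm : ∀ t, Measurable (X' t) := fun t => (hX.measurable t).indicator hNm.compl
  have hrc : ∀ ω' t, ContinuousWithinAt (fun s => X' s ω') (Ici t) t := by
    intro ω' t
    by_cases h : ω' ∈ N
    · simp only [hX', indicator, mem_compl_iff, h, not_true_eq_false, if_false]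
      exact continuousWithinAt_const
    · have h1 : ∀ (t : ℝ≥0), ContinuousWithinAt (fun s => X s ω') (Ici t) t ∧
          ∃ l, Tendsto (fun s => X s ω') (𝓝[<] t) (𝓝 l) := by
        by_contra hcon
        exact h (subset_toMeasurable _ _ hcon)
      simp only [hX', indicator, mem_compl_iff, h, not_false_eq_true, if_true]
      exact (h1 t).1
  refine ⟨X', ⟨measurable_uncurry_of_rightContinuous hm hrc, hrc, ?_, ?_⟩, hae⟩
  · intro s q r hsq hqr
    refine (HasIndepIncrements.indepFun_past hX.indep_increments hX.measurable hsq hqr).congr ?_ ?_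
    · filter_upwards [hae] with ω' h
      ext u : 1
      rw [h, h]
    · filter_upwards [hae] with ω' h
      rw [h, h]
  · intro r s ξ z
    rw [← hX.integral_cos_sub r s ξ z]
    refine integral_congr_ae ?_
    filter_upwards [hae] with ω' h
    rw [h, h]

lemma IsSymmetricLevyProcess.exp_eq (hX : IsSymmetricLevyProcess X Ψ P') (t : ℝ≥0) (ξ : E d) :
    ∫ ω', Real.cos (inner ℝ ξ (X t ω')) ∂P' = Real.exp (-(t * Ψ ξ)) := by
  have h1 := hX.integral_cos_sub t 0 ξ 0
  simp only [NNReal.coe_zero, sub_zero, inner_zero_right, Real.cos_zero, mul_one, add_zero] at h1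
  rw [abs_of_nonneg t.coe_nonneg] at h1
  rw [← h1]
  refine integral_congr_ae ?_
  filter_upwards [hX.zero] with ω' h
  simp [h]

lemma IsSymmetricLevyProcess.integrable_cos (hX : IsSymmetricLevyProcess X Ψ P') (t : ℝ≥0)
    (ξ : E d) : Integrable (fun ω' => Real.cos (inner ℝ ξ (X t ω'))) P' := by
  have h1 := hX.measurable t
  refine Integrable.of_bound (C := 1) ?_ (Eventually.of_forall fun ω => Real.abs_cos_le_one _)
  exact Measurable.aestronglyMeasurable (by fun_prop)

lemma IsSymmetricLevyProcess.exponent_nonneg (hX : IsSymmetricLevyProcess X Ψ P') (ξ : E d) :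
    0 ≤ Ψ ξ := by
  have h1 := hX.exp_eq 1 ξ
  have h2 : ∫ ω', Real.cos (inner ℝ ξ (X 1 ω')) ∂P' ≤ ∫ _, (1 : ℝ) ∂P' :=
    integral_mono (hX.integrable_cos 1 ξ) (integrable_const _) fun ω => Real.cos_le_one _
  rw [h1] at h2
  simp only [NNReal.coe_one, one_mul, integral_const, probReal_univ, smul_eq_mul,
    mul_one, Real.exp_le_one_iff] at h2
  linarith

lemma IsSymmetricLevyProcess.continuous_exponent (hX : IsSymmetricLevyProcess X Ψ P') :
    Continuous Ψ := by
  have h1 : Ψ = fun ξ => -Real.log (∫ ω', Real.cos (inner ℝ ξ (X 1 ω')) ∂P') := by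
    ext ξ
    rw [hX.exp_eq]; simp
  have hm := hX.measurable 1
  have h2 : Continuous fun ξ => ∫ ω', Real.cos (inner ℝ ξ (X 1 ω')) ∂P' := by
    refine continuous_of_dominated (bound := fun _ => 1) (fun ξ => ?_)
      (fun ξ => Eventually.of_forall fun ω => Real.abs_cos_le_one _) (integrable_const _)
      (Eventually.of_forall fun ω => by fun_prop)
    exact Measurable.aestronglyMeasurable (by fun_prop)
  rw [h1]
  refine (h2.log fun ξ => ?_).neg
  rw [hX.exp_eq]; exact (Real.exp_pos _).ne'

/-- The inequality `1 - cos 2x ≤ 4 (1 - cos x)`, averaged over the law of `X t`, compares `1 -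
e^{-tΨ(2ξ)}` with `4 (1 - e^{-tΨ(ξ)})`; division by `t` and `t → 0` gives the exponents. -/
lemma IsSymmetricLevyProcess.exponent_two_smul_le (hX : IsSymmetricLevyProcess X Ψ P') (ξ : E d) :
    Ψ ((2 : ℝ) • ξ) ≤ 4 * Ψ ξ := by
  set a := Ψ ((2 : ℝ) • ξ)
  set b := Ψ ξ
  have ha : 0 ≤ a := hX.exponent_nonneg _
  have h1 : ∀ t : ℝ≥0, 1 - Real.exp (-(t * a)) ≤ 4 * (1 - Real.exp (-(t * b))) := by
    intro t
    rw [← hX.exp_eq t ξ, ← hX.exp_eq t ((2 : ℝ) • ξ)]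
    have h2 : (1 : ℝ) = ∫ _, (1 : ℝ) ∂P' := by simp
    have h3 : 1 - ∫ ω', Real.cos (inner ℝ ((2 : ℝ) • ξ) (X t ω')) ∂P' =
        ∫ ω', (1 - Real.cos (inner ℝ ((2 : ℝ) • ξ) (X t ω'))) ∂P' := by
      rw [integral_sub (integrable_const _) (hX.integrable_cos t _)]; simp
    have h4 : 4 * (1 - ∫ ω', Real.cos (inner ℝ ξ (X t ω')) ∂P') =
        ∫ ω', 4 * (1 - Real.cos (inner ℝ ξ (X t ω'))) ∂P' := by
      rw [integral_const_mul, integral_sub (integrable_const _) (hX.integrable_cos t _)]; simp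
    rw [h3, h4]
    refine integral_mono ((integrable_const _).sub (hX.integrable_cos t _))
      (((integrable_const _).sub (hX.integrable_cos t _)).const_mul _) fun ω => ?_
    rw [inner_smul_left]
    simp only [conj_trivial]
    rw [Real.cos_two_mul]
    nlinarith [sq_nonneg (Real.cos (inner ℝ ξ (X t ω)) - 1)]
  have h2 : ∀ t : ℝ, 0 < t → a ≤ 4 * b * (1 + t * a) := by
    intro t ht
    have h3 : 1 - Real.exp (-(t * a)) ≤ 4 * (1 - Real.exp (-(t * b))) := h1 ⟨t, ht.le⟩
    have h4 : 1 - Real.exp (-(t * b)) ≤ t * b := by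
      have := Real.add_one_le_exp (-(t * b)); linarith
    have h5 : Real.exp (-(t * a)) ≤ 1 / (1 + t * a) := by
      rw [Real.exp_neg, ← one_div]
      exact one_div_le_one_div_of_le (by positivity) (by linarith [Real.add_one_le_exp (t * a)])
    have h6 : t * a / (1 + t * a) ≤ 4 * (t * b) := by
      have : t * a / (1 + t * a) = 1 - 1 / (1 + t * a) := by
        field_simp; ring
      linarith
    rw [div_le_iff₀ (by positivity)] at h6
    have h7 : t * a ≤ t * (4 * b * (1 + t * a)) := by linarith
    exact le_of_mul_le_mul_left h7 ht
  have h3 : Tendsto (fun t : ℝ => 4 * b * (1 + t * a)) (𝓝[>] 0) (𝓝 (4 * b * (1 + 0 * a))) :=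
    ((continuous_const.mul (continuous_const.add (continuous_id.mul continuous_const))).tendsto
      0).mono_left nhdsWithin_le_nhds
  have h4 := ge_of_tendsto h3 (by filter_upwards [self_mem_nhdsWithin] with t ht using h2 t ht)
  linarith

/-- `Ψ` is bounded on the unit ball by continuity, and each doubling of the radius costs a factor
`4`. Rounding `‖ξ‖` up to a power of `2` costs the last factor `4`. -/
lemma IsSymmetricLevyProcess.exists_exponent_le (hX : IsSymmetricLevyProcess X Ψ P') :
    ∃ C, 0 ≤ C ∧ ∀ ξ, Ψ ξ ≤ C * (1 + ‖ξ‖ ^ 2) := by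
  obtain ⟨C, hC⟩ := (isCompact_closedBall (0 : E d) 1).exists_bound_of_continuousOn
    hX.continuous_exponent.continuousOn
  have hC' : ∀ ξ : E d, ‖ξ‖ ≤ 1 → Ψ ξ ≤ C := fun ξ hξ =>
    (le_abs_self _).trans (hC ξ (by simpa using hξ))
  have hC0 : 0 ≤ C := (hX.exponent_nonneg 0).trans (hC' 0 (by simp))
  have h1 : ∀ n : ℕ, ∀ ξ : E d, ‖ξ‖ ≤ 2 ^ n → Ψ ξ ≤ 4 ^ n * C := by
    intro n
    induction n with
    | zero => intro ξ hξ; simpa using hC' ξ (by simpa using hξ)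
    | succ n ih =>
      intro ξ hξ
      have h2 := hX.exponent_two_smul_le ((2⁻¹ : ℝ) • ξ)
      rw [smul_smul] at h2
      norm_num at h2
      have h3 := ih ((2⁻¹ : ℝ) • ξ) (by
        rw [norm_smul]; norm_num; rw [pow_succ] at hξ; linarith)
      norm_num at h3
      rw [pow_succ]
      linarith
  refine ⟨4 * C, by positivity, fun ξ => ?_⟩
  rcases le_total ‖ξ‖ 1 with h | h
  · have := hC' ξ h
    nlinarith [mul_nonneg hC0 (sq_nonneg ‖ξ‖)]
  · obtain ⟨n, hn1, hn2⟩ := exists_nat_pow_near h (by norm_num : (1:ℝ) < 2)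
    have h2 := h1 (n + 1) ξ hn2.le
    have h3 : (4 : ℝ) ^ n ≤ ‖ξ‖ ^ 2 := by
      calc (4 : ℝ) ^ n = (2 ^ n) ^ 2 := by rw [← pow_mul, mul_comm, pow_mul]; norm_num
        _ ≤ _ := by gcongr
    rw [pow_succ] at h2
    nlinarith

/-- The exponent tends to infinity, by the Riemann–Lebesgue lemma. -/
lemma IsSymmetricLevyProcess.tendsto_exponent (hX : IsSymmetricLevyProcess X Ψ P') :
    Tendsto Ψ (cocompact (E d)) atTop := by
  set ν := P'.map (X 1) with hν
  have : IsProbabilityMeasure ν := Measure.isProbabilityMeasure_map (hX.measurable 1).aemeasurable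
  have hac : ν ≪ volume := hX.density 1 one_pos
  have h1 := tendsto_integral_exp_inner_smul_cocompact
    (fun x : E d => ((ν.rnDeriv volume x).toReal : ℂ))
  -- The transform in the Riemann–Lebesgue lemma carries `2π` in its phase, so that it equals the
  -- characteristic function at `-2π w`.
  have h2 : ∀ w : E d, ∫ v, Real.fourierChar (-inner ℝ v w) • ((ν.rnDeriv volume v).toReal : ℂ) =
      ((Real.exp (-Ψ ((-(2 * Real.pi)) • w)) : ℝ) : ℂ) := by
    intro w
    have h3 := hX.exponent 1 ((-(2 * Real.pi)) • w)
    simp only [NNReal.coe_one, one_mul] at h3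
    rw [← h3]
    have h4 : ∫ ω', Complex.exp (Complex.I * (inner ℝ ((-(2 * Real.pi)) • w) (X 1 ω') : ℝ)) ∂P' =
        ∫ v, Complex.exp (Complex.I * (inner ℝ ((-(2 * Real.pi)) • w) v : ℝ)) ∂ν := by
      rw [hν, integral_map (hX.measurable 1).aemeasurable
        (Measurable.aestronglyMeasurable (by fun_prop))]
    rw [h4, ← integral_rnDeriv_smul hac]
    refine integral_congr_ae (Eventually.of_forall fun v => ?_)
    simp only
    rw [Circle.smul_def, Real.fourierChar_apply, smul_eq_mul, mul_comm, Complex.real_smul,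
      inner_smul_left, real_inner_comm]
    congr 2
    simp only [conj_trivial]
    push_cast; ring
  simp_rw [h2] at h1
  have h3 : Tendsto (fun w : E d => Real.exp (-Ψ ((-(2 * Real.pi)) • w))) (cocompact _) (𝓝 0) := by
    refine ((Complex.continuous_re.tendsto 0).comp h1).congr fun w => ?_
    simp only [Function.comp, Complex.ofReal_re]
  have hne : -(2 * Real.pi) ≠ 0 := by have := Real.pi_pos; linarith
  have h4 : Tendsto (fun ξ : E d => (-(2 * Real.pi))⁻¹ • ξ) (cocompact _) (cocompact _) :=
    (Homeomorph.smulOfNeZero _ (inv_ne_zero hne)).isClosedEmbedding.tendsto_cocompact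
  have h5 := h3.comp h4
  have h6 : Tendsto (fun ξ : E d => Real.exp (-Ψ ξ)) (cocompact _) (𝓝 0) := by
    refine h5.congr fun ξ => ?_
    simp only [Function.comp]
    rw [smul_smul, mul_inv_cancel₀ hne, one_smul]
  have h7 : Tendsto (fun ξ => -Ψ ξ) (cocompact (E d)) atBot := by
    rwa [← Real.tendsto_exp_comp_nhds_zero]
  exact (tendsto_neg_atBot_atTop.comp h7).congr fun ξ => neg_neg _

end Levy


/-! ### Consequences of the hypotheses on the spectral measure -/

section Hypotheses

lemma lintegral_lintegral_sub_le {g : ℝ → ℝ≥0∞} {T : ℝ} :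
    ∫⁻ r in Icc 0 T, ∫⁻ s in Icc 0 T, g (r - s) ≤ ENNReal.ofReal T * ∫⁻ v in Icc (-T) T, g v := by
  calc ∫⁻ r in Icc 0 T, ∫⁻ s in Icc 0 T, g (r - s)
      ≤ ∫⁻ _r in Icc 0 T, ∫⁻ v in Icc (-T) T, g v := by
        refine setLIntegral_mono measurable_const fun r hr => ?_
        have h := (Measure.measurePreserving_sub_left (volume : Measure ℝ) r).setLIntegral_comp_preimage_emb
          (Homeomorph.subLeft r).measurableEmbedding g (Icc (-T) T)
        rw [← h]
        refine lintegral_mono_set fun s hs => ?_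
        simp only [mem_preimage, mem_Icc]
        constructor <;> linarith [hr.1, hr.2, hs.1, hs.2]
    _ = _ := by rw [setLIntegral_const, Real.volume_Icc, sub_zero, mul_comm]

/-- For `r` in the upper half `[T, 2T]` every `v ∈ (0, T]` is of the form `r - s` with `s ∈ [0,
2T]`. This extracts single time integrals from the double ones in the hypotheses, at the price of
doubling the horizon. -/
lemma le_lintegral_lintegral_sub {g : ℝ → ℝ≥0∞} (hg : Measurable g) {T : ℝ} (hT : 0 ≤ T) :
    ENNReal.ofReal T * ∫⁻ v in Ioc 0 T, g v ≤
      ∫⁻ r in Icc 0 (2 * T), ∫⁻ s in Icc 0 (2 * T), g (r - s) := by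
  calc ENNReal.ofReal T * ∫⁻ v in Ioc 0 T, g v = ∫⁻ _r in Icc T (2 * T), ∫⁻ v in Ioc 0 T, g v := by
        rw [setLIntegral_const, Real.volume_Icc, mul_comm]; congr 2; ring
    _ ≤ ∫⁻ r in Icc T (2 * T), ∫⁻ s in Icc 0 (2 * T), g (r - s) := by
        refine setLIntegral_mono_ae ?_ ?_
        · exact (Measurable.lintegral_prod_right' (ν := volume.restrict (Icc 0 (2 * T)))
            (f := fun q : ℝ × ℝ => g (q.1 - q.2)) (by fun_prop)).aemeasurable
        refine Eventually.of_forall fun r hr => ?_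
        have h := (Measure.measurePreserving_sub_left (volume : Measure ℝ) r).setLIntegral_comp_preimage_emb
          (Homeomorph.subLeft r).measurableEmbedding g (Ioc 0 T)
        rw [← h]
        refine lintegral_mono_set fun s hs => ?_
        simp only [mem_preimage, mem_Ioc] at hs
        constructor <;> linarith [hr.1, hr.2, hs.1, hs.2]
    _ ≤ _ := lintegral_mono_set (Icc_subset_Icc_left hT)

variable {d : ℕ} {Ψ : E d → ℝ} {μ : Measure (E d)} {β₀ : ℝ}

/-- `∫ e^{-vΨ(ξ)} μ(dξ)`. -/
noncomputable def laplaceMass (Ψ : E d → ℝ) (μ : Measure (E d)) (v : ℝ) : ℝ≥0∞ :=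
  ∫⁻ ξ, ENNReal.ofReal (Real.exp (-(v * Ψ ξ))) ∂μ

lemma measurable_laplaceMass (hΨ : Measurable Ψ) [SFinite μ] : Measurable (laplaceMass Ψ μ) := by
  unfold laplaceMass
  exact Measurable.lintegral_prod_right' (ν := μ)
    (f := fun q : ℝ × E d => ENNReal.ofReal (Real.exp (-(q.1 * Ψ q.2)))) (by fun_prop)

lemma antitone_laplaceMass (hΨ : ∀ ξ, 0 ≤ Ψ ξ) : Antitone (laplaceMass Ψ μ) := by
  intro v w hvw
  refine lintegral_mono fun ξ => ENNReal.ofReal_le_ofReal (Real.exp_le_exp.2 ?_)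
  have := mul_le_mul_of_nonneg_right hvw (hΨ ξ)
  linarith

/-- The integrability condition `∫₀ᵀ v^{-β₀} ∫ e^{-vΨ} dμ dv < ∞`. -/
def DalangCondition (β₀ : ℝ) (Ψ : E d → ℝ) (μ : Measure (E d)) : Prop :=
  ∀ T : ℝ, ∫⁻ v in Ioc 0 T, ENNReal.ofReal (v ^ (-β₀)) * laplaceMass Ψ μ v < ∞

/-- By monotonicity an infinite value at `v` would be infinite on all of `(0, v]`, where the weight
is positive. -/
lemma DalangCondition.laplaceMass_lt_top (h : DalangCondition β₀ Ψ μ) (hΨ : ∀ ξ, 0 ≤ Ψ ξ) {v : ℝ}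
    (hv : 0 < v) : laplaceMass Ψ μ v < ∞ := by
  by_contra hcon
  rw [not_lt, top_le_iff] at hcon
  have h1 := h v
  have h2 : ∫⁻ w in Ioc 0 v, ENNReal.ofReal (w ^ (-β₀)) * laplaceMass Ψ μ w =
      ∫⁻ w in Ioc 0 v, ∞ := by
    refine setLIntegral_congr_fun measurableSet_Ioc fun w hw => ?_
    have h3 : laplaceMass Ψ μ w = ∞ := top_le_iff.1 (hcon ▸ antitone_laplaceMass hΨ hw.2)
    rw [h3, ENNReal.mul_top]
    exact (ENNReal.ofReal_pos.2 (Real.rpow_pos_of_pos hw.1 _)).ne'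
  rw [h2, setLIntegral_const, Real.volume_Ioc, sub_zero, ENNReal.top_mul] at h1
  · exact lt_irrefl _ h1
  · exact (ENNReal.ofReal_pos.2 hv).ne'

lemma lintegral_rpow_lt_top (hβ₁ : β₀ < 1) (T : ℝ) :
    ∫⁻ v in Ioc 0 T, ENNReal.ofReal (v ^ (-β₀)) < ∞ := by
  rcases le_or_gt 0 T with hT | hT
  · rw [lintegral_Ioc_rpow hβ₁ hT]; exact ENNReal.ofReal_lt_top
  · rw [Ioc_eq_empty (by linarith)]; simp

/-- The shift `a = 1` suffices. Where `Ψ ≥ 1`, the difference `e^{-vΨ} - e^{-(v+1)Ψ}` is at least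
`(1 - e^{-1}) e^{-vΨ}`, so (T1) controls the integral. The remaining frequencies lie in a compact
set of finite measure and contribute at most a multiple of `v^{-β₀}`, which is integrable as `β₀ <
1`. -/
theorem dalangCondition_of_T1 {α₂ : ℝ} (hβ₁ : β₀ < 1) [SFinite μ] [IsFiniteMeasureOnCompacts μ]
    (hΨm : Measurable Ψ) (hΨ : ∀ ξ, 0 ≤ Ψ ξ) (hΨtop : Tendsto Ψ (cocompact (E d)) atTop)
    (h : HypothesisT1 β₀ Ψ μ α₂) : DalangCondition β₀ Ψ μ := by
  intro T
  rcases le_or_gt T 0 with hT | hT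
  · rw [Ioc_eq_empty (by linarith)]; simp
  obtain ⟨C, -, hC⟩ := h.2.2 (2 * T) (by linarith) 1 one_pos
  have h1 := hC 1 (by simp)
  set g : ℝ → ℝ≥0∞ := fun v => ∫⁻ ξ, ENNReal.ofReal
    (|v| ^ (-β₀) * |Real.exp (-(|v| * Ψ ξ)) - Real.exp (-(|v + 1| * Ψ ξ))|) ∂μ with hg
  have hgm : Measurable g := Measurable.lintegral_prod_right' (ν := μ)
    (f := fun q : ℝ × E d => ENNReal.ofReal (|q.1| ^ (-β₀) *
      |Real.exp (-(|q.1| * Ψ q.2)) - Real.exp (-(|q.1 + 1| * Ψ q.2))|)) (by fun_prop)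
  have h2 : ∫⁻ v in Ioc 0 T, g v < ∞ := by
    have h3 := (le_lintegral_lintegral_sub hgm hT.le).trans h1
    have h4 := h3.trans_lt ENNReal.ofReal_lt_top
    by_contra hcon
    rw [not_lt, top_le_iff] at hcon
    rw [hcon, ENNReal.mul_top (ENNReal.ofReal_pos.2 hT).ne'] at h4
    exact lt_irrefl _ h4
  obtain ⟨K, hK, hKsub⟩ := mem_cocompact.1 (hΨtop.eventually_ge_atTop 1)
  have hc : 0 < 1 - Real.exp (-1) := by
    have : Real.exp (-1) < 1 := by simp
    linarith
  set c := 1 - Real.exp (-1) with hcdef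
  have hbound : ∀ v ∈ Ioc 0 T, ENNReal.ofReal (v ^ (-β₀)) * laplaceMass Ψ μ v ≤
      ENNReal.ofReal c⁻¹ * g v + ENNReal.ofReal (v ^ (-β₀)) * μ K := by
    intro v hv
    have hv0 : 0 ≤ v ^ (-β₀) := Real.rpow_nonneg hv.1.le _
    rw [laplaceMass, ← lintegral_const_mul _ (by fun_prop),
      ← lintegral_add_compl (μ := μ) _ hK.isClosed.measurableSet, add_comm]
    refine add_le_add ?_ ?_
    · refine le_trans ?_ (mul_le_mul_right (setLIntegral_le_lintegral Kᶜ _) _)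
      rw [← lintegral_const_mul _ (by fun_prop)]
      refine setLIntegral_mono (by fun_prop) fun ξ hξ => ?_
      have hξ1 : 1 ≤ Ψ ξ := hKsub hξ
      rw [← ENNReal.ofReal_mul hv0, ← ENNReal.ofReal_mul (by positivity)]
      refine ENNReal.ofReal_le_ofReal ?_
      rw [abs_of_pos hv.1, abs_of_pos (by linarith [hv.1] : 0 < v + 1)]
      have e1 : Real.exp (-((v + 1) * Ψ ξ)) = Real.exp (-(v * Ψ ξ)) * Real.exp (-Ψ ξ) := by
        rw [← Real.exp_add]; congr 1; ring
      have e2 : Real.exp (-Ψ ξ) ≤ Real.exp (-1) := Real.exp_le_exp.2 (by linarith)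
      have e3 : c * Real.exp (-(v * Ψ ξ)) ≤
          |Real.exp (-(v * Ψ ξ)) - Real.exp (-((v + 1) * Ψ ξ))| := by
        refine le_trans ?_ (le_abs_self _)
        rw [e1]
        have := Real.exp_pos (-(v * Ψ ξ))
        nlinarith
      calc v ^ (-β₀) * Real.exp (-(v * Ψ ξ)) =
            c⁻¹ * (v ^ (-β₀) * (c * Real.exp (-(v * Ψ ξ)))) := by field_simp
        _ ≤ _ := by gcongr
    · calc ∫⁻ ξ in K, ENNReal.ofReal (v ^ (-β₀)) * ENNReal.ofReal (Real.exp (-(v * Ψ ξ))) ∂μ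
          ≤ ∫⁻ _ξ in K, ENNReal.ofReal (v ^ (-β₀)) ∂μ := by
            refine lintegral_mono fun ξ => mul_le_of_le_one_right' ?_
            rw [← ENNReal.ofReal_one]
            refine ENNReal.ofReal_le_ofReal (Real.exp_le_one_iff.2 ?_)
            have := mul_nonneg hv.1.le (hΨ ξ)
            linarith
        _ = _ := by rw [setLIntegral_const]
  calc _ ≤ ∫⁻ v in Ioc 0 T, (ENNReal.ofReal c⁻¹ * g v + ENNReal.ofReal (v ^ (-β₀)) * μ K) :=
        setLIntegral_mono (by fun_prop) hbound
    _ = ENNReal.ofReal c⁻¹ * (∫⁻ v in Ioc 0 T, g v) +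
        (∫⁻ v in Ioc 0 T, ENNReal.ofReal (v ^ (-β₀))) * μ K := by
        rw [lintegral_add_left (by fun_prop), lintegral_const_mul _ hgm,
          lintegral_mul_const _ (by fun_prop)]
    _ < ∞ := by
        have h3 := lintegral_rpow_lt_top hβ₁ T
        have h4 := hK.measure_lt_top (μ := μ)
        finiteness

/-- `∫₀ᵀ v^{-β₀} e^{-vΨ(ξ)} dv`. -/
noncomputable def timeWeight (β₀ : ℝ) (Ψ : E d → ℝ) (T : ℝ) (ξ : E d) : ℝ≥0∞ :=
  ∫⁻ v in Ioc 0 T, ENNReal.ofReal (v ^ (-β₀) * Real.exp (-(v * Ψ ξ)))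

lemma measurable_timeWeight (hΨ : Measurable Ψ) (T : ℝ) : Measurable (timeWeight β₀ Ψ T) := by
  unfold timeWeight
  exact Measurable.lintegral_prod_right' (ν := volume.restrict (Ioc 0 T))
    (f := fun q : E d × ℝ => ENNReal.ofReal (q.2 ^ (-β₀) * Real.exp (-(q.2 * Ψ q.1))))
    (by fun_prop)

lemma lintegral_timeWeight_mul [SFinite μ] (hΨ : Measurable Ψ) (T : ℝ) {F : E d → ℝ≥0∞}
    (hF : Measurable F) : ∫⁻ ξ, timeWeight β₀ Ψ T ξ * F ξ ∂μ =
      ∫⁻ v in Ioc 0 T, ∫⁻ ξ, ENNReal.ofReal (v ^ (-β₀) * Real.exp (-(v * Ψ ξ))) * F ξ ∂μ := by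
  rw [lintegral_lintegral_swap (by unfold Function.uncurry; fun_prop)]
  refine lintegral_congr fun ξ => ?_
  rw [timeWeight, lintegral_mul_const _ (by fun_prop)]

lemma timeWeight_le (hΨ : ∀ ξ, 0 ≤ Ψ ξ) (T : ℝ) (ξ : E d) :
    timeWeight β₀ Ψ T ξ ≤ ∫⁻ v in Ioc 0 T, ENNReal.ofReal (v ^ (-β₀)) := by
  refine setLIntegral_mono (by fun_prop) fun v hv => ENNReal.ofReal_le_ofReal ?_
  refine mul_le_of_le_one_right (Real.rpow_nonneg hv.1.le _) (Real.exp_le_one_iff.2 ?_)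
  have := mul_nonneg hv.1.le (hΨ ξ)
  linarith

/-- This restates (S1) for the measure `timeWeight · μ`, in which form only the behavior of `1 -
cos` in frequency remains to be exploited. -/
lemma HypothesisS1.lintegral_timeWeight_le [SFinite μ] (hΨm : Measurable Ψ) {α₁ : ℝ}
    (h : HypothesisS1 β₀ Ψ μ α₁) {T : ℝ} (hT : 0 < T) : ∃ C : ℝ, 0 < C ∧ ∀ z : E d,
      ∫⁻ ξ, timeWeight β₀ Ψ T ξ * ENNReal.ofReal (1 - Real.cos (inner ℝ ξ z)) ∂μ ≤
        ENNReal.ofReal (C * ‖z‖ ^ (2 * α₁)) := by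
  obtain ⟨C, hC0, hC⟩ := h.2.2 (2 * T) (by linarith)
  refine ⟨T⁻¹ * C, by positivity, fun z => ?_⟩
  set g : ℝ → ℝ≥0∞ := fun v => ∫⁻ ξ, ENNReal.ofReal
    (|v| ^ (-β₀) * Real.exp (-(|v| * Ψ ξ)) * (1 - Real.cos (inner ℝ ξ z))) ∂μ with hg
  have hgm : Measurable g := Measurable.lintegral_prod_right' (ν := μ)
    (f := fun q : ℝ × E d => ENNReal.ofReal (|q.1| ^ (-β₀) * Real.exp (-(|q.1| * Ψ q.2)) *
      (1 - Real.cos (inner ℝ q.2 z)))) (by fun_prop)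
  have h1 := (le_lintegral_lintegral_sub hgm hT.le).trans (hC z)
  rw [lintegral_timeWeight_mul hΨm T (by fun_prop)]
  have h2 : ∫⁻ v in Ioc 0 T, ∫⁻ ξ, ENNReal.ofReal (v ^ (-β₀) * Real.exp (-(v * Ψ ξ))) *
      ENNReal.ofReal (1 - Real.cos (inner ℝ ξ z)) ∂μ = ∫⁻ v in Ioc 0 T, g v := by
    refine setLIntegral_congr_fun measurableSet_Ioc fun v hv => ?_
    simp only [hg]
    refine lintegral_congr fun ξ => ?_
    rw [abs_of_pos hv.1, ENNReal.ofReal_mul (p := v ^ (-β₀) * Real.exp (-(v * Ψ ξ)))]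
    exact mul_nonneg (Real.rpow_nonneg hv.1.le _) (Real.exp_pos _).le
  rw [h2, mul_assoc, ENNReal.ofReal_mul (by positivity), ENNReal.ofReal_inv_of_pos hT]
  rwa [← ENNReal.mul_le_iff_le_inv (ENNReal.ofReal_pos.2 hT).ne' ENNReal.ofReal_ne_top]

/-- Moments of the coordinates of order below the Hölder exponent in (S1). -/
lemma lintegral_coord_lt_top {ν : Measure (E d)} [SFinite ν] {α C : ℝ} (hα : 0 < α)
    (h : ∀ z : E d, ∫⁻ ξ, ENNReal.ofReal (1 - Real.cos (inner ℝ ξ z)) ∂ν ≤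
      ENNReal.ofReal (C * ‖z‖ ^ (2 * α))) (hC : 0 < C) (i : Fin d) :
    ∫⁻ ξ, {ξ : E d | 1 ≤ |ξ i|}.indicator (fun ξ => ENNReal.ofReal (|ξ i| ^ α)) ξ ∂ν < ∞ := by
  have hc : 0 < 1 - Real.cos (1 / 2) := by
    have := Real.cos_lt_cos_of_nonneg_of_le_pi (x := 0) (y := 1 / 2) le_rfl
      (by linarith [Real.pi_gt_three]) (by norm_num)
    rw [Real.cos_zero] at this
    linarith
  set c := 1 - Real.cos (1 / 2) with hcdef
  have hinner : ∀ (ξ : E d) (τ : ℝ), inner ℝ ξ (τ • EuclideanSpace.single i (1 : ℝ)) = τ * ξ i := by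
    intro ξ τ
    rw [inner_smul_right, EuclideanSpace.inner_single_right]; simp
  have hm : Measurable fun q : ℝ × E d => ENNReal.ofReal (q.1 ^ (-1 - α)) *
      ENNReal.ofReal (1 - Real.cos (q.1 * q.2 i)) := by fun_prop
  -- Along `z = τ e_i` the bound is `C τ^{2α}`; against `τ^{-1-α}` it leaves `τ^{α-1}`, integrable
  -- at `0`.
  have hup : ∫⁻ τ in Ioc (0:ℝ) 1, ∫⁻ ξ, ENNReal.ofReal (τ ^ (-1 - α)) *
      ENNReal.ofReal (1 - Real.cos (τ * ξ i)) ∂ν < ∞ := by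
    calc _ ≤ ∫⁻ τ in Ioc (0:ℝ) 1, ENNReal.ofReal C * ENNReal.ofReal (τ ^ (-(1 - α))) := by
          refine setLIntegral_mono (by fun_prop) fun τ hτ => ?_
          rw [lintegral_const_mul _ (by fun_prop)]
          have h1 := h (τ • EuclideanSpace.single i (1 : ℝ))
          simp_rw [hinner] at h1
          rw [norm_smul, Real.norm_of_nonneg hτ.1.le, PiLp.norm_single, norm_one,
            mul_one] at h1
          have hτ0 : 0 ≤ τ ^ (-1 - α) := Real.rpow_nonneg hτ.1.le _
          refine (mul_le_mul_right h1 _).trans_eq ?_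
          rw [← ENNReal.ofReal_mul hτ0, ← ENNReal.ofReal_mul hC.le]
          congr 1
          have : τ ^ (-(1 - α)) = τ ^ (-1 - α) * τ ^ (2 * α) := by
            rw [← Real.rpow_add hτ.1]; congr 1; ring
          rw [this]; ring
      _ < ∞ := by
          rw [lintegral_const_mul _ (by fun_prop)]
          have := lintegral_rpow_lt_top (β₀ := 1 - α) (by linarith) 1
          finiteness
  rw [lintegral_lintegral_swap hm.aemeasurable] at hup
  -- With `x = |ξ i| ≥ 1`, the interval `(1/(2x), 1/x]` lies in `(0, 1]`. On it `τ x ∈ [1/2, 1]`, so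
  -- `1 - cos ≥ c`, and `τ^{-1-α} ≥ x^{1+α}`; its length `1/(2x)` leaves `(c/2) x^α`.
  have hlow : ∀ ξ : E d, ENNReal.ofReal (c / 2) *
      {ξ : E d | 1 ≤ |ξ i|}.indicator (fun ξ => ENNReal.ofReal (|ξ i| ^ α)) ξ ≤
      ∫⁻ τ in Ioc (0:ℝ) 1, ENNReal.ofReal (τ ^ (-1 - α)) *
        ENNReal.ofReal (1 - Real.cos (τ * ξ i)) := by
    intro ξ
    by_cases hξ : 1 ≤ |ξ i|
    · rw [indicator_of_mem (by exact hξ)]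
      set x := |ξ i| with hx
      have hx0 : 0 < x := by linarith
      calc ENNReal.ofReal (c / 2) * ENNReal.ofReal (x ^ α)
          = ∫⁻ _τ in Ioc (1 / (2 * x)) (1 / x), ENNReal.ofReal (x ^ (1 + α) * c) := by
            rw [setLIntegral_const, Real.volume_Ioc, ← ENNReal.ofReal_mul (by positivity),
              ← ENNReal.ofReal_mul (by positivity)]
            congr 1
            rw [Real.rpow_add hx0, Real.rpow_one]
            field_simp; ring
        _ ≤ ∫⁻ τ in Ioc (1 / (2 * x)) (1 / x), ENNReal.ofReal (τ ^ (-1 - α)) *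
              ENNReal.ofReal (1 - Real.cos (τ * ξ i)) := by
            refine setLIntegral_mono (by fun_prop) fun τ hτ => ?_
            have hτ0 : 0 < τ := lt_trans (by positivity) hτ.1
            rw [← ENNReal.ofReal_mul (Real.rpow_nonneg hτ0.le _)]
            refine ENNReal.ofReal_le_ofReal (mul_le_mul ?_ ?_ hc.le (Real.rpow_nonneg hτ0.le _))
            · have h1 := Real.rpow_le_rpow_of_nonpos hτ0 hτ.2 (by linarith : -1 - α ≤ 0)
              refine le_trans (le_of_eq ?_) h1
              rw [one_div, Real.inv_rpow hx0.le, ← Real.rpow_neg hx0.le]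
              congr 1; ring
            · have h1 : Real.cos (τ * ξ i) = Real.cos (τ * x) := by
                rw [← Real.cos_abs, abs_mul, abs_of_pos hτ0]
              have h2 : 1 / 2 ≤ τ * x := by
                have := hτ.1.le
                rw [div_le_iff₀ (by positivity)] at this; linarith
              have h3 : τ * x ≤ 1 := by
                have := hτ.2
                rwa [le_div_iff₀ hx0] at this
              rw [h1, hcdef]
              have := Real.cos_le_cos_of_nonneg_of_le_pi (by norm_num)
                (by linarith [Real.pi_gt_three]) h2
              linarith
        _ ≤ _ := by
            refine lintegral_mono_set fun τ hτ => ⟨lt_trans (by positivity) hτ.1, hτ.2.trans ?_⟩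
            rw [div_le_one hx0]; exact hξ
    · rw [indicator_of_notMem (by exact hξ)]; simp
  have h1 : ENNReal.ofReal (c / 2) *
      ∫⁻ ξ, {ξ : E d | 1 ≤ |ξ i|}.indicator (fun ξ => ENNReal.ofReal (|ξ i| ^ α)) ξ ∂ν < ∞ := by
    rw [← lintegral_const_mul' _ _ ENNReal.ofReal_ne_top]
    exact (lintegral_mono hlow).trans_lt hup
  by_contra hcon
  rw [not_lt, top_le_iff] at hcon
  rw [hcon, ENNReal.mul_top (ENNReal.ofReal_pos.2 (by positivity)).ne'] at h1
  exact lt_irrefl _ h1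

/-- (S1) gives a moment of the exponent, on top of the integrability condition. -/
lemma HypothesisS1.lintegral_exponent_lt_top [SFinite μ] [IsFiniteMeasureOnCompacts μ]
    (hβ₁ : β₀ < 1) (hΨm : Measurable Ψ) (hΨ : ∀ ξ, 0 ≤ Ψ ξ)
    {CΨ : ℝ} (hCΨ : 0 ≤ CΨ) (hgrowth : ∀ ξ, Ψ ξ ≤ CΨ * (1 + ‖ξ‖ ^ 2)) {α₁ : ℝ}
    (h : HypothesisS1 β₀ Ψ μ α₁) {T : ℝ} (hT : 0 < T) :
    ∫⁻ ξ, timeWeight β₀ Ψ T ξ * ENNReal.ofReal (1 + Ψ ξ ^ (α₁ / 2)) ∂μ < ∞ := by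
  have hα := h.1
  obtain ⟨C, hC0, hC⟩ := h.lintegral_timeWeight_le hΨm hT
  have hwm := measurable_timeWeight (β₀ := β₀) hΨm T
  set ν := μ.withDensity (timeWeight β₀ Ψ T) with hν
  have hν' : ∀ z : E d, ∫⁻ ξ, ENNReal.ofReal (1 - Real.cos (inner ℝ ξ z)) ∂ν ≤
      ENNReal.ofReal (C * ‖z‖ ^ (2 * α₁)) := by
    intro z
    rw [hν, lintegral_withDensity_eq_lintegral_mul _ hwm (by fun_prop)]
    exact hC z
  have hcoord := fun i => lintegral_coord_lt_top hα hν' hC0 i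
  -- Inside the unit cube the weighted measure is finite, the time weight being bounded and `μ`
  -- finite on compact sets. Outside it some coordinate is at least `1`, where the coordinate
  -- moments apply.
  set B : Set (E d) := {ξ | ∀ i, |ξ i| < 1} with hB
  have hBm : MeasurableSet B := by
    have : B = ⋂ i, {ξ : E d | |ξ i| < 1} := by ext; simp [hB]
    rw [this]
    exact MeasurableSet.iInter fun i => measurableSet_lt (by fun_prop) measurable_const
  have hnormsq : ∀ ξ : E d, ‖ξ‖ ^ 2 = ∑ i, |ξ i| ^ 2 := fun ξ => by
    rw [EuclideanSpace.norm_sq_eq]; simp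
  have hBfin : ν B < ∞ := by
    have hsub : B ⊆ Metric.closedBall 0 (d + 1) := by
      intro ξ hξ
      rw [mem_closedBall_zero_iff]
      have h1 : ‖ξ‖ ^ 2 ≤ d := by
        rw [hnormsq]
        calc ∑ i, |ξ i| ^ 2 ≤ ∑ _i : Fin d, (1 : ℝ) := Finset.sum_le_sum fun i _ =>
              pow_le_one₀ (abs_nonneg _) (hξ i).le
          _ = d := by simp
      have : (0:ℝ) ≤ d := Nat.cast_nonneg _
      nlinarith [norm_nonneg ξ]
    have h1 : μ B < ∞ := (measure_mono hsub).trans_lt (isCompact_closedBall _ _).measure_lt_top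
    rw [hν, withDensity_apply _ hBm]
    calc _ ≤ ∫⁻ _ξ in B, (∫⁻ v in Ioc 0 T, ENNReal.ofReal (v ^ (-β₀))) ∂μ :=
          lintegral_mono fun ξ => timeWeight_le hΨ T ξ
      _ = (∫⁻ v in Ioc 0 T, ENNReal.ofReal (v ^ (-β₀))) * μ B := setLIntegral_const _ _
      _ < ∞ := by
          have := lintegral_rpow_lt_top hβ₁ T
          finiteness
  set K : ℝ := 1 + (CΨ * (1 + d)) ^ (α₁ / 2) with hK
  have hK0 : 0 ≤ K := by positivity
  have hpt : ∀ ξ : E d, ENNReal.ofReal (1 + Ψ ξ ^ (α₁ / 2)) ≤ ENNReal.ofReal K *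
      (B.indicator (fun _ => 1) ξ +
        ∑ i, {ξ : E d | 1 ≤ |ξ i|}.indicator (fun ξ => ENNReal.ofReal (|ξ i| ^ α₁)) ξ) := by
    intro ξ
    by_cases hξ : ξ ∈ B
    · rw [indicator_of_mem hξ]
      have h1 : 1 + Ψ ξ ^ (α₁ / 2) ≤ K := by
        rw [hK]
        gcongr
        · exact hΨ ξ
        · refine (hgrowth ξ).trans ?_
          gcongr
          rw [hnormsq]
          calc ∑ i, |ξ i| ^ 2 ≤ ∑ _i : Fin d, (1 : ℝ) := Finset.sum_le_sum fun i _ =>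
              pow_le_one₀ (abs_nonneg _) (hξ i).le
            _ = d := by simp
      calc _ ≤ ENNReal.ofReal K * 1 := by rw [mul_one]; exact ENNReal.ofReal_le_ofReal h1
        _ ≤ _ := mul_le_mul_right le_self_add _
    -- The largest coordinate satisfies `‖ξ‖² ≤ d |ξ i|²`, so that the quadratic growth of `Ψ` turns
    -- `Ψ^{α₁/2}` into a multiple of `|ξ i|^{α₁}`.
    · have hne : ∃ i, 1 ≤ |ξ i| := by simpa [hB] using hξ
      obtain ⟨i₀, hi₀⟩ := hne
      obtain ⟨i, -, hi⟩ := Finset.exists_max_image Finset.univ (fun i => |ξ i|) ⟨i₀, Finset.mem_univ _⟩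
      have hi1 : 1 ≤ |ξ i| := hi₀.trans (hi i₀ (Finset.mem_univ _))
      have h1 : ‖ξ‖ ^ 2 ≤ d * |ξ i| ^ 2 := by
        rw [hnormsq]
        calc ∑ j, |ξ j| ^ 2 ≤ ∑ _j : Fin d, |ξ i| ^ 2 := Finset.sum_le_sum fun j hj =>
              pow_le_pow_left₀ (abs_nonneg _) (hi j hj) 2
          _ = _ := by simp
      have h2 : 1 ≤ |ξ i| ^ α₁ := Real.one_le_rpow hi1 hα.le
      have h3 : Ψ ξ ^ (α₁ / 2) ≤ (CΨ * (1 + d)) ^ (α₁ / 2) * |ξ i| ^ α₁ := by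
        have e1 : |ξ i| ^ α₁ = (|ξ i| ^ 2) ^ (α₁ / 2) := by
          rw [← Real.rpow_natCast, ← Real.rpow_mul (abs_nonneg _)]; congr 1; push_cast; ring
        rw [e1, ← Real.mul_rpow (by positivity) (by positivity)]
        refine Real.rpow_le_rpow (hΨ ξ) ((hgrowth ξ).trans ?_) (by positivity)
        have : 1 + ‖ξ‖ ^ 2 ≤ (1 + d) * |ξ i| ^ 2 := by nlinarith [one_le_pow₀ (n := 2) hi1]
        calc _ ≤ CΨ * ((1 + d) * |ξ i| ^ 2) := by gcongr
          _ = _ := by ring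
      calc ENNReal.ofReal (1 + Ψ ξ ^ (α₁ / 2)) ≤ ENNReal.ofReal (K * |ξ i| ^ α₁) := by
            refine ENNReal.ofReal_le_ofReal ?_
            rw [hK, add_mul]; linarith
        _ = ENNReal.ofReal K *
            {ξ : E d | 1 ≤ |ξ i|}.indicator (fun ξ => ENNReal.ofReal (|ξ i| ^ α₁)) ξ := by
            rw [indicator_of_mem (by exact hi1), ENNReal.ofReal_mul hK0]
        _ ≤ _ := by
            gcongr
            refine le_trans ?_ le_add_self
            exact Finset.single_le_sum (f := fun i =>
              {ξ : E d | 1 ≤ |ξ i|}.indicator (fun ξ => ENNReal.ofReal (|ξ i| ^ α₁)) ξ)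
              (fun _ _ => zero_le) (Finset.mem_univ i)
  have hcm : ∀ i, Measurable
      ({ξ : E d | 1 ≤ |ξ i|}.indicator (fun ξ => ENNReal.ofReal (|ξ i| ^ α₁))) := fun i =>
    Measurable.indicator (by fun_prop) (measurableSet_le measurable_const (by fun_prop))
  calc _ = ∫⁻ ξ, ENNReal.ofReal (1 + Ψ ξ ^ (α₁ / 2)) ∂ν := by
        rw [hν, lintegral_withDensity_eq_lintegral_mul _ hwm (by fun_prop)]; rfl
    _ ≤ ∫⁻ ξ, ENNReal.ofReal K * (B.indicator (fun _ => 1) ξ +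
        ∑ i, {ξ : E d | 1 ≤ |ξ i|}.indicator (fun ξ => ENNReal.ofReal (|ξ i| ^ α₁)) ξ) ∂ν :=
        lintegral_mono hpt
    _ = ENNReal.ofReal K * (ν B + ∑ i, ∫⁻ ξ,
        {ξ : E d | 1 ≤ |ξ i|}.indicator (fun ξ => ENNReal.ofReal (|ξ i| ^ α₁)) ξ ∂ν) := by
        rw [lintegral_const_mul' _ _ ENNReal.ofReal_ne_top,
          lintegral_add_left (measurable_const.indicator hBm), lintegral_indicator hBm,
          setLIntegral_one, lintegral_finsetSum _ fun i _ => hcm i]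
    _ < ∞ := by
        refine ENNReal.mul_lt_top ENNReal.ofReal_lt_top (ENNReal.add_lt_top.2 ⟨hBfin, ?_⟩)
        exact ENNReal.sum_lt_top.2 fun i _ => hcoord i

/-- Only the summand `1` of the weight `1 + Ψ^{α₁/2}` is needed. -/
theorem dalangCondition_of_S1 [SFinite μ] [IsFiniteMeasureOnCompacts μ]
    (hβ₁ : β₀ < 1) (hΨm : Measurable Ψ) (hΨ : ∀ ξ, 0 ≤ Ψ ξ)
    {CΨ : ℝ} (hCΨ : 0 ≤ CΨ) (hgrowth : ∀ ξ, Ψ ξ ≤ CΨ * (1 + ‖ξ‖ ^ 2)) {α₁ : ℝ}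
    (h : HypothesisS1 β₀ Ψ μ α₁) : DalangCondition β₀ Ψ μ := by
  intro T
  rcases le_or_gt T 0 with hT | hT
  · rw [Ioc_eq_empty (by linarith)]; simp
  refine lt_of_le_of_lt ?_ (h.lintegral_exponent_lt_top hβ₁ hΨm hΨ hCΨ hgrowth hT)
  rw [lintegral_timeWeight_mul hΨm T (by fun_prop)]
  refine setLIntegral_mono' measurableSet_Ioc fun v hv => ?_
  rw [laplaceMass, ← lintegral_const_mul _ (by fun_prop)]
  refine lintegral_mono fun ξ => ?_
  rw [← ENNReal.ofReal_mul (Real.rpow_nonneg hv.1.le _)]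
  refine le_mul_of_one_le_right' ?_
  rw [← ENNReal.ofReal_one]
  exact ENNReal.ofReal_le_ofReal (by linarith [Real.rpow_nonneg (hΨ ξ) (α₁ / 2)])

/-- Factoring out the larger exponential leaves `1 - e^{-h}` with `h = |x - y|`, and `1 - e^{-h} ≤
min(1, h) ≤ h^η`. -/
lemma abs_exp_sub_exp_le {x y η : ℝ} (hη : 0 < η) (hη1 : η ≤ 1) :
    |Real.exp (-x) - Real.exp (-y)| ≤ |x - y| ^ η * Real.exp (-(min x y)) := by
  wlog hxy : x ≤ y generalizing x y
  · rw [abs_sub_comm, abs_sub_comm x, min_comm]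
    exact this (le_of_not_ge hxy)
  rw [min_eq_left hxy, abs_of_nonneg (sub_nonneg.2 (Real.exp_le_exp.2 (by linarith)))]
  have h1 : Real.exp (-y) = Real.exp (-x) * Real.exp (-(y - x)) := by
    rw [← Real.exp_add]; congr 1; ring
  have h2 : 1 - Real.exp (-(y - x)) ≤ |x - y| ^ η := by
    rw [abs_sub_comm, abs_of_nonneg (by linarith : 0 ≤ y - x)]
    rcases le_total (y - x) 1 with h | h
    · have h3 : y - x ≤ (y - x) ^ η := by
        conv_lhs => rw [← Real.rpow_one (y - x)]
        exact Real.rpow_le_rpow_of_exponent_ge_of_imp (by linarith) h hη1 (by intro _ h'; linarith)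
      linarith [Real.add_one_le_exp (-(y - x))]
    · have h3 := Real.one_le_rpow h hη.le
      linarith [Real.exp_pos (-(y - x))]
  rw [h1]
  nlinarith [Real.exp_pos (-x)]

/-- (S1) implies (T1) with half its exponent. -/
theorem HypothesisS1.hypothesisT1 [SFinite μ] [IsFiniteMeasureOnCompacts μ]
    (hβ₀ : 0 < β₀) (hβ₁ : β₀ < 1) (hΨm : Measurable Ψ) (hΨ : ∀ ξ, 0 ≤ Ψ ξ)
    {CΨ : ℝ} (hCΨ : 0 ≤ CΨ) (hgrowth : ∀ ξ, Ψ ξ ≤ CΨ * (1 + ‖ξ‖ ^ 2)) {α₁ : ℝ}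
    (h : HypothesisS1 β₀ Ψ μ α₁) : HypothesisT1 β₀ Ψ μ (α₁ / 2) := by
  have hα := h.1
  have hα1 := h.2.1
  refine ⟨by linarith, by linarith, fun T hT M hM => ?_⟩
  set η := α₁ / 2 with hη
  have hη0 : 0 < η := by positivity
  set hh : ℝ → ℝ≥0∞ := fun v => ∫⁻ ξ, ENNReal.ofReal (v ^ (-β₀) * Real.exp (-(v * Ψ ξ))) *
    ENNReal.ofReal (Ψ ξ ^ η) ∂μ with hhh
  have hhm : Measurable hh := Measurable.lintegral_prod_right' (ν := μ)
    (f := fun q : ℝ × E d => ENNReal.ofReal (q.1 ^ (-β₀) * Real.exp (-(q.1 * Ψ q.2))) *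
      ENNReal.ofReal (Ψ q.2 ^ η)) (by fun_prop)
  set I := ∫⁻ v in Ioc 0 (T + M), hh v with hI
  have hIfin : I < ∞ := by
    refine lt_of_le_of_lt ?_ (h.lintegral_exponent_lt_top hβ₁ hΨm hΨ hCΨ hgrowth
      (by linarith : 0 < T + M))
    rw [hI, hhh, ← lintegral_timeWeight_mul hΨm _ (by fun_prop)]
    refine lintegral_mono fun ξ => mul_le_mul_right (ENNReal.ofReal_le_ofReal (by linarith)) _
  -- The terms at `|v|` and at `|v + a|` each integrate to at most `2 I` over `[-T, T]`, since both
  -- arguments stay below `T + M`; the outer integral gives `T`. The `1` keeps the constant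
  -- positive.
  refine ⟨4 * T * I.toReal + 1, by positivity, fun a ha => ?_⟩
  set g : ℝ → ℝ≥0∞ := fun v => ∫⁻ ξ, ENNReal.ofReal
    (|v| ^ (-β₀) * |Real.exp (-(|v| * Ψ ξ)) - Real.exp (-(|v + a| * Ψ ξ))|) ∂μ with hg
  have hgm : Measurable g := Measurable.lintegral_prod_right' (ν := μ)
    (f := fun q : ℝ × E d => ENNReal.ofReal (|q.1| ^ (-β₀) *
      |Real.exp (-(|q.1| * Ψ q.2)) - Real.exp (-(|q.1 + a| * Ψ q.2))|)) (by fun_prop)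
  have hgle : ∀ v, v ≠ 0 → v ≠ -a → g v ≤ ENNReal.ofReal (|a| ^ η) * (hh |v| + hh |v + a|) := by
    intro v hv hva
    rw [hhh, ← lintegral_add_left (by fun_prop), ← lintegral_const_mul _ (by fun_prop)]
    refine lintegral_mono fun ξ => ?_
    have hv0 : 0 < |v| := abs_pos.2 hv
    have hva0 : 0 < |v + a| := abs_pos.2 (fun h => hva (by linarith))
    have hΨξ := hΨ ξ
    rw [← add_mul, ← ENNReal.ofReal_add (by positivity) (by positivity),
      ← ENNReal.ofReal_mul (by positivity), ← ENNReal.ofReal_mul (by positivity)]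
    refine ENNReal.ofReal_le_ofReal ?_
    have h1 := abs_exp_sub_exp_le (x := |v| * Ψ ξ) (y := |v + a| * Ψ ξ) hη0 (by linarith)
    have h2 : |(|v| * Ψ ξ - |v + a| * Ψ ξ)| ^ η ≤ |a| ^ η * Ψ ξ ^ η := by
      rw [← Real.mul_rpow (abs_nonneg _) hΨξ]
      refine Real.rpow_le_rpow (abs_nonneg _) ?_ hη0.le
      rw [← sub_mul, abs_mul, abs_of_nonneg hΨξ]
      refine mul_le_mul_of_nonneg_right ?_ hΨξ
      have := abs_abs_sub_abs_le_abs_sub v (v + a)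
      simpa using this
    -- The minimum is attained at the smaller of `|v|` and `|v + a|`, or else the two products
    -- agree. Hence the singular weight can be evaluated at the same argument as the exponential.
    have h3 : |v| ^ (-β₀) * Real.exp (-(min (|v| * Ψ ξ) (|v + a| * Ψ ξ))) ≤
        |v| ^ (-β₀) * Real.exp (-(|v| * Ψ ξ)) + |v + a| ^ (-β₀) * Real.exp (-(|v + a| * Ψ ξ)) := by
      rcases le_total (|v| * Ψ ξ) (|v + a| * Ψ ξ) with hle | hle
      · rw [min_eq_left hle]
        have : 0 ≤ |v + a| ^ (-β₀) * Real.exp (-(|v + a| * Ψ ξ)) := by positivity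
        linarith
      · rw [min_eq_right hle]
        rcases le_total (|v + a|) (|v|) with hle2 | hle2
        · have e1 := Real.rpow_le_rpow_of_nonpos hva0 hle2 (by linarith : -β₀ ≤ 0)
          have e2 : 0 ≤ |v| ^ (-β₀) * Real.exp (-(|v| * Ψ ξ)) := by positivity
          have e3 := mul_le_mul_of_nonneg_right e1 (Real.exp_pos (-(|v + a| * Ψ ξ))).le
          linarith
        · have e1 : |v| * Ψ ξ = |v + a| * Ψ ξ := le_antisymm (by gcongr) hle
          rw [← e1]
          have : 0 ≤ |v + a| ^ (-β₀) * Real.exp (-(|v| * Ψ ξ)) := by positivity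
          linarith
    calc _ ≤ |v| ^ (-β₀) * ((|a| ^ η * Ψ ξ ^ η) *
          Real.exp (-(min (|v| * Ψ ξ) (|v + a| * Ψ ξ)))) := by
          gcongr
          exact h1.trans (by gcongr)
      _ = |a| ^ η * ((|v| ^ (-β₀) * Real.exp (-(min (|v| * Ψ ξ) (|v + a| * Ψ ξ)))) * Ψ ξ ^ η) := by
          ring
      _ ≤ _ := by gcongr
  have ha' := abs_le.1 ha
  have hint1 : ∫⁻ v in Icc (-T) T, hh |v| ≤ 2 * I := by
    refine (lintegral_Icc_abs_le T).trans ?_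
    gcongr
    exact lintegral_mono_set (Ioc_subset_Ioc_right (by linarith))
  have hint2 : ∫⁻ v in Icc (-T) T, hh |v + a| ≤ 2 * I := by
    refine le_trans ?_ (lintegral_Icc_abs_le (T + M))
    have h1 := (measurePreserving_add_right (volume : Measure ℝ) a).setLIntegral_comp_preimage_emb
      (Homeomorph.addRight a).measurableEmbedding (fun v => hh |v|) (Icc (-(T + M)) (T + M))
    rw [← h1]
    refine lintegral_mono_set fun v hv => ?_
    simp only [mem_preimage, mem_Icc]
    constructor <;> linarith [hv.1, hv.2]
  calc _ = ∫⁻ r in Icc 0 T, ∫⁻ s in Icc 0 T, g (r - s) := rfl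
    _ ≤ ENNReal.ofReal T * ∫⁻ v in Icc (-T) T, g v := lintegral_lintegral_sub_le
    _ ≤ ENNReal.ofReal T * ∫⁻ v in Icc (-T) T, ENNReal.ofReal (|a| ^ η) * (hh |v| + hh |v + a|) := by
        refine mul_le_mul_right (lintegral_mono_ae (ae_restrict_of_ae ?_)) _
        have e1 : ∀ᵐ v : ℝ, v ≠ 0 := by rw [ae_iff]; simp
        have e2 : ∀ᵐ v : ℝ, v ≠ -a := by rw [ae_iff]; simp
        filter_upwards [e1, e2] with v h1 h2 using hgle v h1 h2
    _ ≤ ENNReal.ofReal T * (ENNReal.ofReal (|a| ^ η) * (2 * I + 2 * I)) := by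
        rw [lintegral_const_mul _ (by fun_prop), lintegral_add_left (by fun_prop)]
        gcongr
    _ = ENNReal.ofReal (4 * T * I.toReal * |a| ^ η) := by
        rw [ENNReal.ofReal_mul (by positivity), ENNReal.ofReal_mul (by positivity),
          ENNReal.ofReal_mul (by norm_num), ENNReal.ofReal_toReal hIfin.ne]
        rw [ENNReal.ofReal_ofNat]
        ring
    _ ≤ _ := by
        refine ENNReal.ofReal_le_ofReal ?_
        gcongr
        linarith

end Hypotheses


/-! ### Exponential moments -/

section Independence

/-- By independence the joint law is a product, so `η` can be frozen while the expectation over `f`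
is bounded uniformly in its value. -/
lemma lintegral_mul_le_of_indepFun {Ω' S F : Type*} {mΩ : MeasurableSpace Ω'} [MeasurableSpace S]
    [MeasurableSpace F] {P' : Measure Ω'} [IsProbabilityMeasure P'] {f : Ω' → S} {η : Ω' → F}
    (hind : IndepFun f η P') (hf : Measurable f) (hη : Measurable η) {φ : F → ℝ≥0∞}
    (hφ : Measurable φ) {H : S × F → ℝ≥0∞} (hH : Measurable H) {C : ℝ≥0∞}
    (hC : ∀ y, ∫⁻ ω, H (f ω, y) ∂P' ≤ C) :
    ∫⁻ ω, φ (η ω) * H (f ω, η ω) ∂P' ≤ (∫⁻ ω, φ (η ω) ∂P') * C := by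
  have h1 := (indepFun_iff_map_prod_eq_prod_map_map hf.aemeasurable hη.aemeasurable).1 hind
  have := Measure.isProbabilityMeasure_map (μ := P') hf.aemeasurable
  have := Measure.isProbabilityMeasure_map (μ := P') hη.aemeasurable
  calc ∫⁻ ω, φ (η ω) * H (f ω, η ω) ∂P'
      = ∫⁻ z, φ z.2 * H z ∂(P'.map fun ω => (f ω, η ω)) := by
        rw [lintegral_map (by fun_prop) (by fun_prop)]
    _ = ∫⁻ y, ∫⁻ x, φ y * H (x, y) ∂(P'.map f) ∂(P'.map η) := by
        rw [h1, lintegral_prod_symm' _ (by fun_prop)]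
    _ ≤ ∫⁻ y, φ y * C ∂(P'.map η) := by
        refine lintegral_mono fun y => ?_
        rw [lintegral_const_mul _ (by fun_prop), lintegral_map (by fun_prop) hf]
        gcongr
        exact hC y
    _ = _ := by rw [lintegral_mul_const _ hφ, lintegral_map hφ hη]

/-- The fundamental theorem of calculus for `v ↦ exp ∫₀ᵛ f`, in a form requiring only right
derivatives, because the paths are only right-continuous. -/
lemma exp_integral_eq {f : ℝ → ℝ} {b : ℝ} (hb : 0 ≤ b)
    (hrc : ∀ x ∈ Ioo 0 b, ContinuousWithinAt f (Ioi x) x) (hf : IntervalIntegrable f volume 0 b)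
    (hm : Measurable f) :
    Real.exp (∫ u in 0..b, f u) = 1 + ∫ v in 0..b, f v * Real.exp (∫ u in 0..v, f u) := by
  have hcont : ContinuousOn (fun v => ∫ u in 0..v, f u) (uIcc 0 b) :=
    intervalIntegral.continuousOn_primitive_interval' hf left_mem_uIcc
  have hcont' : ContinuousOn (fun v => Real.exp (∫ u in 0..v, f u)) (uIcc 0 b) :=
    Real.continuous_exp.comp_continuousOn hcont
  have h := intervalIntegral.integral_eq_sub_of_hasDeriv_right (a := 0) (b := b) hcont'
    (f' := fun v => f v * Real.exp (∫ u in 0..v, f u)) ?_ ?_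
  · rw [h]; simp
  · intro x hx
    rw [min_eq_left hb, max_eq_right hb] at hx
    have h1 : HasDerivWithinAt (fun v => ∫ u in 0..v, f u) (f x) (Ioi x) x := by
      refine HasDerivWithinAt.mono ?_ Ioi_subset_Ici_self
      exact intervalIntegral.integral_hasDerivWithinAt_right
        (hf.mono_set (by rw [uIcc_of_le hx.1.le, uIcc_of_le hb]; exact Icc_subset_Icc_right hx.2.le))
        (hm.stronglyMeasurable.stronglyMeasurableAtFilter) (hrc x hx)
    simpa [mul_comm] using h1.exp
  · exact hf.mul_continuousOn hcont'

end Independence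

/-! ### Khasminskii's argument for occupation functionals. -/

section Khasminskii

universe u

variable {d : ℕ} {Ω' : Type u} {mΩ : MeasurableSpace Ω'} {X : ℝ≥0 → Ω' → E d} {Ψ : E d → ℝ}
  {P' : Measure Ω'} [IsProbabilityMeasure P']

/-- The functional `∫₀ᵛ (τ-u)^{-β₀} G(X_u - X_v + b) du`. -/
noncomputable def occupation (X : ℝ≥0 → Ω' → E d) (β₀ : ℝ) (G : E d → ℝ) (τ v : ℝ) (b : E d)
    (ω : Ω') : ℝ :=
  ∫ u in 0..v, (τ - u) ^ (-β₀) * G (X u.toNNReal ω - X v.toNNReal ω + b)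

/-- The past up to time `q`, as a random element of a measurable space from which the path can be
recovered in a jointly measurable way. -/
lemma IsRegularProcess.exists_past (hX : IsRegularProcess X Ψ P') (q : ℝ≥0) :
    ∃ (S : Type u) (_ : MeasurableSpace S) (f : Ω' → S) (Y : ℝ≥0 → S → E d), Measurable f ∧
      (Measurable fun z : ℝ≥0 × S => Y z.1 z.2) ∧ (∀ u ≤ q, ∀ ω, Y u (f ω) = X u ω - X q ω) ∧
      ∀ v, q ≤ v → IndepFun f (fun ω => X v ω - X q ω) P' := by
  have hXm : ∀ t, Measurable (X t) := fun t => hX.measurable.comp measurable_prodMk_left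
  set past : Ω' → (Icc 0 q → E d) := fun ω u => X u ω - X 0 ω with hpast
  have hpm : Measurable past := measurable_pi_lambda _ fun u => (hXm _).sub (hXm _)
  have hmin : ∀ u : ℝ≥0, min u q ∈ Icc 0 q := fun u => ⟨zero_le, min_le_right _ _⟩
  -- The past is `Ω'` itself with the `σ`-algebra generated by the increments up to time `q`.
  -- Keeping the points of `Ω'` retains right continuity of the stopped path, hence its joint
  -- measurability for this smaller `σ`-algebra.
  refine ⟨Ω', MeasurableSpace.comap past inferInstance, id, fun u ω => X (min u q) ω - X q ω,
    measurable_id'' hpm.comap_le, ?_, ?_, ?_⟩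
  · refine @measurable_uncurry_of_rightContinuous d Ω' (MeasurableSpace.comap past inferInstance)
      (fun u ω => X (min u q) ω - X q ω) ?_ ?_
    · intro u
      have h2 : Measurable fun w : Icc 0 q → E d =>
          w ⟨min u q, hmin u⟩ - w ⟨q, ⟨zero_le, le_rfl⟩⟩ :=
        (measurable_pi_apply _).sub (measurable_pi_apply _)
      have h3 := h2.comp (comap_measurable past)
      have h4 : (fun w : Icc 0 q → E d => w ⟨min u q, hmin u⟩ - w ⟨q, ⟨zero_le, le_rfl⟩⟩) ∘ past =
          fun ω => X (min u q) ω - X q ω := by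
        ext1 ω
        simp [hpast]
      rwa [h4] at h3
    · intro ω t
      refine ContinuousWithinAt.sub ?_ continuousWithinAt_const
      refine (hX.right_continuous ω (min t q)).comp (t := Ici (min t q))
        (f := fun u => min u q) (by fun_prop) fun u hu => ?_
      exact min_le_min_right q (mem_Ici.1 hu)
  · intro u hu ω
    simp [min_eq_left hu]
  · intro v hqv
    have := hX.indep 0 q v zero_le hqv
    rw [IndepFun_iff_Indep] at this
    refine (@IndepFun_iff_Indep Ω' Ω' (E d) mΩ (MeasurableSpace.comap past inferInstance) _ id
      (fun ω => X v ω - X q ω) P').2 ?_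
    rwa [MeasurableSpace.comap_id]

/-- For `u ≤ q ≤ v`, `X u - X v = (X u - X q) - (X v - X q)` separates the past from an independent
increment. Freezing that increment at `y` turns the exponent into an occupation functional up to `q`
with base point `-y + b`, which is why the bound `hC` must be uniform in the base point. -/
lemma IsRegularProcess.lintegral_mul_occupation_le (hX : IsRegularProcess X Ψ P') {β₀ : ℝ}
    {G : E d → ℝ} (hG : Measurable G) {τ q v : ℝ} (hq : 0 ≤ q) (hqv : q ≤ v) {φ : E d → ℝ≥0∞}
    (hφ : Measurable φ) {C : ℝ≥0∞}
    (hC : ∀ b, ∫⁻ ω, ENNReal.ofReal (Real.exp (occupation X β₀ G τ q b ω)) ∂P' ≤ C) (b : E d) :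
    ∫⁻ ω, φ (X q.toNNReal ω - X v.toNNReal ω + b) * ENNReal.ofReal (Real.exp
        (∫ u in 0..q, (τ - u) ^ (-β₀) * G (X u.toNNReal ω - X v.toNNReal ω + b))) ∂P' ≤
      (∫⁻ ω, φ (X q.toNNReal ω - X v.toNNReal ω + b) ∂P') * C := by
  have hXm : ∀ t, Measurable (X t) := fun t => hX.measurable.comp measurable_prodMk_left
  obtain ⟨S, mS, f, Y, hf, hY, hYX, hind⟩ := hX.exists_past q.toNNReal
  have hle : ∀ u ∈ uIcc 0 q, u.toNNReal ≤ q.toNNReal := fun u hu => by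
    rw [uIcc_of_le hq] at hu
    exact Real.toNNReal_le_toNNReal hu.2
  set H : S × E d → ℝ≥0∞ := fun z => ENNReal.ofReal (Real.exp (∫ u in 0..q,
    (τ - u) ^ (-β₀) * G (Y u.toNNReal z.1 + (-z.2 + b)))) with hHdef
  have hH : Measurable H := by
    refine ENNReal.measurable_ofReal.comp (Real.measurable_exp.comp ?_)
    simp_rw [intervalIntegral.integral_of_le hq]
    refine StronglyMeasurable.measurable ?_
    refine StronglyMeasurable.integral_prod_right' (ν := volume.restrict (Ioc 0 q))
      (f := fun z : (S × E d) × ℝ => (τ - z.2) ^ (-β₀) *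
        G (Y z.2.toNNReal z.1.1 + (-z.1.2 + b))) ?_
    refine Measurable.stronglyMeasurable ?_
    have h2 : Measurable fun z : (S × E d) × ℝ => Y z.2.toNNReal z.1.1 :=
      hY.comp (f := fun z : (S × E d) × ℝ => (z.2.toNNReal, z.1.1)) (by fun_prop)
    exact Measurable.mul (by fun_prop) (hG.comp (h2.add (by fun_prop)))
  have key := lintegral_mul_le_of_indepFun (hind v.toNNReal (Real.toNNReal_le_toNNReal hqv)) hf
    ((hXm _).sub (hXm _)) (φ := fun y => φ (-y + b)) (by fun_prop) hH (C := C) ?_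
  · have e1 : ∀ ω, -(X v.toNNReal ω - X q.toNNReal ω) + b =
        X q.toNNReal ω - X v.toNNReal ω + b := fun ω => by abel
    simp only [e1] at key
    refine le_trans (le_of_eq ?_) key
    refine lintegral_congr fun ω => ?_
    simp only [hHdef, e1]
    congr 3
    refine intervalIntegral.integral_congr fun u hu => ?_
    simp only [hYX _ (hle u hu)]
    congr 2
    abel
  · intro y
    refine le_trans (le_of_eq ?_) (hC (-y + b))
    refine lintegral_congr fun ω => ?_
    simp only [hHdef, occupation]
    congr 2
    refine intervalIntegral.integral_congr fun u hu => ?_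
    simp only [hYX _ (hle u hu)]

lemma intervalIntegrable_weight {β₀ : ℝ} (hβ₁ : β₀ < 1) (τ v : ℝ) :
    IntervalIntegrable (fun u => (τ - u) ^ (-β₀)) volume 0 v := by
  have := (intervalIntegral.intervalIntegrable_rpow' (a := τ) (b := τ - v)
    (by linarith : -1 < -β₀)).comp_sub_left τ
  simpa using this

lemma intervalIntegrable_weight_mul {β₀ : ℝ} (hβ₁ : β₀ < 1) (τ v : ℝ) {f : ℝ → ℝ}
    (hf : Measurable f) {B : ℝ} (hB : ∀ u, |f u| ≤ B) :
    IntervalIntegrable (fun u => (τ - u) ^ (-β₀) * f u) volume 0 v := by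
  have h := intervalIntegrable_weight hβ₁ τ v
  rw [intervalIntegrable_iff] at h ⊢
  exact h.mul_bdd (c := B) hf.aestronglyMeasurable (Eventually.of_forall hB)

/-- The Volterra inequality behind Khasminskii's lemma. The exponential is expanded by
`exp_integral_eq`; in the integrand at time `q` the factor `G` depends only on the increment from
`q` to `v`, and decouples from the exponential over `[0, q]`. As `v ≤ τ`, the weight `(τ - q)^{-β₀}`
may be replaced by the convolution weight `(v - q)^{-β₀}`. -/
lemma IsRegularProcess.occupation_step (hX : IsRegularProcess X Ψ P') {β₀ : ℝ} (hβ₀ : 0 < β₀)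
    (hβ₁ : β₀ < 1) {G : E d → ℝ} (hG : Continuous G) (hG0 : ∀ x, 0 ≤ G x) {B : ℝ}
    (hGB : ∀ x, G x ≤ B) {K : ℝ → ℝ≥0∞}
    (hGK : ∀ (r s : ℝ≥0) z, ∫⁻ ω, ENNReal.ofReal (G (X r ω - X s ω + z)) ∂P' ≤ K |(r : ℝ) - s|)
    {τ v : ℝ} (hv : 0 ≤ v) (hvτ : v ≤ τ) {M : ℝ → ℝ≥0∞}
    (hM : ∀ q ∈ Icc 0 v, ∀ b,
      ∫⁻ ω, ENNReal.ofReal (Real.exp (occupation X β₀ G τ q b ω)) ∂P' ≤ M q) (b : E d) :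
    ∫⁻ ω, ENNReal.ofReal (Real.exp (occupation X β₀ G τ v b ω)) ∂P' ≤
      1 + ∫⁻ q in Ioo 0 v, ENNReal.ofReal ((v - q) ^ (-β₀)) * K (v - q) * M q := by
  have hXu : Measurable fun z : Ω' × ℝ => X z.2.toNNReal z.1 :=
    hX.measurable.comp (f := fun z : Ω' × ℝ => (z.2.toNNReal, z.1)) (by fun_prop)
  have hXm : ∀ t, Measurable (X t) := fun t => hX.measurable.comp measurable_prodMk_left
  have hGm := hG.measurable
  set f : Ω' → ℝ → ℝ := fun ω u =>
    (τ - u) ^ (-β₀) * G (X u.toNNReal ω - X v.toNNReal ω + b) with hf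
  have hXω : ∀ ω, Measurable fun u : ℝ => X u.toNNReal ω := fun ω =>
    hXu.comp measurable_prodMk_left
  have hfm2 : Measurable fun z : Ω' × ℝ => f z.1 z.2 :=
    Measurable.mul (by fun_prop) (hGm.comp ((hXu.sub ((hXm _).comp measurable_fst)).add_const _))
  have hfm : ∀ ω, Measurable (f ω) := fun ω => hfm2.comp measurable_prodMk_left
  have hfi : ∀ ω q, IntervalIntegrable (f ω) volume 0 q := fun ω q =>
    intervalIntegrable_weight_mul hβ₁ τ q (B := B)
      (f := fun u => G (X u.toNNReal ω - X v.toNNReal ω + b))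
      (hGm.comp (((hXω ω).sub_const _).add_const _)) fun u => by
        rw [abs_of_nonneg (hG0 _)]; exact hGB _
  have hf0 : ∀ ω, ∀ u ∈ Ioo 0 v, 0 ≤ f ω u := fun ω u hu =>
    mul_nonneg (Real.rpow_nonneg (by linarith [hu.2]) _) (hG0 _)
  have hpath : ∀ ω, ENNReal.ofReal (Real.exp (occupation X β₀ G τ v b ω)) = 1 +
      ∫⁻ q in Ioo 0 v, ENNReal.ofReal (f ω q) * ENNReal.ofReal (Real.exp (∫ u in 0..q, f ω u)) := by
    intro ω
    have hrc : ∀ x ∈ Ioo 0 v, ContinuousWithinAt (f ω) (Ioi x) x := by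
      intro x hx
      have h1 : ContinuousWithinAt (fun u : ℝ => X u.toNNReal ω) (Ioi x) x := by
        refine (hX.right_continuous ω x.toNNReal).comp (t := Ici x.toNNReal)
          (f := fun u : ℝ => u.toNNReal) continuous_real_toNNReal.continuousWithinAt fun u hu => ?_
        exact Real.toNNReal_le_toNNReal (le_of_lt hu)
      have h2 : ContinuousWithinAt (fun u : ℝ => (τ - u) ^ (-β₀)) (Ioi x) x := by
        refine ContinuousAt.continuousWithinAt ?_
        refine ContinuousAt.rpow_const (by fun_prop) (Or.inl ?_)
        linarith [hx.2]
      refine h2.mul (hG.continuousAt.comp_continuousWithinAt ?_)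
      exact (h1.sub continuousWithinAt_const).add continuousWithinAt_const
    have h1 := exp_integral_eq hv hrc (hfi ω v) (hfm ω)
    have h2 : IntervalIntegrable (fun q => f ω q * Real.exp (∫ u in 0..q, f ω u)) volume 0 v :=
      (hfi ω v).mul_continuousOn (Real.continuous_exp.comp_continuousOn
        (intervalIntegral.continuousOn_primitive_interval' (hfi ω v) left_mem_uIcc))
    have h3 : occupation X β₀ G τ v b ω = ∫ u in 0..v, f ω u := rfl
    have h4 := (intervalIntegrable_iff_integrableOn_Ioo_of_le hv).1 h2
    have h5 : 0 ≤ᵐ[volume.restrict (Ioo 0 v)] fun q => f ω q * Real.exp (∫ u in 0..q, f ω u) := by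
      filter_upwards [ae_restrict_mem measurableSet_Ioo] with q hq
      exact mul_nonneg (hf0 ω q hq) (Real.exp_pos _).le
    rw [h3, h1, intervalIntegral.integral_of_le hv, integral_Ioc_eq_integral_Ioo,
      ENNReal.ofReal_add zero_le_one (integral_nonneg_of_ae h5), ENNReal.ofReal_one,
      ofReal_integral_eq_lintegral_ofReal h4 h5]
    congr 1
    refine setLIntegral_congr_fun measurableSet_Ioo fun q hq => ?_
    exact ENNReal.ofReal_mul (hf0 ω q hq)
  -- Joint measurability in `(ω, q)` is obtained by moving the variable endpoint into an indicator
  -- over a fixed interval.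
  have hmeas : Measurable fun z : Ω' × ℝ => ∫ u in Ioc 0 v, (Iic z.2).indicator (f z.1) u := by
    refine StronglyMeasurable.measurable ?_
    refine StronglyMeasurable.integral_prod_right' (ν := volume.restrict (Ioc 0 v))
      (f := fun z : (Ω' × ℝ) × ℝ => (Iic z.1.2).indicator (f z.1.1) z.2) ?_
    refine Measurable.stronglyMeasurable ?_
    have : (fun z : (Ω' × ℝ) × ℝ => (Iic z.1.2).indicator (f z.1.1) z.2) =
        {z : (Ω' × ℝ) × ℝ | z.2 ≤ z.1.2}.indicator fun z => f z.1.1 z.2 := rfl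
    rw [this]
    exact (hfm2.comp (f := fun z : (Ω' × ℝ) × ℝ => (z.1.1, z.2)) (by fun_prop)).indicator
      (measurableSet_le (by fun_prop) (by fun_prop))
  have hind : ∀ ω, ∀ q ∈ Ioo 0 v, ∫ u in 0..q, f ω u =
      ∫ u in Ioc 0 v, (Iic q).indicator (f ω) u := by
    intro ω q hq
    rw [intervalIntegral.integral_of_le hq.1.le, setIntegral_indicator measurableSet_Iic]
    congr 2
    ext u
    simp only [mem_inter_iff, mem_Ioc, mem_Iic]
    constructor
    · rintro ⟨h1, h2⟩; exact ⟨⟨h1, h2.trans hq.2.le⟩, h2⟩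
    · rintro ⟨⟨h1, -⟩, h2⟩; exact ⟨h1, h2⟩
  have hpath2 : ∀ ω, ENNReal.ofReal (Real.exp (occupation X β₀ G τ v b ω)) = 1 +
      ∫⁻ q in Ioo 0 v, ENNReal.ofReal (f ω q) *
        ENNReal.ofReal (Real.exp (∫ u in Ioc 0 v, (Iic q).indicator (f ω) u)) := by
    intro ω
    rw [hpath ω]
    congr 1
    refine setLIntegral_congr_fun measurableSet_Ioo fun q hq => ?_
    simp only [hind ω q hq]
  simp_rw [hpath2]
  rw [lintegral_add_left measurable_const, lintegral_one, measure_univ]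
  gcongr 1 + ?_
  rw [lintegral_lintegral_swap]
  swap
  · refine Measurable.aemeasurable ?_
    exact hfm2.ennreal_ofReal.mul (Real.measurable_exp.comp hmeas).ennreal_ofReal
  refine setLIntegral_mono' measurableSet_Ioo fun q hq => ?_
  simp_rw [← hind _ q hq]
  have h1 := hX.lintegral_mul_occupation_le hGm hq.1.le hq.2.le
    (φ := fun x => ENNReal.ofReal ((τ - q) ^ (-β₀)) * ENNReal.ofReal (G x)) (by fun_prop)
    (hM q ⟨hq.1.le, hq.2.le⟩) b
  have hτq : 0 ≤ (τ - q) ^ (-β₀) := Real.rpow_nonneg (by linarith [hq.2]) _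
  calc _ = ∫⁻ ω, ENNReal.ofReal ((τ - q) ^ (-β₀)) *
          ENNReal.ofReal (G (X q.toNNReal ω - X v.toNNReal ω + b)) * ENNReal.ofReal (Real.exp
        (∫ u in 0..q, (τ - u) ^ (-β₀) * G (X u.toNNReal ω - X v.toNNReal ω + b))) ∂P' := by
        refine lintegral_congr fun ω => ?_
        rw [← ENNReal.ofReal_mul hτq]
    _ ≤ _ := h1
    _ ≤ _ := by
        gcongr ?_ * _
        rw [lintegral_const_mul' _ _ ENNReal.ofReal_ne_top]
        have h2 := hGK q.toNNReal v.toNNReal b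
        rw [Real.coe_toNNReal _ hq.1.le, Real.coe_toNNReal _ hv, abs_sub_comm,
          abs_of_pos (sub_pos.2 hq.2)] at h2
        refine mul_le_mul' (ENNReal.ofReal_le_ofReal ?_) h2
        exact Real.rpow_le_rpow_of_nonpos (sub_pos.2 hq.2) (by linarith) (by linarith)

/-- Khasminskii's lemma, with an exponential weight in time. -/
theorem IsRegularProcess.lintegral_exp_occupation_le (hX : IsRegularProcess X Ψ P') {β₀ : ℝ}
    (hβ₀ : 0 < β₀) (hβ₁ : β₀ < 1) {G : E d → ℝ} (hG : Continuous G) (hG0 : ∀ x, 0 ≤ G x) {B : ℝ}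
    (hGB : ∀ x, G x ≤ B) {K : ℝ → ℝ≥0∞} (hK : Measurable K)
    (hGK : ∀ (r s : ℝ≥0) z, ∫⁻ ω, ENNReal.ofReal (G (X r ω - X s ω + z)) ∂P' ≤ K |(r : ℝ) - s|)
    {T θ : ℝ} (hθ0 : 0 ≤ θ) (hθ : ∫⁻ v in Ioc 0 T, ENNReal.ofReal (v ^ (-β₀)) * K v *
      ENNReal.ofReal (Real.exp (-(θ * v))) ≤ 2⁻¹) {τ : ℝ} (hτ : 0 ≤ τ) (hτT : τ ≤ T) (b : E d) :
    ∫⁻ ω, ENNReal.ofReal (Real.exp (occupation X β₀ G τ τ b ω)) ∂P' ≤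
      2 * ENNReal.ofReal (Real.exp (θ * T)) := by
  set Mf : ℝ → E d → ℝ≥0∞ := fun v b =>
    ∫⁻ ω, ENNReal.ofReal (Real.exp (occupation X β₀ G τ v b ω)) ∂P' with hMf
  set R : ℝ := B * ∫ u in 0..τ, (τ - u) ^ (-β₀) with hR
  have hB0 : 0 ≤ B := (hG0 0).trans (hGB 0)
  have hbdd : ∀ v ∈ Icc 0 τ, ∀ b, Mf v b ≤ ENNReal.ofReal (Real.exp R) := by
    intro v hv b
    have h1 : ∀ ω, occupation X β₀ G τ v b ω ≤ R := by
      intro ω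
      have hXω : Measurable fun u : ℝ => X u.toNNReal ω :=
        hX.measurable.comp (f := fun u : ℝ => (u.toNNReal, ω)) (by fun_prop)
      have hi : ∀ v, IntervalIntegrable (fun u => (τ - u) ^ (-β₀)) volume 0 v :=
        intervalIntegrable_weight hβ₁ τ
      calc occupation X β₀ G τ v b ω ≤ ∫ u in 0..v, B * (τ - u) ^ (-β₀) := by
            refine intervalIntegral.integral_mono_on hv.1 ?_ ((hi v).const_mul B) fun u hu => ?_
            · exact intervalIntegrable_weight_mul hβ₁ τ v (B := B)
                (f := fun u => G (X u.toNNReal ω - X v.toNNReal ω + b))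
                (hG.measurable.comp ((hXω.sub_const _).add_const _)) fun u => by
                  rw [abs_of_nonneg (hG0 _)]; exact hGB _
            · rw [mul_comm]
              exact mul_le_mul_of_nonneg_right (hGB _)
                (Real.rpow_nonneg (by linarith [hu.2, hv.2]) _)
        _ ≤ ∫ u in 0..τ, B * (τ - u) ^ (-β₀) := by
            refine intervalIntegral.integral_mono_interval le_rfl hv.1 hv.2 ?_ ((hi τ).const_mul B)
            filter_upwards [ae_restrict_mem measurableSet_Ioc] with u hu
            exact mul_nonneg hB0 (Real.rpow_nonneg (by linarith [hu.2]) _)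
        _ = R := by rw [intervalIntegral.integral_const_mul]
    calc Mf v b ≤ ∫⁻ _ω, ENNReal.ofReal (Real.exp R) ∂P' :=
          lintegral_mono fun ω => ENNReal.ofReal_le_ofReal (Real.exp_le_exp.2 (h1 ω))
      _ = _ := by simp
  have hexp0 : ∀ x : ℝ, ENNReal.ofReal (Real.exp x) ≠ 0 := fun x =>
    (ENNReal.ofReal_pos.2 (Real.exp_pos x)).ne'
  have hexpmul : ∀ x y : ℝ, ENNReal.ofReal (Real.exp x) * ENNReal.ofReal (Real.exp y) =
      ENNReal.ofReal (Real.exp (x + y)) := fun x y => by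
    rw [← ENNReal.ofReal_mul (Real.exp_pos _).le, Real.exp_add]
  -- The supremum over times and base points closes the Volterra inequality on itself. It is finite
  -- by the crude bound `hbdd`, which depends on `B`; this finiteness is what allows `S / 2` to be
  -- absorbed and leaves a bound free of `B`.
  set S : ℝ≥0∞ := ⨆ v ∈ Icc 0 τ, ⨆ b, ENNReal.ofReal (Real.exp (-(θ * v))) * Mf v b with hS
  have hMS : ∀ v ∈ Icc 0 τ, ∀ b, Mf v b ≤ S * ENNReal.ofReal (Real.exp (θ * v)) := by
    intro v hv b
    have h1 : ENNReal.ofReal (Real.exp (-(θ * v))) * Mf v b ≤ S :=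
      le_trans (le_iSup (fun b => ENNReal.ofReal (Real.exp (-(θ * v))) * Mf v b) b)
        (le_iSup₂ (f := fun v (_ : v ∈ Icc 0 τ) =>
          ⨆ b, ENNReal.ofReal (Real.exp (-(θ * v))) * Mf v b) v hv)
    calc Mf v b = ENNReal.ofReal (Real.exp (-(θ * v))) * Mf v b *
          ENNReal.ofReal (Real.exp (θ * v)) := by
          rw [mul_right_comm, hexpmul]; simp
      _ ≤ _ := by gcongr
  have hSfin : S ≠ ∞ := by
    refine ne_top_of_le_ne_top (b := ENNReal.ofReal (Real.exp R)) ENNReal.ofReal_ne_top ?_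
    refine iSup₂_le fun v hv => iSup_le fun b => ?_
    refine le_trans (mul_le_of_le_one_left' ?_) (hbdd v hv b)
    rw [← ENNReal.ofReal_one]
    refine ENNReal.ofReal_le_ofReal (Real.exp_le_one_iff.2 ?_)
    have := mul_nonneg hθ0 hv.1
    linarith
  -- The factors `e^{-θv}` and `e^{θq}` combine to `e^{-θ(v-q)}`, so the weighted kernel has mass at
  -- most `1/2` by `hθ`.
  have hstep : S ≤ 1 + 2⁻¹ * S := by
    refine iSup₂_le fun v hv => iSup_le fun b => ?_
    have h1 := hX.occupation_step hβ₀ hβ₁ hG hG0 hGB hGK hv.1 hv.2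
      (M := fun q => S * ENNReal.ofReal (Real.exp (θ * q)))
      (fun q hq b => hMS q ⟨hq.1, hq.2.trans hv.2⟩ b) b
    calc ENNReal.ofReal (Real.exp (-(θ * v))) * Mf v b
        ≤ ENNReal.ofReal (Real.exp (-(θ * v))) * (1 + ∫⁻ q in Ioo 0 v,
          ENNReal.ofReal ((v - q) ^ (-β₀)) * K (v - q) *
            (S * ENNReal.ofReal (Real.exp (θ * q)))) := by gcongr
      _ = ENNReal.ofReal (Real.exp (-(θ * v))) + S * ∫⁻ q in Ioo 0 v,
          ENNReal.ofReal ((v - q) ^ (-β₀)) * K (v - q) *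
            ENNReal.ofReal (Real.exp (-(θ * (v - q)))) := by
          rw [mul_add, mul_one, ← lintegral_const_mul _ (by fun_prop),
            ← lintegral_const_mul _ (by fun_prop)]
          congr 1
          refine lintegral_congr fun q => ?_
          rw [show -(θ * (v - q)) = -(θ * v) + θ * q by ring, ← hexpmul]
          ring
      _ ≤ 1 + S * 2⁻¹ := by
          gcongr
          · rw [← ENNReal.ofReal_one]
            refine ENNReal.ofReal_le_ofReal (Real.exp_le_one_iff.2 ?_)
            have := mul_nonneg hθ0 hv.1
            linarith
          · refine le_trans ?_ hθ
            have h2 := (Measure.measurePreserving_sub_left (volume : Measure ℝ)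
              v).setLIntegral_comp_preimage_emb (Homeomorph.subLeft v).measurableEmbedding
              (fun u => ENNReal.ofReal (u ^ (-β₀)) * K u * ENNReal.ofReal (Real.exp (-(θ * u))))
              (Ioc 0 T)
            rw [← h2]
            refine lintegral_mono_set fun q hq => ?_
            simp only [mem_preimage, mem_Ioc]
            constructor <;> linarith [hq.1, hq.2, hv.2]
      _ = _ := by rw [mul_comm]
  have hS2 : S ≤ 2 := by
    have h1 := ENNReal.toReal_mono (by finiteness) hstep
    rw [ENNReal.toReal_add (by simp) (by finiteness), ENNReal.toReal_mul, ENNReal.toReal_inv] at h1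
    simp only [ENNReal.toReal_one, ENNReal.toReal_ofNat] at h1
    rw [← ENNReal.ofReal_toReal hSfin, ← ENNReal.ofReal_ofNat 2]
    exact ENNReal.ofReal_le_ofReal (by linarith)
  calc _ ≤ S * ENNReal.ofReal (Real.exp (θ * τ)) := hMS τ ⟨hτ, le_rfl⟩ b
    _ ≤ _ := by gcongr

end Khasminskii


/-! ### Expected spatial covariances along the process. -/

section MollifiedCovariance

variable {d : ℕ} {p : E d → ℝ} {γ : E d → ℝ≥0∞} {γhat Ψ : E d → ℝ}

/-- `(2π)⁻ᵈ ∫ p̂(εξ) p̂(ε'ξ) e^{-vΨ(ξ)} cos(ξ·z) μ(dξ)`. -/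
noncomputable def mollCov (p γhat Ψ : E d → ℝ) (ε ε' v : ℝ) (z : E d) : ℝ :=
  ((2 * Real.pi) ^ d)⁻¹ * ∫ ξ, cosTransform p (ε • ξ) * cosTransform p (ε' • ξ) *
    (Real.exp (-(v * Ψ ξ)) * Real.cos (inner ℝ ξ z)) ∂(spectralMeasure γhat)

/-- `(2π)⁻ᵈ ∫ e^{-vΨ(ξ)} cos(ξ·z) μ(dξ)`. -/
noncomputable def limitCov (γhat Ψ : E d → ℝ) (v : ℝ) (z : E d) : ℝ :=
  ((2 * Real.pi) ^ d)⁻¹ * ∫ ξ, Real.exp (-(v * Ψ ξ)) * Real.cos (inner ℝ ξ z)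
    ∂(spectralMeasure γhat)

lemma measurable_mollCov (hp : IsMollifier p) (hΨ : Measurable Ψ) (ε ε' : ℝ) (z : E d) :
    Measurable fun v => mollCov p γhat Ψ ε ε' v z := by
  have hc := continuous_cosTransform hp
  unfold mollCov
  refine Measurable.const_mul (StronglyMeasurable.measurable ?_) _
  refine StronglyMeasurable.integral_prod_right' (ν := spectralMeasure γhat)
    (f := fun q : ℝ × E d => cosTransform p (ε • q.2) * cosTransform p (ε' • q.2) *
    (Real.exp (-(q.1 * Ψ q.2)) * Real.cos (inner ℝ q.2 z))) (Measurable.stronglyMeasurable ?_)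
  fun_prop

lemma measurable_limitCov (hΨ : Measurable Ψ) (z : E d) :
    Measurable fun v => limitCov γhat Ψ v z := by
  unfold limitCov
  refine Measurable.const_mul (StronglyMeasurable.measurable ?_) _
  refine StronglyMeasurable.integral_prod_right' (ν := spectralMeasure γhat)
    (f := fun q : ℝ × E d =>
    (Real.exp (-(q.1 * Ψ q.2)) * Real.cos (inner ℝ q.2 z))) (Measurable.stronglyMeasurable ?_)
  fun_prop

/-- Since `|p̂| ≤ 1` and `|cos| ≤ 1`, the bound does not depend on the mollification or on the
point. It is the source of all the uniformity below. -/
lemma ofReal_mollCov_le (hp : IsMollifier p) (ε ε' v : ℝ) (z : E d) :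
    ENNReal.ofReal (mollCov p γhat Ψ ε ε' v z) ≤
      ENNReal.ofReal (((2 * Real.pi) ^ d)⁻¹) * laplaceMass Ψ (spectralMeasure γhat) v := by
  rw [mollCov, ENNReal.ofReal_mul (by positivity)]
  gcongr
  refine (Real.ofReal_le_enorm _).trans ((enorm_integral_le_lintegral_enorm _).trans ?_)
  refine lintegral_mono fun ξ => ?_
  rw [← ofReal_norm, Real.norm_eq_abs]
  refine ENNReal.ofReal_le_ofReal ?_
  rw [abs_mul, abs_mul, abs_mul, abs_of_pos (Real.exp_pos _)]
  have h1 := abs_cosTransform_le hp (ε • ξ)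
  have h2 := abs_cosTransform_le hp (ε' • ξ)
  have h3 := Real.abs_cos_le_one (inner ℝ ξ z)
  calc _ ≤ 1 * 1 * (Real.exp (-(v * Ψ ξ)) * 1) := by gcongr
    _ = _ := by ring

lemma ofReal_limitCov_le (v : ℝ) (z : E d) :
    ENNReal.ofReal (limitCov γhat Ψ v z) ≤
      ENNReal.ofReal (((2 * Real.pi) ^ d)⁻¹) * laplaceMass Ψ (spectralMeasure γhat) v := by
  rw [limitCov, ENNReal.ofReal_mul (by positivity)]
  gcongr
  refine (Real.ofReal_le_enorm _).trans ((enorm_integral_le_lintegral_enorm _).trans ?_)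
  refine lintegral_mono fun ξ => ?_
  rw [← ofReal_norm, Real.norm_eq_abs]
  refine ENNReal.ofReal_le_ofReal ?_
  rw [abs_mul, abs_of_pos (Real.exp_pos _)]
  exact mul_le_of_le_one_right (Real.exp_pos _).le (Real.abs_cos_le_one _)

lemma integrable_exp_of_laplaceMass (hΨ : Measurable Ψ) {v : ℝ}
    (h : laplaceMass Ψ (spectralMeasure γhat) v < ∞) :
    Integrable (fun ξ => Real.exp (-(v * Ψ ξ))) (spectralMeasure γhat) := by
  refine ⟨(by fun_prop : Measurable fun ξ => Real.exp (-(v * Ψ ξ))).aestronglyMeasurable, ?_⟩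
  rw [hasFiniteIntegral_iff_ofReal (Eventually.of_forall fun _ => (Real.exp_pos _).le)]
  exact h

lemma tendsto_mollCov (hp : IsMollifier p) (hΨ : Measurable Ψ) {v : ℝ}
    (h : laplaceMass Ψ (spectralMeasure γhat) v < ∞) (z : E d) :
    Tendsto (fun q : ℝ × ℝ => mollCov p γhat Ψ q.1 q.2 v z) (𝓝[>] 0 ×ˢ 𝓝[>] 0)
      (𝓝 (limitCov γhat Ψ v z)) := by
  have hc := continuous_cosTransform hp
  refine Tendsto.const_mul _ ?_
  refine tendsto_integral_filter_of_dominated_convergence (fun ξ => Real.exp (-(v * Ψ ξ))) ?_ ?_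
    (integrable_exp_of_laplaceMass hΨ h) ?_
  · refine Eventually.of_forall fun q => Measurable.aestronglyMeasurable ?_
    fun_prop
  · refine Eventually.of_forall fun q => Eventually.of_forall fun ξ => ?_
    rw [Real.norm_eq_abs, abs_mul, abs_mul, abs_mul, abs_of_pos (Real.exp_pos _)]
    have h1 := abs_cosTransform_le hp (q.1 • ξ)
    have h2 := abs_cosTransform_le hp (q.2 • ξ)
    have h3 := Real.abs_cos_le_one (inner ℝ ξ z)
    calc _ ≤ 1 * 1 * (Real.exp (-(v * Ψ ξ)) * 1) := by gcongr
      _ = _ := by ring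
  · refine Eventually.of_forall fun ξ => ?_
    have hle : (𝓝[>] (0:ℝ) ×ˢ 𝓝[>] (0:ℝ)) ≤ 𝓝 ((0:ℝ), (0:ℝ)) := by
      rw [nhds_prod_eq]; exact Filter.prod_mono nhdsWithin_le_nhds nhdsWithin_le_nhds
    have h1 : Continuous fun q : ℝ × ℝ => cosTransform p (q.1 • ξ) * cosTransform p (q.2 • ξ) *
      (Real.exp (-(v * Ψ ξ)) * Real.cos (inner ℝ ξ z)) := by fun_prop
    have h2 := (h1.tendsto (0, 0)).mono_left hle
    simpa [cosTransform_zero hp] using h2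

variable {Ω' : Type*} {mΩ : MeasurableSpace Ω'} {X : ℝ≥0 → Ω' → E d} {P' : Measure Ω'}
  [IsProbabilityMeasure P']

lemma IsRegularProcess.measurable_eval (hX : IsRegularProcess X Ψ P') (t : ℝ≥0) :
    Measurable (X t) := hX.measurable.comp measurable_prodMk_left

lemma IsRegularProcess.measurable_path (hX : IsRegularProcess X Ψ P') (ω : Ω') :
    Measurable fun s => X s ω := hX.measurable.comp measurable_prodMk_right

/-- Averaging over the path, frequency by frequency, replaces the random phase by the characteristic
function of an increment. -/
lemma IsRegularProcess.integral_smoothCov (hX : IsRegularProcess X Ψ P')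
    (hγ : IsCovarianceKernel γ γhat) (hp : IsMollifier p) {ε : ℝ} (hε : 0 < ε) (ε' : ℝ)
    (r s : ℝ≥0) (z : E d) :
    ∫ ω, smoothCov p γhat ε ε' (X r ω - X s ω + z) ∂P' = mollCov p γhat Ψ ε ε' |(r : ℝ) - s| z := by
  have hc := continuous_cosTransform hp
  have hr := hX.measurable_eval r
  have hs := hX.measurable_eval s
  simp only [smoothCov]
  rw [integral_const_mul, mollCov]
  congr 1
  rw [integral_integral_swap]
  · refine integral_congr_ae (Eventually.of_forall fun ξ => ?_)
    simp only
    rw [integral_const_mul, hX.integral_cos r s ξ z]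
  · have h1 : Integrable (fun q : Ω' × E d => (1 : ℝ) * |cosTransform p (ε • q.2)|)
        (P'.prod (spectralMeasure γhat)) :=
      (integrable_const (μ := P') (1 : ℝ)).mul_prod (integrable_cosTransform hγ hp hε).abs
    refine h1.mono' (Measurable.aestronglyMeasurable ?_) (Eventually.of_forall fun q => ?_)
    · unfold Function.uncurry; fun_prop
    · simp only [Function.uncurry]
      rw [Real.norm_eq_abs, abs_mul, abs_mul, one_mul, mul_assoc]
      exact mul_le_of_le_one_right (abs_nonneg _)
        (mul_le_one₀ (abs_cosTransform_le hp _) (abs_nonneg _) (Real.abs_cos_le_one _))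

lemma IsRegularProcess.lintegral_smoothCov (hX : IsRegularProcess X Ψ P') (hd : 0 < d)
    (hγ : IsCovarianceKernel γ γhat) (hp : IsMollifier p) {ε ε' : ℝ} (hε : 0 < ε) (hε' : 0 < ε')
    (r s : ℝ≥0) (z : E d) :
    ∫⁻ ω, ENNReal.ofReal (smoothCov p γhat ε ε' (X r ω - X s ω + z)) ∂P' =
      ENNReal.ofReal (mollCov p γhat Ψ ε ε' |(r : ℝ) - s| z) := by
  obtain ⟨B, hB⟩ := smoothCov_bounded hγ hp hε ε'
  have hm := (continuous_smoothCov hγ hp hε ε').measurable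
  have hr := hX.measurable_eval r
  have hs := hX.measurable_eval s
  rw [← hX.integral_smoothCov hγ hp hε ε', ofReal_integral_eq_lintegral_ofReal]
  · exact Integrable.of_bound (hm.comp ((hr.sub hs).add_const z)).aestronglyMeasurable B
      (Eventually.of_forall fun ω => hB _)
  · exact Eventually.of_forall fun ω => smoothCov_nonneg hd hγ hp hε hε' _

end MollifiedCovariance

/-! ### Uniform exponential moments of the energy. -/

section ExponentialMoments

/-- Jensen's inequality, also valid when `exp ∘ f` is not integrable, the right side then being
infinite. -/
lemma ofReal_exp_integral_le {α : Type*} {mα : MeasurableSpace α} {μ : Measure α}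
    [IsProbabilityMeasure μ] {f : α → ℝ} (hf : Integrable f μ) :
    ENNReal.ofReal (Real.exp (∫ x, f x ∂μ)) ≤ ∫⁻ x, ENNReal.ofReal (Real.exp (f x)) ∂μ := by
  by_cases h : Integrable (fun x => Real.exp (f x)) μ
  · rw [← ofReal_integral_eq_lintegral_ofReal h (Eventually.of_forall fun _ => (Real.exp_pos _).le)]
    exact ENNReal.ofReal_le_ofReal (convexOn_exp.map_integral_le Real.continuous_exp.continuousOn
      isClosed_univ (by simp) hf h)
  · have h1 : ¬ HasFiniteIntegral (fun x => Real.exp (f x)) μ := fun hfin =>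
      h ⟨Real.continuous_exp.comp_aestronglyMeasurable hf.aestronglyMeasurable, hfin⟩
    rw [hasFiniteIntegral_iff_ofReal (Eventually.of_forall fun _ => (Real.exp_pos _).le), not_lt,
      top_le_iff] at h1
    rw [h1]; exact le_top

lemma lintegral_symm_le {J : ℝ → ℝ → ℝ≥0∞} (hJ : Measurable fun q : ℝ × ℝ => J q.1 q.2)
    (hs : ∀ a b, J a b = J b a) (t : ℝ) :
    ∫⁻ a in Icc 0 t, ∫⁻ b in Icc 0 t, J a b ≤ 2 * ∫⁻ b in Icc 0 t, ∫⁻ a in Ioc 0 b, J a b := by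
  set L : ℝ → ℝ → ℝ≥0∞ := fun a b => if a ≤ b then J a b else 0 with hL
  have hLm : Measurable fun q : ℝ × ℝ => L q.1 q.2 :=
    hJ.ite (measurableSet_le measurable_fst measurable_snd) measurable_const
  have hLm' : Measurable fun q : ℝ × ℝ => L q.2 q.1 := hLm.comp measurable_swap
  have h1 : ∀ b ∈ Icc 0 t, ∫⁻ a in Icc 0 t, L a b ≤ ∫⁻ a in Ioc 0 b, J a b := by
    intro b hb
    rw [restrict_Ioc_eq_restrict_Icc, ← lintegral_indicator measurableSet_Icc,
      ← lintegral_indicator measurableSet_Icc]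
    refine lintegral_mono fun a => ?_
    by_cases ha : a ∈ Icc 0 t
    · rw [indicator_of_mem ha]
      simp only [hL]
      split_ifs with h
      · rw [indicator_of_mem (by exact ⟨ha.1, h⟩)]
      · exact zero_le
    · rw [indicator_of_notMem ha]; exact zero_le
  calc ∫⁻ a in Icc 0 t, ∫⁻ b in Icc 0 t, J a b
      ≤ ∫⁻ a in Icc 0 t, ((∫⁻ b in Icc 0 t, L a b) + ∫⁻ b in Icc 0 t, L b a) := by
        refine lintegral_mono fun a => ?_
        rw [← lintegral_add_left (f := fun b => L a b) (hLm.comp measurable_prodMk_left)]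
        refine lintegral_mono fun b => ?_
        simp only [hL]
        rcases le_total a b with h | h
        · rw [if_pos h]; exact le_self_add
        · rw [if_pos h, hs a b]; exact le_add_self
    _ = (∫⁻ b in Icc 0 t, ∫⁻ a in Icc 0 t, L a b) + ∫⁻ b in Icc 0 t, ∫⁻ a in Icc 0 t, L a b := by
        rw [lintegral_add_left, lintegral_lintegral_swap hLm.aemeasurable]
        exact Measurable.lintegral_prod_right' (ν := volume.restrict (Icc 0 t)) hLm
    _ ≤ (∫⁻ b in Icc 0 t, ∫⁻ a in Ioc 0 b, J a b) + ∫⁻ b in Icc 0 t, ∫⁻ a in Ioc 0 b, J a b :=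
        add_le_add (setLIntegral_mono' measurableSet_Icc h1)
          (setLIntegral_mono' measurableSet_Icc h1)
    _ = _ := by rw [two_mul]

/-- By dominated convergence the weighted integral vanishes as `θ → ∞`. No bound on the size of `f`
is needed, so every exponential moment is reached at every time horizon. -/
lemma exists_exponential_weight {f : ℝ → ℝ≥0∞} (hf : Measurable f) {T : ℝ}
    (h : ∫⁻ v in Ioc 0 T, f v < ∞) :
    ∃ θ : ℝ, 0 ≤ θ ∧ ∫⁻ v in Ioc 0 T, f v * ENNReal.ofReal (Real.exp (-(θ * v))) ≤ 2⁻¹ := by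
  have hfin : ∀ᵐ v ∂volume.restrict (Ioc 0 T), f v < ∞ := ae_lt_top hf h.ne
  have hlim : Tendsto (fun n : ℕ => ∫⁻ v in Ioc 0 T, f v * ENNReal.ofReal (Real.exp (-(n * v))))
      atTop (𝓝 (∫⁻ _v in Ioc 0 T, 0)) := by
    refine tendsto_lintegral_of_dominated_convergence f (fun n => by fun_prop) (fun n => ?_) h.ne ?_
    · filter_upwards [ae_restrict_mem measurableSet_Ioc] with v hv
      refine mul_le_of_le_one_right' ?_
      rw [← ENNReal.ofReal_one]
      refine ENNReal.ofReal_le_ofReal (Real.exp_le_one_iff.2 ?_)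
      have := mul_nonneg (Nat.cast_nonneg (α := ℝ) n) hv.1.le
      linarith
    · filter_upwards [ae_restrict_mem measurableSet_Ioc, hfin] with v hv hfv
      have h1 : Tendsto (fun n : ℕ => Real.exp (-(n * v))) atTop (𝓝 0) := by
        refine Real.tendsto_exp_neg_atTop_nhds_zero.comp ?_
        exact tendsto_natCast_atTop_atTop.atTop_mul_const hv.1
      have h2 := ENNReal.Tendsto.const_mul (a := f v) (ENNReal.tendsto_ofReal h1) (Or.inr hfv.ne)
      simpa using h2
  rw [lintegral_zero] at hlim
  have h2 : ∀ᶠ n : ℕ in atTop, ∫⁻ v in Ioc 0 T, f v * ENNReal.ofReal (Real.exp (-(n * v))) < 2⁻¹ :=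
    hlim.eventually_lt_const (by simp)
  obtain ⟨n, hn⟩ := h2.exists
  exact ⟨n, Nat.cast_nonneg n, hn.le⟩

variable {d : ℕ} {p : E d → ℝ} {γ : E d → ℝ≥0∞} {γhat Ψ : E d → ℝ}

lemma smoothCov_neg (ε ε' : ℝ) (w : E d) : smoothCov p γhat ε ε' (-w) = smoothCov p γhat ε ε' w := by
  simp [smoothCov, inner_neg_right]

variable {Ω' : Type*} {mΩ : MeasurableSpace Ω'} {X : ℝ≥0 → Ω' → E d} {P' : Measure Ω'}
  [IsProbabilityMeasure P'] {β₀ : ℝ}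

/-- The energy along a path is controlled by occupation functionals. -/
lemma IsRegularProcess.energy_Phi_le (hX : IsRegularProcess X Ψ P') (hd : 0 < d) (hβ₀ : 0 < β₀)
    (hβ₁ : β₀ < 1) (hγ : IsCovarianceKernel γ γhat) (hp : IsMollifier p) {ε δ : ℝ} (hε : 0 < ε)
    (hδ : 0 < δ) (t : ℝ≥0) (x : E d) (ω : Ω') :
    energy β₀ γ (Phi p ε δ t x fun s => X s ω) (Phi p ε δ t x fun s => X s ω) ≤
      ENNReal.ofReal (2 * avgConst β₀ ^ 2) * ∫⁻ b in Icc (0 : ℝ) t,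
        ENNReal.ofReal (occupation X β₀ (smoothCov p γhat ε ε) b b 0 ω) := by
  have hpath := hX.measurable_path ω
  have hpath' : Measurable fun u : ℝ => X u.toNNReal ω := hpath.comp measurable_real_toNNReal
  have hG := (continuous_smoothCov hγ hp hε ε).measurable
  obtain ⟨B, hB⟩ := smoothCov_bounded hγ hp hε ε
  rw [energy_Phi hp hγ.continuous.measurable hε hδ hε hδ hpath hpath]
  set J : ℝ → ℝ → ℝ≥0∞ := fun a b => ENNReal.ofReal (|b - a| ^ (-β₀)) *
    ENNReal.ofReal (smoothCov p γhat ε ε (X a.toNNReal ω - X b.toNNReal ω)) with hJ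
  have hJm : Measurable fun q : ℝ × ℝ => J q.1 q.2 := by
    have h1 : Measurable fun q : ℝ × ℝ => X q.1.toNNReal ω := hpath'.comp measurable_fst
    have h2 : Measurable fun q : ℝ × ℝ => X q.2.toNNReal ω := hpath'.comp measurable_snd
    exact Measurable.mul (by fun_prop) (hG.comp (h1.sub h2)).ennreal_ofReal
  have hJs : ∀ a b, J a b = J b a := fun a b => by
    simp only [hJ]
    rw [abs_sub_comm, ← smoothCov_neg, neg_sub]
  calc _ ≤ ∫⁻ a in Icc (0 : ℝ) t, ∫⁻ b in Icc (0 : ℝ) t,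
        ENNReal.ofReal (avgConst β₀ ^ 2) * J a b := by
        refine lintegral_mono fun a => lintegral_mono_ae (ae_restrict_of_ae ?_)
        have e1 : ∀ᵐ b : ℝ, b ≠ a := by rw [ae_iff]; simp
        filter_upwards [e1] with b hb
        rw [(spaceKernel_eq hd hγ hp hε hε _ _).2]
        have h1 := timeKernel_le hβ₀ hβ₁ hδ hδ (t := t) (s := t) (a := a) (b := b)
          (by intro h; exact hb (by linarith))
        rw [show (t : ℝ) - a - (t - b) = b - a by ring] at h1
        rw [add_sub_add_right_eq_sub, hJ, ← mul_assoc]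
        gcongr
    _ = ENNReal.ofReal (avgConst β₀ ^ 2) * ∫⁻ a in Icc (0 : ℝ) t, ∫⁻ b in Icc (0 : ℝ) t, J a b := by
        rw [← lintegral_const_mul]
        · refine lintegral_congr fun a => ?_
          rw [lintegral_const_mul' _ _ ENNReal.ofReal_ne_top]
        · exact Measurable.lintegral_prod_right' (ν := volume.restrict (Icc (0:ℝ) t)) hJm
    _ ≤ ENNReal.ofReal (avgConst β₀ ^ 2) *
        (2 * ∫⁻ b in Icc (0 : ℝ) t, ∫⁻ a in Ioc 0 b, J a b) := by
        gcongr
        exact lintegral_symm_le hJm hJs t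
    _ = ENNReal.ofReal (2 * avgConst β₀ ^ 2) * ∫⁻ b in Icc (0 : ℝ) t, ∫⁻ a in Ioc 0 b, J a b := by
        rw [ENNReal.ofReal_mul zero_le_two, ENNReal.ofReal_ofNat]; ring
    _ = _ := by
        congr 1
        refine setLIntegral_congr_fun measurableSet_Icc fun b hb => ?_
        have h1 := intervalIntegrable_weight_mul hβ₁ b b (B := B)
          (f := fun u => smoothCov p γhat ε ε (X u.toNNReal ω - X b.toNNReal ω + 0))
          (hG.comp ((hpath'.sub_const _).add_const _)) fun u => hB _
        rw [intervalIntegrable_iff_integrableOn_Ioc_of_le hb.1] at h1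
        simp only [occupation]
        rw [intervalIntegral.integral_of_le hb.1, ofReal_integral_eq_lintegral_ofReal h1]
        · refine setLIntegral_congr_fun measurableSet_Ioc fun a ha => ?_
          have : 0 ≤ b - a := by linarith [ha.2]
          simp only [hJ, add_zero]
          rw [abs_of_nonneg this, ENNReal.ofReal_mul (Real.rpow_nonneg this _)]
        · filter_upwards [ae_restrict_mem measurableSet_Ioc] with a ha
          exact mul_nonneg (Real.rpow_nonneg (by linarith [ha.2]) _)
            (smoothCov_nonneg hd hγ hp hε hε _)

lemma IsRegularProcess.measurable_occupation (hX : IsRegularProcess X Ψ P') {G : E d → ℝ}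
    (hG : Measurable G) (b : E d) :
    Measurable fun q : ℝ × Ω' => occupation X β₀ G q.1 q.1 b q.2 := by
  -- The oriented integral from `0` to `q.1` is the difference of the integrals over `Ioc 0 q.1` and
  -- `Ioc q.1 0`, treated together.
  have hm : ∀ A : ℝ → Set ℝ, MeasurableSet {z : ℝ × ℝ | z.2 ∈ A z.1} →
      Measurable fun q : ℝ × Ω' => ∫ u, (A q.1).indicator (fun u => (q.1 - u) ^ (-β₀) *
        G (X u.toNNReal q.2 - X q.1.toNNReal q.2 + b)) u := by
    intro A hA
    refine StronglyMeasurable.measurable ?_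
    refine StronglyMeasurable.integral_prod_right' (ν := volume)
      (f := fun z : (ℝ × Ω') × ℝ => (A z.1.1).indicator
        (fun u => (z.1.1 - u) ^ (-β₀) * G (X u.toNNReal z.1.2 - X z.1.1.toNNReal z.1.2 + b)) z.2)
      (Measurable.stronglyMeasurable ?_)
    have h1 : Measurable fun z : (ℝ × Ω') × ℝ => X z.2.toNNReal z.1.2 :=
      hX.measurable.comp (f := fun z : (ℝ × Ω') × ℝ => (z.2.toNNReal, z.1.2)) (by fun_prop)
    have h2 : Measurable fun z : (ℝ × Ω') × ℝ => X z.1.1.toNNReal z.1.2 :=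
      hX.measurable.comp (f := fun z : (ℝ × Ω') × ℝ => (z.1.1.toNNReal, z.1.2)) (by fun_prop)
    have h3 : Measurable fun z : (ℝ × Ω') × ℝ => (z.1.1 - z.2) ^ (-β₀) *
        G (X z.2.toNNReal z.1.2 - X z.1.1.toNNReal z.1.2 + b) :=
      Measurable.mul (by fun_prop) (hG.comp ((h1.sub h2).add_const _))
    have hset : MeasurableSet {z : (ℝ × Ω') × ℝ | z.2 ∈ A z.1.1} :=
      (by fun_prop : Measurable fun z : (ℝ × Ω') × ℝ => (z.1.1, z.2)) hA
    exact h3.indicator hset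
  have h1 := hm (fun q => Ioc 0 q) ((measurableSet_lt measurable_const measurable_snd).inter
    (measurableSet_le measurable_snd measurable_fst))
  have h2 := hm (fun q => Ioc q 0) ((measurableSet_lt measurable_fst measurable_snd).inter
    (measurableSet_le measurable_snd measurable_const))
  simp_rw [integral_indicator measurableSet_Ioc] at h1 h2
  exact h1.sub h2

/-- Exponential moments of the energy of the approximations, uniformly in the approximation. -/
theorem IsRegularProcess.exists_lintegral_exp_energy_le (hX : IsRegularProcess X Ψ P') (hd : 0 < d)
    (hβ₀ : 0 < β₀) (hβ₁ : β₀ < 1) (hγ : IsCovarianceKernel γ γhat) (hp : IsMollifier p)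
    (hΨm : Measurable Ψ) (hD : DalangCondition β₀ Ψ (spectralMeasure γhat))
    {lam T : ℝ} (hlam : 0 ≤ lam) (hT : 0 ≤ T) :
    ∃ C : ℝ≥0, ∀ ε δ : ℝ, 0 < ε → 0 < δ → ∀ t : ℝ≥0, t ≤ T → ∀ x : E d,
      ∫⁻ ω, ENNReal.ofReal (Real.exp (lam * (energy β₀ γ (Phi p ε δ t x fun s => X s ω)
        (Phi p ε δ t x fun s => X s ω)).toReal)) ∂P' ≤ C := by
  set c : ℝ := lam * (2 * avgConst β₀ ^ 2) with hc
  have hc0 : 0 ≤ c := by positivity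
  -- Since `t ≤ T`, `lam` times the energy is at most the average over `b ∈ [0, t]` of `T * c` times
  -- the occupation functional ending at `b`. Khasminskii's lemma is therefore applied to `T * c *
  -- G`.
  set K : ℝ → ℝ≥0∞ := fun v => ENNReal.ofReal (T * c) * (ENNReal.ofReal (((2 * Real.pi) ^ d)⁻¹) *
    laplaceMass Ψ (spectralMeasure γhat) v) with hK
  have hkm := measurable_laplaceMass (μ := spectralMeasure γhat) hΨm
  have hKm : Measurable K := by fun_prop
  obtain ⟨θ, hθ0, hθ⟩ := exists_exponential_weight (T := T)
    (f := fun v => ENNReal.ofReal (v ^ (-β₀)) * K v) (by fun_prop) (by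
      have h1 : ∀ v, ENNReal.ofReal (v ^ (-β₀)) * K v = (ENNReal.ofReal (T * c) *
          ENNReal.ofReal (((2 * Real.pi) ^ d)⁻¹)) * (ENNReal.ofReal (v ^ (-β₀)) *
          laplaceMass Ψ (spectralMeasure γhat) v) := fun v => by simp only [hK]; ring
      simp_rw [h1]
      rw [lintegral_const_mul _ (by fun_prop)]
      have := hD T
      finiteness)
  refine ⟨(2 * Real.exp (θ * T)).toNNReal, fun ε δ hε hδ t ht x => ?_⟩
  have hCeq : (((2 * Real.exp (θ * T)).toNNReal : ℝ≥0) : ℝ≥0∞) =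
      2 * ENNReal.ofReal (Real.exp (θ * T)) := by
    rw [← ENNReal.ofReal_ofNat 2, ← ENNReal.ofReal_mul zero_le_two]; rfl
  rw [hCeq]
  have hGc := continuous_smoothCov hγ hp hε ε
  obtain ⟨B, hB⟩ := smoothCov_bounded hγ hp hε ε
  set G := smoothCov p γhat ε ε with hG
  have hG0 : ∀ w, 0 ≤ G w := smoothCov_nonneg hd hγ hp hε hε
  have hGB : ∀ w, G w ≤ B := fun w => (le_abs_self _).trans (hB w)
  have hB0 : 0 ≤ B := (hG0 0).trans (hGB 0)
  have hkh : ∀ τ : ℝ, 0 ≤ τ → τ ≤ T → ∫⁻ ω, ENNReal.ofReal (Real.exp (T * c *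
      occupation X β₀ G τ τ 0 ω)) ∂P' ≤ 2 * ENNReal.ofReal (Real.exp (θ * T)) := by
    intro τ hτ hτT
    have h1 := hX.lintegral_exp_occupation_le hβ₀ hβ₁ (G := fun w => T * c * G w) (by fun_prop)
      (fun w => mul_nonneg (by positivity) (hG0 w)) (B := T * c * B) (fun w => by
        have := hGB w; gcongr) hKm (fun r s z => by
        simp_rw [ENNReal.ofReal_mul (by positivity : 0 ≤ T * c)]
        rw [lintegral_const_mul' _ _ ENNReal.ofReal_ne_top,
          hX.lintegral_smoothCov hd hγ hp hε hε r s z]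
        exact mul_le_mul_right (ofReal_mollCov_le hp ε ε _ z) _) hθ0 hθ hτ hτT 0
    refine le_trans (le_of_eq ?_) h1
    refine lintegral_congr fun ω => ?_
    congr 2
    simp only [occupation]
    rw [← intervalIntegral.integral_const_mul]
    refine intervalIntegral.integral_congr fun u _ => ?_
    ring
  -- At `t = 0` there is no uniform probability measure on `[0, t]` for Jensen's inequality, but the
  -- energy vanishes.
  rcases eq_or_lt_of_le t.2 with ht0 | ht0
  · have hz : ∀ ω, (energy β₀ γ (Phi p ε δ t x fun s => X s ω)
        (Phi p ε δ t x fun s => X s ω)).toReal = 0 := by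
      intro ω
      have h1 := hX.energy_Phi_le hd hβ₀ hβ₁ hγ hp hε hδ t x ω
      have h2 : (t : ℝ) = 0 := ht0.symm
      rw [h2, Icc_self, Measure.restrict_singleton] at h1
      simp only [Real.volume_singleton, zero_smul, lintegral_zero_measure, mul_zero,
        nonpos_iff_eq_zero] at h1
      rw [h1]; rfl
    simp only [hz, mul_zero, Real.exp_zero, ENNReal.ofReal_one, lintegral_const, measure_univ,
      mul_one]
    calc (1 : ℝ≥0∞) ≤ 2 * 1 := by norm_num
      _ ≤ _ := by
        gcongr
        rw [← ENNReal.ofReal_one]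
        exact ENNReal.ofReal_le_ofReal (Real.one_le_exp (by positivity))
  have ht0' : (0 : ℝ) < t := ht0
  set ν : Measure ℝ := (ENNReal.ofReal t)⁻¹ • volume.restrict (Icc (0 : ℝ) t) with hν
  have : IsProbabilityMeasure ν := ⟨by
    rw [hν, Measure.smul_apply, Measure.restrict_apply_univ, Real.volume_Icc, sub_zero, smul_eq_mul]
    exact ENNReal.inv_mul_cancel (ENNReal.ofReal_pos.2 ht0').ne' ENNReal.ofReal_ne_top⟩
  have hνle : ∀ᵐ b ∂ν, b ∈ Icc (0 : ℝ) t :=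
    Measure.ae_smul_measure (ae_restrict_mem measurableSet_Icc) _
  have hom := hX.measurable_occupation (β₀ := β₀) hGc.measurable 0
  set W : ℝ := B * (T ^ (1 - β₀) / (1 - β₀)) with hW
  have hobd : ∀ b ∈ Icc (0 : ℝ) t, ∀ ω, 0 ≤ occupation X β₀ G b b 0 ω ∧
      occupation X β₀ G b b 0 ω ≤ W := by
    intro b hb ω
    have hXω : Measurable fun u : ℝ => X u.toNNReal ω :=
      (hX.measurable_path ω).comp measurable_real_toNNReal
    refine ⟨intervalIntegral.integral_nonneg hb.1 fun u hu =>
      mul_nonneg (Real.rpow_nonneg (by linarith [hu.2]) _) (hG0 _), ?_⟩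
    have h1β : 0 < 1 - β₀ := by linarith
    calc occupation X β₀ G b b 0 ω ≤ ∫ u in 0..b, B * (b - u) ^ (-β₀) := by
          refine intervalIntegral.integral_mono_on hb.1 ?_
            ((intervalIntegrable_weight hβ₁ b b).const_mul B) fun u hu => ?_
          · exact intervalIntegrable_weight_mul hβ₁ b b (B := B)
              (f := fun u => G (X u.toNNReal ω - X b.toNNReal ω + 0))
              (hGc.measurable.comp ((hXω.sub_const _).add_const _)) fun u => hB _
          · rw [mul_comm]
            exact mul_le_mul_of_nonneg_right (hGB _) (Real.rpow_nonneg (by linarith [hu.2]) _)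
      _ = B * (b ^ (1 - β₀) / (1 - β₀)) := by
          rw [intervalIntegral.integral_const_mul,
            intervalIntegral.integral_comp_sub_left (fun u => u ^ (-β₀)) b, sub_self, sub_zero,
            integral_rpow (Or.inl (by linarith)), neg_add_eq_sub,
            Real.zero_rpow (by linarith), sub_zero]
      _ ≤ W := by
          rw [hW]
          have hbT : b ≤ T := hb.2.trans ht
          have hb0 := hb.1
          gcongr
  have hpt : ∀ ω, ENNReal.ofReal (Real.exp (lam * (energy β₀ γ (Phi p ε δ t x fun s => X s ω)
      (Phi p ε δ t x fun s => X s ω)).toReal)) ≤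
      ∫⁻ b, ENNReal.ofReal (Real.exp (T * c * occupation X β₀ G b b 0 ω)) ∂ν := by
    intro ω
    have hom' : Measurable fun b => occupation X β₀ G b b 0 ω := hom.comp measurable_prodMk_right
    have hInt : IntegrableOn (fun b => occupation X β₀ G b b 0 ω) (Icc (0:ℝ) t) := by
      refine Measure.integrableOn_of_bounded (M := W) (by simp) hom'.aestronglyMeasurable ?_
      filter_upwards [ae_restrict_mem measurableSet_Icc] with b hb
      rw [Real.norm_of_nonneg (hobd b hb ω).1]
      exact (hobd b hb ω).2
    have hnn : 0 ≤ᵐ[volume.restrict (Icc (0:ℝ) t)] fun b => occupation X β₀ G b b 0 ω := by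
      filter_upwards [ae_restrict_mem measurableSet_Icc] with b hb using (hobd b hb ω).1
    have hInt' : Integrable (fun b => occupation X β₀ G b b 0 ω) ν :=
      hInt.smul_measure (ENNReal.inv_ne_top.2 (ENNReal.ofReal_pos.2 ht0').ne')
    have h1 := hX.energy_Phi_le hd hβ₀ hβ₁ hγ hp hε hδ t x ω
    rw [← ofReal_integral_eq_lintegral_ofReal hInt hnn, ← ENNReal.ofReal_mul (by positivity)] at h1
    have h2 : (energy β₀ γ (Phi p ε δ t x fun s => X s ω) (Phi p ε δ t x fun s => X s ω)).toReal ≤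
        2 * avgConst β₀ ^ 2 * ∫ b in Icc (0:ℝ) t, occupation X β₀ G b b 0 ω :=
      ENNReal.toReal_le_of_le_ofReal (mul_nonneg (by positivity) (integral_nonneg_of_ae hnn)) h1
    refine le_trans (ENNReal.ofReal_le_ofReal (Real.exp_le_exp.2 ?_))
      (ofReal_exp_integral_le (hInt'.const_mul (T * c)))
    rw [integral_const_mul, hν, integral_smul_measure, ENNReal.toReal_inv,
      ENNReal.toReal_ofReal ht0'.le, smul_eq_mul]
    have hI0 : 0 ≤ ∫ b in Icc (0:ℝ) t, occupation X β₀ G b b 0 ω := integral_nonneg_of_ae hnn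
    have hTt : 1 ≤ T * (t : ℝ)⁻¹ := by
      rw [← div_eq_mul_inv, one_le_div ht0']; exact ht
    calc _ ≤ lam * (2 * avgConst β₀ ^ 2 * ∫ b in Icc (0:ℝ) t, occupation X β₀ G b b 0 ω) := by
          gcongr
      _ = 1 * (c * ∫ b in Icc (0:ℝ) t, occupation X β₀ G b b 0 ω) := by rw [hc]; ring
      _ ≤ (T * (t : ℝ)⁻¹) * (c * ∫ b in Icc (0:ℝ) t, occupation X β₀ G b b 0 ω) := by gcongr
      _ = _ := by ring
  calc _ ≤ ∫⁻ ω, ∫⁻ b, ENNReal.ofReal (Real.exp (T * c * occupation X β₀ G b b 0 ω)) ∂ν ∂P' :=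
        lintegral_mono hpt
    _ = ∫⁻ b, ∫⁻ ω, ENNReal.ofReal (Real.exp (T * c * occupation X β₀ G b b 0 ω)) ∂P' ∂ν := by
        rw [lintegral_lintegral_swap]
        have := hom.comp measurable_swap
        refine Measurable.aemeasurable ?_
        exact ((this.const_mul (T * c)).exp).ennreal_ofReal
    _ ≤ ∫⁻ _b, 2 * ENNReal.ofReal (Real.exp (θ * T)) ∂ν := by
        refine lintegral_mono_ae ?_
        filter_upwards [hνle] with b hb using hkh b hb.1 (hb.2.trans ht)
    _ = _ := by simp

end ExponentialMoments


/-! ### Convergence of the expected energies. -/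

section CovarianceLimit

variable {d : ℕ} {p : E d → ℝ} {γ : E d → ℝ≥0∞} {γhat Ψ : E d → ℝ} {β₀ : ℝ}

lemma isFiniteMeasureOnCompacts_spectralMeasure (hγ : IsCovarianceKernel γ γhat) :
    IsFiniteMeasureOnCompacts (spectralMeasure γhat) := by
  refine ⟨fun K hK => ?_⟩
  rw [spectralMeasure, withDensity_apply _ hK.isClosed.measurableSet]
  refine lt_of_le_of_lt (lintegral_mono fun ξ => Real.ofReal_le_enorm (γhat ξ)) ?_
  exact (hγ.hat_locallyIntegrable.integrableOn_isCompact hK).2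

/-- The time weight and the Laplace mass are singular at different places. Comparing `w` with `v`
moves one of the two factors to the argument of the other, and leaves functions of a single variable
covered by the integrability condition. -/
lemma rpow_mul_antitone_le {k : ℝ → ℝ≥0∞} (hk : Antitone k) (hβ₀ : 0 < β₀) {v w : ℝ} (hv : 0 < v) :
    ENNReal.ofReal (w ^ (-β₀)) * k v ≤
      ENNReal.ofReal (w ^ (-β₀)) * k w + ENNReal.ofReal (v ^ (-β₀)) * k v := by
  rcases le_total w v with h | h
  · exact le_trans (by gcongr; exact hk h) le_self_add
  · refine le_trans ?_ le_add_self
    gcongr ENNReal.ofReal ?_ * _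
    exact Real.rpow_le_rpow_of_nonpos hv h (by linarith)

lemma lintegral_shift_le {k : ℝ → ℝ≥0∞} {N h : ℝ} (hh : |h| ≤ N) :
    ∫⁻ v in Icc (-N) N, k |h - v| ≤ 2 * ∫⁻ v in Ioc 0 (2 * N), k v := by
  refine le_trans ?_ (lintegral_Icc_abs_le (2 * N))
  have h1 := (Measure.measurePreserving_sub_left (volume : Measure ℝ) h).setLIntegral_comp_preimage_emb
    (Homeomorph.subLeft h).measurableEmbedding (fun v => k |v|) (Icc (-(2 * N)) (2 * N))
  rw [← h1]
  refine lintegral_mono_set fun v hv => ?_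
  have := abs_le.1 hh
  simp only [mem_preimage, mem_Icc]
  constructor <;> linarith [hv.1, hv.2]

/-- The majorant of the mollified covariances is integrable. -/
lemma lintegral_majorant_lt_top {k : ℝ → ℝ≥0∞} (hkm : Measurable k) (hk : Antitone k)
    (hβ₀ : 0 < β₀) (hD : ∀ T : ℝ, ∫⁻ v in Ioc 0 T, ENNReal.ofReal (v ^ (-β₀)) * k v < ∞) {t s : ℝ}
    (ht : 0 ≤ t) (hs : 0 ≤ s) :
    ∫⁻ a in Icc 0 t, ∫⁻ b in Icc 0 s, ENNReal.ofReal (|t - a - (s - b)| ^ (-β₀)) * k |a - b| < ∞ := by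
  set N := max t s with hN
  have hN0 : 0 ≤ N := ht.trans (le_max_left _ _)
  set w : ℝ → ℝ≥0∞ := fun v => ENNReal.ofReal (v ^ (-β₀)) * k v with hw
  set g : ℝ → ℝ≥0∞ := fun v => w |t - s - v| + w |v| with hg
  have hwm : Measurable w := by fun_prop
  have hgm : Measurable g := by fun_prop
  calc _ ≤ ∫⁻ a in Icc 0 t, ∫⁻ b in Icc 0 s, g (a - b) := by
        refine lintegral_mono fun a => lintegral_mono_ae (ae_restrict_of_ae ?_)
        have e1 : ∀ᵐ b : ℝ, b ≠ a := by rw [ae_iff]; simp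
        have e2 : ∀ᵐ b : ℝ, b ≠ s - t + a := by rw [ae_iff]; simp
        filter_upwards [e1, e2] with b h1 h2
        have h3 : 0 < |a - b| := abs_pos.2 (sub_ne_zero.2 (Ne.symm h1))
        have h4 : 0 < |t - s - (a - b)| := abs_pos.2 (fun h => h2 (by linarith))
        rw [show t - a - (s - b) = t - s - (a - b) by ring]
        exact rpow_mul_antitone_le hk hβ₀ h3
    _ ≤ ∫⁻ a in Icc 0 N, ∫⁻ b in Icc 0 N, g (a - b) := by
        refine (lintegral_mono fun a => lintegral_mono_set (Icc_subset_Icc_right (le_max_right t s))).trans ?_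
        exact lintegral_mono_set (Icc_subset_Icc_right (le_max_left t s))
    _ ≤ ENNReal.ofReal N * ∫⁻ v in Icc (-N) N, g v := lintegral_lintegral_sub_le
    _ ≤ ENNReal.ofReal N * (2 * (∫⁻ v in Ioc 0 (2 * N), w v) + 2 * ∫⁻ v in Ioc 0 N, w v) := by
        rw [hg, lintegral_add_left (by fun_prop)]
        gcongr
        · refine lintegral_shift_le (abs_le.2 ⟨?_, ?_⟩)
          · linarith [le_max_right t s]
          · linarith [le_max_left t s]
        · exact lintegral_Icc_abs_le N
    _ < ∞ := by
        have h1 := hD (2 * N)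
        have h2 := hD N
        simp only [hw]
        finiteness

lemma lintegral_timeKernel_lt_top (hβ₀ : 0 < β₀) (hβ₁ : β₀ < 1) {δ δ' : ℝ} (hδ : 0 < δ)
    (hδ' : 0 < δ') {t s : ℝ} (ht : 0 ≤ t) (hs : 0 ≤ s) :
    ∫⁻ a in Icc 0 t, ∫⁻ b in Icc 0 s, timeKernel β₀ δ δ' t s a b < ∞ := by
  have h := lintegral_majorant_lt_top (β₀ := β₀) (k := fun _ => ENNReal.ofReal (avgConst β₀ ^ 2))
    measurable_const antitone_const hβ₀ (fun T => by
      rw [lintegral_mul_const _ (by fun_prop)]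
      have := lintegral_rpow_lt_top hβ₁ T
      finiteness) ht hs
  refine lt_of_le_of_lt ?_ h
  refine lintegral_mono fun a => lintegral_mono_ae (ae_restrict_of_ae ?_)
  have e2 : ∀ᵐ b : ℝ, b ≠ s - t + a := by rw [ae_iff]; simp
  filter_upwards [e2] with b h2
  rw [mul_comm]
  exact timeKernel_le hβ₀ hβ₁ hδ hδ' fun h => h2 (by linarith)

/-- The limit of the expected energies of the approximations. -/
noncomputable def limitEnergy (β₀ : ℝ) (γhat Ψ : E d → ℝ) (t s : ℝ) (z : E d) : ℝ≥0∞ :=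
  ∫⁻ a in Icc 0 t, ∫⁻ b in Icc 0 s, ENNReal.ofReal (|t - a - (s - b)| ^ (-β₀)) *
    ENNReal.ofReal (limitCov γhat Ψ |a - b| z)

lemma limitEnergy_lt_top (hβ₀ : 0 < β₀) (hΨm : Measurable Ψ) (hΨ : ∀ ξ, 0 ≤ Ψ ξ)
    (hD : DalangCondition β₀ Ψ (spectralMeasure γhat)) {t s : ℝ} (ht : 0 ≤ t) (hs : 0 ≤ s)
    (z : E d) : limitEnergy β₀ γhat Ψ t s z < ∞ := by
  have h := lintegral_majorant_lt_top (measurable_laplaceMass (μ := spectralMeasure γhat) hΨm)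
    (antitone_laplaceMass hΨ) hβ₀ hD ht hs
  calc _ ≤ ∫⁻ a in Icc 0 t, ∫⁻ b in Icc 0 s, ENNReal.ofReal (((2 * Real.pi) ^ d)⁻¹) *
        (ENNReal.ofReal (|t - a - (s - b)| ^ (-β₀)) *
          laplaceMass Ψ (spectralMeasure γhat) |a - b|) := by
        refine lintegral_mono fun a => lintegral_mono fun b => ?_
        rw [mul_left_comm]
        exact mul_le_mul_right (ofReal_limitCov_le _ z) _
    _ = ENNReal.ofReal (((2 * Real.pi) ^ d)⁻¹) * ∫⁻ a in Icc 0 t, ∫⁻ b in Icc 0 s,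
        (ENNReal.ofReal (|t - a - (s - b)| ^ (-β₀)) *
          laplaceMass Ψ (spectralMeasure γhat) |a - b|) := by
        simp_rw [lintegral_const_mul' _ _ ENNReal.ofReal_ne_top]
    _ < ∞ := by finiteness

lemma energy_Phi_eq_smoothCov (hd : 0 < d) (hγ : IsCovarianceKernel γ γhat) (hp : IsMollifier p)
    {ε δ ε' δ' : ℝ} (hε : 0 < ε) (hδ : 0 < δ) (hε' : 0 < ε') (hδ' : 0 < δ') (t s : ℝ≥0) (x y : E d)
    {f g : ℝ≥0 → E d} (hf : Measurable f) (hg : Measurable g) :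
    energy β₀ γ (Phi p ε δ t x f) (Phi p ε' δ' s y g) =
      ∫⁻ q, timeKernel β₀ δ δ' t s q.1 q.2 * ENNReal.ofReal (smoothCov p γhat ε ε'
        (f q.1.toNNReal - g q.2.toNNReal + (x - y)))
        ∂((volume.restrict (Icc (0 : ℝ) t)).prod (volume.restrict (Icc (0 : ℝ) s))) := by
  have hG := (continuous_smoothCov hγ hp hε ε').measurable
  rw [energy_Phi hp hγ.continuous.measurable hε hδ hε' hδ' hf hg, lintegral_prod]
  · refine lintegral_congr fun a => lintegral_congr fun b => ?_
    rw [(spaceKernel_eq hd hγ hp hε hε' _ _).2]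
    congr 3
    abel
  · refine ((measurable_timeKernel β₀ δ δ' t s).mul (hG.comp ?_).ennreal_ofReal).aemeasurable
    fun_prop

variable {Ω' : Type*} {mΩ : MeasurableSpace Ω'} {X : ℝ≥0 → Ω' → E d} {P' : Measure Ω'}
  [IsProbabilityMeasure P']

lemma IsRegularProcess.energy_Phi_eq (hX : IsRegularProcess X Ψ P') (hd : 0 < d)
    (hγ : IsCovarianceKernel γ γhat) (hp : IsMollifier p) {ε δ ε' δ' : ℝ} (hε : 0 < ε)
    (hδ : 0 < δ) (hε' : 0 < ε') (hδ' : 0 < δ') (t s : ℝ≥0) (x y : E d) (ω : Ω') :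
    energy β₀ γ (Phi p ε δ t x fun s => X s ω) (Phi p ε' δ' s y fun s => X s ω) =
      ∫⁻ q, timeKernel β₀ δ δ' t s q.1 q.2 * ENNReal.ofReal (smoothCov p γhat ε ε'
        (X q.1.toNNReal ω - X q.2.toNNReal ω + (x - y)))
        ∂((volume.restrict (Icc (0 : ℝ) t)).prod (volume.restrict (Icc (0 : ℝ) s))) :=
  energy_Phi_eq_smoothCov hd hγ hp hε hδ hε' hδ' t s x y (hX.measurable_path ω)
    (hX.measurable_path ω)

lemma IsRegularProcess.measurable_energy_integrand (hX : IsRegularProcess X Ψ P')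
    (hγ : IsCovarianceKernel γ γhat) (hp : IsMollifier p) {ε ε' : ℝ} (δ δ' : ℝ) (hε : 0 < ε)
    (t s : ℝ≥0) (z : E d) :
    Measurable fun q : Ω' × (ℝ × ℝ) => timeKernel β₀ δ δ' t s q.2.1 q.2.2 *
      ENNReal.ofReal (smoothCov p γhat ε ε'
        (X q.2.1.toNNReal q.1 - X q.2.2.toNNReal q.1 + z)) := by
  have hG := (continuous_smoothCov hγ hp hε ε').measurable
  have h1 : Measurable fun q : Ω' × (ℝ × ℝ) => X q.2.1.toNNReal q.1 :=
    hX.measurable.comp (f := fun q : Ω' × (ℝ × ℝ) => (q.2.1.toNNReal, q.1)) (by fun_prop)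
  have h2 : Measurable fun q : Ω' × (ℝ × ℝ) => X q.2.2.toNNReal q.1 :=
    hX.measurable.comp (f := fun q : Ω' × (ℝ × ℝ) => (q.2.2.toNNReal, q.1)) (by fun_prop)
  exact ((measurable_timeKernel β₀ δ δ' t s).comp measurable_snd).mul
    (hG.comp ((h1.sub h2).add_const _)).ennreal_ofReal

lemma IsRegularProcess.measurable_energy (hX : IsRegularProcess X Ψ P') (hd : 0 < d)
    (hγ : IsCovarianceKernel γ γhat) (hp : IsMollifier p) {ε δ ε' δ' : ℝ} (hε : 0 < ε)
    (hδ : 0 < δ) (hε' : 0 < ε') (hδ' : 0 < δ') (t s : ℝ≥0) (x y : E d) :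
    Measurable fun ω =>
      energy β₀ γ (Phi p ε δ t x fun s => X s ω) (Phi p ε' δ' s y fun s => X s ω) := by
  simp_rw [hX.energy_Phi_eq hd hγ hp hε hδ hε' hδ' t s x y]
  exact Measurable.lintegral_prod_right' (hX.measurable_energy_integrand hγ hp δ δ' hε t s (x - y))

lemma IsRegularProcess.lintegral_energy (hX : IsRegularProcess X Ψ P') (hd : 0 < d)
    (hγ : IsCovarianceKernel γ γhat) (hp : IsMollifier p) {ε δ ε' δ' : ℝ} (hε : 0 < ε)
    (hδ : 0 < δ) (hε' : 0 < ε') (hδ' : 0 < δ') (t s : ℝ≥0) (x y : E d) :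
    ∫⁻ ω, energy β₀ γ (Phi p ε δ t x fun s => X s ω) (Phi p ε' δ' s y fun s => X s ω) ∂P' =
      ∫⁻ q, timeKernel β₀ δ δ' t s q.1 q.2 * ENNReal.ofReal (mollCov p γhat Ψ ε ε'
        |q.1 - q.2| (x - y))
        ∂((volume.restrict (Icc (0 : ℝ) t)).prod (volume.restrict (Icc (0 : ℝ) s))) := by
  simp_rw [hX.energy_Phi_eq hd hγ hp hε hδ hε' hδ' t s x y]
  rw [lintegral_lintegral_swap
    (hX.measurable_energy_integrand hγ hp δ δ' hε t s (x - y)).aemeasurable]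
  have hmem : ∀ᵐ q ∂((volume.restrict (Icc (0 : ℝ) t)).prod (volume.restrict (Icc (0 : ℝ) s))),
      q ∈ Icc (0 : ℝ) t ×ˢ Icc (0 : ℝ) s := by
    rw [Measure.prod_restrict]
    exact ae_restrict_mem (measurableSet_Icc.prod measurableSet_Icc)
  refine lintegral_congr_ae ?_
  filter_upwards [hmem] with q hq
  have hG := (continuous_smoothCov hγ hp hε ε').measurable
  have hm : Measurable fun ω => ENNReal.ofReal (smoothCov p γhat ε ε'
      (X q.1.toNNReal ω - X q.2.toNNReal ω + (x - y))) :=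
    (hG.comp (((hX.measurable_eval _).sub (hX.measurable_eval _)).add_const _)).ennreal_ofReal
  rw [lintegral_const_mul _ hm,
    hX.lintegral_smoothCov hd hγ hp hε hε', Real.coe_toNNReal _ hq.1.1, Real.coe_toNNReal _ hq.2.1]

lemma tendsto_energy_integrand (hβ₀ : 0 < β₀) (hp : IsMollifier p) (hΨm : Measurable Ψ)
    {t s a b v : ℝ} (ha : 0 ≤ a) (hb : 0 ≤ b) (hat : a < t) (hbs : b < s) (h : t - a ≠ s - b)
    (hv : laplaceMass Ψ (spectralMeasure γhat) v < ∞) (z : E d) :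
    Tendsto (fun q : (ℝ × ℝ) × (ℝ × ℝ) => timeKernel β₀ q.1.2 q.2.2 t s a b *
        ENNReal.ofReal (mollCov p γhat Ψ q.1.1 q.2.1 v z))
      ((𝓝[>] 0 ×ˢ 𝓝[>] 0) ×ˢ (𝓝[>] 0 ×ˢ 𝓝[>] 0))
      (𝓝 (ENNReal.ofReal (|t - a - (s - b)| ^ (-β₀)) * ENNReal.ofReal (limitCov γhat Ψ v z))) := by
  have h1 := tendsto_timeKernel hβ₀ ha hb hat hbs h
  have h2 := tendsto_mollCov hp hΨm hv z
  have p1 : Tendsto (fun q : (ℝ × ℝ) × (ℝ × ℝ) => (q.1.2, q.2.2))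
      ((𝓝[>] 0 ×ˢ 𝓝[>] 0) ×ˢ (𝓝[>] 0 ×ˢ 𝓝[>] 0)) (𝓝[>] 0 ×ˢ 𝓝[>] 0) :=
    (tendsto_snd.comp tendsto_fst).prodMk (tendsto_snd.comp tendsto_snd)
  have p2 : Tendsto (fun q : (ℝ × ℝ) × (ℝ × ℝ) => (q.1.1, q.2.1))
      ((𝓝[>] 0 ×ˢ 𝓝[>] 0) ×ˢ (𝓝[>] 0 ×ˢ 𝓝[>] 0)) (𝓝[>] 0 ×ˢ 𝓝[>] 0) :=
    (tendsto_fst.comp tendsto_fst).prodMk (tendsto_fst.comp tendsto_snd)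
  have h3 := h1.comp p1
  have h4 := ENNReal.tendsto_ofReal (h2.comp p2)
  have h5 := ENNReal.Tendsto.mul h3 (Or.inr ENNReal.ofReal_ne_top) h4 (Or.inr ENNReal.ofReal_ne_top)
  exact h5

/-- Convergence of the expected energies of the approximations. -/
theorem IsRegularProcess.tendsto_lintegral_energy (hX : IsRegularProcess X Ψ P') (hd : 0 < d)
    (hβ₀ : 0 < β₀) (hβ₁ : β₀ < 1) (hγ : IsCovarianceKernel γ γhat) (hp : IsMollifier p)
    (hΨm : Measurable Ψ) (hΨ : ∀ ξ, 0 ≤ Ψ ξ) (hD : DalangCondition β₀ Ψ (spectralMeasure γhat))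
    (t s : ℝ≥0) (x y : E d) :
    Tendsto (fun q : (ℝ × ℝ) × (ℝ × ℝ) => ∫⁻ ω, energy β₀ γ (Phi p q.1.1 q.1.2 t x fun s => X s ω)
        (Phi p q.2.1 q.2.2 s y fun s => X s ω) ∂P')
      ((𝓝[>] 0 ×ˢ 𝓝[>] 0) ×ˢ (𝓝[>] 0 ×ˢ 𝓝[>] 0)) (𝓝 (limitEnergy β₀ γhat Ψ t s (x - y))) := by
  set ν := (volume.restrict (Icc (0 : ℝ) t)).prod (volume.restrict (Icc (0 : ℝ) s)) with hν
  set l : Filter ((ℝ × ℝ) × (ℝ × ℝ)) := (𝓝[>] 0 ×ˢ 𝓝[>] 0) ×ˢ (𝓝[>] 0 ×ˢ 𝓝[>] 0) with hl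
  set k := laplaceMass Ψ (spectralMeasure γhat) with hk
  have hkm : Measurable k := measurable_laplaceMass hΨm
  have hpos : ∀ᶠ q in l, (0 < q.1.1 ∧ 0 < q.1.2) ∧ (0 < q.2.1 ∧ 0 < q.2.2) := by
    have h0 : ∀ᶠ e : ℝ in 𝓝[>] 0, 0 < e := eventually_mem_nhdsWithin
    exact (h0.prod_mk h0).prod_mk (h0.prod_mk h0)
  have hlc : limitEnergy β₀ γhat Ψ t s (x - y) =
      ∫⁻ q, ENNReal.ofReal (|t - q.1 - (s - q.2)| ^ (-β₀)) *
        ENNReal.ofReal (limitCov γhat Ψ |q.1 - q.2| (x - y)) ∂ν := by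
    rw [hν, lintegral_prod]
    · rfl
    · have h1 := measurable_limitCov (γhat := γhat) hΨm (x - y)
      have h2 : Measurable fun q : ℝ × ℝ => limitCov γhat Ψ |q.1 - q.2| (x - y) :=
        h1.comp (by fun_prop : Measurable fun q : ℝ × ℝ => |q.1 - q.2|)
      exact (Measurable.mul (by fun_prop) h2.ennreal_ofReal).aemeasurable
  rw [hlc]
  -- The discarded null sets are the right endpoints, where no averaging window fits; the diagonal,
  -- where the Laplace mass at `0` may be infinite; and `t - q.1 = s - q.2`, where the time weight
  -- is singular.
  have hae : ∀ᵐ q ∂ν, q ∈ Ico (0 : ℝ) t ×ˢ Ico (0 : ℝ) s ∧ q.1 ≠ q.2 ∧ t - q.1 ≠ s - q.2 := by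
    have e0 : ∀ᵐ q ∂ν, q ∈ Ico (0 : ℝ) t ×ˢ Ico (0 : ℝ) s := by
      rw [hν, ← Measure.restrict_congr_set Ico_ae_eq_Icc, ← Measure.restrict_congr_set Ico_ae_eq_Icc,
        Measure.prod_restrict]
      exact ae_restrict_mem (measurableSet_Ico.prod measurableSet_Ico)
    have e1 : ∀ c : ℝ, ∀ᵐ q ∂ν, q.1 + c ≠ q.2 := by
      intro c
      refine (Measure.ae_prod_iff_ae_ae ?_).2 (Eventually.of_forall fun a => ?_)
      · exact (measurableSet_eq_fun (by fun_prop) (by fun_prop)).compl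
      · refine ae_restrict_of_ae ?_
        rw [ae_iff]; simp [eq_comm]
    filter_upwards [e0, e1 0, e1 (s - t)] with q h1 h2 h3
    exact ⟨h1, by simpa using h2, fun h => h3 (by linarith)⟩
  have hmain : Tendsto (fun q : (ℝ × ℝ) × (ℝ × ℝ) => ∫⁻ r, timeKernel β₀ q.1.2 q.2.2 t s r.1 r.2 *
      ENNReal.ofReal (mollCov p γhat Ψ q.1.1 q.2.1 |r.1 - r.2| (x - y)) ∂ν) l
      (𝓝 (∫⁻ q, ENNReal.ofReal (|t - q.1 - (s - q.2)| ^ (-β₀)) *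
        ENNReal.ofReal (limitCov γhat Ψ |q.1 - q.2| (x - y)) ∂ν)) := by
    refine tendsto_lintegral_filter_of_dominated_convergence
      (fun r => ENNReal.ofReal (avgConst β₀ ^ 2) * ENNReal.ofReal (((2 * Real.pi) ^ d)⁻¹) *
        (ENNReal.ofReal (|t - r.1 - (s - r.2)| ^ (-β₀)) * k |r.1 - r.2|)) ?_ ?_ ?_ ?_
    · refine Eventually.of_forall fun q => (measurable_timeKernel _ _ _ _ _).mul ?_
      have h1 := measurable_mollCov (γhat := γhat) hp hΨm q.1.1 q.2.1 (x - y)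
      exact (h1.comp (by fun_prop : Measurable fun q : ℝ × ℝ => |q.1 - q.2|)).ennreal_ofReal
    · filter_upwards [hpos] with q hq
      filter_upwards [hae] with r hr
      calc _ ≤ (ENNReal.ofReal (avgConst β₀ ^ 2) *
            ENNReal.ofReal (|t - r.1 - (s - r.2)| ^ (-β₀))) *
            (ENNReal.ofReal (((2 * Real.pi) ^ d)⁻¹) * k |r.1 - r.2|) :=
            mul_le_mul' (timeKernel_le hβ₀ hβ₁ hq.1.2 hq.2.2 hr.2.2)
              (ofReal_mollCov_le hp _ _ _ _)
        _ = _ := by ring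
    · rw [lintegral_const_mul' _ _ (by finiteness)]
      refine (ENNReal.mul_lt_top (by finiteness) ?_).ne
      rw [hν, lintegral_prod _ (by fun_prop)]
      exact lintegral_majorant_lt_top hkm (antitone_laplaceMass hΨ) hβ₀ hD t.2 s.2
    · filter_upwards [hae] with r hr
      have hv : 0 < |r.1 - r.2| := abs_pos.2 (sub_ne_zero.2 hr.2.1)
      exact tendsto_energy_integrand hβ₀ hp hΨm hr.1.1.1 hr.1.2.1 hr.1.1.2 hr.1.2.2 hr.2.2
        (hD.laplaceMass_lt_top hΨ hv) (x - y)
  refine hmain.congr' ?_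
  filter_upwards [hpos] with q hq
  exact (hX.lintegral_energy hd hγ hp hq.1.1 hq.1.2 hq.2.1 hq.2.2 t s x y).symm

end CovarianceLimit


/-! ### Finiteness and continuity of the energy as a function of the path. -/

section PathEnergy

variable {d : ℕ} {p : E d → ℝ} {γ : E d → ℝ≥0∞} {γhat : E d → ℝ} {β₀ : ℝ}

lemma lintegral_timeKernel_prod_lt_top (hβ₀ : 0 < β₀) (hβ₁ : β₀ < 1) {δ δ' : ℝ} (hδ : 0 < δ)
    (hδ' : 0 < δ') (t s : ℝ≥0) :
    ∫⁻ q, timeKernel β₀ δ δ' t s q.1 q.2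
      ∂((volume.restrict (Icc (0 : ℝ) t)).prod (volume.restrict (Icc (0 : ℝ) s))) < ∞ := by
  rw [lintegral_prod _ (measurable_timeKernel β₀ δ δ' t s).aemeasurable]
  exact lintegral_timeKernel_lt_top hβ₀ hβ₁ hδ hδ' t.2 s.2

/-- The energies of mollified occupation densities are bounded, uniformly in the paths. -/
lemma exists_energy_Phi_le (hd : 0 < d) (hβ₀ : 0 < β₀) (hβ₁ : β₀ < 1)
    (hγ : IsCovarianceKernel γ γhat) (hp : IsMollifier p)
    {ε δ ε' δ' : ℝ} (hε : 0 < ε) (hδ : 0 < δ) (hε' : 0 < ε') (hδ' : 0 < δ') (t s : ℝ≥0)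
    (x y : E d) : ∃ C : ℝ≥0, ∀ f g : ℝ≥0 → E d, Measurable f → Measurable g →
      energy β₀ γ (Phi p ε δ t x f) (Phi p ε' δ' s y g) ≤ C := by
  obtain ⟨B, hB⟩ := smoothCov_bounded hγ hp hε ε'
  have h1 := lintegral_timeKernel_prod_lt_top hβ₀ hβ₁ hδ hδ' t s
  refine ⟨((∫⁻ q, timeKernel β₀ δ δ' t s q.1 q.2
      ∂((volume.restrict (Icc (0 : ℝ) t)).prod (volume.restrict (Icc (0 : ℝ) s)))) *
      ENNReal.ofReal B).toNNReal, fun f g hf hg => ?_⟩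
  rw [ENNReal.coe_toNNReal (ENNReal.mul_ne_top h1.ne ENNReal.ofReal_ne_top),
    energy_Phi_eq_smoothCov hd hγ hp hε hδ hε' hδ' t s x y hf hg,
    ← lintegral_mul_const _ (measurable_timeKernel β₀ δ δ' t s)]
  refine lintegral_mono fun q => ?_
  gcongr
  exact (le_abs_self _).trans (hB _)

lemma energy_Phi_lt_top (hd : 0 < d) (hβ₀ : 0 < β₀) (hβ₁ : β₀ < 1)
    (hγ : IsCovarianceKernel γ γhat) (hp : IsMollifier p)
    {ε δ ε' δ' : ℝ} (hε : 0 < ε) (hδ : 0 < δ) (hε' : 0 < ε') (hδ' : 0 < δ') (t s : ℝ≥0)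
    (x y : E d) {f g : ℝ≥0 → E d} (hf : Measurable f) (hg : Measurable g) :
    energy β₀ γ (Phi p ε δ t x f) (Phi p ε' δ' s y g) < ∞ := by
  obtain ⟨C, hC⟩ := exists_energy_Phi_le hd hβ₀ hβ₁ hγ hp hε hδ hε' hδ' t s x y
  exact (hC f g hf hg).trans_lt ENNReal.coe_lt_top

lemma finiteEnergy_Phi (hd : 0 < d) (hβ₀ : 0 < β₀) (hβ₁ : β₀ < 1)
    (hγ : IsCovarianceKernel γ γhat) (hp : IsMollifier p) {ε δ : ℝ} (hε : 0 < ε) (hδ : 0 < δ)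
    (t : ℝ≥0) (x : E d) {f : ℝ≥0 → E d} (hf : Measurable f) :
    FiniteEnergy β₀ γ (Phi p ε δ t x f) :=
  finiteEnergy_of_energy_lt_top (measurable_Phi hp hf) (Phi_nonneg hp hε hδ)
    (energy_Phi_lt_top hd hβ₀ hβ₁ hγ hp hε hδ hε hδ t t x x hf hf)

/-- The path enters only through the bounded continuous function `smoothCov`, so pointwise
convergence of paths suffices, with an integrable multiple of `timeKernel` as majorant. -/
lemma tendsto_energy_Phi (hd : 0 < d) (hβ₀ : 0 < β₀) (hβ₁ : β₀ < 1)
    (hγ : IsCovarianceKernel γ γhat) (hp : IsMollifier p)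
    {ε δ ε' δ' : ℝ} (hε : 0 < ε) (hδ : 0 < δ) (hε' : 0 < ε') (hδ' : 0 < δ') (t s : ℝ≥0)
    (x y : E d) {ι : Type*} {l : Filter ι} [l.IsCountablyGenerated] {f g : ι → ℝ≥0 → E d}
    {f₀ g₀ : ℝ≥0 → E d} (hf : ∀ i, Measurable (f i)) (hg : ∀ i, Measurable (g i))
    (hf₀ : Measurable f₀) (hg₀ : Measurable g₀) (hlf : ∀ r, Tendsto (fun i => f i r) l (𝓝 (f₀ r)))
    (hlg : ∀ r, Tendsto (fun i => g i r) l (𝓝 (g₀ r))) :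
    Tendsto (fun i => energy β₀ γ (Phi p ε δ t x (f i)) (Phi p ε' δ' s y (g i))) l
      (𝓝 (energy β₀ γ (Phi p ε δ t x f₀) (Phi p ε' δ' s y g₀))) := by
  obtain ⟨B, hB⟩ := smoothCov_bounded hγ hp hε ε'
  have hGc := continuous_smoothCov hγ hp hε ε'
  have hG := hGc.measurable
  have hK := measurable_timeKernel β₀ δ δ' t s
  have h1 := lintegral_timeKernel_prod_lt_top hβ₀ hβ₁ hδ hδ' t s
  simp_rw [fun i => energy_Phi_eq_smoothCov (β₀ := β₀) hd hγ hp hε hδ hε' hδ' t s x y (hf i) (hg i)]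
  rw [energy_Phi_eq_smoothCov (β₀ := β₀) hd hγ hp hε hδ hε' hδ' t s x y hf₀ hg₀]
  refine tendsto_lintegral_filter_of_dominated_convergence
    (fun q => timeKernel β₀ δ δ' t s q.1 q.2 * ENNReal.ofReal B) ?_ ?_ ?_ ?_
  · refine Eventually.of_forall fun i => hK.mul (hG.comp ?_).ennreal_ofReal
    have := hf i
    have := hg i
    fun_prop
  · refine Eventually.of_forall fun i => Eventually.of_forall fun q => ?_
    gcongr
    exact (le_abs_self _).trans (hB _)
  · rw [lintegral_mul_const _ hK]
    exact ENNReal.mul_ne_top h1.ne ENNReal.ofReal_ne_top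
  · refine (ae_lt_top hK h1.ne).mono fun q hq => ?_
    have h2 : Tendsto (fun i => smoothCov p γhat ε ε' (f i q.1.toNNReal - g i q.2.toNNReal + (x - y)))
        l (𝓝 (smoothCov p γhat ε ε' (f₀ q.1.toNNReal - g₀ q.2.toNNReal + (x - y)))) :=
      (hGc.tendsto _).comp (((hlf _).sub (hlg _)).add_const _)
    exact ENNReal.Tendsto.const_mul (ENNReal.tendsto_ofReal h2) (Or.inr hq.ne)

end PathEnergy

/-! ### Moments of centered normal laws. -/

section Gaussian

/-- The moments of the standard normal law. -/
noncomputable def gaussianMoment (m : ℕ) : ℝ≥0∞ := ∫⁻ x, ‖x‖ₑ ^ (2 * m) ∂(gaussianReal 0 1)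

lemma gaussianMoment_lt_top (m : ℕ) : gaussianMoment m < ∞ := by
  have h := (memLp_id_gaussianReal (μ := 0) (v := 1) ((2 * m : ℕ) : ℝ≥0)).integrable_norm_pow'
  have h2 := h.2
  rw [hasFiniteIntegral_iff_enorm] at h2
  refine lt_of_le_of_lt (le_of_eq ?_) h2
  refine lintegral_congr fun x => ?_
  simp [enorm_pow]

lemma lintegral_enorm_pow_gaussianReal (v : ℝ≥0) (m : ℕ) :
    ∫⁻ x, ‖x‖ₑ ^ (2 * m) ∂(gaussianReal 0 v) = gaussianMoment m * (v : ℝ≥0∞) ^ m := by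
  have h := gaussianReal_map_const_mul (μ := 0) (v := 1) (NNReal.sqrt v : ℝ)
  have hv : (⟨(NNReal.sqrt v : ℝ) ^ 2, sq_nonneg _⟩ : ℝ≥0) * 1 = v := by
    ext; simp
  rw [mul_zero] at h
  have h' : gaussianReal 0 v = (gaussianReal 0 1).map fun x => (NNReal.sqrt v : ℝ) * x := by
    rw [h]; congr 1; exact hv.symm
  rw [h', lintegral_map (by fun_prop) (by fun_prop)]
  simp_rw [enorm_mul, mul_pow]
  rw [lintegral_const_mul _ (by fun_prop), mul_comm, gaussianMoment, pow_mul ‖(NNReal.sqrt v : ℝ)‖ₑ]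
  congr 2
  rw [← enorm_pow, ← NNReal.coe_pow, NNReal.sq_sqrt]
  simp

lemma lintegral_exp_gaussianReal (v : ℝ≥0) (q : ℝ) :
    ∫⁻ x, ENNReal.ofReal (Real.exp (q * x)) ∂(gaussianReal 0 v) =
      ENNReal.ofReal (Real.exp (q ^ 2 / 2 * v)) := by
  rw [← ofReal_integral_eq_lintegral_ofReal (integrable_exp_mul_gaussianReal q)
    (Eventually.of_forall fun _ => (Real.exp_pos _).le)]
  have h := congrFun (mgf_fun_id_gaussianReal (μ := 0) (v := v)) q
  rw [mgf] at h
  rw [h]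
  congr 2
  ring

end Gaussian

/-! ### Gaussian identities for the noise, and its joint measurability along random paths. -/

section Noise

variable {d : ℕ} {p : E d → ℝ} {γ : E d → ℝ≥0∞} {γhat : E d → ℝ} {β₀ : ℝ}
  {Ω : Type*} {mΩ : MeasurableSpace Ω} {P : Measure Ω}
  {W : {φ : ℝ × E d → ℝ // FiniteEnergy β₀ γ φ} → Ω → ℝ}

lemma IsGaussianNoise.memLp (hW : IsGaussianNoise β₀ γ W P) (φ) : MemLp (W φ) 2 P :=
  (hW.gaussian.hasGaussianLaw_eval φ).memLp_two

lemma IsGaussianNoise.integral_sub_sq (hW : IsGaussianNoise β₀ γ W P) (φ ψ) :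
    ∫ ω, (W φ ω - W ψ ω) ^ 2 ∂P =
      energyInner β₀ γ φ.1 φ.1 + energyInner β₀ γ ψ.1 ψ.1 - 2 * energyInner β₀ γ φ.1 ψ.1 := by
  have h1 := hW.memLp φ
  have h2 := hW.memLp ψ
  rw [← hW.covariance, ← hW.covariance, ← hW.covariance]
  have i1 : Integrable (fun ω => W φ ω * W φ ω) P := h1.integrable_mul h1
  have i2 : Integrable (fun ω => W ψ ω * W ψ ω) P := h2.integrable_mul h2
  have i3 : Integrable (fun ω => W φ ω * W ψ ω) P := h1.integrable_mul h2
  have i4 : Integrable (fun ω => W φ ω * W φ ω + W ψ ω * W ψ ω) P := i1.add i2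
  rw [← integral_const_mul, ← integral_add i1 i2, ← integral_sub i4 (i3.const_mul 2)]
  refine integral_congr_ae (Eventually.of_forall fun ω => ?_)
  simp only
  ring

lemma IsGaussianNoise.lintegral_sub_sq (hW : IsGaussianNoise β₀ γ W P) (φ ψ) :
    ∫⁻ ω, ‖W φ ω - W ψ ω‖ₑ ^ 2 ∂P = ENNReal.ofReal
      (energyInner β₀ γ φ.1 φ.1 + energyInner β₀ γ ψ.1 ψ.1 - 2 * energyInner β₀ γ φ.1 ψ.1) := by
  have h : Integrable (fun ω => (W φ ω - W ψ ω) ^ 2) P :=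
    ((hW.memLp φ).sub (hW.memLp ψ)).integrable_sq
  rw [← hW.integral_sub_sq, ofReal_integral_eq_lintegral_ofReal h
    (Eventually.of_forall fun _ => sq_nonneg _)]
  refine lintegral_congr fun ω => ?_
  rw [← enorm_pow, Real.enorm_of_nonneg (sq_nonneg _)]

lemma IsGaussianNoise.map_eq (hW : IsGaussianNoise β₀ γ W P) (φ) :
    P.map (W φ) = gaussianReal 0 (energyInner β₀ γ φ.1 φ.1).toNNReal := by
  have h := hW.gaussian.hasGaussianLaw_eval φ
  have h1 := h.map_eq_gaussianReal
  have := h.isProbabilityMeasure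
  rw [variance_of_integral_eq_zero h.aemeasurable (hW.centered φ), hW.centered φ] at h1
  rw [h1, ← hW.covariance]
  congr 3
  ext ω
  ring

lemma IsGaussianNoise.map_sub_eq (hW : IsGaussianNoise β₀ γ W P) (φ ψ) :
    P.map (fun ω => W φ ω - W ψ ω) = gaussianReal 0 (energyInner β₀ γ φ.1 φ.1 +
      energyInner β₀ γ ψ.1 ψ.1 - 2 * energyInner β₀ γ φ.1 ψ.1).toNNReal := by
  have h := hW.gaussian.hasGaussianLaw_fun_sub (s := φ) (t := ψ)
  have h1 := h.map_eq_gaussianReal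
  have := h.isProbabilityMeasure
  have h0 : ∫ ω, (W φ ω - W ψ ω) ∂P = 0 := by
    rw [integral_sub ((hW.memLp φ).integrable one_le_two) ((hW.memLp ψ).integrable one_le_two),
      hW.centered, hW.centered, sub_zero]
  rw [variance_of_integral_eq_zero h.aemeasurable h0, h0] at h1
  rw [h1, ← hW.integral_sub_sq]

lemma IsGaussianNoise.lintegral_sub_pow (hW : IsGaussianNoise β₀ γ W P) (φ ψ) (m : ℕ) :
    ∫⁻ ω, ‖W φ ω - W ψ ω‖ₑ ^ (2 * m) ∂P = gaussianMoment m * (ENNReal.ofReal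
      (energyInner β₀ γ φ.1 φ.1 + energyInner β₀ γ ψ.1 ψ.1 -
        2 * energyInner β₀ γ φ.1 ψ.1)) ^ m := by
  have h := lintegral_enorm_pow_gaussianReal (energyInner β₀ γ φ.1 φ.1 +
      energyInner β₀ γ ψ.1 ψ.1 - 2 * energyInner β₀ γ φ.1 ψ.1).toNNReal m
  rw [← hW.map_sub_eq, lintegral_map' (by fun_prop)
    (hW.gaussian.hasGaussianLaw_fun_sub (s := φ) (t := ψ)).aemeasurable] at h
  exact h

lemma IsGaussianNoise.lintegral_exp (hW : IsGaussianNoise β₀ γ W P) (φ) (q : ℝ) :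
    ∫⁻ ω, ENNReal.ofReal (Real.exp (q * W φ ω)) ∂P =
      ENNReal.ofReal (Real.exp (q ^ 2 / 2 * energyInner β₀ γ φ.1 φ.1)) := by
  have h := lintegral_exp_gaussianReal (energyInner β₀ γ φ.1 φ.1).toNNReal q
  rw [← hW.map_eq, lintegral_map' (by fun_prop)
    (hW.gaussian.hasGaussianLaw_eval φ).aemeasurable] at h
  rw [h, Real.coe_toNNReal]
  rw [← hW.covariance]
  exact integral_nonneg fun ω => mul_self_nonneg _

variable [IsProbabilityMeasure P]

lemma energyInner_Phi (hd : 0 < d) (hγ : IsCovarianceKernel γ γhat)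
    (hp : IsMollifier p) {ε δ ε' δ' : ℝ} (hε : 0 < ε) (hδ : 0 < δ) (hε' : 0 < ε') (hδ' : 0 < δ')
    (t s : ℝ≥0) (x y : E d) {f g : ℝ≥0 → E d} (hf : Measurable f) (hg : Measurable g) :
    energyInner β₀ γ (Phi p ε δ t x f) (Phi p ε' δ' s y g) =
      (energy β₀ γ (Phi p ε δ t x f) (Phi p ε' δ' s y g)).toReal :=
  energyInner_eq_toReal hγ.continuous.measurable (ae_lt_top_of_isCovarianceKernel hd hγ)
    (measurable_Phi hp hf) (measurable_Phi hp hg) (Phi_nonneg hp hε hδ) (Phi_nonneg hp hε' hδ')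

/-- The noise integral of a mollified occupation density depends continuously on the path. -/
lemma IsGaussianNoise.tendsto_toLp (hW : IsGaussianNoise β₀ γ W P)
    (hd : 0 < d) (hβ₀ : 0 < β₀) (hβ₁ : β₀ < 1) (hγ : IsCovarianceKernel γ γhat)
    (hp : IsMollifier p) {ε δ : ℝ} (hε : 0 < ε) (hδ : 0 < δ) (t : ℝ≥0) (x : E d)
    {ι : Type*} {l : Filter ι} [l.IsCountablyGenerated] {f : ι → ℝ≥0 → E d} {f₀ : ℝ≥0 → E d}
    (hf : ∀ i, Measurable (f i)) (hf₀ : Measurable f₀)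
    (hlim : ∀ r, Tendsto (fun i => f i r) l (𝓝 (f₀ r)))
    (hi : ∀ i, FiniteEnergy β₀ γ (Phi p ε δ t x (f i)))
    (h₀ : FiniteEnergy β₀ γ (Phi p ε δ t x f₀)) :
    Tendsto (fun i => (hW.memLp ⟨_, hi i⟩).toLp _) l (𝓝 ((hW.memLp ⟨_, h₀⟩).toLp _)) := by
  rw [tendsto_iff_edist_tendsto_0]
  set e : ι → ℝ := fun i => (energy β₀ γ (Phi p ε δ t x (f i)) (Phi p ε δ t x (f i))).toReal with he
  set e' : ι → ℝ := fun i => (energy β₀ γ (Phi p ε δ t x (f i)) (Phi p ε δ t x f₀)).toReal with he'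
  set e₀ : ℝ := (energy β₀ γ (Phi p ε δ t x f₀) (Phi p ε δ t x f₀)).toReal with he₀
  have e1 : ∀ i, edist ((hW.memLp ⟨_, hi i⟩).toLp _) ((hW.memLp ⟨_, h₀⟩).toLp _) =
      (ENNReal.ofReal (e i + e₀ - 2 * e' i)) ^ (1 / 2 : ℝ) := by
    intro i
    rw [Lp.edist_toLp_toLp, eLpNorm_eq_lintegral_rpow_enorm_toReal two_ne_zero ENNReal.ofNat_ne_top]
    simp only [ENNReal.toReal_ofNat]
    congr 1
    have h1 := hW.lintegral_sub_sq ⟨_, hi i⟩ ⟨_, h₀⟩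
    simp only at h1
    rw [energyInner_Phi hd hγ hp hε hδ hε hδ t t x x (hf i) (hf i),
      energyInner_Phi hd hγ hp hε hδ hε hδ t t x x hf₀ hf₀,
      energyInner_Phi hd hγ hp hε hδ hε hδ t t x x (hf i) hf₀] at h1
    rw [← h1]
    refine lintegral_congr fun ω => ?_
    norm_cast
  simp_rw [e1]
  have hlt := (energy_Phi_lt_top hd hβ₀ hβ₁ hγ hp hε hδ hε hδ t t x x hf₀ hf₀).ne
  have t1 : Tendsto e l (𝓝 e₀) := (ENNReal.tendsto_toReal hlt).comp
    (tendsto_energy_Phi (β₀ := β₀) hd hβ₀ hβ₁ hγ hp hε hδ hε hδ t t x x hf hf hf₀ hf₀ hlim hlim)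
  have t2 : Tendsto e' l (𝓝 e₀) := (ENNReal.tendsto_toReal hlt).comp
    (tendsto_energy_Phi (β₀ := β₀) hd hβ₀ hβ₁ hγ hp hε hδ hε hδ t t x x hf (fun _ => hf₀) hf₀ hf₀
      hlim (fun _ => tendsto_const_nhds))
  have t3 : Tendsto (fun i => e i + e₀ - 2 * e' i) l (𝓝 0) := by
    have := (t1.add_const e₀).sub (t2.const_mul 2)
    rwa [show e₀ + e₀ - 2 * e₀ = 0 by ring] at this
  have t4 := (ENNReal.continuous_rpow_const (y := (1 / 2 : ℝ))).tendsto _ |>.comp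
    (ENNReal.tendsto_ofReal t3)
  rw [ENNReal.ofReal_zero, ENNReal.zero_rpow_of_pos (by norm_num)] at t4
  exact t4

/-- The noise integral of a mollified occupation density is jointly measurable. -/
theorem IsGaussianNoise.exists_measurable_noiseIntegral (hW : IsGaussianNoise β₀ γ W P)
    (hd : 0 < d) (hβ₀ : 0 < β₀) (hβ₁ : β₀ < 1) (hγ : IsCovarianceKernel γ γhat)
    (hp : IsMollifier p) {ε δ : ℝ} (hε : 0 < ε) (hδ : 0 < δ) (t : ℝ≥0) (x : E d)
    {Ω' : Type*} {mΩ' : MeasurableSpace Ω'} {P' : Measure Ω'}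
    {X : ℝ≥0 → Ω' → E d} {Ψ : E d → ℝ} (hX : IsRegularProcess X Ψ P') :
    ∃ Y : Ω × Ω' → ℝ, StronglyMeasurable Y ∧
      ∀ ω' (h : FiniteEnergy β₀ γ (Phi p ε δ t x fun s => X s ω')),
        ∀ᵐ ω ∂P, Y (ω, ω') = W ⟨_, h⟩ ω := by
  have hpathm : ∀ ω, Measurable fun s => X s ω := fun ω => hX.measurable.comp measurable_prodMk_right
  have hevalm : ∀ s, Measurable (X s) := fun s => hX.measurable.comp measurable_prodMk_left
  have hfe : ∀ f : ℝ≥0 → E d, Measurable f → FiniteEnergy β₀ γ (Phi p ε δ t x f) :=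
    fun f hf => finiteEnergy_Phi hd hβ₀ hβ₁ hγ hp hε hδ t x hf
  obtain ⟨F, hF⟩ : ∃ F : {f : ℝ≥0 → E d // Measurable f} → Lp ℝ 2 P,
      ∀ f, F f = (hW.memLp ⟨_, hfe f.1 f.2⟩).toLp _ := ⟨_, fun _ => rfl⟩
  have hcont : ∀ {ι : Type} {l : Filter ι} [l.IsCountablyGenerated]
      (f : ι → {f : ℝ≥0 → E d // Measurable f}) (f₀ : {f : ℝ≥0 → E d // Measurable f}),
      (∀ r, Tendsto (fun i => (f i).1 r) l (𝓝 (f₀.1 r))) →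
      Tendsto (fun i => F (f i)) l (𝓝 (F f₀)) := by
    intro ι l _ f f₀ hlim
    simp_rw [hF]
    exact hW.tendsto_toLp hd hβ₀ hβ₁ hγ hp hε hδ t x (fun i => (f i).2) f₀.2 hlim _ _
  -- A step path is determined by a sequence of values, on which its noise integral in `L²` depends
  -- continuously. Composed with the sampled process this is strongly measurable in `ω'`, and right
  -- continuity of the paths passes it to the limit.
  set step : ℕ → (ℕ → E d) → {f : ℝ≥0 → E d // Measurable f} := fun n z =>
    ⟨fun s => z ⌈((n : ℝ≥0) + 1) * s⌉₊, (measurable_from_nat (f := z)).comp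
      (Nat.measurable_ceil.comp (measurable_id.const_mul _))⟩ with hstep
  have hstepc : ∀ n, Continuous fun z => F (step n z) := by
    intro n
    refine continuous_iff_continuousAt.2 fun z => ?_
    exact hcont (fun z => step n z) (step n z) fun r =>
      (continuous_apply (⌈((n : ℝ≥0) + 1) * r⌉₊)).tendsto z
  have hsm : ∀ n : ℕ, StronglyMeasurable fun ω' =>
      F (step n fun k => X ((k : ℝ≥0) / (n + 1)) ω') := by
    intro n
    have h1 : Measurable fun ω' (k : ℕ) => X ((k : ℝ≥0) / (n + 1)) ω' :=
      measurable_pi_lambda _ fun k => hevalm _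
    exact (hstepc n).stronglyMeasurable.comp_measurable h1
  have hFm : StronglyMeasurable fun ω' => F ⟨fun s => X s ω', hpathm ω'⟩ := by
    refine stronglyMeasurable_of_tendsto atTop hsm (tendsto_pi_nhds.2 fun ω' => ?_)
    refine hcont _ _ fun r => ?_
    exact (hX.right_continuous ω' r).tendsto.comp (tendsto_gridAbove r)
  obtain ⟨Y, hY, hYF⟩ := exists_stronglyMeasurable_uncurry hFm
  refine ⟨Y, hY, fun ω' h => ?_⟩
  filter_upwards [hYF ω', (hW.memLp ⟨_, h⟩).coeFn_toLp] with ω h1 h2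
  rw [h1, hF, h2]

end Noise


/-! ### Moments of partial integrals over a product space -/

section ProductMoments

variable {Ω Ω' : Type*} {mΩ : MeasurableSpace Ω} {mΩ' : MeasurableSpace Ω'} {P : Measure Ω}
  {P' : Measure Ω'} [IsProbabilityMeasure P] [IsProbabilityMeasure P']

/-- A weighted Jensen inequality: moments of `∫ D² dP'` from the moments of `D` for fixed `ω'`. -/
lemma lintegral_lintegral_sq_pow_le_of_pos {D : Ω × Ω' → ℝ≥0∞} (hD : Measurable D)
    {s : Ω' → ℝ≥0∞} (hs : Measurable s) (hs0 : ∀ ω', s ω' ≠ 0) (hs1 : ∀ ω', s ω' ≠ ∞) {m : ℕ}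
    (hm : 1 ≤ m) {c : ℝ≥0∞} (h : ∀ᵐ ω' ∂P', ∫⁻ ω, D (ω, ω') ^ (2 * m) ∂P ≤ c * s ω' ^ m) :
    ∫⁻ ω, (∫⁻ ω', D (ω, ω') ^ 2 ∂P') ^ m ∂P ≤ c * (∫⁻ ω', s ω' ∂P') ^ m := by
  rcases eq_or_lt_of_le hm with rfl | hm1
  · simp only [mul_one, pow_one] at h ⊢
    rw [lintegral_lintegral_swap (f := fun ω ω' => D (ω, ω') ^ 2) (hD.pow_const 2).aemeasurable,
      ← lintegral_const_mul _ hs]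
    exact lintegral_mono_ae h
  have hm1' : (1 : ℝ) < m := by exact_mod_cast hm1
  have hmpos : (0 : ℝ) < m := by linarith
  -- Hölder's inequality is applied to `D² = (D² s^{-1/q}) s^{1/q}`, where `m / q = m - 1`. The
  -- weight is what yields `(∫ s)^m` rather than `∫ s^m`: later only the mean of the conditional
  -- variance is controlled by `limitVar`.
  have hpq : (m : ℝ).HolderConjugate (m / (m - 1)) := Real.HolderConjugate.conjExponent hm1'
  set q : ℝ := m / (m - 1) with hq
  have hq0 : 0 < q := hpq.symm.pos
  have hmq : 1 / q * (m : ℝ) = (m - 1 : ℕ) := by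
    rw [hq, Nat.cast_sub hm]; field_simp; simp
  have hsq0 : ∀ ω', s ω' ^ (1 / q) ≠ 0 := fun ω' => by
    simp [ENNReal.rpow_eq_zero_iff, hs0, hs1]
  have hsq1 : ∀ ω', s ω' ^ (1 / q) ≠ ∞ := fun ω' =>
    ENNReal.rpow_ne_top_of_nonneg (by positivity) (hs1 ω')
  have hsm : Measurable fun ω' => s ω' ^ (1 / q) := hs.pow_const (1 / q)
  have hsm' : Measurable fun ω' => (s ω' ^ (1 / q))⁻¹ := hsm.inv
  have hfm : Measurable fun z : Ω × Ω' => D z ^ 2 * (s z.2 ^ (1 / q))⁻¹ :=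
    (hD.pow_const 2).mul (hsm'.comp measurable_snd)
  have hpt : ∀ ω, (∫⁻ ω', D (ω, ω') ^ 2 ∂P') ^ m ≤
      (∫⁻ ω', D (ω, ω') ^ (2 * m) * (s ω' ^ (m - 1))⁻¹ ∂P') * (∫⁻ ω', s ω' ∂P') ^ (m - 1) := by
    intro ω
    have h1 := ENNReal.lintegral_mul_le_Lp_mul_Lq P' hpq
      (f := fun ω' => D (ω, ω') ^ 2 * (s ω' ^ (1 / q))⁻¹) (g := fun ω' => s ω' ^ (1 / q))
      (hfm.comp measurable_prodMk_left).aemeasurable hsm.aemeasurable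
    have h2 : ∫⁻ ω', ((fun ω' => D (ω, ω') ^ 2 * (s ω' ^ (1 / q))⁻¹) * fun ω' => s ω' ^ (1 / q)) ω'
        ∂P' = ∫⁻ ω', D (ω, ω') ^ 2 ∂P' := by
      refine lintegral_congr fun ω' => ?_
      simp only [Pi.mul_apply]
      rw [mul_assoc, ENNReal.inv_mul_cancel (hsq0 _) (hsq1 _), mul_one]
    rw [h2] at h1
    refine (pow_le_pow_left' h1 m).trans (le_of_eq ?_)
    rw [mul_pow, ← ENNReal.rpow_natCast (_ ^ (1 / (m : ℝ))), ← ENNReal.rpow_mul,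
      ← ENNReal.rpow_natCast (_ ^ (1 / q)), ← ENNReal.rpow_mul, hmq,
      one_div_mul_cancel hmpos.ne', ENNReal.rpow_one, ENNReal.rpow_natCast]
    congr 2
    · ext ω'
      rw [ENNReal.rpow_natCast, mul_pow, ← pow_mul, ← ENNReal.inv_pow,
        ← ENNReal.rpow_natCast (s ω' ^ (1 / q)), ← ENNReal.rpow_mul, hmq, ENNReal.rpow_natCast]
    · refine lintegral_congr fun ω' => ?_
      rw [← ENNReal.rpow_mul, one_div_mul_cancel hq0.ne', ENNReal.rpow_one]
  have hF : Measurable fun z : Ω × Ω' => D z ^ (2 * m) * (s z.2 ^ (m - 1))⁻¹ :=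
    (hD.pow_const _).mul ((hs.comp measurable_snd).pow_const _).inv
  refine (lintegral_mono hpt).trans ?_
  rw [lintegral_mul_const _ hF.lintegral_prod_right',
    lintegral_lintegral_swap (f := fun ω ω' => D (ω, ω') ^ (2 * m) * (s ω' ^ (m - 1))⁻¹)
      hF.aemeasurable]
  have h3 : ∫⁻ ω', ∫⁻ ω, D (ω, ω') ^ (2 * m) * (s ω' ^ (m - 1))⁻¹ ∂P ∂P' ≤
      c * ∫⁻ ω', s ω' ∂P' := by
    rw [← lintegral_const_mul _ hs]
    refine lintegral_mono_ae (h.mono fun ω' hω' => ?_)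
    rw [lintegral_mul_const (f := fun ω => D (ω, ω') ^ (2 * m)) _
      ((hD.comp (measurable_prodMk_right (y := ω'))).pow_const (2 * m))]
    refine (mul_le_mul_left hω' _).trans (le_of_eq ?_)
    have h4 : s ω' ^ m = s ω' * s ω' ^ (m - 1) := by rw [← pow_succ', Nat.sub_add_cancel hm]
    rw [h4, mul_assoc, mul_assoc, ENNReal.mul_inv_cancel (pow_ne_zero _ (hs0 _))
      (ENNReal.pow_ne_top (hs1 _)), mul_one]
  refine (mul_le_mul_left h3 _).trans (le_of_eq ?_)
  rw [mul_assoc, ← pow_succ', Nat.sub_add_cancel hm]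

/-- A conditional variance may vanish, so the division by `s` is performed for `s + 1/n` before `n →
∞`. At `n = 0` the inverse is infinite and the estimate is trivial, except when `c = 0`. -/
lemma lintegral_lintegral_sq_pow_le {D : Ω × Ω' → ℝ≥0∞} (hD : Measurable D)
    {s : Ω' → ℝ≥0∞} (hs : Measurable s) (hs1 : ∀ ω', s ω' ≠ ∞) {m : ℕ}
    (hm : 1 ≤ m) {c : ℝ≥0∞} (hc : c ≠ ∞)
    (h : ∀ᵐ ω' ∂P', ∫⁻ ω, D (ω, ω') ^ (2 * m) ∂P ≤ c * s ω' ^ m) :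
    ∫⁻ ω, (∫⁻ ω', D (ω, ω') ^ 2 ∂P') ^ m ∂P ≤ c * (∫⁻ ω', s ω' ∂P') ^ m := by
  have key : ∀ n : ℕ, ∫⁻ ω, (∫⁻ ω', D (ω, ω') ^ 2 ∂P') ^ m ∂P ≤
      c * ((∫⁻ ω', s ω' ∂P') + (n : ℝ≥0∞)⁻¹) ^ m := by
    intro n
    rcases Nat.eq_zero_or_pos n with rfl | hn
    · rcases eq_or_ne c 0 with rfl | hc0
      · have := lintegral_lintegral_sq_pow_le_of_pos (P := P) (P' := P') hD
          (s := fun ω' => s ω' + 1) (hs.add_const _) (fun ω' => by simp)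
          (fun ω' => by simp [hs1]) hm (c := 0) (by simpa using h)
        simpa using this
      · simp [ENNReal.mul_top, hc0, ENNReal.top_pow (show m ≠ 0 by omega)]
    · have h1 := lintegral_lintegral_sq_pow_le_of_pos (P := P) (P' := P') hD
          (s := fun ω' => s ω' + (n : ℝ≥0∞)⁻¹) (hs.add_const _) (fun ω' => by simp)
          (fun ω' => by simp [hs1, hn.ne']) hm (c := c)
          (h.mono fun ω' hω' => hω'.trans (by gcongr; exact le_self_add))
      rwa [lintegral_add_right _ measurable_const, lintegral_const, measure_univ, mul_one] at h1
  have h1 : Tendsto (fun n : ℕ => c * ((∫⁻ ω', s ω' ∂P') + (n : ℝ≥0∞)⁻¹) ^ m) atTop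
      (𝓝 (c * ((∫⁻ ω', s ω' ∂P') + 0) ^ m)) := by
    have h2 := (tendsto_const_nhds (x := ∫⁻ ω', s ω' ∂P')).add ENNReal.tendsto_inv_nat_nhds_zero
    have h3 := ((ENNReal.continuous_pow m).tendsto _).comp h2
    exact ENNReal.Tendsto.const_mul h3 (Or.inr hc)
  rw [add_zero] at h1
  exact ge_of_tendsto' h1 key

/-- Convergence in `L²` of the product space yields a sequence converging almost surely. -/
lemma exists_seq_ae_tendsto {ι : Type*} {l : Filter ι} [l.NeBot] [l.IsCountablyGenerated]
    {Y : ι → Ω × Ω' → ℝ} {V : Ω × Ω' → ℝ}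
    (hY : ∀ᶠ i in l, AEStronglyMeasurable (Y i) (P.prod P'))
    (hV : AEStronglyMeasurable V (P.prod P'))
    (h : Tendsto (fun i => eLpNorm (Y i - V) 2 (P.prod P')) l (𝓝 0)) :
    ∃ ns : ℕ → ι, Tendsto ns atTop l ∧ (∀ n, AEStronglyMeasurable (Y (ns n)) (P.prod P')) ∧
      ∀ᵐ ω ∂P, ∀ᵐ ω' ∂P', Tendsto (fun n => Y (ns n) (ω, ω')) atTop (𝓝 (V (ω, ω'))) := by
  obtain ⟨ms, hms⟩ := exists_seq_tendsto l
  obtain ⟨k, hk⟩ := eventually_atTop.1 (hms.eventually hY)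
  set Y' : ℕ → Ω × Ω' → ℝ := fun n => Y (ms (n + k)) with hY'
  have hm : Tendsto (fun n => ms (n + k)) atTop l := hms.comp (tendsto_add_atTop_nat k)
  have h1 : TendstoInMeasure (P.prod P') Y' atTop V :=
    tendstoInMeasure_of_tendsto_eLpNorm two_ne_zero (fun n => hk _ (by omega)) hV (h.comp hm)
  obtain ⟨ns, hns, hae⟩ := h1.exists_seq_tendsto_ae
  exact ⟨fun n => ms (ns n + k), hm.comp hns.tendsto_atTop, fun n => hk _ (by omega),
    Measure.ae_ae_of_ae_prod hae⟩

/-- Fatou's lemma for functionals of the form `∫ (∫ F(V) dP')^m dP`. -/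
lemma lintegral_lintegral_pow_le_of_tendsto {ι : Type*} {l : Filter ι} [l.NeBot]
    [l.IsCountablyGenerated] {Y : ι → Ω × Ω' → ℝ} {V : Ω × Ω' → ℝ}
    (hY : ∀ᶠ i in l, AEStronglyMeasurable (Y i) (P.prod P'))
    (hV : AEStronglyMeasurable V (P.prod P'))
    (h : Tendsto (fun i => eLpNorm (Y i - V) 2 (P.prod P')) l (𝓝 0))
    {F : ℝ → ℝ≥0∞} (hF : Continuous F) (m : ℕ) {R : ι → ℝ≥0∞} {R₀ : ℝ≥0∞}
    (hR : Tendsto R l (𝓝 R₀))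
    (hle : ∀ᶠ i in l, ∫⁻ ω, (∫⁻ ω', F (Y i (ω, ω')) ∂P') ^ m ∂P ≤ R i) :
    ∫⁻ ω, (∫⁻ ω', F (V (ω, ω')) ∂P') ^ m ∂P ≤ R₀ := by
  obtain ⟨ns, hns, hm, hae⟩ := exists_seq_ae_tendsto hY hV h
  have hFm : ∀ n, AEMeasurable (fun z => F (Y (ns n) z)) (P.prod P') := fun n =>
    hF.measurable.comp_aemeasurable (hm n).aemeasurable
  have hFω : ∀ᵐ ω ∂P, ∀ n, AEMeasurable (fun ω' => F (Y (ns n) (ω, ω'))) P' :=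
    ae_all_iff.2 fun n => by
      filter_upwards [(hm n).prodMk_left] with ω hω
      exact hF.measurable.comp_aemeasurable hω.aemeasurable
  have h1 : ∀ᵐ ω ∂P, (∫⁻ ω', F (V (ω, ω')) ∂P') ^ m ≤
      liminf (fun n => (∫⁻ ω', F (Y (ns n) (ω, ω')) ∂P') ^ m) atTop := by
    filter_upwards [hae, hFω] with ω h1 h2
    have h3 : ∫⁻ ω', F (V (ω, ω')) ∂P' ≤
        liminf (fun n => ∫⁻ ω', F (Y (ns n) (ω, ω')) ∂P') atTop := by
      refine le_trans (lintegral_mono_ae ?_) (lintegral_liminf_le' h2)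
      filter_upwards [h1] with ω' h4
      exact (((hF.tendsto _).comp h4).liminf_eq).ge
    refine (pow_le_pow_left' h3 m).trans (le_of_eq ?_)
    have hmono : Monotone fun x : ℝ≥0∞ => x ^ m := fun a b hab => pow_le_pow_left' hab m
    exact hmono.map_liminf_of_continuousAt _ (ENNReal.continuous_pow m).continuousAt
  refine (lintegral_mono_ae h1).trans ?_
  refine (lintegral_liminf_le' fun n => ((hFm n).lintegral_prod_right').pow_const m).trans ?_
  have h2 := hR.comp hns
  rw [← h2.liminf_eq]
  exact liminf_le_liminf (hns.eventually hle)

lemma pow_lintegral_le_lintegral_pow {f : Ω' → ℝ≥0∞} (hf : AEMeasurable f P') {k : ℕ} (hk : 1 ≤ k) :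
    (∫⁻ ω', f ω' ∂P') ^ k ≤ ∫⁻ ω', f ω' ^ k ∂P' := by
  rcases eq_or_lt_of_le hk with rfl | hk1
  · simp
  have hk1' : (1 : ℝ) < k := by exact_mod_cast hk1
  have h := ENNReal.lintegral_mul_le_Lp_mul_Lq P' (Real.HolderConjugate.conjExponent hk1')
    (f := f) (g := fun _ => 1) hf aemeasurable_const
  simp only [Pi.mul_apply, mul_one, ENNReal.one_rpow, lintegral_const, measure_univ] at h
  refine (pow_le_pow_left' h k).trans (le_of_eq ?_)
  rw [← ENNReal.rpow_natCast, ← ENNReal.rpow_mul, one_div_mul_cancel (by positivity),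
    ENNReal.rpow_one]
  simp_rw [ENNReal.rpow_natCast]

lemma enorm_exp_sub_exp_le (a b : ℝ) :
    ‖Real.exp a - Real.exp b‖ₑ ≤
      ‖a - b‖ₑ * (ENNReal.ofReal (Real.exp a) + ENNReal.ofReal (Real.exp b)) := by
  have key : ∀ a b : ℝ, Real.exp a - Real.exp b ≤ |a - b| * (Real.exp a + Real.exp b) := by
    intro a b
    have h1 : Real.exp a * (b - a + 1) ≤ Real.exp b := by
      have := mul_le_mul_of_nonneg_left (Real.add_one_le_exp (b - a)) (Real.exp_pos a).le
      rwa [← Real.exp_add, add_sub_cancel] at this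
    have h2 := le_abs_self (a - b)
    have := mul_le_mul_of_nonneg_right h2 (Real.exp_pos a).le
    have := mul_nonneg (abs_nonneg (a - b)) (Real.exp_pos b).le
    nlinarith
  rw [← ENNReal.ofReal_add (Real.exp_pos a).le (Real.exp_pos b).le, ← ofReal_norm, ← ofReal_norm,
    ← ENNReal.ofReal_mul (norm_nonneg _)]
  refine ENNReal.ofReal_le_ofReal ?_
  rw [Real.norm_eq_abs, Real.norm_eq_abs, abs_le']
  refine ⟨key a b, ?_⟩
  have := key b a
  rw [abs_sub_comm] at this
  linarith

/-- Moments of the difference of two exponential averages. -/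
lemma lintegral_enorm_sub_pow_le {V V' : Ω × Ω' → ℝ} (hV : AEStronglyMeasurable V (P.prod P'))
    (hV' : AEStronglyMeasurable V' (P.prod P')) {m : ℕ} (hm : 1 ≤ m) {A R c : ℝ≥0∞}
    (hD : ∫⁻ ω, (∫⁻ ω', ‖V (ω, ω') - V' (ω, ω')‖ₑ ^ 2 ∂P') ^ (2 * m) ∂P ≤ c * R ^ (2 * m))
    (hG : ∫⁻ ω, ∫⁻ ω', ENNReal.ofReal (Real.exp ((4 * m : ℕ) * V (ω, ω'))) ∂P' ∂P ≤ A)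
    (hG' : ∫⁻ ω, ∫⁻ ω', ENNReal.ofReal (Real.exp ((4 * m : ℕ) * V' (ω, ω'))) ∂P' ∂P ≤ A)
    {u u' : Ω → ℝ}
    (hu : ∀ᵐ ω ∂P, Integrable (fun ω' => Real.exp (V (ω, ω'))) P' ∧
      u ω = ∫ ω', Real.exp (V (ω, ω')) ∂P')
    (hu' : ∀ᵐ ω ∂P, Integrable (fun ω' => Real.exp (V' (ω, ω'))) P' ∧
      u' ω = ∫ ω', Real.exp (V' (ω, ω')) ∂P') :
    ∫⁻ ω, ‖u ω - u' ω‖ₑ ^ (2 * m) ∂P ≤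
      c ^ (1 / 2 : ℝ) * (2 ^ (4 * m) * A) ^ (1 / 2 : ℝ) * R ^ m := by
  set G : Ω × Ω' → ℝ≥0∞ := fun z =>
    ENNReal.ofReal (Real.exp (V z)) + ENNReal.ofReal (Real.exp (V' z)) with hGdef
  have hGm : AEMeasurable G (P.prod P') :=
    (Real.measurable_exp.comp_aemeasurable hV.aemeasurable).ennreal_ofReal.add
      (Real.measurable_exp.comp_aemeasurable hV'.aemeasurable).ennreal_ofReal
  have hDm : AEMeasurable (fun z => ‖V z - V' z‖ₑ) (P.prod P') := (hV.sub hV').enorm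
  have hpt : ∀ᵐ ω ∂P, ‖u ω - u' ω‖ₑ ^ (2 * m) ≤
      (∫⁻ ω', ‖V (ω, ω') - V' (ω, ω')‖ₑ ^ 2 ∂P') ^ m * (∫⁻ ω', G (ω, ω') ^ 2 ∂P') ^ m := by
    filter_upwards [hu, hu', hV.prodMk_left, hV'.prodMk_left] with ω h1 h2 h3 h4
    -- For fixed noise, the difference of exponentials is bounded by `|V - V'|` times `G`, and the
    -- first Cauchy–Schwarz inequality, over the path, separates these factors.
    have h5 : ‖u ω - u' ω‖ₑ ≤ ∫⁻ ω', ‖V (ω, ω') - V' (ω, ω')‖ₑ * G (ω, ω') ∂P' := by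
      rw [h1.2, h2.2, ← integral_sub h1.1 h2.1]
      refine (enorm_integral_le_lintegral_enorm _).trans (lintegral_mono fun ω' => ?_)
      exact enorm_exp_sub_exp_le _ _
    have h6 := ENNReal.lintegral_mul_le_Lp_mul_Lq P' Real.HolderConjugate.two_two
      (f := fun ω' => ‖V (ω, ω') - V' (ω, ω')‖ₑ) (g := fun ω' => G (ω, ω'))
      (h3.sub h4).enorm
      ((Real.measurable_exp.comp_aemeasurable h3.aemeasurable).ennreal_ofReal.add
      (Real.measurable_exp.comp_aemeasurable h4.aemeasurable).ennreal_ofReal)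
    have h7 := pow_le_pow_left' (h5.trans h6) (2 * m)
    refine h7.trans (le_of_eq ?_)
    have h8 : ∀ x : ℝ≥0∞, (x ^ (1 / 2 : ℝ)) ^ (2 * m) = x ^ m := fun x => by
      rw [pow_mul, ← ENNReal.rpow_natCast (x ^ (1 / 2 : ℝ)), ← ENNReal.rpow_mul]
      norm_num
    rw [mul_pow, h8, h8]
    norm_cast
  have hA2 : ∫⁻ ω, (∫⁻ ω', G (ω, ω') ^ 2 ∂P') ^ (2 * m) ∂P ≤ 2 ^ (4 * m) * A := by
    have h1 : ∀ᵐ ω ∂P, (∫⁻ ω', G (ω, ω') ^ 2 ∂P') ^ (2 * m) ≤ ∫⁻ ω', G (ω, ω') ^ (4 * m) ∂P' := by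
      filter_upwards [hV.prodMk_left, hV'.prodMk_left] with ω h3 h4
      have h5 : AEMeasurable (fun ω' => G (ω, ω')) P' :=
        (Real.measurable_exp.comp_aemeasurable h3.aemeasurable).ennreal_ofReal.add
        (Real.measurable_exp.comp_aemeasurable h4.aemeasurable).ennreal_ofReal
      refine (pow_lintegral_le_lintegral_pow (h5.pow_const 2) (by omega)).trans (le_of_eq ?_)
      refine lintegral_congr fun ω' => ?_
      rw [← pow_mul]
      congr 1
      ring
    have h2 : ∀ z, G z ^ (4 * m) ≤ 2 ^ (4 * m - 1) * (ENNReal.ofReal (Real.exp ((4 * m : ℕ) * V z)) +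
        ENNReal.ofReal (Real.exp ((4 * m : ℕ) * V' z))) := by
      intro z
      have h3 := ENNReal.rpow_add_le_mul_rpow_add_rpow (ENNReal.ofReal (Real.exp (V z)))
        (ENNReal.ofReal (Real.exp (V' z))) (p := (4 * m : ℕ)) (by norm_cast; omega)
      rw [ENNReal.rpow_natCast, ENNReal.rpow_natCast, ENNReal.rpow_natCast,
        ← ENNReal.ofReal_pow (Real.exp_pos _).le, ← ENNReal.ofReal_pow (Real.exp_pos _).le,
        ← Real.exp_nat_mul, ← Real.exp_nat_mul] at h3
      refine h3.trans (le_of_eq ?_)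
      congr 1
      rw [← ENNReal.rpow_natCast, Nat.cast_sub (by omega)]
      simp
    have h3 : AEMeasurable (fun z => ENNReal.ofReal (Real.exp ((4 * m : ℕ) * V z))) (P.prod P') :=
      (Real.measurable_exp.comp_aemeasurable (hV.aemeasurable.const_mul _)).ennreal_ofReal
    have h3' : AEMeasurable (fun z => ENNReal.ofReal (Real.exp ((4 * m : ℕ) * V' z))) (P.prod P') :=
      (Real.measurable_exp.comp_aemeasurable (hV'.aemeasurable.const_mul _)).ennreal_ofReal
    have h4 : ∫⁻ ω, ∫⁻ ω', G (ω, ω') ^ (4 * m) ∂P' ∂P ≤ 2 ^ (4 * m - 1) * (A + A) := by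
      rw [lintegral_lintegral (f := fun ω ω' => ENNReal.ofReal (Real.exp ((4 * m : ℕ) * V (ω, ω'))))
        h3] at hG
      rw [lintegral_lintegral (f := fun ω ω' => ENNReal.ofReal (Real.exp ((4 * m : ℕ) * V' (ω, ω'))))
        h3'] at hG'
      rw [lintegral_lintegral (f := fun ω ω' => G (ω, ω') ^ (4 * m)) (hGm.pow_const _)]
      refine (lintegral_mono fun z => h2 z).trans ?_
      rw [lintegral_const_mul' _ _ (by finiteness), lintegral_add_left' h3]
      gcongr
    refine (lintegral_mono_ae h1).trans (h4.trans (le_of_eq ?_))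
    obtain ⟨k, hk⟩ : ∃ k, 4 * m = k + 1 := ⟨4 * m - 1, by omega⟩
    rw [hk, Nat.add_sub_cancel, pow_succ]
    ring
  refine (lintegral_mono_ae hpt).trans ?_
  -- The second Cauchy–Schwarz inequality, over the noise, doubles the power to `2 * m`; the
  -- exponential factor is then a moment of order `4 * m`.
  have h1 := ENNReal.lintegral_mul_le_Lp_mul_Lq P Real.HolderConjugate.two_two
    (f := fun ω => (∫⁻ ω', ‖V (ω, ω') - V' (ω, ω')‖ₑ ^ 2 ∂P') ^ m)
    (g := fun ω => (∫⁻ ω', G (ω, ω') ^ 2 ∂P') ^ m)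
    ((AEMeasurable.lintegral_prod_right' (hDm.pow_const 2)).pow_const m)
    ((AEMeasurable.lintegral_prod_right' (hGm.pow_const 2)).pow_const m)
  refine h1.trans ?_
  have h2 : ∀ x : ℝ≥0∞, (x ^ m) ^ (2 : ℝ) = x ^ (2 * m) := fun x => by
    rw [mul_comm, pow_mul]; norm_cast
  simp_rw [h2]
  have h3 : (c * R ^ (2 * m)) ^ (1 / 2 : ℝ) = c ^ (1 / 2 : ℝ) * R ^ m := by
    rw [ENNReal.mul_rpow_of_nonneg _ _ (by norm_num), ← ENNReal.rpow_natCast R (2 * m),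
      ← ENNReal.rpow_mul]
    congr 1
    rw [← ENNReal.rpow_natCast]
    congr 1
    push_cast; ring
  calc _ ≤ (c * R ^ (2 * m)) ^ (1 / 2 : ℝ) * (2 ^ (4 * m) * A) ^ (1 / 2 : ℝ) := by gcongr
    _ = _ := by rw [h3]; ring

end ProductMoments


/-! ### Conditional variances of differences of approximations. -/

section Model

variable {d : ℕ} {p : E d → ℝ} {γ : E d → ℝ≥0∞} {γhat Ψ : E d → ℝ} {β₀ : ℝ}
  {Ω Ω' : Type*} [mΩ : MeasurableSpace Ω] [mΩ' : MeasurableSpace Ω'] {P : Measure Ω}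
  {P' : Measure Ω'} {X : ℝ≥0 → Ω' → E d}
  {W : {φ : ℝ × E d → ℝ // FiniteEnergy β₀ γ φ} → Ω → ℝ}

/-- The standing assumptions, with a regular version of the Lévy process. -/
structure IsModel (γ : E d → ℝ≥0∞) (γhat : E d → ℝ) (β₀ : ℝ)
    (W : {φ : ℝ × E d → ℝ // FiniteEnergy β₀ γ φ} → Ω → ℝ) (P : Measure Ω) (X : ℝ≥0 → Ω' → E d)
    (Ψ : E d → ℝ) (P' : Measure Ω') (p : E d → ℝ) : Prop where
  dim_pos : 0 < d
  exponent_pos : 0 < β₀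
  exponent_lt_one : β₀ < 1
  kernel : IsCovarianceKernel γ γhat
  mollifier : IsMollifier p
  regular : IsRegularProcess X Ψ P'
  measurable_psi : Measurable Ψ
  psi_nonneg : ∀ ξ, 0 ≤ Ψ ξ
  dalang : DalangCondition β₀ Ψ (spectralMeasure γhat)
  noise : IsGaussianNoise β₀ γ W P

/-- The energy of two mollified occupation densities of the same path. -/
noncomputable def pathEnergy (β₀ : ℝ) (γ : E d → ℝ≥0∞) (p : E d → ℝ) (X : ℝ≥0 → Ω' → E d)
    (t s : ℝ≥0) (x y : E d) (a b : ℝ × ℝ) (ω' : Ω') : ℝ≥0∞ :=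
  energy β₀ γ (Phi p a.1 a.2 t x fun r => X r ω') (Phi p b.1 b.2 s y fun r => X r ω')

/-- The conditional variance of a difference of two mollified noise integrals. -/
noncomputable def incVar (β₀ : ℝ) (γ : E d → ℝ≥0∞) (p : E d → ℝ) (X : ℝ≥0 → Ω' → E d)
    (t s : ℝ≥0) (x y : E d) (a b : ℝ × ℝ) (ω' : Ω') : ℝ :=
  (pathEnergy β₀ γ p X t t x x a a ω').toReal + (pathEnergy β₀ γ p X s s y y b b ω').toReal -
    2 * (pathEnergy β₀ γ p X t s x y a b ω').toReal

/-- The variance of a difference of two limiting noise integrals. -/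
noncomputable def limitVar (β₀ : ℝ) (γhat Ψ : E d → ℝ) (t s : ℝ≥0) (x y : E d) : ℝ :=
  (limitEnergy β₀ γhat Ψ t t 0).toReal + (limitEnergy β₀ γhat Ψ s s 0).toReal -
    2 * (limitEnergy β₀ γhat Ψ t s (x - y)).toReal

/-- A jointly measurable choice of the mollified noise integrals. -/
structure IsNoiseField (W : {φ : ℝ × E d → ℝ // FiniteEnergy β₀ γ φ} → Ω → ℝ) (P : Measure Ω)
    (X : ℝ≥0 → Ω' → E d) (p : E d → ℝ) (Y : ℝ × ℝ → ℝ≥0 → E d → Ω × Ω' → ℝ) : Prop where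
  stronglyMeasurable : ∀ a t x, StronglyMeasurable (Y a t x)
  eq_noise : ∀ a : ℝ × ℝ, 0 < a.1 → 0 < a.2 → ∀ t x ω',
    ∀ h : FiniteEnergy β₀ γ (Phi p a.1 a.2 t x fun r => X r ω'), ∀ᵐ ω ∂P, Y a t x (ω, ω') = W ⟨_, h⟩ ω
  eq_zero : ∀ a : ℝ × ℝ, ¬ (0 < a.1 ∧ 0 < a.2) → ∀ t x, Y a t x = 0

variable [IsProbabilityMeasure P] [IsProbabilityMeasure P']

/-- Prescribing `0` for nonpositive parameters puts every member of the family in `L²`, so that the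
family is a single map into that space. -/
lemma IsModel.exists_noiseField (M : IsModel γ γhat β₀ W P X Ψ P' p) :
    ∃ Y : ℝ × ℝ → ℝ≥0 → E d → Ω × Ω' → ℝ, IsNoiseField W P X p Y := by
  classical
  have h : ∀ (a : ℝ × ℝ) (t : ℝ≥0) (x : E d), ∃ Y : Ω × Ω' → ℝ, StronglyMeasurable Y ∧
      ((0 < a.1 ∧ 0 < a.2) → ∀ ω', ∀ h : FiniteEnergy β₀ γ (Phi p a.1 a.2 t x fun r => X r ω'),
        ∀ᵐ ω ∂P, Y (ω, ω') = W ⟨_, h⟩ ω) ∧ (¬ (0 < a.1 ∧ 0 < a.2) → Y = 0) := by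
    intro a t x
    by_cases ha : 0 < a.1 ∧ 0 < a.2
    · obtain ⟨Y, h1, h2⟩ := M.noise.exists_measurable_noiseIntegral M.dim_pos M.exponent_pos
        M.exponent_lt_one M.kernel M.mollifier ha.1 ha.2 t x M.regular
      exact ⟨Y, h1, fun _ => h2, fun h => absurd ha h⟩
    · exact ⟨0, stronglyMeasurable_zero, fun h => absurd h ha, fun _ => rfl⟩
  choose Y h1 h2 h3 using h
  exact ⟨Y, h1, fun a ha ha' t x => h2 a t x ⟨ha, ha'⟩, fun a ha t x => h3 a t x ha⟩

section Bounds

variable {a b : ℝ × ℝ} {Y : ℝ × ℝ → ℝ≥0 → E d → Ω × Ω' → ℝ}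

lemma IsModel.finiteEnergy (M : IsModel γ γhat β₀ W P X Ψ P' p) (ha : 0 < a.1 ∧ 0 < a.2) (t : ℝ≥0)
    (x : E d) (ω' : Ω') :
    FiniteEnergy β₀ γ (Phi p a.1 a.2 t x fun r => X r ω') :=
  finiteEnergy_Phi M.dim_pos M.exponent_pos M.exponent_lt_one M.kernel M.mollifier ha.1 ha.2 t x
    (M.regular.measurable_path ω')

lemma IsModel.measurable_pathEnergy (M : IsModel γ γhat β₀ W P X Ψ P' p) (ha : 0 < a.1 ∧ 0 < a.2)
    (hb : 0 < b.1 ∧ 0 < b.2) (t s : ℝ≥0) (x y : E d) : Measurable (pathEnergy β₀ γ p X t s x y a b) :=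
  M.regular.measurable_energy M.dim_pos M.kernel M.mollifier ha.1 ha.2 hb.1 hb.2 t s x y

lemma IsModel.exists_pathEnergy_le (M : IsModel γ γhat β₀ W P X Ψ P' p) (ha : 0 < a.1 ∧ 0 < a.2)
    (hb : 0 < b.1 ∧ 0 < b.2) (t s : ℝ≥0) (x y : E d) : ∃ C : ℝ≥0, ∀ ω', pathEnergy β₀ γ p X t s x y a b ω' ≤ C := by
  obtain ⟨C, hC⟩ := exists_energy_Phi_le M.dim_pos M.exponent_pos M.exponent_lt_one M.kernel
    M.mollifier ha.1 ha.2 hb.1 hb.2 t s x y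
  exact ⟨C, fun ω' => hC _ _ (M.regular.measurable_path ω') (M.regular.measurable_path ω')⟩

lemma IsModel.pathEnergy_ne_top (M : IsModel γ γhat β₀ W P X Ψ P' p) (ha : 0 < a.1 ∧ 0 < a.2)
    (hb : 0 < b.1 ∧ 0 < b.2) (t s : ℝ≥0) (x y : E d) (ω' : Ω') : pathEnergy β₀ γ p X t s x y a b ω' ≠ ∞ := by
  obtain ⟨C, hC⟩ := M.exists_pathEnergy_le ha hb t s x y
  exact ((hC ω').trans_lt ENNReal.coe_lt_top).ne

lemma IsModel.lintegral_pathEnergy_ne_top (M : IsModel γ γhat β₀ W P X Ψ P' p) (ha : 0 < a.1 ∧ 0 < a.2)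
    (hb : 0 < b.1 ∧ 0 < b.2) (t s : ℝ≥0) (x y : E d) : ∫⁻ ω', pathEnergy β₀ γ p X t s x y a b ω' ∂P' ≠ ∞ := by
  obtain ⟨C, hC⟩ := M.exists_pathEnergy_le ha hb t s x y
  exact ((lintegral_mono hC).trans_lt (by simp)).ne

lemma IsModel.energyInner_eq (M : IsModel γ γhat β₀ W P X Ψ P' p) (ha : 0 < a.1 ∧ 0 < a.2)
    (hb : 0 < b.1 ∧ 0 < b.2) (t s : ℝ≥0) (x y : E d) (ω' : Ω') :
    energyInner β₀ γ (Phi p a.1 a.2 t x fun r => X r ω') (Phi p b.1 b.2 s y fun r => X r ω') =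
      (pathEnergy β₀ γ p X t s x y a b ω').toReal :=
  energyInner_Phi M.dim_pos M.kernel M.mollifier ha.1 ha.2 hb.1 hb.2 t s x y
    (M.regular.measurable_path ω') (M.regular.measurable_path ω')

lemma IsModel.incVar_nonneg (M : IsModel γ γhat β₀ W P X Ψ P' p) (ha : 0 < a.1 ∧ 0 < a.2)
    (hb : 0 < b.1 ∧ 0 < b.2) (t s : ℝ≥0) (x y : E d) (ω' : Ω') : 0 ≤ incVar β₀ γ p X t s x y a b ω' := by
  have h := M.noise.integral_sub_sq ⟨_, M.finiteEnergy ha t x ω'⟩ ⟨_, M.finiteEnergy hb s y ω'⟩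
  simp only at h
  rw [M.energyInner_eq ha ha, M.energyInner_eq hb hb, M.energyInner_eq ha hb] at h
  rw [incVar, ← h]
  exact integral_nonneg fun ω => sq_nonneg _

lemma IsModel.lintegral_incVar (M : IsModel γ γhat β₀ W P X Ψ P' p) (ha : 0 < a.1 ∧ 0 < a.2)
    (hb : 0 < b.1 ∧ 0 < b.2) (t s : ℝ≥0) (x y : E d) :
    ∫⁻ ω', ENNReal.ofReal (incVar β₀ γ p X t s x y a b ω') ∂P' = ENNReal.ofReal
      ((∫⁻ ω', pathEnergy β₀ γ p X t t x x a a ω' ∂P').toReal +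
        (∫⁻ ω', pathEnergy β₀ γ p X s s y y b b ω' ∂P').toReal -
        2 * (∫⁻ ω', pathEnergy β₀ γ p X t s x y a b ω' ∂P').toReal) := by
  have i1 := integrable_toReal_of_lintegral_ne_top
    (M.measurable_pathEnergy ha ha t t x x).aemeasurable (M.lintegral_pathEnergy_ne_top ha ha t t x x)
  have i2 := integrable_toReal_of_lintegral_ne_top
    (M.measurable_pathEnergy hb hb s s y y).aemeasurable (M.lintegral_pathEnergy_ne_top hb hb s s y y)
  have i3 := integrable_toReal_of_lintegral_ne_top
    (M.measurable_pathEnergy ha hb t s x y).aemeasurable (M.lintegral_pathEnergy_ne_top ha hb t s x y)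
  have i4 : Integrable (fun ω' => (pathEnergy β₀ γ p X t t x x a a ω').toReal +
      (pathEnergy β₀ γ p X s s y y b b ω').toReal) P' := i1.add i2
  have i5 : Integrable (incVar β₀ γ p X t s x y a b) P' := i4.sub (i3.const_mul 2)
  rw [← ofReal_integral_eq_lintegral_ofReal i5
    (Eventually.of_forall fun ω' => M.incVar_nonneg ha hb t s x y ω')]
  congr 1
  unfold incVar
  rw [integral_sub i4 (i3.const_mul 2), integral_const_mul, integral_add i1 i2,
    integral_toReal (M.measurable_pathEnergy ha ha t t x x).aemeasurable
      (Eventually.of_forall fun ω' => (M.pathEnergy_ne_top ha ha t t x x ω').lt_top),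
    integral_toReal (M.measurable_pathEnergy hb hb s s y y).aemeasurable
      (Eventually.of_forall fun ω' => (M.pathEnergy_ne_top hb hb s s y y ω').lt_top),
    integral_toReal (M.measurable_pathEnergy ha hb t s x y).aemeasurable
      (Eventually.of_forall fun ω' => (M.pathEnergy_ne_top ha hb t s x y ω').lt_top)]

lemma IsModel.lintegral_noise_sub_pow (M : IsModel γ γhat β₀ W P X Ψ P' p) (ha : 0 < a.1 ∧ 0 < a.2)
    (hb : 0 < b.1 ∧ 0 < b.2) (t s : ℝ≥0) (x y : E d) (hY : IsNoiseField W P X p Y) (m : ℕ) (ω' : Ω') :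
    ∫⁻ ω, ‖Y a t x (ω, ω') - Y b s y (ω, ω')‖ₑ ^ (2 * m) ∂P =
      gaussianMoment m * ENNReal.ofReal (incVar β₀ γ p X t s x y a b ω') ^ m := by
  have h := M.noise.lintegral_sub_pow ⟨_, M.finiteEnergy ha t x ω'⟩ ⟨_, M.finiteEnergy hb s y ω'⟩ m
  simp only at h
  rw [M.energyInner_eq ha ha, M.energyInner_eq hb hb, M.energyInner_eq ha hb] at h
  rw [incVar, ← h]
  refine lintegral_congr_ae ?_
  filter_upwards [hY.eq_noise a ha.1 ha.2 t x ω' (M.finiteEnergy ha t x ω'),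
    hY.eq_noise b hb.1 hb.2 s y ω' (M.finiteEnergy hb s y ω')] with ω h1 h2
  rw [h1, h2]

lemma IsModel.lintegral_noise_sub_sq (M : IsModel γ γhat β₀ W P X Ψ P' p) (ha : 0 < a.1 ∧ 0 < a.2)
    (hb : 0 < b.1 ∧ 0 < b.2) (t s : ℝ≥0) (x y : E d) (hY : IsNoiseField W P X p Y) (ω' : Ω') :
    ∫⁻ ω, ‖Y a t x (ω, ω') - Y b s y (ω, ω')‖ₑ ^ 2 ∂P =
      ENNReal.ofReal (incVar β₀ γ p X t s x y a b ω') := by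
  have h := M.noise.lintegral_sub_sq ⟨_, M.finiteEnergy ha t x ω'⟩ ⟨_, M.finiteEnergy hb s y ω'⟩
  simp only at h
  rw [M.energyInner_eq ha ha, M.energyInner_eq hb hb, M.energyInner_eq ha hb] at h
  rw [incVar, ← h]
  refine lintegral_congr_ae ?_
  filter_upwards [hY.eq_noise a ha.1 ha.2 t x ω' (M.finiteEnergy ha t x ω'),
    hY.eq_noise b hb.1 hb.2 s y ω' (M.finiteEnergy hb s y ω')] with ω h1 h2
  rw [h1, h2]

lemma IsModel.eLpNorm_noise_sub (M : IsModel γ γhat β₀ W P X Ψ P' p) (ha : 0 < a.1 ∧ 0 < a.2)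
    (hb : 0 < b.1 ∧ 0 < b.2) (t s : ℝ≥0) (x y : E d) (hY : IsNoiseField W P X p Y) :
    eLpNorm (Y a t x - Y b s y) 2 (P.prod P') = ENNReal.ofReal
      ((∫⁻ ω', pathEnergy β₀ γ p X t t x x a a ω' ∂P').toReal +
        (∫⁻ ω', pathEnergy β₀ γ p X s s y y b b ω' ∂P').toReal -
        2 * (∫⁻ ω', pathEnergy β₀ γ p X t s x y a b ω' ∂P').toReal) ^ (1 / 2 : ℝ) := by
  have hm : Measurable fun z => ‖(Y a t x - Y b s y) z‖ₑ ^ 2 :=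
    ((hY.stronglyMeasurable a t x).sub (hY.stronglyMeasurable b s y)).enorm.pow_const 2
  rw [eLpNorm_eq_lintegral_rpow_enorm_toReal two_ne_zero ENNReal.ofNat_ne_top]
  simp only [ENNReal.toReal_ofNat]
  congr 1
  rw [← M.lintegral_incVar ha hb t s x y]
  simp_rw [← M.lintegral_noise_sub_sq ha hb t s x y hY]
  simp only [ENNReal.rpow_ofNat]
  exact lintegral_prod_symm' (μ := P) (ν := P') (fun z => ‖(Y a t x - Y b s y) z‖ₑ ^ 2) hm

/-- Given the path, the difference is Gaussian, so its moment of order `2 * m` is a constant times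
the `m`-th power of its conditional variance. The weighted Jensen inequality then leaves only the
mean of that variance. -/
lemma IsModel.lintegral_lintegral_noise_sub_sq_pow_le (M : IsModel γ γhat β₀ W P X Ψ P' p) (ha : 0 < a.1 ∧ 0 < a.2)
    (hb : 0 < b.1 ∧ 0 < b.2) (t s : ℝ≥0) (x y : E d) (hY : IsNoiseField W P X p Y) {m : ℕ} (hm : 1 ≤ m) :
    ∫⁻ ω, (∫⁻ ω', ‖Y a t x (ω, ω') - Y b s y (ω, ω')‖ₑ ^ 2 ∂P') ^ m ∂P ≤
      gaussianMoment m * ENNReal.ofReal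
      ((∫⁻ ω', pathEnergy β₀ γ p X t t x x a a ω' ∂P').toReal +
        (∫⁻ ω', pathEnergy β₀ γ p X s s y y b b ω' ∂P').toReal -
        2 * (∫⁻ ω', pathEnergy β₀ γ p X t s x y a b ω' ∂P').toReal) ^ m := by
  have hD : Measurable fun z => ‖Y a t x z - Y b s y z‖ₑ :=
    ((hY.stronglyMeasurable a t x).sub (hY.stronglyMeasurable b s y)).enorm
  rw [← M.lintegral_incVar ha hb t s x y]
  refine lintegral_lintegral_sq_pow_le (D := fun z => ‖Y a t x z - Y b s y z‖ₑ)
    (s := fun ω' => ENNReal.ofReal (incVar β₀ γ p X t s x y a b ω')) hD ?_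
    (fun _ => ENNReal.ofReal_ne_top) hm (gaussianMoment_lt_top m).ne
    (Eventually.of_forall fun ω' => (M.lintegral_noise_sub_pow ha hb t s x y hY m ω').le)
  have h1 := M.measurable_pathEnergy ha ha t t x x
  have h2 := M.measurable_pathEnergy hb hb s s y y
  have h3 := M.measurable_pathEnergy ha hb t s x y
  unfold incVar
  fun_prop

lemma IsModel.lintegral_exp_noise (M : IsModel γ γhat β₀ W P X Ψ P' p) (ha : 0 < a.1 ∧ 0 < a.2) (t : ℝ≥0)
    (x : E d) (hY : IsNoiseField W P X p Y) (q : ℝ) (ω' : Ω') :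
    ∫⁻ ω, ENNReal.ofReal (Real.exp (q * Y a t x (ω, ω'))) ∂P = ENNReal.ofReal
      (Real.exp (q ^ 2 / 2 * (pathEnergy β₀ γ p X t t x x a a ω').toReal)) := by
  have h := M.noise.lintegral_exp ⟨_, M.finiteEnergy ha t x ω'⟩ q
  simp only at h
  rw [M.energyInner_eq ha ha] at h
  rw [← h]
  refine lintegral_congr_ae ?_
  filter_upwards [hY.eq_noise a ha.1 ha.2 t x ω' (M.finiteEnergy ha t x ω')] with ω h1
  rw [h1]

end Bounds

end Model


/-! ### The limiting noise integrals and the moments of the Feynman–Kac solution. -/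

section Limit

variable {d : ℕ} {p : E d → ℝ} {γ : E d → ℝ≥0∞} {γhat Ψ : E d → ℝ} {β₀ : ℝ}
  {Ω Ω' : Type*} [mΩ : MeasurableSpace Ω] [mΩ' : MeasurableSpace Ω'] {P : Measure Ω}
  {P' : Measure Ω'} {X : ℝ≥0 → Ω' → E d}
  {W : {φ : ℝ × E d → ℝ // FiniteEnergy β₀ γ φ} → Ω → ℝ}
  {Y : ℝ × ℝ → ℝ≥0 → E d → Ω × Ω' → ℝ}

/-- `V` is the `L²`-limit of the mollified noise integrals `Y` at `(t, x)`. -/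
def IsNoiseLimit (P : Measure Ω) (P' : Measure Ω') (Y : ℝ × ℝ → ℝ≥0 → E d → Ω × Ω' → ℝ)
    (t : ℝ≥0) (x : E d) (V : Ω × Ω' → ℝ) : Prop :=
  MemLp V 2 (P.prod P') ∧
    Tendsto (fun q : ℝ × ℝ => eLpNorm (Y q t x - V) 2 (P.prod P')) (𝓝[>] 0 ×ˢ 𝓝[>] 0) (𝓝 0)

lemma eventually_pos_prod : ∀ᶠ q : ℝ × ℝ in 𝓝[>] 0 ×ˢ 𝓝[>] 0, 0 < q.1 ∧ 0 < q.2 := by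
  have h0 : ∀ᶠ e : ℝ in 𝓝[>] 0, 0 < e := eventually_mem_nhdsWithin
  exact h0.prod_mk h0

variable [IsProbabilityMeasure P] [IsProbabilityMeasure P']

lemma IsModel.tendsto_toReal_lintegral_pathEnergy (M : IsModel γ γhat β₀ W P X Ψ P' p)
    (t s : ℝ≥0) (x y : E d) {ι : Type*} {l : Filter ι} {a b : ι → ℝ × ℝ}
    (ha : Tendsto a l (𝓝[>] 0 ×ˢ 𝓝[>] 0)) (hb : Tendsto b l (𝓝[>] 0 ×ˢ 𝓝[>] 0)) :
    Tendsto (fun i => (∫⁻ ω', pathEnergy β₀ γ p X t s x y (a i) (b i) ω' ∂P').toReal) l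
      (𝓝 (limitEnergy β₀ γhat Ψ t s (x - y)).toReal) := by
  have h1 := M.regular.tendsto_lintegral_energy M.dim_pos M.exponent_pos M.exponent_lt_one M.kernel
    M.mollifier M.measurable_psi M.psi_nonneg M.dalang t s x y
  have h2 := h1.comp (ha.prodMk hb)
  have h3 := limitEnergy_lt_top (γhat := γhat) M.exponent_pos M.measurable_psi M.psi_nonneg M.dalang
    t.2 s.2 (x - y)
  exact (ENNReal.tendsto_toReal h3.ne).comp h2

/-- The two approximations have independent parameters: for one space-time point this expresses the
Cauchy property, for two it identifies the variance of the increment. -/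
lemma IsModel.tendsto_variance (M : IsModel γ γhat β₀ W P X Ψ P' p) (t s : ℝ≥0) (x y : E d) :
    Tendsto (fun q : (ℝ × ℝ) × (ℝ × ℝ) => ENNReal.ofReal
      ((∫⁻ ω', pathEnergy β₀ γ p X t t x x q.1 q.1 ω' ∂P').toReal +
        (∫⁻ ω', pathEnergy β₀ γ p X s s y y q.2 q.2 ω' ∂P').toReal -
        2 * (∫⁻ ω', pathEnergy β₀ γ p X t s x y q.1 q.2 ω' ∂P').toReal))
      ((𝓝[>] 0 ×ˢ 𝓝[>] 0) ×ˢ (𝓝[>] 0 ×ˢ 𝓝[>] 0))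
      (𝓝 (ENNReal.ofReal (limitVar β₀ γhat Ψ t s x y))) := by
  have h1 := M.tendsto_toReal_lintegral_pathEnergy t t x x
    (l := (𝓝[>] (0 : ℝ) ×ˢ 𝓝[>] (0 : ℝ)) ×ˢ (𝓝[>] (0 : ℝ) ×ˢ 𝓝[>] (0 : ℝ))) tendsto_fst tendsto_fst
  have h2 := M.tendsto_toReal_lintegral_pathEnergy s s y y
    (l := (𝓝[>] (0 : ℝ) ×ˢ 𝓝[>] (0 : ℝ)) ×ˢ (𝓝[>] (0 : ℝ) ×ˢ 𝓝[>] (0 : ℝ))) tendsto_snd tendsto_snd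
  have h3 := M.tendsto_toReal_lintegral_pathEnergy t s x y
    (l := (𝓝[>] (0 : ℝ) ×ˢ 𝓝[>] (0 : ℝ)) ×ˢ (𝓝[>] (0 : ℝ) ×ˢ 𝓝[>] (0 : ℝ))) tendsto_fst tendsto_snd
  rw [sub_self] at h1 h2
  exact ENNReal.tendsto_ofReal ((h1.add h2).sub (h3.const_mul 2))

lemma limitVar_self (t : ℝ≥0) (x : E d) : limitVar β₀ γhat Ψ t t x x = 0 := by
  rw [limitVar, sub_self]; ring

lemma IsModel.memLp_noise (M : IsModel γ γhat β₀ W P X Ψ P' p) (hY : IsNoiseField W P X p Y)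
    (a : ℝ × ℝ) (t : ℝ≥0) (x : E d) : MemLp (Y a t x) 2 (P.prod P') := by
  by_cases ha : 0 < a.1 ∧ 0 < a.2
  · have hm := hY.stronglyMeasurable a t x
    refine ⟨hm.aestronglyMeasurable, ?_⟩
    rw [eLpNorm_lt_top_iff_lintegral_rpow_enorm_lt_top two_ne_zero ENNReal.ofNat_ne_top]
    have h1 : ∀ ω', ∫⁻ ω, ‖Y a t x (ω, ω')‖ₑ ^ 2 ∂P = pathEnergy β₀ γ p X t t x x a a ω' := by
      intro ω'
      have h2 : ∫⁻ ω, ‖Y a t x (ω, ω')‖ₑ ^ 2 ∂P =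
          ∫⁻ ω, ‖W ⟨_, M.finiteEnergy ha t x ω'⟩ ω‖ₑ ^ 2 ∂P := by
        refine lintegral_congr_ae ?_
        filter_upwards [hY.eq_noise a ha.1 ha.2 t x ω' (M.finiteEnergy ha t x ω')] with ω h1
        rw [h1]
      have h3 := M.noise.covariance ⟨_, M.finiteEnergy ha t x ω'⟩ ⟨_, M.finiteEnergy ha t x ω'⟩
      simp only at h3
      rw [M.energyInner_eq ha ha] at h3
      have h4 := M.noise.memLp ⟨_, M.finiteEnergy ha t x ω'⟩
      have h5 : Integrable (fun ω => W ⟨_, M.finiteEnergy ha t x ω'⟩ ω *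
        W ⟨_, M.finiteEnergy ha t x ω'⟩ ω) P := h4.integrable_mul h4
      rw [h2, ← ENNReal.ofReal_toReal (M.pathEnergy_ne_top ha ha t t x x ω'), ← h3,
        ofReal_integral_eq_lintegral_ofReal h5
          (Eventually.of_forall fun ω => mul_self_nonneg _)]
      refine lintegral_congr fun ω => ?_
      rw [← pow_two, ← enorm_pow, Real.enorm_of_nonneg (sq_nonneg _)]
    have h5 : ∫⁻ z, ‖Y a t x z‖ₑ ^ 2 ∂(P.prod P') = ∫⁻ ω', pathEnergy β₀ γ p X t t x x a a ω' ∂P' := by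
      rw [lintegral_prod_symm' _ (hm.enorm.pow_const 2)]
      exact lintegral_congr h1
    have h6 := (M.lintegral_pathEnergy_ne_top ha ha t t x x).lt_top
    rw [← h5] at h6
    convert h6 using 3
    norm_num
  · rw [hY.eq_zero a ha]
    exact MemLp.zero

/-- The squared `L²` distance of two approximations at the same point tends to `limitVar β₀ γhat Ψ t
t x x = 0`, and `L²` is complete. -/
lemma IsModel.exists_noiseLimit (M : IsModel γ γhat β₀ W P X Ψ P' p) (hY : IsNoiseField W P X p Y)
    (t : ℝ≥0) (x : E d) : ∃ V, IsNoiseLimit P P' Y t x V := by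
  set F : ℝ × ℝ → Lp ℝ 2 (P.prod P') := fun q => (M.memLp_noise hY q t x).toLp _ with hF
  set l : Filter (ℝ × ℝ) := 𝓝[>] 0 ×ˢ 𝓝[>] 0 with hl
  have hpos2 : ∀ᶠ q in l ×ˢ l, (0 < q.1.1 ∧ 0 < q.1.2) ∧ (0 < q.2.1 ∧ 0 < q.2.2) :=
    eventually_pos_prod.prod_mk eventually_pos_prod
  have h1 : Tendsto (fun q : (ℝ × ℝ) × (ℝ × ℝ) => edist (F q.1) (F q.2)) (l ×ˢ l) (𝓝 0) := by
    have h2 := M.tendsto_variance t t x x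
    rw [limitVar_self, ENNReal.ofReal_zero] at h2
    have h3 := ((ENNReal.continuous_rpow_const (y := (1 / 2 : ℝ))).tendsto _).comp h2
    rw [ENNReal.zero_rpow_of_pos (by norm_num)] at h3
    refine h3.congr' ?_
    filter_upwards [hpos2] with q hq
    rw [hF, Lp.edist_toLp_toLp, M.eLpNorm_noise_sub hq.1 hq.2 t t x x hY]
    rfl
  have h2 : Cauchy (map F l) := by
    rw [cauchy_map_iff]
    refine ⟨inferInstance, ?_⟩
    rw [tendsto_uniformity_iff_dist_tendsto_zero]
    have h3 := (ENNReal.tendsto_toReal ENNReal.zero_ne_top).comp h1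
    rw [ENNReal.toReal_zero] at h3
    refine h3.congr fun q => ?_
    simp only [Function.comp_apply, edist_dist, ENNReal.toReal_ofReal dist_nonneg]
  obtain ⟨V, hV⟩ := cauchy_iff_exists_le_nhds.1 h2
  refine ⟨V, Lp.memLp V, ?_⟩
  have h3 : Tendsto F l (𝓝 V) := hV
  rw [tendsto_iff_edist_tendsto_0] at h3
  refine h3.congr fun q => ?_
  rw [Lp.edist_def]
  exact eLpNorm_congr_ae ((MemLp.coeFn_toLp _).sub (ae_eq_refl _))

/-- Given the path, `E e^{qY} = exp(q²/2 · energy)`, so the uniform exponential moments of the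
energy apply to the approximations. Fatou's lemma carries the bound to the limit. -/
lemma IsModel.exists_lintegral_exp_le (M : IsModel γ γhat β₀ W P X Ψ P' p)
    (hY : IsNoiseField W P X p Y) (q : ℝ) {T : ℝ} (hT : 0 ≤ T) :
    ∃ C : ℝ≥0, ∀ t : ℝ≥0, t ≤ T → ∀ x V, IsNoiseLimit P P' Y t x V →
      ∫⁻ ω, ∫⁻ ω', ENNReal.ofReal (Real.exp (q * V (ω, ω'))) ∂P' ∂P ≤ C := by
  obtain ⟨C, hC⟩ := M.regular.exists_lintegral_exp_energy_le M.dim_pos M.exponent_pos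
    M.exponent_lt_one M.kernel M.mollifier M.measurable_psi M.dalang (lam := q ^ 2 / 2)
    (by positivity) hT
  refine ⟨C, fun t ht x V hV => ?_⟩
  have h := lintegral_lintegral_pow_le_of_tendsto (P := P) (P' := P')
    (l := 𝓝[>] (0 : ℝ) ×ˢ 𝓝[>] (0 : ℝ))
    (Y := fun a => Y a t x) (V := V)
    (Eventually.of_forall fun a => (hY.stronglyMeasurable a t x).aestronglyMeasurable)
    hV.1.aestronglyMeasurable hV.2 (F := fun v => ENNReal.ofReal (Real.exp (q * v)))
    (ENNReal.continuous_ofReal.comp (by fun_prop)) 1 (R := fun _ => C) tendsto_const_nhds ?_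
  · simpa using h
  · filter_upwards [eventually_pos_prod] with a ha
    simp only [pow_one]
    rw [lintegral_lintegral_swap
      (f := fun ω ω' => ENNReal.ofReal (Real.exp (q * Y a t x (ω, ω')))) ?_]
    · simp_rw [M.lintegral_exp_noise ha t x hY q]
      exact hC a.1 a.2 ha.1 ha.2 t ht x
    · have := (hY.stronglyMeasurable a t x).measurable
      exact Measurable.aemeasurable (by fun_prop)

/-- The moment bound for a pair of approximations survives the limit by Fatou's lemma along the
product filter. -/
lemma IsModel.lintegral_noiseLimit_sub_le (M : IsModel γ γhat β₀ W P X Ψ P' p)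
    (hY : IsNoiseField W P X p Y) {t s : ℝ≥0} {x y : E d} {V V' : Ω × Ω' → ℝ}
    (hV : IsNoiseLimit P P' Y t x V) (hV' : IsNoiseLimit P P' Y s y V') {m : ℕ} (hm : 1 ≤ m) :
    ∫⁻ ω, (∫⁻ ω', ‖V (ω, ω') - V' (ω, ω')‖ₑ ^ 2 ∂P') ^ m ∂P ≤
      gaussianMoment m * ENNReal.ofReal (limitVar β₀ γhat Ψ t s x y) ^ m := by
  set l : Filter (ℝ × ℝ) := 𝓝[>] 0 ×ˢ 𝓝[>] 0 with hl
  have hpos2 : ∀ᶠ q in l ×ˢ l, (0 < q.1.1 ∧ 0 < q.1.2) ∧ (0 < q.2.1 ∧ 0 < q.2.2) :=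
    eventually_pos_prod.prod_mk eventually_pos_prod
  have hR := ENNReal.Tendsto.const_mul (a := gaussianMoment m)
    (((ENNReal.continuous_pow m).tendsto _).comp (M.tendsto_variance t s x y))
    (Or.inr (gaussianMoment_lt_top m).ne)
  refine lintegral_lintegral_pow_le_of_tendsto (P := P) (P' := P') (l := l ×ˢ l)
    (Y := fun q => Y q.1 t x - Y q.2 s y) (V := V - V')
    (Eventually.of_forall fun q => ((hY.stronglyMeasurable q.1 t x).sub
      (hY.stronglyMeasurable q.2 s y)).aestronglyMeasurable)
    (hV.1.aestronglyMeasurable.sub hV'.1.aestronglyMeasurable) ?_ (F := fun v => ‖v‖ₑ ^ 2)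
    ((ENNReal.continuous_pow 2).comp continuous_enorm) m hR ?_
  · have h1 := (hV.2.comp tendsto_fst).add (hV'.2.comp (tendsto_snd (f := l) (g := l)))
    rw [add_zero] at h1
    refine tendsto_of_tendsto_of_tendsto_of_le_of_le tendsto_const_nhds h1 (fun _ => zero_le)
      fun q => ?_
    have h2 : Y q.1 t x - Y q.2 s y - (V - V') = (Y q.1 t x - V) - (Y q.2 s y - V') := by abel
    simp only [h2]
    exact eLpNorm_sub_le
      ((hY.stronglyMeasurable q.1 t x).aestronglyMeasurable.sub hV.1.aestronglyMeasurable)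
      ((hY.stronglyMeasurable q.2 s y).aestronglyMeasurable.sub hV'.1.aestronglyMeasurable)
      (by norm_num)
  · filter_upwards [hpos2] with q hq
    exact M.lintegral_lintegral_noise_sub_sq_pow_le hq.1 hq.2 t s x y hY hm

/-- Moment bound for the increments of exponential averages of the limiting noise integrals. -/
theorem IsModel.exists_lintegral_sub_pow_le (M : IsModel γ γhat β₀ W P X Ψ P' p)
    (hY : IsNoiseField W P X p Y) {m : ℕ} (hm : 1 ≤ m) {T : ℝ} (hT : 0 ≤ T) :
    ∃ K : ℝ≥0, ∀ (t s : ℝ≥0), t ≤ T → s ≤ T → ∀ (x y : E d) (V V' : Ω × Ω' → ℝ) (u u' : Ω → ℝ),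
      IsNoiseLimit P P' Y t x V → IsNoiseLimit P P' Y s y V' →
      (∀ᵐ ω ∂P, Integrable (fun ω' => Real.exp (V (ω, ω'))) P' ∧
        u ω = ∫ ω', Real.exp (V (ω, ω')) ∂P') →
      (∀ᵐ ω ∂P, Integrable (fun ω' => Real.exp (V' (ω, ω'))) P' ∧
        u' ω = ∫ ω', Real.exp (V' (ω, ω')) ∂P') →
      ∫⁻ ω, ‖u ω - u' ω‖ₑ ^ (2 * m) ∂P ≤
        K * ENNReal.ofReal (limitVar β₀ γhat Ψ t s x y) ^ m := by
  obtain ⟨A, hA⟩ := M.exists_lintegral_exp_le hY ((4 * m : ℕ) : ℝ) hT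
  have hg := (gaussianMoment_lt_top (2 * m)).ne
  have hK : gaussianMoment (2 * m) ^ (1 / 2 : ℝ) * (2 ^ (4 * m) * (A : ℝ≥0∞)) ^ (1 / 2 : ℝ) ≠ ∞ := by
    refine ENNReal.mul_ne_top (ENNReal.rpow_ne_top_of_nonneg (by norm_num) hg)
      (ENNReal.rpow_ne_top_of_nonneg (by norm_num) (by finiteness))
  refine ⟨(gaussianMoment (2 * m) ^ (1 / 2 : ℝ) *
    (2 ^ (4 * m) * (A : ℝ≥0∞)) ^ (1 / 2 : ℝ)).toNNReal, fun t s ht hs x y V V' u u' hV hV' hu hu' => ?_⟩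
  rw [ENNReal.coe_toNNReal hK]
  exact lintegral_enorm_sub_pow_le hV.1.aestronglyMeasurable hV'.1.aestronglyMeasurable hm
    (M.lintegral_noiseLimit_sub_le hY hV hV' (by omega)) (hA t ht x V hV) (hA s hs y V' hV') hu hu'

lemma IsModel.ae_integrable_exp (M : IsModel γ γhat β₀ W P X Ψ P' p)
    (hY : IsNoiseField W P X p Y) {t : ℝ≥0} {x : E d} {V : Ω × Ω' → ℝ}
    (hV : IsNoiseLimit P P' Y t x V) :
    ∀ᵐ ω ∂P, Integrable (fun ω' => Real.exp (V (ω, ω'))) P' := by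
  obtain ⟨C, hC⟩ := M.exists_lintegral_exp_le hY 1 t.2
  have h1 := hC t le_rfl x V hV
  simp only [one_mul] at h1
  have hm : AEStronglyMeasurable (fun z => Real.exp (V z)) (P.prod P') :=
    Real.continuous_exp.comp_aestronglyMeasurable hV.1.aestronglyMeasurable
  have h2 : ∀ᵐ ω ∂P, ∫⁻ ω', ENNReal.ofReal (Real.exp (V (ω, ω'))) ∂P' < ∞ :=
    ae_lt_top' (AEMeasurable.lintegral_prod_right' hm.aemeasurable.ennreal_ofReal)
      (h1.trans_lt ENNReal.coe_lt_top).ne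
  filter_upwards [h2, hm.prodMk_left] with ω h3 h4
  refine ⟨h4, ?_⟩
  rw [hasFiniteIntegral_iff_ofReal (Eventually.of_forall fun _ => (Real.exp_pos _).le)]
  exact h3

/-! ### Transfer to the original process -/

variable {X₀ : ℝ≥0 → Ω' → E d}

lemma IsModel.isNoiseIntegral (M : IsModel γ γhat β₀ W P X Ψ P' p) (hY : IsNoiseField W P X p Y)
    (hX : ∀ᵐ ω' ∂P', ∀ t, X t ω' = X₀ t ω') {ε δ : ℝ} (hε : 0 < ε) (hδ : 0 < δ) (t : ℝ≥0) (x : E d) :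
    IsNoiseIntegral W P P' (fun ω' => Phi p ε δ t x fun s => X₀ s ω') (Y (ε, δ) t x) := by
  refine ⟨(hY.stronglyMeasurable _ t x).aestronglyMeasurable, ?_⟩
  filter_upwards [hX] with ω' hω'
  have h1 : (fun s => X₀ s ω') = fun s => X s ω' := funext fun s => (hω' s).symm
  simp only [h1]
  exact ⟨M.finiteEnergy (a := (ε, δ)) ⟨hε, hδ⟩ t x ω', hY.eq_noise (ε, δ) hε hδ t x ω' _⟩

/-- Both variables have the same sections up to null sets of the noise, for almost every path; joint
measurability makes this an equality almost everywhere on the product. -/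
lemma IsNoiseIntegral.ae_eq {Φ : Ω' → ℝ × E d → ℝ} {Y₁ Y₂ : Ω × Ω' → ℝ}
    (h₁ : IsNoiseIntegral W P P' Φ Y₁) (h₂ : IsNoiseIntegral W P P' Φ Y₂) :
    Y₁ =ᵐ[P.prod P'] Y₂ := by
  have hm : AEMeasurable (fun z => ‖Y₁ z - Y₂ z‖ₑ) (P.prod P') := (h₁.1.sub h₂.1).enorm
  have h : ∫⁻ z, ‖Y₁ z - Y₂ z‖ₑ ∂(P.prod P') = 0 := by
    rw [lintegral_prod_symm _ hm]
    rw [lintegral_congr_ae (g := fun _ => 0), lintegral_zero]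
    filter_upwards [h₁.2, h₂.2] with ω' ⟨f1, e1⟩ ⟨f2, e2⟩
    rw [lintegral_congr_ae (g := fun _ => 0), lintegral_zero]
    filter_upwards [e1, e2] with ω h3 h4
    rw [h3, h4]; simp
  rw [lintegral_eq_zero_iff' hm] at h
  filter_upwards [h] with z hz
  simpa [sub_eq_zero] using hz

/-- Any admissible approximants agree almost everywhere with the chosen family `Y`. The estimates
thus hold for every Feynman–Kac solution, not only for the one constructed here. -/
lemma IsModel.isNoiseLimit_of_isDeltaIntegral (M : IsModel γ γhat β₀ W P X Ψ P' p)
    (hY : IsNoiseField W P X p Y) (hX : ∀ᵐ ω' ∂P', ∀ t, X t ω' = X₀ t ω') {t : ℝ≥0} {x : E d}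
    {V : Ω × Ω' → ℝ} (h : IsDeltaIntegral W P X₀ P' p t x V) : IsNoiseLimit P P' Y t x V := by
  obtain ⟨hV, Y₀, h1, h2⟩ := h
  refine ⟨hV, h2.congr' ?_⟩
  filter_upwards [eventually_pos_prod] with q hq
  exact eLpNorm_congr_ae
    (((h1 q.1 q.2 hq.1 hq.2).ae_eq (M.isNoiseIntegral hY hX hq.1 hq.2 t x)).sub (ae_eq_refl _))

lemma IsModel.exists_isFeynmanKac (M : IsModel γ γhat β₀ W P X Ψ P' p)
    (hX : ∀ᵐ ω' ∂P', ∀ t, X t ω' = X₀ t ω') : ∃ u, IsFeynmanKac W P X₀ P' p (fun _ => 1) u := by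
  obtain ⟨Y, hY⟩ := M.exists_noiseField
  choose V hV using fun t x => M.exists_noiseLimit hY t x
  refine ⟨fun t x ω => ∫ ω', Real.exp (V t x (ω, ω')) ∂P', fun t x => ⟨V t x, ?_, ?_⟩⟩
  · exact ⟨(hV t x).1, fun ε δ => Y (ε, δ) t x,
      fun ε δ hε hδ => M.isNoiseIntegral hY hX hε hδ t x, (hV t x).2⟩
  · filter_upwards [M.ae_integrable_exp hY (hV t x)] with ω hω
    simpa using hω

/-- Moment bound for the increments of the Feynman–Kac solution. -/
theorem IsModel.exists_lintegral_feynmanKac_sub_le (M : IsModel γ γhat β₀ W P X Ψ P' p)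
    (hX : ∀ᵐ ω' ∂P', ∀ t, X t ω' = X₀ t ω') {u : ℝ≥0 → E d → Ω → ℝ}
    (hu : IsFeynmanKac W P X₀ P' p (fun _ => 1) u) {m : ℕ} (hm : 1 ≤ m) {T : ℝ} (hT : 0 ≤ T) :
    ∃ K : ℝ≥0, ∀ (t s : ℝ≥0), t ≤ T → s ≤ T → ∀ (x y : E d),
      ∫⁻ ω, ‖u t x ω - u s y ω‖ₑ ^ (2 * m) ∂P ≤
        K * ENNReal.ofReal (limitVar β₀ γhat Ψ t s x y) ^ m := by
  obtain ⟨Y, hY⟩ := M.exists_noiseField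
  obtain ⟨K, hK⟩ := M.exists_lintegral_sub_pow_le hY hm hT
  refine ⟨K, fun t s ht hs x y => ?_⟩
  obtain ⟨V, hV, hVu⟩ := hu t x
  obtain ⟨V', hV', hVu'⟩ := hu s y
  simp only [one_mul] at hVu hVu'
  exact hK t s ht hs x y V V' _ _ (M.isNoiseLimit_of_isDeltaIntegral hY hX hV)
    (M.isNoiseLimit_of_isDeltaIntegral hY hX hV') hVu hVu'

lemma IsFeynmanKac.aemeasurable {u : ℝ≥0 → E d → Ω → ℝ}
    (hu : IsFeynmanKac W P X₀ P' p (fun _ => 1) u) (t : ℝ≥0) (x : E d) : AEMeasurable (u t x) P := by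
  obtain ⟨V, hV, hVu⟩ := hu t x
  simp only [one_mul] at hVu
  have hm : AEStronglyMeasurable (fun z => Real.exp (V z)) (P.prod P') :=
    Real.continuous_exp.comp_aestronglyMeasurable hV.1.aestronglyMeasurable
  exact hm.integral_prod_right'.aemeasurable.congr (hVu.mono fun ω h => h.2.symm)

end Limit


/-! ### Increments of the limiting variances -/

section Increments

variable {d : ℕ} {γhat Ψ : E d → ℝ} {β₀ : ℝ}

lemma lintegral_Icc_reflect (f : ℝ → ℝ≥0∞) (t : ℝ) :
    ∫⁻ a in Icc 0 t, f (t - a) = ∫⁻ r in Icc 0 t, f r := by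
  have h1 := (Measure.measurePreserving_sub_left (volume : Measure ℝ) t).setLIntegral_comp_preimage_emb
    (Homeomorph.subLeft t).measurableEmbedding f (Icc 0 t)
  rw [← h1]
  congr 2
  ext a
  simp only [mem_Icc, mem_preimage]
  constructor <;> rintro ⟨h1, h2⟩ <;> constructor <;> linarith

lemma lintegral_rectangle_le {f g h : ℝ → ℝ → ℝ≥0∞} (hg : Measurable fun q : ℝ × ℝ => g q.1 q.2)
    {K : ℝ≥0∞} (hK : K ≠ ∞) (hle : ∀ r r', f r r' ≤ g r r' + K * h r r') {A B T : ℝ} (hA : A ≤ T)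
    (hB : B ≤ T) :
    ∫⁻ r in Icc 0 A, ∫⁻ r' in Icc 0 B, f r r' ≤
      (∫⁻ r in Icc 0 A, ∫⁻ r' in Icc 0 B, g r r') +
        K * ∫⁻ r in Icc 0 T, ∫⁻ r' in Icc 0 T, h r r' := by
  have hg2 : Measurable fun r => ∫⁻ r' in Icc 0 B, g r r' := hg.lintegral_prod_right'
  calc _ ≤ ∫⁻ r in Icc 0 A, ((∫⁻ r' in Icc 0 B, g r r') + K * ∫⁻ r' in Icc 0 B, h r r') := by
        refine lintegral_mono fun r => ?_
        rw [← lintegral_const_mul' _ _ hK,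
          ← lintegral_add_left (f := fun r' => g r r') (hg.comp measurable_prodMk_left)]
        exact lintegral_mono fun r' => hle r r'
    _ = (∫⁻ r in Icc 0 A, ∫⁻ r' in Icc 0 B, g r r') +
          K * ∫⁻ r in Icc 0 A, ∫⁻ r' in Icc 0 B, h r r' := by
        rw [lintegral_add_left hg2, lintegral_const_mul' _ _ hK]
    _ ≤ _ := by
        gcongr

/-- Bounding the variance of a difference requires only that each diagonal energy exceed the mixed
energy by little. -/
lemma toReal_add_sub_le {a b c x y : ℝ≥0∞} (ha : a ≤ c + x) (hb : b ≤ c + y) (hc : c ≠ ∞)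
    (hx : x ≠ ∞) (hy : y ≠ ∞) :
    ENNReal.ofReal (a.toReal + b.toReal - 2 * c.toReal) ≤ x + y := by
  have h1 := ENNReal.toReal_mono (ENNReal.add_ne_top.2 ⟨hc, hx⟩) ha
  have h2 := ENNReal.toReal_mono (ENNReal.add_ne_top.2 ⟨hc, hy⟩) hb
  rw [ENNReal.toReal_add hc hx] at h1
  rw [ENNReal.toReal_add hc hy] at h2
  rw [← ENNReal.ofReal_toReal (ENNReal.add_ne_top.2 ⟨hx, hy⟩), ENNReal.toReal_add hx hy]
  exact ENNReal.ofReal_le_ofReal (by linarith)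

lemma ofReal_limitCov_zero (hΨm : Measurable Ψ) {v : ℝ}
    (hv : laplaceMass Ψ (spectralMeasure γhat) v < ∞) :
    ENNReal.ofReal (limitCov γhat Ψ v 0) =
      ENNReal.ofReal (((2 * Real.pi) ^ d)⁻¹) * laplaceMass Ψ (spectralMeasure γhat) v := by
  rw [limitCov, ENNReal.ofReal_mul (by positivity)]
  congr 1
  simp only [inner_zero_right, Real.cos_zero, mul_one]
  rw [ofReal_integral_eq_lintegral_ofReal (integrable_exp_of_laplaceMass hΨm hv)
    (Eventually.of_forall fun _ => (Real.exp_pos _).le)]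
  rfl

/-- The splitting `1 = cos + (1 - cos)` under the spectral integral isolates exactly the integrand
of (S1). -/
lemma ofReal_limitCov_zero_le (hΨm : Measurable Ψ) {v : ℝ}
    (hv : laplaceMass Ψ (spectralMeasure γhat) v < ∞) (z : E d) :
    ENNReal.ofReal (limitCov γhat Ψ v 0) ≤ ENNReal.ofReal (limitCov γhat Ψ v z) +
      ENNReal.ofReal (((2 * Real.pi) ^ d)⁻¹) * ∫⁻ ξ, ENNReal.ofReal
        (Real.exp (-(v * Ψ ξ)) * (1 - Real.cos (inner ℝ ξ z))) ∂(spectralMeasure γhat) := by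
  have i1 := integrable_exp_of_laplaceMass hΨm hv
  have i2 : Integrable (fun ξ => Real.exp (-(v * Ψ ξ)) * Real.cos (inner ℝ ξ z))
      (spectralMeasure γhat) := by
    refine i1.mono (Measurable.aestronglyMeasurable (by fun_prop)) (Eventually.of_forall fun ξ => ?_)
    rw [norm_mul]
    exact mul_le_of_le_one_right (norm_nonneg _) (Real.abs_cos_le_one _)
  have i3 : Integrable (fun ξ => Real.exp (-(v * Ψ ξ)) * (1 - Real.cos (inner ℝ ξ z)))
      (spectralMeasure γhat) := by
    refine (i1.sub i2).congr (Eventually.of_forall fun ξ => ?_)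
    simp only [Pi.sub_apply]; ring
  have hnn : ∀ ξ, 0 ≤ Real.exp (-(v * Ψ ξ)) * (1 - Real.cos (inner ℝ ξ z)) := fun ξ =>
    mul_nonneg (Real.exp_pos _).le (sub_nonneg.2 (Real.cos_le_one _))
  rw [← ofReal_integral_eq_lintegral_ofReal i3 (Eventually.of_forall hnn),
    ← ENNReal.ofReal_mul (by positivity)]
  refine le_trans (ENNReal.ofReal_le_ofReal (le_of_eq ?_)) ENNReal.ofReal_add_le
  rw [limitCov, limitCov, ← mul_add, ← integral_add i2 i3]
  congr 2
  ext ξ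
  simp only [inner_zero_right, Real.cos_zero, mul_one]
  ring

lemma laplaceMass_le_add (hΨm : Measurable Ψ) (μ : Measure (E d)) (v w : ℝ) :
    laplaceMass Ψ μ v ≤ laplaceMass Ψ μ w +
      ∫⁻ ξ, ENNReal.ofReal |Real.exp (-(v * Ψ ξ)) - Real.exp (-(w * Ψ ξ))| ∂μ := by
  unfold laplaceMass
  rw [← lintegral_add_left (by fun_prop)]
  refine lintegral_mono fun ξ => ?_
  rw [← ENNReal.ofReal_add (Real.exp_pos _).le (abs_nonneg _)]
  refine ENNReal.ofReal_le_ofReal ?_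
  have := le_abs_self (Real.exp (-(v * Ψ ξ)) - Real.exp (-(w * Ψ ξ)))
  linarith

/-- The variance of spatial increments. -/
theorem HypothesisS1.exists_limitVar_le {α₁ : ℝ} (hβ₀ : 0 < β₀) (hΨm : Measurable Ψ)
    (hΨ : ∀ ξ, 0 ≤ Ψ ξ) (hD : DalangCondition β₀ Ψ (spectralMeasure γhat))
    (h : HypothesisS1 β₀ Ψ (spectralMeasure γhat) α₁) {T : ℝ} (hT : 0 < T) :
    ∃ C : ℝ, 0 ≤ C ∧ ∀ t : ℝ≥0, t ≤ T → ∀ x y : E d,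
      ENNReal.ofReal (limitVar β₀ γhat Ψ t t x y) ≤ ENNReal.ofReal (C * ‖x - y‖ ^ (2 * α₁)) := by
  obtain ⟨C, hC, hS⟩ := h.2.2 T hT
  set c : ℝ := ((2 * Real.pi) ^ d)⁻¹ with hc
  have hc0 : 0 ≤ c := by positivity
  -- Each of the two diagonal energies exceeds the mixed one by at most `c * C * ‖x - y‖ ^ (2 *
  -- α₁)`.
  refine ⟨2 * (c * C), by positivity, fun t ht x y => ?_⟩
  set z := x - y with hz
  have hfin : limitEnergy β₀ γhat Ψ t t z ≠ ∞ := (limitEnergy_lt_top hβ₀ hΨm hΨ hD t.2 t.2 z).ne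
  set S : ℝ → ℝ → ℝ≥0∞ := fun r s => ∫⁻ ξ, ENNReal.ofReal
        (|r - s| ^ (-β₀) * Real.exp (-(|r - s| * Ψ ξ)) * (1 - Real.cos (inner ℝ ξ z)))
        ∂(spectralMeasure γhat) with hSdef
  have hSm : Measurable fun q : ℝ × ℝ => S q.1 q.2 := by
    refine Measurable.lintegral_prod_right' (f := fun q : (ℝ × ℝ) × E d => ENNReal.ofReal
        (|q.1.1 - q.1.2| ^ (-β₀) * Real.exp (-(|q.1.1 - q.1.2| * Ψ q.2)) *
          (1 - Real.cos (inner ℝ q.2 z)))) ?_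
    fun_prop
  have hle : limitEnergy β₀ γhat Ψ t t 0 ≤ limitEnergy β₀ γhat Ψ t t z +
      ENNReal.ofReal (c * (C * ‖z‖ ^ (2 * α₁))) := by
    have h1 : ∀ a, ∫⁻ b in Icc (0 : ℝ) t, ENNReal.ofReal (|(t : ℝ) - a - (t - b)| ^ (-β₀)) *
          ENNReal.ofReal (limitCov γhat Ψ |a - b| 0) ≤
        (∫⁻ b in Icc (0 : ℝ) t, ENNReal.ofReal (|(t : ℝ) - a - (t - b)| ^ (-β₀)) *
          ENNReal.ofReal (limitCov γhat Ψ |a - b| z)) +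
        ENNReal.ofReal c * ∫⁻ b in Icc (0 : ℝ) t, S a b := by
      intro a
      have hm : Measurable fun b => ENNReal.ofReal (|(t : ℝ) - a - (t - b)| ^ (-β₀)) *
          ENNReal.ofReal (limitCov γhat Ψ |a - b| z) := by
        have := measurable_limitCov (γhat := γhat) hΨm z
        fun_prop
      rw [← lintegral_const_mul' _ _ ENNReal.ofReal_ne_top, ← lintegral_add_left hm]
      have e1 : ∀ᵐ b : ℝ, b ≠ a := by rw [ae_iff]; simp
      refine lintegral_mono_ae (ae_restrict_of_ae (e1.mono fun b hb => ?_))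
      have hv : 0 < |a - b| := abs_pos.2 (sub_ne_zero.2 hb.symm)
      have h2 := ofReal_limitCov_zero_le (z := z) hΨm (hD.laplaceMass_lt_top hΨ hv)
      refine (mul_le_mul_right h2 _).trans (le_of_eq ?_)
      rw [mul_add]
      congr 1
      rw [mul_left_comm, ← lintegral_const_mul' _ _ ENNReal.ofReal_ne_top]
      congr 1
      refine lintegral_congr fun ξ => ?_
      rw [← ENNReal.ofReal_mul (by positivity), show |(t : ℝ) - a - (t - b)| = |a - b| by
        rw [abs_sub_comm a b]; congr 1; ring, mul_assoc]
    have hm2 : Measurable fun a => ∫⁻ b in Icc (0 : ℝ) t, S a b := hSm.lintegral_prod_right'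
    calc _ ≤ ∫⁻ a in Icc (0 : ℝ) t, ((∫⁻ b in Icc (0 : ℝ) t,
          ENNReal.ofReal (|(t : ℝ) - a - (t - b)| ^ (-β₀)) *
          ENNReal.ofReal (limitCov γhat Ψ |a - b| z)) +
        ENNReal.ofReal c * ∫⁻ b in Icc (0 : ℝ) t, S a b) := lintegral_mono h1
      _ = limitEnergy β₀ γhat Ψ t t z +
          ENNReal.ofReal c * ∫⁻ a in Icc (0 : ℝ) t, ∫⁻ b in Icc (0 : ℝ) t, S a b := by
        rw [lintegral_add_right _ (hm2.const_mul _), lintegral_const_mul _ hm2]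
        rfl
      _ ≤ _ := by
        rw [ENNReal.ofReal_mul hc0]
        gcongr
        refine le_trans ?_ (hS z)
        refine (lintegral_mono_set (Icc_subset_Icc_right ht)).trans (lintegral_mono fun a => ?_)
        exact lintegral_mono_set (Icc_subset_Icc_right ht)
  have hfin2 := ENNReal.ofReal_ne_top (r := c * (C * ‖z‖ ^ (2 * α₁)))
  refine (toReal_add_sub_le hle hle hfin hfin2 hfin2).trans (le_of_eq ?_)
  rw [← ENNReal.ofReal_add (by positivity) (by positivity)]
  congr 1
  ring

/-- The variance of temporal increments. -/
theorem HypothesisT1.exists_limitVar_le {α₂ : ℝ} (hβ₀ : 0 < β₀) (hΨm : Measurable Ψ)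
    (hΨ : ∀ ξ, 0 ≤ Ψ ξ) (hD : DalangCondition β₀ Ψ (spectralMeasure γhat))
    (h : HypothesisT1 β₀ Ψ (spectralMeasure γhat) α₂) {T : ℝ} (hT : 0 < T) :
    ∃ C : ℝ, 0 ≤ C ∧ ∀ s t : ℝ≥0, s ≤ t → t ≤ T → ∀ x : E d,
      ENNReal.ofReal (limitVar β₀ γhat Ψ t s x x) ≤
        ENNReal.ofReal (C * ((t : ℝ) - s) ^ α₂) := by
  obtain ⟨C, hC, hS⟩ := h.2.2 T hT T hT
  set c : ℝ := ((2 * Real.pi) ^ d)⁻¹ with hc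
  have hc0 : 0 ≤ c := by positivity
  set μ := spectralMeasure γhat with hμ
  set k : ℝ → ℝ≥0∞ := fun v => ENNReal.ofReal c * laplaceMass Ψ μ v with hk
  have hkm : Measurable k := (measurable_laplaceMass hΨm).const_mul _
  set w : ℝ → ℝ≥0∞ := fun v => ENNReal.ofReal (v ^ (-β₀)) * k v with hw
  have hwm : Measurable w := by fun_prop
  have hDw : ∫⁻ v in Ioc 0 T, w v ≠ ∞ := by
    have h1 : ∫⁻ v in Ioc 0 T, w v = ENNReal.ofReal c *
        ∫⁻ v in Ioc 0 T, ENNReal.ofReal (v ^ (-β₀)) * laplaceMass Ψ μ v := by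
      rw [← lintegral_const_mul' _ _ ENNReal.ofReal_ne_top]
      refine lintegral_congr fun v => ?_
      simp only [hw, hk]; ring
    rw [h1]
    exact ENNReal.mul_ne_top ENNReal.ofReal_ne_top (hD T).ne
  set D : ℝ := (∫⁻ v in Ioc 0 T, w v).toReal with hDdef
  have hD0 : 0 ≤ D := ENNReal.toReal_nonneg
  -- The first summand comes from two uses of (T1) with shift `-δ`. The second is the contribution
  -- of the strip of width `δ` between `s` and `t`, where `δ ≤ T^{1-α₂} δ^{α₂}`.
  refine ⟨2 * (c * C) + 2 * D * T ^ (1 - α₂), by positivity, fun s t hst ht x => ?_⟩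
  set δ : ℝ := (t : ℝ) - s with hδ
  have hst' : (s : ℝ) ≤ t := hst
  have hδ0 : 0 ≤ δ := sub_nonneg.2 hst'
  have hs0 : (0 : ℝ) ≤ s := s.2
  have hδT : δ ≤ T := by linarith
  have hcov : ∀ v, 0 < v → ENNReal.ofReal (limitCov γhat Ψ v 0) = k v := fun v hv =>
    ofReal_limitCov_zero hΨm (hD.laplaceMass_lt_top hΨ hv)
  -- In the variables `r = t - a`, `r' = s - b` the time weight becomes `|r - r'|^{-β₀}`, and `t -
  -- s` appears as a shift in the Laplace mass. Diagonal and mixed energies then differ precisely by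
  -- the quantity in (T1).
  have hL : ∀ t s : ℝ, limitEnergy β₀ γhat Ψ t s 0 =
      ∫⁻ r in Icc 0 t, ∫⁻ r' in Icc 0 s, ENNReal.ofReal (|r - r'| ^ (-β₀)) * k |r - r' - (t - s)| := by
    intro t s
    rw [limitEnergy, ← lintegral_Icc_reflect (fun r => ∫⁻ r' in Icc 0 s,
      ENNReal.ofReal (|r - r'| ^ (-β₀)) * k |r - r' - (t - s)|)]
    refine lintegral_congr fun a => ?_
    rw [← lintegral_Icc_reflect (fun r' => ENNReal.ofReal (|t - a - r'| ^ (-β₀)) *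
      k |t - a - r' - (t - s)|)]
    have e1 : ∀ᵐ b : ℝ, b ≠ a := by rw [ae_iff]; simp
    refine lintegral_congr_ae (ae_restrict_of_ae (e1.mono fun b hb => ?_))
    have hv : 0 < |a - b| := abs_pos.2 (sub_ne_zero.2 hb.symm)
    simp only
    rw [hcov _ hv, show t - a - (s - b) - (t - s) = -(a - b) by ring, abs_neg]
  set Δ : ℝ → ℝ → ℝ≥0∞ := fun r r' => ∫⁻ ξ, ENNReal.ofReal
        (|r - r'| ^ (-β₀) * |Real.exp (-(|r - r'| * Ψ ξ)) - Real.exp (-(|r - r' + -δ| * Ψ ξ))|)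
        ∂μ with hΔ
  have hΔm : Measurable fun q : ℝ × ℝ => Δ q.1 q.2 := by
    refine Measurable.lintegral_prod_right' (f := fun q : (ℝ × ℝ) × E d => ENNReal.ofReal
        (|q.1.1 - q.1.2| ^ (-β₀) * |Real.exp (-(|q.1.1 - q.1.2| * Ψ q.2)) -
          Real.exp (-(|q.1.1 - q.1.2 + -δ| * Ψ q.2))|)) ?_
    fun_prop
  have hpt : ∀ r r' : ℝ, w |r - r'| ≤ ENNReal.ofReal (|r - r'| ^ (-β₀)) * k |r - r' - δ| +
      ENNReal.ofReal c * Δ r r' := by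
    intro r r'
    have h1 := mul_le_mul_right (laplaceMass_le_add hΨm μ |r - r'| |r - r' + -δ|)
      (ENNReal.ofReal (|r - r'| ^ (-β₀)) * ENNReal.ofReal c)
    simp only [hw, hk, hΔ, sub_eq_add_neg _ δ]
    rw [← mul_assoc]
    refine h1.trans (le_of_eq ?_)
    rw [mul_add, mul_assoc, mul_comm (ENNReal.ofReal (|r - r'| ^ (-β₀))) (ENNReal.ofReal c), mul_assoc,
      ← lintegral_const_mul' _ _ ENNReal.ofReal_ne_top]
    congr 2
    refine lintegral_congr fun ξ => ?_
    rw [← ENNReal.ofReal_mul (by positivity)]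
  have hm1 : Measurable fun q : ℝ × ℝ => ENNReal.ofReal (|q.1 - q.2| ^ (-β₀)) *
      k |q.1 - q.2 - δ| := by fun_prop
  have hrect : ∀ {A : ℝ}, A ≤ T → (∫⁻ r in Icc 0 A, ∫⁻ r' in Icc (0 : ℝ) s, w |r - r'|) ≤
      (∫⁻ r in Icc 0 A, ∫⁻ r' in Icc (0 : ℝ) s, ENNReal.ofReal (|r - r'| ^ (-β₀)) * k |r - r' - δ|) +
      ENNReal.ofReal (c * (C * δ ^ α₂)) := by
    intro A hA
    refine (lintegral_rectangle_le hm1 ENNReal.ofReal_ne_top hpt hA (hst'.trans ht)).trans ?_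
    rw [ENNReal.ofReal_mul hc0]
    gcongr
    have h3 := hS (-δ) (by rw [abs_neg, abs_of_nonneg hδ0]; exact hδT)
    rw [abs_neg, abs_of_nonneg hδ0] at h3
    exact h3
  have hfin : limitEnergy β₀ γhat Ψ t s 0 ≠ ∞ := (limitEnergy_lt_top hβ₀ hΨm hΨ hD t.2 s.2 0).ne
  have hss : limitEnergy β₀ γhat Ψ s s 0 ≤ limitEnergy β₀ γhat Ψ t s 0 +
      ENNReal.ofReal (c * (C * δ ^ α₂)) := by
    have h1 := hrect (hst'.trans ht)
    have h2 : limitEnergy β₀ γhat Ψ s s 0 = ∫⁻ r in Icc (0 : ℝ) s, ∫⁻ r' in Icc (0 : ℝ) s, w |r - r'| := by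
      rw [hL]; simp only [sub_self, sub_zero, hw]
    rw [h2, hL]
    refine h1.trans ?_
    gcongr
  -- For each `r'` in the strip the integral over `r` is at most twice the integral of `w` over `(0,
  -- T]`.
  have hstrip : ∫⁻ r in Icc (0 : ℝ) t, ∫⁻ r' in Ioc (s : ℝ) t, w |r - r'| ≤
      ENNReal.ofReal (2 * D * δ) := by
    have hm3 : Measurable fun q : ℝ × ℝ => w |q.1 - q.2| := by fun_prop
    rw [lintegral_lintegral_swap (f := fun r r' => w |r - r'|) hm3.aemeasurable]
    have h1 : ∀ r' ∈ Ioc (s : ℝ) t, ∫⁻ r in Icc (0 : ℝ) t, w |r - r'| ≤ ENNReal.ofReal (2 * D) := by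
      intro r' hr'
      have h2 := (measurePreserving_sub_right (volume : Measure ℝ) r').setLIntegral_comp_preimage_emb
        (Homeomorph.subRight r').measurableEmbedding (fun v => w |v|) (Icc (-T) T)
      rw [ENNReal.ofReal_mul zero_le_two, hDdef, ENNReal.ofReal_toReal hDw, ENNReal.ofReal_ofNat]
      refine le_trans ?_ (lintegral_Icc_abs_le T)
      rw [← h2]
      refine lintegral_mono_set fun r hr => ?_
      simp only [mem_preimage, mem_Icc]
      constructor <;> linarith [hr.1, hr.2, hr'.1, hr'.2]
    refine (setLIntegral_mono measurable_const h1).trans (le_of_eq ?_)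
    rw [setLIntegral_const, Real.volume_Ioc, ← ENNReal.ofReal_mul (by positivity)]
  have htt : limitEnergy β₀ γhat Ψ t t 0 ≤ limitEnergy β₀ γhat Ψ t s 0 +
      ENNReal.ofReal (c * (C * δ ^ α₂) + 2 * D * δ) := by
    have h2 : limitEnergy β₀ γhat Ψ t t 0 = ∫⁻ r in Icc (0 : ℝ) t, ∫⁻ r' in Icc (0 : ℝ) t, w |r - r'| := by
      rw [hL]; simp only [sub_self, sub_zero, hw]
    have h3 : ∀ r : ℝ, ∫⁻ r' in Icc (0 : ℝ) t, w |r - r'| =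
        (∫⁻ r' in Icc (0 : ℝ) s, w |r - r'|) + ∫⁻ r' in Ioc (s : ℝ) t, w |r - r'| := by
      intro r
      rw [← Icc_union_Ioc_eq_Icc hs0 hst', lintegral_union measurableSet_Ioc]
      rw [Set.disjoint_left]
      exact fun x hx hx' => absurd hx.2 (not_le.2 hx'.1)
    have hm3 : Measurable fun q : ℝ × ℝ => w |q.1 - q.2| := by fun_prop
    have hm4 : Measurable fun r => ∫⁻ r' in Icc (0 : ℝ) s, w |r - r'| := hm3.lintegral_prod_right'
    rw [h2]
    simp_rw [h3]
    rw [lintegral_add_left hm4, ENNReal.ofReal_add (by positivity) (by positivity), ← add_assoc, hL]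
    exact add_le_add (hrect ht) hstrip
  rw [limitVar, sub_self]
  refine (toReal_add_sub_le htt hss hfin ENNReal.ofReal_ne_top ENNReal.ofReal_ne_top).trans ?_
  rw [← ENNReal.ofReal_add (by positivity) (by positivity)]
  refine ENNReal.ofReal_le_ofReal ?_
  have h5 : δ ≤ T ^ (1 - α₂) * δ ^ α₂ := by
    rcases hδ0.eq_or_lt with h0 | h0
    · rw [← h0]; positivity
    · calc δ = δ ^ (1 - α₂) * δ ^ α₂ := by rw [← Real.rpow_add h0]; simp
        _ ≤ _ := by
          gcongr
          linarith [h.2.1]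
  have h6 := mul_le_mul_of_nonneg_left h5 (show 0 ≤ 2 * D by positivity)
  nlinarith

end Increments


/-! ### Dyadic rounding -/

section Rounding

/-- Rounding down to the grid of mesh `b⁻ⁿ`. -/
noncomputable def timeGrid (b n : ℕ) (t : ℝ≥0) : ℝ≥0 := (⌊(b : ℝ≥0) ^ n * t⌋₊ : ℝ≥0) / (b : ℝ≥0) ^ n

lemma timeGrid_le {b : ℕ} (hb : 0 < b) (n : ℕ) (t : ℝ≥0) : timeGrid b n t ≤ t := by
  have hb' : (0 : ℝ≥0) < (b : ℝ≥0) ^ n := by positivity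
  rw [timeGrid, div_le_iff₀ hb', mul_comm t]
  exact Nat.floor_le zero_le

lemma abs_timeGrid_sub_le {b : ℕ} (hb : 0 < b) (n : ℕ) (t : ℝ≥0) :
    |(timeGrid b n t : ℝ) - t| ≤ ((b : ℝ) ^ n)⁻¹ := by
  have hb' : (0 : ℝ≥0) < (b : ℝ≥0) ^ n := by positivity
  have h1 : (timeGrid b n t : ℝ) ≤ t := timeGrid_le hb n t
  have h2 : t ≤ timeGrid b n t + ((b : ℝ≥0) ^ n)⁻¹ := by
    rw [timeGrid, ← one_div, ← add_div, le_div_iff₀ hb', mul_comm]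
    exact (Nat.lt_floor_add_one _).le
  have h3 : (t : ℝ) ≤ timeGrid b n t + ((b : ℝ) ^ n)⁻¹ := by exact_mod_cast h2
  rw [abs_le]
  constructor <;> linarith

lemma timeGrid_mem {b : ℕ} {N : ℕ} (n : ℕ) {t : ℝ≥0} (ht : t ≤ N) :
    timeGrid b n t ∈ (fun k : ℕ => (k : ℝ≥0) / (b : ℝ≥0) ^ n) '' (Finset.range (N * b ^ n + 1)) := by
  refine ⟨⌊(b : ℝ≥0) ^ n * t⌋₊, ?_, rfl⟩
  rw [Finset.coe_range, mem_Iio, Nat.lt_succ_iff]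
  refine Nat.floor_le_of_le ?_
  push_cast
  rw [mul_comm]
  gcongr

variable {d : ℕ}

/-- Rounding down every coordinate to a multiple of `2⁻ⁿ`. -/
noncomputable def spaceGrid (n : ℕ) (x : E d) : E d :=
  WithLp.toLp 2 fun i => (⌊(2 : ℝ) ^ n * x i⌋ : ℝ) / 2 ^ n

lemma norm_le_sqrt_mul {x : E d} {r : ℝ} (hr : 0 ≤ r) (h : ∀ i, |x i| ≤ r) : ‖x‖ ≤ √d * r := by
  rw [EuclideanSpace.norm_eq, ← Real.sqrt_sq hr, ← Real.sqrt_mul (Nat.cast_nonneg d)]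
  refine Real.sqrt_le_sqrt ?_
  calc ∑ i, ‖x i‖ ^ 2 ≤ ∑ _i : Fin d, r ^ 2 := by
        refine Finset.sum_le_sum fun i _ => ?_
        have := h i
        rw [← Real.norm_eq_abs] at this
        gcongr
    _ = d * r ^ 2 := by simp

lemma norm_spaceGrid_sub_le (n : ℕ) (x : E d) : ‖spaceGrid n x - x‖ ≤ √d * (2⁻¹ : ℝ) ^ n := by
  refine norm_le_sqrt_mul (by positivity) fun i => ?_
  have h1 := Int.floor_le ((2 : ℝ) ^ n * x i)
  have h2 := Int.lt_floor_add_one ((2 : ℝ) ^ n * x i)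
  have hp : (0 : ℝ) < 2 ^ n := by positivity
  have h3 : (spaceGrid n x - x) i = (⌊(2 : ℝ) ^ n * x i⌋ - 2 ^ n * x i) / 2 ^ n := by
    simp only [spaceGrid, PiLp.sub_apply]
    field_simp
  rw [h3, abs_div, abs_of_pos hp, inv_pow, ← one_div]
  gcongr
  rw [abs_le]
  constructor <;> linarith

lemma abs_spaceGrid_le {N : ℕ} (n : ℕ) {x : E d} (hx : ∀ i, |x i| ≤ N) (i : Fin d) :
    ⌊(2 : ℝ) ^ n * x i⌋ ∈ Finset.Icc (-(N * 2 ^ n : ℤ)) (N * 2 ^ n) := by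
  have hp : (0 : ℝ) < 2 ^ n := by positivity
  have h := abs_le.1 (hx i)
  rw [Finset.mem_Icc]
  constructor
  · rw [Int.le_floor]; push_cast; nlinarith
  · have h1 := Int.floor_le ((2 : ℝ) ^ n * x i)
    have : (⌊(2 : ℝ) ^ n * x i⌋ : ℝ) ≤ N * 2 ^ n := by nlinarith
    exact_mod_cast this

lemma spaceGrid_mapsTo {N : ℕ} (n : ℕ) {x : E d} (hx : ∀ i, |x i| ≤ N) (i : Fin d) :
    |spaceGrid n x i| ≤ N := by
  have h := Finset.mem_Icc.1 (abs_spaceGrid_le n hx i)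
  have hp : (0 : ℝ) < 2 ^ n := by positivity
  simp only [spaceGrid]
  rw [abs_div, abs_of_pos hp, div_le_iff₀ hp, abs_le]
  constructor
  · exact_mod_cast h.1
  · exact_mod_cast h.2

end Rounding

/-! ### Moments of spatial and of temporal increments. -/

section MomentBounds

variable {d : ℕ} {p : E d → ℝ} {γ : E d → ℝ≥0∞} {γhat Ψ : E d → ℝ} {β₀ : ℝ}
  {Ω Ω' : Type*} [mΩ : MeasurableSpace Ω] [mΩ' : MeasurableSpace Ω'] {P : Measure Ω}
  {P' : Measure Ω'} {X X₀ : ℝ≥0 → Ω' → E d}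
  {W : {φ : ℝ × E d → ℝ // FiniteEnergy β₀ γ φ} → Ω → ℝ}
  [IsProbabilityMeasure P] [IsProbabilityMeasure P']

lemma ofReal_mul_rpow_pow {C r α : ℝ} (hC : 0 ≤ C) (hr : 0 ≤ r) (m : ℕ) :
    ENNReal.ofReal (C * r ^ (2 * α)) ^ m = ENNReal.ofReal C ^ m * ENNReal.ofReal (r ^ α) ^ (2 * m) := by
  have h : r ^ (2 * α) = (r ^ α) ^ 2 := by rw [mul_comm, Real.rpow_mul hr, Real.rpow_ofNat]
  rw [h, ENNReal.ofReal_mul hC, ENNReal.ofReal_pow (Real.rpow_nonneg hr _), mul_pow, pow_mul]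

lemma IsModel.exists_moment_space_le (M : IsModel γ γhat β₀ W P X Ψ P' p)
    (hX : ∀ᵐ ω' ∂P', ∀ t, X t ω' = X₀ t ω') {u : ℝ≥0 → E d → Ω → ℝ}
    (hu : IsFeynmanKac W P X₀ P' p (fun _ => 1) u) {α₁ : ℝ}
    (h : HypothesisS1 β₀ Ψ (spectralMeasure γhat) α₁) {m : ℕ} (hm : 1 ≤ m) (N : ℕ) :
    ∃ K : ℝ≥0, ∀ t : ℝ≥0, t ≤ N → ∀ x y : E d,
      ∫⁻ ω, ‖u t x ω - u t y ω‖ₑ ^ (2 * m) ∂P ≤ K * ENNReal.ofReal (‖x - y‖ ^ α₁) ^ (2 * m) := by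
  -- The horizon is `N + 1` rather than `N`, to be positive when `N = 0`.
  have hT : (0 : ℝ) < N + 1 := by positivity
  obtain ⟨K, hK⟩ := M.exists_lintegral_feynmanKac_sub_le hX hu hm hT.le
  obtain ⟨C, hC, hC'⟩ := h.exists_limitVar_le M.exponent_pos M.measurable_psi M.psi_nonneg M.dalang hT
  refine ⟨K * C.toNNReal ^ m, fun t ht x y => ?_⟩
  have ht' : (t : ℝ) ≤ N + 1 := by
    have : (t : ℝ) ≤ N := by exact_mod_cast ht
    linarith
  refine (hK t t ht' ht' x y).trans ?_
  push_cast
  rw [mul_assoc]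
  refine mul_le_mul_right ((pow_le_pow_left' (hC' t ht' x y) m).trans (le_of_eq ?_)) _
  rw [ofReal_mul_rpow_pow hC (norm_nonneg _)]
  rfl

lemma IsModel.exists_moment_time_le (M : IsModel γ γhat β₀ W P X Ψ P' p)
    (hX : ∀ᵐ ω' ∂P', ∀ t, X t ω' = X₀ t ω') {u : ℝ≥0 → E d → Ω → ℝ}
    (hu : IsFeynmanKac W P X₀ P' p (fun _ => 1) u) {α₂ : ℝ}
    (h : HypothesisT1 β₀ Ψ (spectralMeasure γhat) α₂) {m : ℕ} (hm : 1 ≤ m) (N : ℕ) :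
    ∃ K : ℝ≥0, ∀ t s : ℝ≥0, t ≤ N → s ≤ N → ∀ x : E d,
      ∫⁻ ω, ‖u t x ω - u s x ω‖ₑ ^ (2 * m) ∂P ≤
        K * ENNReal.ofReal (|(t : ℝ) - s| ^ (α₂ / 2)) ^ (2 * m) := by
  have hT : (0 : ℝ) < N + 1 := by positivity
  obtain ⟨K, hK⟩ := M.exists_lintegral_feynmanKac_sub_le hX hu hm hT.le
  obtain ⟨C, hC, hC'⟩ := h.exists_limitVar_le M.exponent_pos M.measurable_psi M.psi_nonneg M.dalang hT
  refine ⟨K * C.toNNReal ^ m, fun t s ht hs x => ?_⟩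
  wlog hst : s ≤ t generalizing t s with H
  · have := H s t hs ht (le_of_not_ge hst)
    simp_rw [enorm_sub_rev (u t x _), abs_sub_comm (t : ℝ)]
    exact this
  have ht' : (t : ℝ) ≤ N + 1 := by
    have : (t : ℝ) ≤ N := by exact_mod_cast ht
    linarith
  have hst' : (s : ℝ) ≤ t := hst
  refine (hK t s ht' (hst'.trans ht') x x).trans ?_
  push_cast
  rw [mul_assoc]
  refine mul_le_mul_right ((pow_le_pow_left' (hC' s t hst ht' x) m).trans (le_of_eq ?_)) _
  have h1 := ofReal_mul_rpow_pow (α := α₂ / 2) hC (abs_nonneg ((t : ℝ) - s)) m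
  rw [mul_div_cancel₀ _ two_ne_zero, abs_of_nonneg (sub_nonneg.2 hst')] at h1
  rw [h1, abs_of_nonneg (sub_nonneg.2 hst')]
  rfl

end MomentBounds


/-! ### Hölder continuous versions by Kolmogorov–Chentsov. -/

section Versions

variable {d : ℕ} {p : E d → ℝ} {γ : E d → ℝ≥0∞} {γhat Ψ : E d → ℝ} {β₀ : ℝ}
  {Ω Ω' : Type*} [mΩ : MeasurableSpace Ω] [mΩ' : MeasurableSpace Ω'] {P : Measure Ω}
  {P' : Measure Ω'} {X X₀ : ℝ≥0 → Ω' → E d}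
  {W : {φ : ℝ × E d → ℝ // FiniteEnergy β₀ γ φ} → Ω → ℝ}
  [IsProbabilityMeasure P] [IsProbabilityMeasure P']

/-- For fixed `x` this is a process indexed by time alone. Its exponent is `α₂ / 2` because (T1)
bounds the variance, the square of the size of the increments. -/
lemma IsModel.exists_holder_time (M : IsModel γ γhat β₀ W P X Ψ P' p)
    (hX : ∀ᵐ ω' ∂P', ∀ t, X t ω' = X₀ t ω') {u : ℝ≥0 → E d → Ω → ℝ}
    (hu : IsFeynmanKac W P X₀ P' p (fun _ => 1) u) {α₂ : ℝ}
    (h : HypothesisT1 β₀ Ψ (spectralMeasure γhat) α₂) (x : E d) :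
    ∃ v : ℝ≥0 → Ω → ℝ, (∀ t, Measurable (v t)) ∧ (∀ t, v t =ᵐ[P] u t x) ∧
      ∀ ω θ, 0 < θ → θ < α₂ / 2 → ∀ N : ℕ, ∃ C, ∀ t ∈ Iic (N : ℝ≥0), ∀ s ∈ Iic (N : ℝ≥0),
        |v t ω - v s ω| ≤ C * |(t : ℝ) - s| ^ θ := by
  refine exists_holder_version (ρ := fun t s : ℝ≥0 => |(t : ℝ) - s|) (π := timeGrid 2) (c := 1)
    (S := fun N : ℕ => Iic (N : ℝ≥0)) (u := fun t => u t x)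
    (fun a b => abs_sub_comm _ _) (fun a b c => abs_sub_le _ _ _) (fun a b => abs_nonneg _)
    (fun n t => ?_) (fun t => ⟨⌈t⌉₊, Nat.le_ceil t⟩)
    (fun N n t ht => (timeGrid_le two_pos n t).trans ht) (fun N => ⟨N, fun t ht s hs => ?_⟩)
    (fun N => ⟨N + 1, 2, by positivity, by norm_num, fun n => ?_⟩) (fun t => hu.aemeasurable t x)
    (half_pos h.1) (fun N p₀ => ?_)
  · have := abs_timeGrid_sub_le two_pos n t
    rw [one_mul, inv_pow]
    exact_mod_cast this
  · have h1 : (t : ℝ) ≤ N := by exact_mod_cast ht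
    have h2 : (s : ℝ) ≤ N := by exact_mod_cast hs
    have h3 : (0 : ℝ) ≤ t := t.2
    have h4 : (0 : ℝ) ≤ s := s.2
    exact abs_le.2 ⟨by linarith, by linarith⟩
  · have hsub : timeGrid 2 n '' Iic (N : ℝ≥0) ⊆ (fun k : ℕ => (k : ℝ≥0) / ((2 : ℕ) : ℝ≥0) ^ n) ''
        (Finset.range (N * 2 ^ n + 1)) := by
      rintro _ ⟨t, ht, rfl⟩
      exact timeGrid_mem n ht
    have hfin := (Finset.finite_toSet (Finset.range (N * 2 ^ n + 1))).image
      (fun k : ℕ => (k : ℝ≥0) / ((2 : ℕ) : ℝ≥0) ^ n)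
    refine ⟨hfin.subset hsub, ?_⟩
    have h1 := (ncard_le_ncard hsub hfin).trans (ncard_image_le (Finset.finite_toSet _))
    rw [ncard_coe_finset, Finset.card_range] at h1
    have h2 : ((timeGrid 2 n '' Iic (N : ℝ≥0)).ncard : ℝ) ≤ N * 2 ^ n + 1 := by exact_mod_cast h1
    have h3 : (1 : ℝ) ≤ 2 ^ n := one_le_pow₀ one_le_two
    linarith
  · obtain ⟨K, hK⟩ := M.exists_moment_time_le hX hu h (m := p₀ + 1) (by omega) N
    exact ⟨2 * (p₀ + 1), by omega, K, fun t ht s hs => hK t s ht hs x⟩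

/-- Uniformity of the constant in `t` requires some regularity in time, so the field is treated on
`ℝ₊ × ℝᵈ`. With (T1) of exponent `α₁ / 2`, temporal increments are of size `|t - s|^{α₁/4}`;
measuring time by `|t - s|^{1/4}` gives both directions the common exponent `α₁`. -/
lemma IsModel.exists_holder_space (M : IsModel γ γhat β₀ W P X Ψ P' p)
    (hX : ∀ᵐ ω' ∂P', ∀ t, X t ω' = X₀ t ω') {u : ℝ≥0 → E d → Ω → ℝ}
    (hu : IsFeynmanKac W P X₀ P' p (fun _ => 1) u) {α₁ : ℝ}
    (h : HypothesisS1 β₀ Ψ (spectralMeasure γhat) α₁)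
    (h' : HypothesisT1 β₀ Ψ (spectralMeasure γhat) (α₁ / 2)) :
    ∃ v : ℝ≥0 × E d → Ω → ℝ, (∀ z, Measurable (v z)) ∧ (∀ z, v z =ᵐ[P] u z.1 z.2) ∧
      ∀ ω θ, 0 < θ → θ < α₁ → ∀ N : ℕ, ∃ C,
        ∀ z ∈ {z : ℝ≥0 × E d | z.1 ≤ N ∧ ∀ i, |z.2 i| ≤ N},
        ∀ z' ∈ {z : ℝ≥0 × E d | z.1 ≤ N ∧ ∀ i, |z.2 i| ≤ N},
        |v z ω - v z' ω| ≤ C * (‖z.2 - z'.2‖ + |(z.1 : ℝ) - z'.1| ^ (1 / 4 : ℝ)) ^ θ := by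
  have hq : (0 : ℝ) < 1 / 4 := by norm_num
  refine exists_holder_version
    (ρ := fun z z' : ℝ≥0 × E d => ‖z.2 - z'.2‖ + |(z.1 : ℝ) - z'.1| ^ (1 / 4 : ℝ))
    (π := fun n z => (timeGrid 16 n z.1, spaceGrid n z.2)) (c := √d + 1)
    (S := fun N : ℕ => {z : ℝ≥0 × E d | z.1 ≤ N ∧ ∀ i, |z.2 i| ≤ N}) (u := fun z => u z.1 z.2)
    (fun a b => by simp only [norm_sub_rev a.2, abs_sub_comm (a.1 : ℝ)]) (fun a b c => ?_)
    (fun a b => by positivity) (fun n z => ?_) (fun z => ?_) (fun N n z hz => ?_)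
    (fun N => ⟨√d * (2 * N) + (N : ℝ) ^ (1 / 4 : ℝ), fun z hz z' hz' => ?_⟩)
    (fun N => ⟨(N + 1) * (2 * N + 1) ^ d, 16 * 2 ^ d, by positivity, ?_, fun n => ?_⟩)
    (fun z => hu.aemeasurable z.1 z.2) h.1 (fun N p₀ => ?_)
  · have h1 : ‖a.2 - c.2‖ ≤ ‖a.2 - b.2‖ + ‖b.2 - c.2‖ := norm_sub_le_norm_sub_add_norm_sub _ _ _
    have h2 : |(a.1 : ℝ) - c.1| ^ (1 / 4 : ℝ) ≤
        |(a.1 : ℝ) - b.1| ^ (1 / 4 : ℝ) + |(b.1 : ℝ) - c.1| ^ (1 / 4 : ℝ) :=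
      (Real.rpow_le_rpow (abs_nonneg _) (abs_sub_le _ _ _) hq.le).trans
        (Real.rpow_add_le_add_rpow (abs_nonneg _) (abs_nonneg _) hq.le (by norm_num))
    linarith
  · have h1 := norm_spaceGrid_sub_le n z.2
    have h2 := Real.rpow_le_rpow (abs_nonneg _) (abs_timeGrid_sub_le (b := 16) (by norm_num) n z.1)
      hq.le
    -- The time grid has mesh `16⁻ⁿ` so that its fourth root matches the mesh `2⁻ⁿ` of the space
    -- grid.
    have h3 : (((16 : ℕ) : ℝ) ^ n)⁻¹ ^ (1 / 4 : ℝ) = (2⁻¹ : ℝ) ^ n := by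
      have h4 : (((16 : ℕ) : ℝ) ^ n)⁻¹ = ((2⁻¹ : ℝ) ^ n) ^ (4 : ℝ) := by
        rw [Real.rpow_ofNat, ← pow_mul, mul_comm, pow_mul, inv_pow, ← inv_pow]
        norm_num
      rw [h4, ← Real.rpow_mul (by positivity)]
      norm_num
    rw [h3] at h2
    simp only
    linarith
  · obtain ⟨N, hN⟩ := exists_nat_ge (max (z.1 : ℝ) ‖z.2‖)
    refine ⟨N, ?_, fun i => ?_⟩
    · exact_mod_cast (le_max_left _ _).trans hN
    · have := PiLp.norm_apply_le z.2 i
      rw [Real.norm_eq_abs] at this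
      exact this.trans ((le_max_right _ _).trans hN)
  · exact ⟨(timeGrid_le (by norm_num) n z.1).trans hz.1, spaceGrid_mapsTo n hz.2⟩
  · have h1 : (z.1 : ℝ) ≤ N := by exact_mod_cast hz.1
    have h2 : (z'.1 : ℝ) ≤ N := by exact_mod_cast hz'.1
    have h3 : (0 : ℝ) ≤ z.1 := z.1.2
    have h4 : (0 : ℝ) ≤ z'.1 := z'.1.2
    refine add_le_add (norm_le_sqrt_mul (by positivity) fun i => ?_)
      (Real.rpow_le_rpow (abs_nonneg _) (abs_le.2 ⟨by linarith, by linarith⟩) hq.le)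
    have h5 := abs_sub (z.2 i) (z'.2 i)
    have h6 := hz.2 i
    have h7 := hz'.2 i
    rw [PiLp.sub_apply]
    linarith
  · have : (1 : ℝ) ≤ 2 ^ d := one_le_pow₀ one_le_two
    linarith
  · set F : ℕ × (Fin d → ℤ) → ℝ≥0 × E d := fun q =>
      ((q.1 : ℝ≥0) / ((16 : ℕ) : ℝ≥0) ^ n, WithLp.toLp 2 fun i => (q.2 i : ℝ) / 2 ^ n) with hF
    set J : Finset (ℕ × (Fin d → ℤ)) := Finset.range (N * 16 ^ n + 1) ×ˢ
      Fintype.piFinset fun _ => Finset.Icc (-(N * 2 ^ n : ℤ)) (N * 2 ^ n) with hJ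
    have hsub : (fun z : ℝ≥0 × E d => (timeGrid 16 n z.1, spaceGrid n z.2)) ''
        {z : ℝ≥0 × E d | z.1 ≤ N ∧ ∀ i, |z.2 i| ≤ N} ⊆ F '' J := by
      rintro _ ⟨z, hz, rfl⟩
      obtain ⟨k, hk, hk'⟩ := timeGrid_mem (b := 16) n hz.1
      refine ⟨(k, fun i => ⌊(2 : ℝ) ^ n * z.2 i⌋), ?_, ?_⟩
      · rw [hJ, Finset.mem_coe, Finset.mem_product]
        exact ⟨hk, Fintype.mem_piFinset.2 fun i => abs_spaceGrid_le n hz.2 i⟩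
      · exact Prod.ext hk' rfl
    have hfin := J.finite_toSet.image F
    refine ⟨hfin.subset hsub, ?_⟩
    have h1 := (ncard_le_ncard hsub hfin).trans (ncard_image_le J.finite_toSet)
    have hcard : (J.card : ℝ) = (N * 16 ^ n + 1) * (2 * (N * 2 ^ n) + 1) ^ d := by
      rw [hJ, Finset.card_product, Finset.card_range, Fintype.card_piFinset_const, Int.card_Icc]
      have : ((N * 2 ^ n + 1 - -(N * 2 ^ n) : ℤ)).toNat = 2 * (N * 2 ^ n) + 1 := by
        have h0 : ((N * 2 ^ n + 1 - -(N * 2 ^ n) : ℤ)) = ((2 * (N * 2 ^ n) + 1 : ℕ) : ℤ) := by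
          push_cast; ring
        rw [h0, Int.toNat_natCast]
      rw [this]
      push_cast
      ring
    rw [ncard_coe_finset] at h1
    refine (Nat.cast_le.2 h1).trans ?_
    rw [hcard]
    have h3 : (1 : ℝ) ≤ 16 ^ n := one_le_pow₀ (by norm_num)
    have h4 : (1 : ℝ) ≤ 2 ^ n := one_le_pow₀ one_le_two
    calc ((N : ℝ) * 16 ^ n + 1) * (2 * (N * 2 ^ n) + 1) ^ d
        ≤ ((N + 1) * 16 ^ n) * ((2 * N + 1) * 2 ^ n) ^ d := by
          gcongr
          · linarith
          · linarith
      _ = _ := by rw [mul_pow, mul_pow, ← pow_mul, ← pow_mul, mul_comm n d]; ring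
  · obtain ⟨K, hK⟩ := M.exists_moment_space_le hX hu h (m := p₀ + 1) (by omega) N
    obtain ⟨K', hK'⟩ := M.exists_moment_time_le hX hu h' (m := p₀ + 1) (by omega) N
    set q := 2 * (p₀ + 1) with hqdef
    refine ⟨q, by omega, 2 ^ (q - 1) * (K + K'), fun z hz z' hz' => ?_⟩
    set ρ : ℝ := ‖z.2 - z'.2‖ + |(z.1 : ℝ) - z'.1| ^ (1 / 4 : ℝ) with hρ
    -- The increment is split at the intermediate point `(z.1, z'.2)` into a spatial and a temporal
    -- one.
    have h1 : ∀ ω, ‖u z.1 z.2 ω - u z'.1 z'.2 ω‖ₑ ^ q ≤ 2 ^ (q - 1) *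
        (‖u z.1 z.2 ω - u z.1 z'.2 ω‖ₑ ^ q + ‖u z.1 z'.2 ω - u z'.1 z'.2 ω‖ₑ ^ q) := by
      intro ω
      have h2 : ‖u z.1 z.2 ω - u z'.1 z'.2 ω‖ₑ ≤
          ‖u z.1 z.2 ω - u z.1 z'.2 ω‖ₑ + ‖u z.1 z'.2 ω - u z'.1 z'.2 ω‖ₑ := by
        rw [← sub_add_sub_cancel (u z.1 z.2 ω) (u z.1 z'.2 ω) (u z'.1 z'.2 ω)]
        exact enorm_add_le _ _
      refine (pow_le_pow_left' h2 q).trans ?_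
      have h3 := ENNReal.rpow_add_le_mul_rpow_add_rpow (‖u z.1 z.2 ω - u z.1 z'.2 ω‖ₑ)
        (‖u z.1 z'.2 ω - u z'.1 z'.2 ω‖ₑ) (p := (q : ℕ)) (by norm_cast; omega)
      rw [ENNReal.rpow_natCast, ENNReal.rpow_natCast, ENNReal.rpow_natCast] at h3
      refine h3.trans (le_of_eq ?_)
      congr 1
      rw [← ENNReal.rpow_natCast, Nat.cast_sub (by omega)]
      simp
    have hm1 : AEMeasurable (fun ω => ‖u z.1 z.2 ω - u z.1 z'.2 ω‖ₑ ^ q) P :=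
      ((hu.aemeasurable _ _).sub (hu.aemeasurable _ _)).enorm.pow_const q
    have hr1 : ‖z.2 - z'.2‖ ^ α₁ ≤ ρ ^ α₁ :=
      Real.rpow_le_rpow (norm_nonneg _) (le_add_of_nonneg_right (by positivity)) h.1.le
    have hr2 : |(z.1 : ℝ) - z'.1| ^ (α₁ / 2 / 2) ≤ ρ ^ α₁ := by
      have h4 : α₁ / 2 / 2 = 1 / 4 * α₁ := by ring
      rw [h4, Real.rpow_mul (abs_nonneg _)]
      exact Real.rpow_le_rpow (by positivity) (le_add_of_nonneg_left (norm_nonneg _)) h.1.le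
    calc _ ≤ ∫⁻ ω, 2 ^ (q - 1) * (‖u z.1 z.2 ω - u z.1 z'.2 ω‖ₑ ^ q +
          ‖u z.1 z'.2 ω - u z'.1 z'.2 ω‖ₑ ^ q) ∂P := lintegral_mono h1
      _ = 2 ^ (q - 1) * ((∫⁻ ω, ‖u z.1 z.2 ω - u z.1 z'.2 ω‖ₑ ^ q ∂P) +
          ∫⁻ ω, ‖u z.1 z'.2 ω - u z'.1 z'.2 ω‖ₑ ^ q ∂P) := by
        rw [lintegral_const_mul' _ _ (by finiteness), lintegral_add_left' hm1]
      _ ≤ 2 ^ (q - 1) * (K * ENNReal.ofReal (ρ ^ α₁) ^ q + K' * ENNReal.ofReal (ρ ^ α₁) ^ q) := by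
        refine mul_le_mul_right (add_le_add ((hK z.1 hz.1 z.2 z'.2).trans ?_)
          ((hK' z.1 z'.1 hz.1 hz'.1 z'.2).trans ?_)) _
        · gcongr
        · gcongr
      _ = _ := by push_cast; ring

end Versions

/-! ### From exhausting sets to arbitrary compact sets. -/

section Assembly

variable {d : ℕ} {p : E d → ℝ} {γ : E d → ℝ≥0∞} {γhat Ψ : E d → ℝ} {β₀ : ℝ}
  {Ω Ω' : Type*} [mΩ : MeasurableSpace Ω] [mΩ' : MeasurableSpace Ω'] {P : Measure Ω}
  {P' : Measure Ω'} {X X₀ : ℝ≥0 → Ω' → E d}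
  {W : {φ : ℝ × E d → ℝ // FiniteEnergy β₀ γ φ} → Ω → ℝ}
  [IsProbabilityMeasure P] [IsProbabilityMeasure P']

lemma exists_isModel (hd : 0 < d) (hβ₀ : 0 < β₀) (hβ₁ : β₀ < 1) (hγ : IsCovarianceKernel γ γhat)
    (hW : IsGaussianNoise β₀ γ W P) (hX : IsSymmetricLevyProcess X₀ Ψ P') (hp : IsMollifier p)
    (hD : DalangCondition β₀ Ψ (spectralMeasure γhat)) :
    ∃ X, IsModel γ γhat β₀ W P X Ψ P' p ∧ ∀ᵐ ω' ∂P', ∀ t, X t ω' = X₀ t ω' := by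
  obtain ⟨X, h1, h2⟩ := hX.exists_regular
  exact ⟨X, ⟨hd, hβ₀, hβ₁, hγ, hp, h1, hX.continuous_exponent.measurable, hX.exponent_nonneg, hD, hW⟩,
    h2⟩

/-- As the Hölder constant in time may depend on `x`, the versions for different `x` are chosen
separately. -/
lemma IsModel.exists_version_holderInTime (M : IsModel γ γhat β₀ W P X Ψ P' p)
    (hX : ∀ᵐ ω' ∂P', ∀ t, X t ω' = X₀ t ω') {u : ℝ≥0 → E d → Ω → ℝ}
    (hu : IsFeynmanKac W P X₀ P' p (fun _ => 1) u) {α₂ : ℝ}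
    (h : HypothesisT1 β₀ Ψ (spectralMeasure γhat) α₂) :
    ∃ v, IsVersion P u v ∧ ∀ ω, ∀ θ₂ : ℝ, 0 < θ₂ → θ₂ < α₂ / 2 →
      HolderInTime θ₂ (fun t x => v t x ω) := by
  choose v hv1 hv2 hv3 using fun x => M.exists_holder_time hX hu h x
  refine ⟨fun t x => v x t, fun t x => ⟨hv1 x t, hv2 x t⟩, fun ω θ hθ hθ' K hK x => ?_⟩
  obtain ⟨B, hB⟩ := (hK.image continuous_fst).bddAbove
  obtain ⟨C, hC⟩ := hv3 x ω θ hθ hθ' ⌈B⌉₊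
  have hmem : ∀ t, (t, x) ∈ K → t ∈ Iic (⌈B⌉₊ : ℝ≥0) := fun t ht =>
    (hB (mem_image_of_mem _ ht)).trans (Nat.le_ceil B)
  exact ⟨C, fun s t hs ht => hC s (hmem s hs) t (hmem t ht)⟩

lemma IsModel.exists_version_holderInSpace (M : IsModel γ γhat β₀ W P X Ψ P' p)
    (hX : ∀ᵐ ω' ∂P', ∀ t, X t ω' = X₀ t ω') {u : ℝ≥0 → E d → Ω → ℝ}
    (hu : IsFeynmanKac W P X₀ P' p (fun _ => 1) u) {α₁ : ℝ}
    (h : HypothesisS1 β₀ Ψ (spectralMeasure γhat) α₁)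
    (h' : HypothesisT1 β₀ Ψ (spectralMeasure γhat) (α₁ / 2)) :
    ∃ v, IsVersion P u v ∧ ∀ ω, ∀ θ₁ : ℝ, 0 < θ₁ → θ₁ < α₁ →
      HolderInSpace θ₁ (fun t x => v t x ω) := by
  obtain ⟨v, hv1, hv2, hv3⟩ := M.exists_holder_space hX hu h h'
  refine ⟨fun t x => v (t, x), fun t x => ⟨hv1 _, hv2 _⟩, fun ω θ hθ hθ' K hK => ?_⟩
  obtain ⟨B, hB⟩ := (hK.image continuous_fst).bddAbove
  obtain ⟨R, hR⟩ := (hK.image continuous_snd).isBounded.exists_norm_le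
  set N := max ⌈B⌉₊ ⌈R⌉₊ with hN
  obtain ⟨C, hC⟩ := hv3 ω θ hθ hθ' N
  have hmem : ∀ z ∈ K, z ∈ {z : ℝ≥0 × E d | z.1 ≤ N ∧ ∀ i, |z.2 i| ≤ N} := by
    intro z hz
    refine ⟨?_, fun i => ?_⟩
    · refine (hB (mem_image_of_mem _ hz)).trans ((Nat.le_ceil B).trans ?_)
      exact_mod_cast le_max_left _ _
    · have h1 := PiLp.norm_apply_le z.2 i
      rw [Real.norm_eq_abs] at h1
      refine h1.trans ((hR _ (mem_image_of_mem _ hz)).trans ((Nat.le_ceil R).trans ?_))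
      exact_mod_cast le_max_right _ _
  refine ⟨C, fun t x y hx hy => ?_⟩
  have h1 := hC _ (hmem _ hx) _ (hmem _ hy)
  -- At equal times the temporal part of the distance vanishes and the spatial estimate remains,
  -- with the constant of the joint one.
  simp only [sub_self, abs_zero] at h1
  rwa [Real.zero_rpow (by norm_num), add_zero] at h1

end Assembly

end FeynmanKac

theorem theorem4p9 {d : ℕ} (hd : 0 < d) {β₀ : ℝ} (hβ₀ : 0 < β₀) (hβ₁ : β₀ < 1)
    {γ : FeynmanKac.E d → ℝ≥0∞} {γhat : FeynmanKac.E d → ℝ}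
    (hγ : FeynmanKac.IsCovarianceKernel γ γhat)
    {Ω : Type*} [MeasurableSpace Ω] (P : Measure Ω) [IsProbabilityMeasure P]
    {W : {φ : ℝ × FeynmanKac.E d → ℝ // FeynmanKac.FiniteEnergy β₀ γ φ} → Ω → ℝ}
    (hW : FeynmanKac.IsGaussianNoise β₀ γ W P)
    {Ω' : Type*} [MeasurableSpace Ω'] (P' : Measure Ω') [IsProbabilityMeasure P']
    {X : ℝ≥0 → Ω' → FeynmanKac.E d} {Ψ : FeynmanKac.E d → ℝ}
    (hX : FeynmanKac.IsSymmetricLevyProcess X Ψ P')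
    {p : FeynmanKac.E d → ℝ} (hp : FeynmanKac.IsMollifier p) :
    (∀ α₁ : ℝ, FeynmanKac.HypothesisS1 β₀ Ψ (FeynmanKac.spectralMeasure γhat) α₁ →
      (∃ u, FeynmanKac.IsFeynmanKac W P X P' p (fun _ => 1) u) ∧
      ∀ u, FeynmanKac.IsFeynmanKac W P X P' p (fun _ => 1) u →
        ∃ v, FeynmanKac.IsVersion P u v ∧
          ∀ ω, ∀ θ₁ : ℝ, 0 < θ₁ → θ₁ < α₁ →
            FeynmanKac.HolderInSpace θ₁ (fun t x => v t x ω)) ∧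
    (∀ α₂ : ℝ, FeynmanKac.HypothesisT1 β₀ Ψ (FeynmanKac.spectralMeasure γhat) α₂ →
      (∃ u, FeynmanKac.IsFeynmanKac W P X P' p (fun _ => 1) u) ∧
      ∀ u, FeynmanKac.IsFeynmanKac W P X P' p (fun _ => 1) u →
        ∃ v, FeynmanKac.IsVersion P u v ∧
          ∀ ω, ∀ θ₂ : ℝ, 0 < θ₂ → θ₂ < α₂ / 2 →
            FeynmanKac.HolderInTime θ₂ (fun t x => v t x ω)) := by
  have := FeynmanKac.isFiniteMeasureOnCompacts_spectralMeasure hγ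
  have hΨm := hX.continuous_exponent.measurable
  have hΨ := hX.exponent_nonneg
  obtain ⟨C, hC, hgrowth⟩ := hX.exists_exponent_le
  refine ⟨fun α₁ h => ?_, fun α₂ h => ?_⟩
  · have hD := FeynmanKac.dalangCondition_of_S1 hβ₁ hΨm hΨ hC hgrowth h
    obtain ⟨X', M, hXX⟩ := FeynmanKac.exists_isModel hd hβ₀ hβ₁ hγ hW hX hp hD
    exact ⟨M.exists_isFeynmanKac hXX, fun u hu =>
      M.exists_version_holderInSpace hXX hu h (h.hypothesisT1 hβ₀ hβ₁ hΨm hΨ hC hgrowth)⟩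
  -- Here the existence of densities enters, through `Ψ → ∞`.
  · have hD := FeynmanKac.dalangCondition_of_T1 hβ₁ hΨm hΨ hX.tendsto_exponent h
    obtain ⟨X', M, hXX⟩ := FeynmanKac.exists_isModel hd hβ₀ hβ₁ hγ hW hX hp hD
    exact ⟨M.exists_isFeynmanKac hXX, fun u hu => M.exists_version_holderInTime hXX hu h⟩
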